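/- Let $\gamma\subseteq\mathbb N\setminus\{0\}$ be such that membership $j\in\gamma$ can be decided in time polynomial in $j$. For a graph $G=(V,E)$, let $\mathcal C$ be a set of cliques of $G$ (sets of pairwise adjacent vertices) whose sizes all belong to $\gamma$. We call $\mathcal C$ a $\gamma$-clique packing of $G$ if its members are pairwise disjoint, and a $\gamma$-clique partitioning of $G$ if moreover its members cover $V$. Model. Algorithms run on a random access machine whose word size is $O(k+\log L)$ bits, where $k$ is the width of the given tree decomposition and $L$ is the length of the input. Instructions on numbers (including memory addresses) that fit in a word take unit time. An instruction on longer, $b$-bit numbers takes time $i_\times(b)$ if it is a multiplication and time $b$ otherwise. Here $i_\times$ is any nondecreasing function with $i_\times(b)\ge b$ and $i_\times(2b)=O(i_\times(b))$. The input consists of the edges of an $n$-vertex graph $G$, $n\ge 1$, and a tree decomposition of $G$ of width $k$ whose tree has $O(n)$ nodes, given by the edges of the tree and the members of the bags. Below, $\log n$ stands for $\lfloor\log_2 n\rfloor+1$. The polynomial factor $k^2$ in the time bounds is to be read as $(k+1)^2$, so that $k=0$ is included. For every such $\gamma$ there are algorithms that, given a tree decomposition of width $k$ of an $n$-vertex graph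 $G$: 1. compute, for all $0\le\kappa\le n$, the number of $\gamma$-clique packings of $G$ consisting of exactly $\kappa$ cliques, in $O\big(n^3k^2 2^k\, i_\times(nk+n\log n)\big)$ time; 2. compute, for all $0\le\kappa\le n$, the number of $\gamma$-clique partitionings of $G$ consisting of exactly $\kappa$ cliques, in $O\big(n^3k^2 2^k\, i_\times(nk+n\log n)\big)$ time; 3. decide whether $G$ has a $\gamma$-clique partitioning, in $O(nk^2 2^k)$ time; 4. compute the number of all $\gamma$-clique packings of $G$, in $O\big(nk^2 2^k\, i_\times(nk+n\log n)\big)$ time; 5. compute the number of all $\gamma$-clique partitionings of $G$, in $O\big(nk^2 2^k\, i_\times(nk+n\log n)\big)$ time. In particular, Partition Into Triangles (the case $\gamma=\{3\}$ of 3) can be solved in $O(nk^2 2^k)$ time. The algorithms and the constants in the word sizes depend only on $\gamma$. The constants in the time bounds depend only on $\gamma$, on $i_\times$, and on the constant in the bound on the number of nodes of the tree. -/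

import Mathlib

/-! ### Random access machines

Programs over finitely many registers and a memory with indirect addressing.  Registers and memory
cells hold natural numbers.  An instruction that handles numbers (addresses included) of at most `b`
bits takes one unit of time if `b` does not exceed the word size `w`.  Otherwise a multiplication
takes `imul b` units of time and every other instruction takes `b` units of time. -/

namespace RAM

/-- Programs.  Registers are named by natural numbers, written `x`, `y`, `z`. -/
inductive Program : Type
  /-- do nothing -/
  | skip : Program
  /-- `x := v` -/
  | const (x v : ℕ) : Program
  /-- `x := y + z` -/
  | add (x y z : ℕ) : Program
  /-- `x := max (y - z) 0` -/
  | sub (x y z : ℕ) : Program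
  /-- `x := y * z` -/
  | mul (x y z : ℕ) : Program
  /-- `x := memory[y]` -/
  | load (x y : ℕ) : Program
  /-- `memory[x] := y` -/
  | store (x y : ℕ) : Program
  /-- first `p`, then `q` -/
  | seq (p q : Program) : Program
  /-- `p` if register `x` is nonzero, otherwise `q` -/
  | ite (x : ℕ) (p q : Program) : Program
  /-- repeat `p` as long as register `x` is nonzero -/
  | loop (x : ℕ) (p : Program) : Program

/-- A configuration: the contents of the registers and of the memory. -/
structure State where
  reg : ℕ → ℕ
  mem : ℕ → ℕ

/-- The configuration after writing `v` to register `x`. -/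
def State.setReg (s : State) (x v : ℕ) : State :=
  { s with reg := Function.update s.reg x v }

/-- The configuration after writing `v` to the memory cell with address `i`. -/
def State.setMem (s : State) (i v : ℕ) : State :=
  { s with mem := Function.update s.mem i v }

/-- The time for handling `b`-bit numbers without multiplying them, at word size `w`. -/
def linCost (w b : ℕ) : ℕ := if b ≤ w then 1 else b

/-- The time for multiplying `b`-bit numbers, at word size `w`. -/
def mulCost (w : ℕ) (imul : ℕ → ℕ) (b : ℕ) : ℕ := if b ≤ w then 1 else imul b

/-- `Exec w imul p s t s'`: started in configuration `s`, the program `p` halts in configuration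
`s'` after exactly `t` units of time, at word size `w`.  (`Nat.size v` is the number of binary digits
of `v`.) -/
inductive Exec (w : ℕ) (imul : ℕ → ℕ) : Program → State → ℕ → State → Prop
  | skip (s : State) : Exec w imul .skip s 1 s
  | const (s : State) (x v : ℕ) :
      Exec w imul (.const x v) s (linCost w (Nat.size v)) (s.setReg x v)
  | add (s : State) (x y z : ℕ) :
      Exec w imul (.add x y z) s (linCost w (max (Nat.size (s.reg y)) (Nat.size (s.reg z))))
        (s.setReg x (s.reg y + s.reg z))
  | sub (s : State) (x y z : ℕ) :
      Exec w imul (.sub x y z) s (linCost w (max (Nat.size (s.reg y)) (Nat.size (s.reg z))))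
        (s.setReg x (s.reg y - s.reg z))
  | mul (s : State) (x y z : ℕ) :
      Exec w imul (.mul x y z) s (mulCost w imul (max (Nat.size (s.reg y)) (Nat.size (s.reg z))))
        (s.setReg x (s.reg y * s.reg z))
  | load (s : State) (x y : ℕ) :
      Exec w imul (.load x y) s
        (linCost w (max (Nat.size (s.reg y)) (Nat.size (s.mem (s.reg y)))))
        (s.setReg x (s.mem (s.reg y)))
  | store (s : State) (x y : ℕ) :
      Exec w imul (.store x y) s (linCost w (max (Nat.size (s.reg x)) (Nat.size (s.reg y))))
        (s.setMem (s.reg x) (s.reg y))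
  | seq {p q : Program} {s s' s'' : State} {t t' : ℕ} :
      Exec w imul p s t s' → Exec w imul q s' t' s'' → Exec w imul (.seq p q) s (t + t') s''
  | ite_pos {x : ℕ} {p q : Program} {s s' : State} {t : ℕ} :
      s.reg x ≠ 0 → Exec w imul p s t s' →
        Exec w imul (.ite x p q) s (linCost w (Nat.size (s.reg x)) + t) s'
  | ite_zero {x : ℕ} {p q : Program} {s s' : State} {t : ℕ} :
      s.reg x = 0 → Exec w imul q s t s' →
        Exec w imul (.ite x p q) s (linCost w (Nat.size (s.reg x)) + t) s'
  | loop_pos {x : ℕ} {p : Program} {s s' s'' : State} {t t' : ℕ} :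
      s.reg x ≠ 0 → Exec w imul p s t s' → Exec w imul (.loop x p) s' t' s'' →
        Exec w imul (.loop x p) s (linCost w (Nat.size (s.reg x)) + t + t') s''
  | loop_zero {x : ℕ} {p : Program} {s : State} :
      s.reg x = 0 → Exec w imul (.loop x p) s (linCost w (Nat.size (s.reg x))) s

/-- The initial configuration: the input in the first memory cells, zero everywhere else. -/
def initState (inp : List ℕ) : State where
  reg := fun _ => 0
  mem := fun i => inp.getD i 0

/-- On input `inp`, the program `p` halts within `t` units of time, with `out` in the first memory
cells. -/
def ComputesWithin (w : ℕ) (imul : ℕ → ℕ) (p : Program) (inp : List ℕ) (t : ℕ)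
    (out : List ℕ) : Prop :=
  ∃ (t' : ℕ) (s : State), Exec w imul p (initState inp) t' s ∧ t' ≤ t ∧
    ∀ (i : ℕ) (hi : i < out.length), s.mem i = out[i]

/-- `imul` is a possible time for multiplying `b`-bit numbers, as a function of `b`: it is
nondecreasing, at least linear, and doubling the length costs at most a constant factor. -/
structure IsMulTime (imul : ℕ → ℕ) : Prop where
  mono : Monotone imul
  le_self : ∀ b, b ≤ imul b
  doubling : ∃ K, ∀ b, imul (2 * b) ≤ K * imul b

open Classical in
/-- The answer to a decision problem, as a number. -/
noncomputable def answer (p : Prop) : ℕ := if p then 1 else 0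

/-- Membership of `j` in `γ` can be decided in time polynomial in `j`.  Every instruction is charged
for all bits it handles (word size `0`), multiplication at its schoolbook cost. -/
def PolyTimeDecidable (γ : Set ℕ) : Prop :=
  ∃ (p : Program) (time : Polynomial ℕ), ∀ j : ℕ,
    ComputesWithin 0 (fun b => b ^ 2) p [j] (time.eval j) [answer (j ∈ γ)]

end RAM

/-! ### Clique packings and clique partitionings -/

section Cliques

variable {V : Type*} (γ : Set ℕ) (G : SimpleGraph V)

/-- A collection of cliques whose sizes are members of `γ`. -/
def IsCliqueCollection (𝒞 : Finset (Finset V)) : Prop :=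
  ∀ C ∈ 𝒞, G.IsClique (C : Set V) ∧ C.card ∈ γ

/-- `γ`-clique covers of the vertices of `G`. -/
def IsCliqueCover (𝒞 : Finset (Finset V)) : Prop :=
  IsCliqueCollection γ G 𝒞 ∧ ∀ v : V, ∃ C ∈ 𝒞, v ∈ C

/-- `γ`-clique packings of `G`. -/
def IsCliquePacking (𝒞 : Finset (Finset V)) : Prop :=
  IsCliqueCollection γ G 𝒞 ∧ ∀ C₁ ∈ 𝒞, ∀ C₂ ∈ 𝒞, C₁ ≠ C₂ → Disjoint C₁ C₂

/-- `γ`-clique partitionings of `G`. -/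
def IsCliquePartitioning (𝒞 : Finset (Finset V)) : Prop :=
  IsCliqueCover γ G 𝒞 ∧ IsCliquePacking γ G 𝒞

end Cliques

/-! ### Tree decompositions -/

/-- A tree decomposition of `G` whose tree has node set `ι`. -/
structure TreeDecomposition {V : Type*} (G : SimpleGraph V) (ι : Type*) where
  tree : SimpleGraph ι
  isTree : tree.IsTree
  bag : ι → Finset V
  exists_mem_bag : ∀ v : V, ∃ x, v ∈ bag x
  exists_edge_bag : ∀ u v : V, G.Adj u v → ∃ x, u ∈ bag x ∧ v ∈ bag x
  mem_bag_of_path : ∀ (v : V) (x y : ι) (p : tree.Walk x y), p.IsPath →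
    v ∈ bag x → v ∈ bag y → ∀ z ∈ p.support, v ∈ bag z

namespace TreeDecomposition

/-- The size of the largest bag minus one. -/
def width {V ι : Type*} [Fintype ι] {G : SimpleGraph V} (D : TreeDecomposition G ι) : ℕ :=
  (Finset.univ.sup fun x => (D.bag x).card) - 1

/-- `l` lists every edge of `H` exactly once, each edge as a pair of its end points in some order. -/
def ListsEdges {n : ℕ} (H : SimpleGraph (Fin n)) (l : List (Fin n × Fin n)) : Prop :=
  (l.map fun e => s(e.1, e.2)).Nodup ∧
    ∀ e : Sym2 (Fin n), e ∈ l.map (fun e => s(e.1, e.2)) ↔ e ∈ H.edgeSet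

/-- The list of numbers that represents a list of pairs. -/
def encodePairs {n : ℕ} (l : List (Fin n × Fin n)) : List ℕ :=
  l.flatMap fun e => [(e.1 : ℕ), (e.2 : ℕ)]

/-- `inp` represents the graph `G` together with its tree decomposition `D`: first the numbers of
vertices of `G`, of edges of `G` and of nodes of the tree; then the edges of `G`, the edges of the
tree, and, node by node, the size of the bag followed by its members.  The edges and the members of
the bags may be listed in any order. -/
def IsInput {n N : ℕ} {G : SimpleGraph (Fin n)} (D : TreeDecomposition G (Fin N))
    (inp : List ℕ) : Prop :=
  ∃ (es : List (Fin n × Fin n)) (ts : List (Fin N × Fin N)) (bs : Fin N → List (Fin n)),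
    ListsEdges G es ∧ ListsEdges D.tree ts ∧
    (∀ x, (bs x).Nodup ∧ ∀ v, v ∈ bs x ↔ v ∈ D.bag x) ∧
    inp = [n, es.length, N] ++ encodePairs es ++ encodePairs ts ++
      (List.finRange N).flatMap fun x => (bs x).length :: (bs x).map fun v => (v : ℕ)

end TreeDecomposition

/-- There is an algorithm that, given a tree decomposition of a graph `G` with `n` vertices, of width
`k` and with `O(n)` nodes, computes `out n G` in `O(time imul n k)` time, where `imul b` is the time
for multiplying `b`-bit numbers.  The word size is `O(k + log L)`, where `L` is the length of the
input.  The program and the constant in the word size depend on nothing else; the constant in the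
time bound depends only on `imul` and on the constant `a` in the bound on the number of nodes. -/
def ComputableOnTreeDecompositions (out : ∀ n : ℕ, SimpleGraph (Fin n) → List ℕ)
    (time : (ℕ → ℕ) → ℕ → ℕ → ℕ) : Prop :=
  ∃ (p : RAM.Program) (c : ℕ), ∀ imul : ℕ → ℕ, RAM.IsMulTime imul → ∀ a : ℕ, ∃ A : ℕ,
    ∀ (n N : ℕ) (G : SimpleGraph (Fin n)) (D : TreeDecomposition G (Fin N)) (inp : List ℕ),
      1 ≤ n → N ≤ a * n → D.IsInput inp →
      RAM.ComputesWithin (c * (D.width + Nat.size inp.length)) imul p inp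
        (A * time imul n D.width) (out n G)

/-! Let w = X^e as a power series over ℕ, and let P(S) be the sum of w^κ over the packings (or the
partitionings) of the subgraph induced by a set S of vertices, where κ is the number of cliques
(`weightSum`). For e = 1 the coefficients of P(V) are the numbers of collections with a given number
of cliques; for e = 0 the constant coefficient is their total number.

Under subset convolution, (f * g)(S) = ∑ f(T) g(S \ T) over T ⊆ S, functions on finite sets form a
commutative monoid. Deciding how a vertex v is covered gives P = A_v * P', where P' is P restricted
to the sets without v, and A_v (`vertexSum`) has the value 1 at ∅, the value w at the cliques
through v with size in γ, and, for packings, an additional 1 at {v}. This is `weightSum_eq_mul`.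

The algorithm maintains a subtree R of the tree, a set U of vertices, and for every node x in R a
table F_x supported on the bag of x, such that ((∏ F_x) * P)(U) = P(V) (`forestSum`). At the start
all F_x are 1 and U = V. Two moves preserve the value. A vertex v that is in no other remaining bag
than that of x has all its remaining neighbors in this bag. It is eliminated by putting F_x(T) :=
(F_x * A_v)(T ∪ {v}) for the sets T without v (`forestSum_forget`). If x is a leaf of R with
neighbor y and the vertices left in the bag of x all lie in the bag of y, then x is removed and F_y
is multiplied by F_x (`forestSum_join`). By the path property, a vertex of a leaf bag that is
missing from the bag of the neighbor is in no other bag of R (`TreeDecomposition.mem_bag_of_leaf`).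
So leaves can be removed until one node is left. Eliminating the rest of its bag gives P(V) as its
entry at ∅.

Every move is a single subset convolution on the subsets of a bag. It is computed by ranked zeta
transforms (`ConvContext.conv`): the transforms are multiplied as polynomials in the rank and in X,
the Möbius transform is applied, and the entry of rank |S| is read at S, since two sets with union S
and sizes adding up to |S| are disjoint. With D = en + 1 coefficients and bags of size at most K,
this takes O(2^K (K+1)² D²) steps. There are at most n + N moves, where N is the number of nodes.

Without normalization, a move multiplies the bound on the entries by at most `growth K D`, which has
O(K + log D) bits. All numbers therefore have O(nk + n log n) bits, and this is the length at which
multiplications are charged. For the decision problem only signs matter. Being nonzero is a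
congruence on ℕ (`valueCon`), so the same invariant holds in the quotient semiring `Truncated`, and
each result is replaced by 0 or 1. Then all numbers fit into a word and each instruction takes one
unit of time.

To obtain an actual machine program, the algorithm is written in a small language with variables,
three-dimensional arrays, bounded sums and counting loops. Its compiler (`Expr.compile_spec`,
`Stmt.compile_spec`) is proved correct with constant overhead. The answers to the questions j ∈ γ, j
≤ K, are found by running the given decision procedure inside the machine (`decideProg_spec`). The
total cost is a sum of polynomially bounded terms over j ≤ K and hence O(2^K). -/

/-! ### Executions with a uniform price per instruction -/

namespace RAM

/-- Every instruction on numbers of at most `β` bits costs at most `κ`. -/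
structure UnitCost (w : ℕ) (imul : ℕ → ℕ) (κ β : ℕ) : Prop where
  lin : ∀ b ≤ β, linCost w b ≤ κ
  mul : ∀ b ≤ β, mulCost w imul b ≤ κ

/-- The program `p` leads from `s` to `s'` within `T` units of time. -/
def Leads (w : ℕ) (imul : ℕ → ℕ) (p : Program) (s s' : State) (T : ℕ) : Prop :=
  ∃ t ≤ T, Exec w imul p s t s'

section Leads

variable {w : ℕ} {imul : ℕ → ℕ} {κ β : ℕ}

theorem Leads.mono {p : Program} {s s' : State} {T T' : ℕ} (h : Leads w imul p s s' T)
    (hT : T ≤ T') : Leads w imul p s s' T' :=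
  let ⟨t, ht, he⟩ := h
  ⟨t, ht.trans hT, he⟩

theorem Leads.seq {p q : Program} {s s' s'' : State} {T T' : ℕ} (h : Leads w imul p s s' T)
    (h' : Leads w imul q s' s'' T') : Leads w imul (.seq p q) s s'' (T + T') :=
  let ⟨_, ht, he⟩ := h
  let ⟨_, ht', he'⟩ := h'
  ⟨_, Nat.add_le_add ht ht', he.seq he'⟩

theorem UnitCost.lin_max (hc : UnitCost w imul κ β) {u v : ℕ} (hu : u < 2 ^ β) (hv : v < 2 ^ β) :
    linCost w (max (Nat.size u) (Nat.size v)) ≤ κ :=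
  hc.lin _ (max_le (Nat.size_le.2 hu) (Nat.size_le.2 hv))

theorem UnitCost.lin_one (hc : UnitCost w imul κ β) {u : ℕ} (hu : u < 2 ^ β) :
    linCost w (Nat.size u) ≤ κ :=
  hc.lin _ (Nat.size_le.2 hu)

theorem UnitCost.one_le (hc : UnitCost w imul κ β) : 1 ≤ κ := by
  have := hc.lin 0 (Nat.zero_le _)
  simpa [linCost] using this

theorem UnitCost.skip (hc : UnitCost w imul κ β) (s : State) : Leads w imul .skip s s κ :=
  ⟨1, hc.one_le, .skip s⟩

theorem UnitCost.const (hc : UnitCost w imul κ β) (s : State) (x v : ℕ) (hv : v < 2 ^ β) :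
    Leads w imul (.const x v) s (s.setReg x v) κ :=
  ⟨_, hc.lin_one hv, .const s x v⟩

theorem UnitCost.add (hc : UnitCost w imul κ β) (s : State) (x y z : ℕ) (hy : s.reg y < 2 ^ β)
    (hz : s.reg z < 2 ^ β) :
    Leads w imul (.add x y z) s (s.setReg x (s.reg y + s.reg z)) κ :=
  ⟨_, hc.lin_max hy hz, .add s x y z⟩

theorem UnitCost.sub (hc : UnitCost w imul κ β) (s : State) (x y z : ℕ) (hy : s.reg y < 2 ^ β)
    (hz : s.reg z < 2 ^ β) :
    Leads w imul (.sub x y z) s (s.setReg x (s.reg y - s.reg z)) κ :=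
  ⟨_, hc.lin_max hy hz, .sub s x y z⟩

theorem UnitCost.mul' (hc : UnitCost w imul κ β) (s : State) (x y z : ℕ) (hy : s.reg y < 2 ^ β)
    (hz : s.reg z < 2 ^ β) :
    Leads w imul (.mul x y z) s (s.setReg x (s.reg y * s.reg z)) κ :=
  ⟨_, hc.mul _ (max_le (Nat.size_le.2 hy) (Nat.size_le.2 hz)), .mul s x y z⟩

theorem UnitCost.load (hc : UnitCost w imul κ β) (s : State) (x y : ℕ) (hy : s.reg y < 2 ^ β)
    (hz : s.mem (s.reg y) < 2 ^ β) :
    Leads w imul (.load x y) s (s.setReg x (s.mem (s.reg y))) κ :=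
  ⟨_, hc.lin_max hy hz, .load s x y⟩

theorem UnitCost.store (hc : UnitCost w imul κ β) (s : State) (x y : ℕ) (hy : s.reg x < 2 ^ β)
    (hz : s.reg y < 2 ^ β) :
    Leads w imul (.store x y) s (s.setMem (s.reg x) (s.reg y)) κ :=
  ⟨_, hc.lin_max hy hz, .store s x y⟩

theorem UnitCost.ite_pos (hc : UnitCost w imul κ β) {s s' : State} {x T : ℕ} {p q : Program}
    (hx : s.reg x < 2 ^ β) (h0 : s.reg x ≠ 0) (h : Leads w imul p s s' T) :
    Leads w imul (.ite x p q) s s' (κ + T) :=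
  let ⟨_, ht, he⟩ := h
  ⟨_, Nat.add_le_add (hc.lin_one hx) ht, .ite_pos h0 he⟩

theorem UnitCost.ite_zero (hc : UnitCost w imul κ β) {s s' : State} {x T : ℕ} {p q : Program}
    (h0 : s.reg x = 0) (h : Leads w imul q s s' T) :
    Leads w imul (.ite x p q) s s' (κ + T) :=
  let ⟨_, ht, he⟩ := h
  ⟨_, Nat.add_le_add (hc.lin_one (h0 ▸ Nat.two_pow_pos β)) ht, .ite_zero h0 he⟩

theorem UnitCost.loop_pos (hc : UnitCost w imul κ β) {s s' s'' : State} {x T T' : ℕ} {p : Program}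
    (hx : s.reg x < 2 ^ β) (h0 : s.reg x ≠ 0) (h : Leads w imul p s s' T)
    (h' : Leads w imul (.loop x p) s' s'' T') :
    Leads w imul (.loop x p) s s'' (κ + T + T') :=
  let ⟨_, ht, he⟩ := h
  let ⟨_, ht', he'⟩ := h'
  ⟨_, Nat.add_le_add (Nat.add_le_add (hc.lin_one hx) ht) ht', .loop_pos h0 he he'⟩

theorem UnitCost.loop_zero (hc : UnitCost w imul κ β) {s : State} {x : ℕ} {p : Program}
    (h0 : s.reg x = 0) : Leads w imul (.loop x p) s s κ :=
  ⟨_, hc.lin_one (h0 ▸ Nat.two_pow_pos β), .loop_zero h0⟩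

end Leads

@[simp] theorem State.setReg_mem (s : State) (x v : ℕ) : (s.setReg x v).mem = s.mem := rfl

@[simp] theorem State.setMem_reg (s : State) (x v : ℕ) : (s.setMem x v).reg = s.reg := rfl

theorem State.setReg_reg (s : State) (x v y : ℕ) :
    (s.setReg x v).reg y = if y = x then v else s.reg y := by
  simp [State.setReg, Function.update_apply]

theorem State.setMem_mem (s : State) (x v y : ℕ) :
    (s.setMem x v).mem y = if y = x then v else s.mem y := by
  simp [State.setMem, Function.update_apply]

/-! ### A structured language -/

/-- The values of variables and arrays, and the contents of the first memory cells. -/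
@[ext] structure Store where
  var : ℕ → ℕ
  arr : ℕ → ℕ → ℕ → ℕ → ℕ
  raw : ℕ → ℕ

namespace Store

/-- Assignment to a variable. -/
def setVar (σ : Store) (x v : ℕ) : Store := { σ with var := Function.update σ.var x v }

/-- Assignment to an array. -/
def setArr (σ : Store) (a : ℕ) (f : ℕ → ℕ → ℕ → ℕ) : Store :=
  { σ with arr := Function.update σ.arr a f }

/-- Assignment to a raw memory cell. -/
def setRaw (σ : Store) (i v : ℕ) : Store := { σ with raw := Function.update σ.raw i v }

/-- Assignment to an entry of a three-dimensional array. -/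
def _root_.RAM.entryUpdate (f : ℕ → ℕ → ℕ → ℕ) (i j k v : ℕ) : ℕ → ℕ → ℕ → ℕ :=
  fun i' j' k' => if i' = i ∧ j' = j ∧ k' = k then v else f i' j' k'

variable (σ : Store)

theorem setVar_var (x v y : ℕ) : (σ.setVar x v).var y = if y = x then v else σ.var y := by
  simp [setVar, Function.update_apply]
@[simp] theorem setVar_arr (x v : ℕ) : (σ.setVar x v).arr = σ.arr := rfl
@[simp] theorem setVar_raw (x v : ℕ) : (σ.setVar x v).raw = σ.raw := rfl
@[simp] theorem setArr_var (a : ℕ) (f : ℕ → ℕ → ℕ → ℕ) : (σ.setArr a f).var = σ.var := rfl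
@[simp] theorem setArr_raw (a : ℕ) (f : ℕ → ℕ → ℕ → ℕ) : (σ.setArr a f).raw = σ.raw := rfl
theorem setArr_arr (a : ℕ) (f : ℕ → ℕ → ℕ → ℕ) (b : ℕ) :
    (σ.setArr a f).arr b = if b = a then f else σ.arr b := by
  simp [setArr, Function.update_apply]
@[simp] theorem setRaw_var (i v : ℕ) : (σ.setRaw i v).var = σ.var := rfl
@[simp] theorem setRaw_arr (i v : ℕ) : (σ.setRaw i v).arr = σ.arr := rfl

theorem setVar_comm {x y : ℕ} (h : x ≠ y) (u v : ℕ) :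
    (σ.setVar x u).setVar y v = (σ.setVar y v).setVar x u := by
  simp [setVar, Function.update_comm h]

@[simp] theorem setVar_setVar (x u v : ℕ) : (σ.setVar x u).setVar x v = σ.setVar x v := by
  simp [setVar]

@[simp] theorem setVar_var_self (x : ℕ) : σ.setVar x (σ.var x) = σ := by
  simp [setVar]

theorem setVar_setArr (x v a : ℕ) (f : ℕ → ℕ → ℕ → ℕ) :
    (σ.setArr a f).setVar x v = (σ.setVar x v).setArr a f := rfl

/-- Variables, arrays (array `0` excepted) and raw memory hold numbers up to `M`. -/
structure Bounded (M : ℕ) (σ : Store) : Prop where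
  var : ∀ x, σ.var x ≤ M
  arr : ∀ a, a ≠ 0 → ∀ i j k, σ.arr a i j k ≤ M
  raw : ∀ i, σ.raw i ≤ M

variable {σ} {M : ℕ}

theorem Bounded.mono {M' : ℕ} (h : σ.Bounded M) (hM : M ≤ M') : σ.Bounded M' :=
  ⟨fun x => (h.var x).trans hM, fun a ha i j k => (h.arr a ha i j k).trans hM,
    fun i => (h.raw i).trans hM⟩

theorem Bounded.setVar (h : σ.Bounded M) {x v : ℕ} (hv : v ≤ M) : (σ.setVar x v).Bounded M :=
  ⟨fun y => by rw [setVar_var]; split_ifs; exacts [hv, h.var y], h.arr, h.raw⟩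

theorem Bounded.setEntry (h : σ.Bounded M) {a i j k v : ℕ} (hv : v ≤ M) :
    (σ.setArr a (entryUpdate (σ.arr a) i j k v)).Bounded M := by
  refine ⟨h.var, fun b hb i' j' k' => ?_, h.raw⟩
  rw [setArr_arr]
  split_ifs with hba
  · unfold entryUpdate
    split_ifs
    exacts [hv, h.arr a (hba ▸ hb) _ _ _]
  · exact h.arr b hb _ _ _

theorem Bounded.setRaw (h : σ.Bounded M) {i v : ℕ} (hv : v ≤ M) : (σ.setRaw i v).Bounded M :=
  ⟨h.var, h.arr, fun y => by
    simp only [Store.setRaw, Function.update_apply]; split_ifs; exacts [hv, h.raw y]⟩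

end Store

/-- Arithmetic expressions. -/
inductive Expr : Type
  | lit (v : ℕ) : Expr
  | var (x : ℕ) : Expr
  /-- the contents of a raw memory cell -/
  | inp (i : Expr) : Expr
  /-- an entry of an array -/
  | get (a : ℕ) (i j k : Expr) : Expr
  | add (e f : Expr) : Expr
  | sub (e f : Expr) : Expr
  | mul (e f : Expr) : Expr
  /-- the sum of `f` over all values of the variable `x` below `e` -/
  | sum (x : ℕ) (e f : Expr) : Expr

namespace Expr

/-- The value of an expression. -/
def eval : Expr → Store → ℕ
  | lit v, _ => v
  | var x, σ => σ.var x
  | inp i, σ => σ.raw (i.eval σ)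
  | get a i j k, σ => σ.arr a (i.eval σ) (j.eval σ) (k.eval σ)
  | add e f, σ => e.eval σ + f.eval σ
  | sub e f, σ => e.eval σ - f.eval σ
  | mul e f, σ => e.eval σ * f.eval σ
  | sum x e f, σ => ∑ i ∈ Finset.range (e.eval σ), f.eval (σ.setVar x i)

/-- The number of steps of the evaluation of an expression. -/
def time : Expr → Store → ℕ
  | lit _, _ => 1
  | var _, _ => 1
  | inp i, σ => i.time σ + 1
  | get _ i j k, σ => i.time σ + j.time σ + k.time σ + 1
  | add e f, σ => e.time σ + f.time σ + 1
  | sub e f, σ => e.time σ + f.time σ + 1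
  | mul e f, σ => e.time σ + f.time σ + 1
  | sum x e f, σ => e.time σ + 1 + ∑ i ∈ Finset.range (e.eval σ), (f.time (σ.setVar x i) + 1)

/-- The expression reads raw memory only below `base`, and does not read array `0`. -/
def Ok (base : ℕ) : Expr → Store → Prop
  | lit _, _ => True
  | var _, _ => True
  | inp i, σ => i.Ok base σ ∧ i.eval σ < base
  | get a i j k, σ => a ≠ 0 ∧ i.Ok base σ ∧ j.Ok base σ ∧ k.Ok base σ
  | add e f, σ => e.Ok base σ ∧ f.Ok base σ
  | sub e f, σ => e.Ok base σ ∧ f.Ok base σ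
  | mul e f, σ => e.Ok base σ ∧ f.Ok base σ
  | sum x e f, σ => e.Ok base σ ∧ ∀ i < e.eval σ, f.Ok base (σ.setVar x i)

/-- If all variables and array entries are at most `M`, the numbers that occur in the evaluation
are at most `M ^ deg`. -/
def deg : Expr → ℕ
  | lit v => v + 1
  | var _ => 1
  | inp i => i.deg + 1
  | get a i j k => 8 * (i.deg + j.deg + k.deg + a + 1) + 16
  | add e f => e.deg + f.deg + 1
  | sub e f => e.deg + f.deg + 1
  | mul e f => e.deg + f.deg + 1
  | sum _ e f => e.deg * (f.deg + 2) + 1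

theorem one_le_deg (e : Expr) : 1 ≤ e.deg := by
  cases e <;> simp [deg]

end Expr

/-! ### Translation of expressions -/

/-- The register of a variable. -/
def regV (x : ℕ) : ℕ := 3 * x
/-- Registers for intermediate results. -/
def regT (d : ℕ) : ℕ := 3 * d + 1
/-- Further registers. -/
def regG (y : ℕ) : ℕ := 3 * y + 2

@[simp] theorem regV_inj {x y : ℕ} : regV x = regV y ↔ x = y := by simp [regV]
@[simp] theorem regT_inj {x y : ℕ} : regT x = regT y ↔ x = y := by simp [regT]
@[simp] theorem regG_inj {x y : ℕ} : regG x = regG y ↔ x = y := by simp [regG]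
@[simp] theorem regV_ne_regT {x y : ℕ} : regV x ≠ regT y := by simp only [regV, regT]; omega
@[simp] theorem regT_ne_regV {x y : ℕ} : regT x ≠ regV y := by simp only [regV, regT]; omega
@[simp] theorem regV_ne_regG {x y : ℕ} : regV x ≠ regG y := by simp only [regV, regG]; omega
@[simp] theorem regG_ne_regV {x y : ℕ} : regG x ≠ regV y := by simp only [regV, regG]; omega
@[simp] theorem regT_ne_regG {x y : ℕ} : regT x ≠ regG y := by simp only [regT, regG]; omega
@[simp] theorem regG_ne_regT {x y : ℕ} : regG x ≠ regT y := by simp only [regT, regG]; omega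

/-- The memory address of an array entry. -/
def cell (base a i j k : ℕ) : ℕ := base + Nat.pair a (Nat.pair i (Nat.pair j k))

theorem cell_inj {base a i j k a' i' j' k' : ℕ} :
    cell base a i j k = cell base a' i' j' k' ↔ a = a' ∧ i = i' ∧ j = j' ∧ k = k' := by
  simp [cell, Nat.pair_eq_pair]

theorem le_cell (base a i j k : ℕ) : base ≤ cell base a i j k := Nat.le_add_right _ _

/-- The store that a configuration represents. -/
def State.store (base : ℕ) (s : State) : Store where
  var := fun x => s.reg (regV x)
  arr := fun a i j k => s.mem (cell base a i j k)
  raw := fun i => if i < base then s.mem i else 0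

/-- Only registers for intermediate results, from number `d` on, have changed. -/
structure Pres (d : ℕ) (s s' : State) : Prop where
  mem : s'.mem = s.mem
  regV : ∀ x, s'.reg (regV x) = s.reg (regV x)
  regG : ∀ x, s'.reg (regG x) = s.reg (regG x)
  regT : ∀ x < d, s'.reg (regT x) = s.reg (regT x)

theorem Pres.refl (d : ℕ) (s : State) : Pres d s s := ⟨rfl, fun _ => rfl, fun _ => rfl, fun _ _ => rfl⟩

theorem Pres.trans {d : ℕ} {s s' s'' : State} (h : Pres d s s') (h' : Pres d s' s'') :
    Pres d s s'' :=
  ⟨h'.mem.trans h.mem, fun x => (h'.regV x).trans (h.regV x), fun x => (h'.regG x).trans (h.regG x),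
    fun x hx => (h'.regT x hx).trans (h.regT x hx)⟩

theorem Pres.mono {d d' : ℕ} {s s' : State} (h : Pres d' s s') (hd : d ≤ d') : Pres d s s' :=
  ⟨h.mem, h.regV, h.regG, fun x hx => h.regT x (hx.trans_le hd)⟩

theorem Pres.setReg {d d' : ℕ} {s s' : State} (h : Pres d s s') (hd : d ≤ d') (v : ℕ) :
    Pres d s (s'.setReg (RAM.regT d') v) := by
  refine ⟨h.mem, fun x => ?_, fun x => ?_, fun x hx => ?_⟩
  · simp [State.setReg_reg, h.regV]
  · simp [State.setReg_reg, h.regG]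
  · have : x ≠ d' := by omega
    simp [State.setReg_reg, h.regT x hx, this]

theorem Pres.store {d : ℕ} {s s' : State} (h : Pres d s s') (base : ℕ) :
    s'.store base = s.store base := by
  simp [State.store, h.mem, h.regV]

/-- Put the pair of registers `d` and `d + 1` for intermediate results into register `d`. -/
def pairProg (d : ℕ) : Program :=
  .seq (.sub (regT (d + 2)) (regT (d + 1)) (regT d))
    (.ite (regT (d + 2))
      (.seq (.mul (regT (d + 2)) (regT (d + 1)) (regT (d + 1)))
        (.add (regT d) (regT (d + 2)) (regT d)))
      (.seq (.mul (regT (d + 2)) (regT d) (regT d))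
        (.seq (.add (regT (d + 2)) (regT (d + 2)) (regT d))
          (.add (regT d) (regT (d + 2)) (regT (d + 1))))))

/-- Put the address of the array entry described by the registers `d`, …, `d + 3` for intermediate
results into register `d`. -/
def addressProg (d : ℕ) : Program :=
  .seq (pairProg (d + 2)) <| .seq (pairProg (d + 1)) <| .seq (pairProg d) <|
    .add (regT d) (regG 0) (regT d)

/-- Copy a register to another one. -/
def copyProg (x y : ℕ) : Program := .seq (.const x 0) (.add x x y)

/-- Translation of expressions: the value is left in register `d` for intermediate results. -/
def Expr.compile : ℕ → Expr → Program
  | d, .lit v => .const (regT d) v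
  | d, .var x => copyProg (regT d) (regV x)
  | d, .inp i => .seq (i.compile d) (.load (regT d) (regT d))
  | d, .get a i j k =>
    .seq (.const (regT d) a) <| .seq (i.compile (d + 1)) <| .seq (j.compile (d + 2)) <|
    .seq (k.compile (d + 3)) <| .seq (addressProg d) <| .load (regT d) (regT d)
  | d, .add e f =>
    .seq (e.compile d) <| .seq (f.compile (d + 1)) <| .add (regT d) (regT d) (regT (d + 1))
  | d, .sub e f =>
    .seq (e.compile d) <| .seq (f.compile (d + 1)) <| .sub (regT d) (regT d) (regT (d + 1))
  | d, .mul e f =>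
    .seq (e.compile d) <| .seq (f.compile (d + 1)) <| .mul (regT d) (regT d) (regT (d + 1))
  | d, .sum x e f =>
    .seq (e.compile d) <| .seq (.const (regT (d + 1)) 0) <|
    .seq (copyProg (regT (d + 2)) (regV x)) <|
    .seq (.loop (regT d) <|
      .seq (.const (regT (d + 3)) 1) <| .seq (.sub (regT d) (regT d) (regT (d + 3))) <|
      .seq (copyProg (regV x) (regT d)) <| .seq (f.compile (d + 3)) <|
      .add (regT (d + 1)) (regT (d + 1)) (regT (d + 3))) <|
    .seq (copyProg (regV x) (regT (d + 2))) <| copyProg (regT d) (regT (d + 1))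

/-! ### Correctness and cost of translated expressions -/

section Compile

variable {w : ℕ} {imul : ℕ → ℕ} {κ β : ℕ}

theorem UnitCost.copy (hc : UnitCost w imul κ β) (s : State) {x y : ℕ} (hxy : x ≠ y)
    (hy : s.reg y < 2 ^ β) :
    Leads w imul (copyProg x y) s (s.setReg x (s.reg y)) (2 * κ) := by
  have h1 := hc.const s x 0 (Nat.two_pow_pos β)
  have h2 := hc.add (s.setReg x 0) x x y (by simp [State.setReg_reg])
    (by simpa [State.setReg_reg, hxy.symm] using hy)
  have h := (h1.seq h2).mono (by omega : κ + κ ≤ 2 * κ)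
  have e : (s.setReg x 0).setReg x ((s.setReg x 0).reg x + (s.setReg x 0).reg y)
      = s.setReg x (s.reg y) := by
    simp [State.setReg, hxy.symm]
  rwa [e] at h

/-- The two branches follow the two cases of `Nat.pair`, b² + a for a < b and a² + a + b otherwise.
No intermediate value exceeds the result, so a bound on the result suffices. The longer branch makes
five instructions, the test included. -/
theorem UnitCost.pair (hc : UnitCost w imul κ β) (s : State) (d : ℕ)
    (h : Nat.pair (s.reg (regT d)) (s.reg (regT (d + 1))) < 2 ^ β) :
    ∃ s', Leads w imul (pairProg d) s s' (5 * κ) ∧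
      s'.reg (regT d) = Nat.pair (s.reg (regT d)) (s.reg (regT (d + 1))) ∧ Pres d s s' := by
  set a := s.reg (regT d) with ha
  set b := s.reg (regT (d + 1)) with hb
  have ha' : a < 2 ^ β := (Nat.left_le_pair a b).trans_lt h
  have hb' : b < 2 ^ β := (Nat.right_le_pair a b).trans_lt h
  have h1 := hc.sub s (regT (d + 2)) (regT (d + 1)) (regT d) hb' ha'
  rw [← ha, ← hb] at h1
  set s1 := s.setReg (regT (d + 2)) (b - a) with hs1
  have r0 : s1.reg (regT d) = a := by simp [s1, State.setReg_reg, ha]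
  have r1 : s1.reg (regT (d + 1)) = b := by simp [s1, State.setReg_reg, hb]
  have r2 : s1.reg (regT (d + 2)) = b - a := by simp [s1, State.setReg_reg]
  have P1 : Pres d s s1 := (Pres.refl d s).setReg (by omega) _
  by_cases hab : a < b
  · have hp : Nat.pair a b = b * b + a := by simp [Nat.pair, hab]
    have h2 := hc.mul' s1 (regT (d + 2)) (regT (d + 1)) (regT (d + 1)) (r1 ▸ hb') (r1 ▸ hb')
    rw [r1] at h2
    set s2 := s1.setReg (regT (d + 2)) (b * b) with hs2
    have q0 : s2.reg (regT d) = a := by simp [s2, State.setReg_reg, r0]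
    have q2 : s2.reg (regT (d + 2)) = b * b := by simp [s2, State.setReg_reg]
    have h3 := hc.add s2 (regT d) (regT (d + 2)) (regT d) (by rw [q2]; omega) (by rw [q0]; omega)
    rw [q0, q2, ← hp] at h3
    exact ⟨_, (h1.seq (hc.ite_pos (by rw [r2]; omega) (by rw [r2]; omega) (h2.seq h3))).mono
      (by omega), by simp [State.setReg_reg],
      (P1.setReg (by omega) _).setReg le_rfl _⟩
  · have hp : Nat.pair a b = a * a + a + b := by simp [Nat.pair, hab]
    have h2 := hc.mul' s1 (regT (d + 2)) (regT d) (regT d) (r0 ▸ ha') (r0 ▸ ha')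
    rw [r0] at h2
    set s2 := s1.setReg (regT (d + 2)) (a * a) with hs2
    have q0 : s2.reg (regT d) = a := by simp [s2, State.setReg_reg, r0]
    have q1 : s2.reg (regT (d + 1)) = b := by simp [s2, State.setReg_reg, r1]
    have q2 : s2.reg (regT (d + 2)) = a * a := by simp [s2, State.setReg_reg]
    have h3 := hc.add s2 (regT (d + 2)) (regT (d + 2)) (regT d) (by rw [q2]; omega)
      (by rw [q0]; omega)
    rw [q0, q2] at h3
    set s3 := s2.setReg (regT (d + 2)) (a * a + a) with hs3
    have p1 : s3.reg (regT (d + 1)) = b := by simp [s3, State.setReg_reg, q1]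
    have p2 : s3.reg (regT (d + 2)) = a * a + a := by simp [s3, State.setReg_reg]
    have h4 := hc.add s3 (regT d) (regT (d + 2)) (regT (d + 1)) (by rw [p2]; omega)
      (by rw [p1]; omega)
    rw [p1, p2, ← hp] at h4
    exact ⟨_, (h1.seq (hc.ite_zero (by rw [r2]; omega) (h2.seq (h3.seq h4)))).mono
      (by omega), by simp [State.setReg_reg],
      ((P1.setReg (by omega) _).setReg (by omega) _).setReg le_rfl _⟩

theorem pair_le_pow {M p a b : ℕ} (hM : 2 ≤ M) (ha : a ≤ M ^ p) (hb : b ≤ M ^ p) :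
    Nat.pair a b ≤ M ^ (2 * p + 2) := by
  have h1 : Nat.pair a b < (max a b + 1) ^ 2 := Nat.pair_lt_max_add_one_sq a b
  have h2 : max a b + 1 ≤ M ^ (p + 1) := by
    have : M ^ p * 2 ≤ M ^ p * M := Nat.mul_le_mul_left _ hM
    have h3 : 1 ≤ M ^ p := Nat.one_le_pow _ _ (by omega)
    rw [pow_succ]
    have := max_le ha hb
    omega
  calc Nat.pair a b ≤ (max a b + 1) ^ 2 := h1.le
    _ ≤ (M ^ (p + 1)) ^ 2 := Nat.pow_le_pow_left h2 2
    _ = M ^ (2 * p + 2) := by rw [← pow_mul]; ring_nf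

theorem le_pow_self' {M v : ℕ} (hM : 2 ≤ M) : v ≤ M ^ v :=
  (Nat.lt_pow_self (by omega)).le

/-- The address computation: registers `d`, …, `d + 3` hold `a`, `i`, `j`, `k`. -/
theorem UnitCost.address (hc : UnitCost w imul κ β) (s : State) (d : ℕ) {base : ℕ}
    (hbase : s.reg (regG 0) = base)
    (h : cell base (s.reg (regT d)) (s.reg (regT (d + 1))) (s.reg (regT (d + 2)))
      (s.reg (regT (d + 3))) < 2 ^ β) :
    ∃ s', Leads w imul (addressProg d) s s' (16 * κ) ∧
      s'.reg (regT d) = cell base (s.reg (regT d)) (s.reg (regT (d + 1))) (s.reg (regT (d + 2)))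
      (s.reg (regT (d + 3))) ∧ Pres d s s' := by
  set a := s.reg (regT d) with ha
  set i := s.reg (regT (d + 1)) with hi
  set j := s.reg (regT (d + 2)) with hj
  set k := s.reg (regT (d + 3)) with hk
  have e3 : Nat.pair a (Nat.pair i (Nat.pair j k)) < 2 ^ β := by
    unfold cell at h; omega
  have e2 : Nat.pair i (Nat.pair j k) < 2 ^ β := (Nat.right_le_pair _ _).trans_lt e3
  have e1 : Nat.pair j k < 2 ^ β := (Nat.right_le_pair _ _).trans_lt e2
  obtain ⟨s1, h1, r1, p1⟩ := hc.pair s (d + 2) e1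
  have q1 : s1.reg (regT (d + 1)) = i := p1.regT _ (by omega)
  obtain ⟨s2, h2, r2, p2⟩ := hc.pair s1 (d + 1) (by rw [q1, r1]; exact e2)
  rw [q1, r1] at r2
  have q2 : s2.reg (regT d) = a := (p2.regT _ (by omega)).trans (p1.regT _ (by omega))
  obtain ⟨s3, h3, r3, p3⟩ := hc.pair s2 d (by rw [q2, r2]; exact e3)
  rw [q2, r2] at r3
  have pp : Pres d s s3 := ((p1.mono (by omega)).trans (p2.mono (by omega))).trans p3
  have g : s3.reg (regG 0) = base := (pp.regG 0).trans hbase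
  have h4 := hc.add s3 (regT d) (regG 0) (regT d) (by rw [g]; unfold cell at h; omega)
    (by rw [r3]; exact e3)
  refine ⟨_, (h1.seq (h2.seq (h3.seq h4))).mono (by omega), ?_, pp.setReg le_rfl _⟩
  simp [State.setReg_reg, g, r3, cell, hj, hk]

/-- Each of the three nested pairings turns an exponent q into 2q + 2, which leads from p to 8p +
14. The remaining slack absorbs the addition of `base`. -/
theorem cell_le_pow {M p base a i j k : ℕ} (hM : 2 ≤ M) (hb : base ≤ M)
    (ha : a ≤ M ^ p) (hi : i ≤ M ^ p) (hj : j ≤ M ^ p) (hk : k ≤ M ^ p) :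
    cell base a i j k ≤ M ^ (8 * p + 16) := by
  have mono : ∀ {x q q' : ℕ}, x ≤ M ^ q → q ≤ q' → x ≤ M ^ q' := fun h h' =>
    h.trans (Nat.pow_le_pow_right (by omega) h')
  have h1 := pair_le_pow hM hj hk
  have h2 := pair_le_pow hM (p := 2 * p + 2) (mono hi (by omega)) h1
  have h3 := pair_le_pow hM (p := 2 * (2 * p + 2) + 2) (mono ha (by omega)) h2
  have h4 := mono h3 (q' := 8 * p + 15) (by omega)
  have h5 : base ≤ M ^ (8 * p + 15) := mono (by simpa using hb : base ≤ M ^ 1) (by omega)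
  have h6 : M ^ (8 * p + 15) * 2 ≤ M ^ (8 * p + 16) := by
    rw [pow_succ]; exact Nat.mul_le_mul_left _ hM
  unfold cell
  omega

/-- Sums and products of values add the exponents. In a bounded sum the index can be as large as `M
^ e.deg`, so the body is estimated with this number in place of `M`; this is why degrees are
multiplied there and why `M` is quantified inside the induction. -/
theorem Expr.eval_le {base : ℕ} (e : Expr) : ∀ {M : ℕ} {σ : Store}, 2 ≤ M → σ.Bounded M →
    e.Ok base σ → e.eval σ ≤ M ^ e.deg := by
  have two : ∀ {M a b p q : ℕ}, 2 ≤ M → a ≤ M ^ p → b ≤ M ^ q → a + b ≤ M ^ (p + q + 1) := by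
    intro M a b p q hM ha hb
    have h1 : M ^ p ≤ M ^ (p + q) := Nat.pow_le_pow_right (by omega) (by omega)
    have h2 : M ^ q ≤ M ^ (p + q) := Nat.pow_le_pow_right (by omega) (by omega)
    have h6 : M ^ (p + q) * 2 ≤ M ^ (p + q + 1) := by
      rw [pow_succ]; exact Nat.mul_le_mul_left _ hM
    omega
  have up : ∀ {M q q' : ℕ}, 2 ≤ M → q ≤ q' → M ^ q ≤ M ^ q' := fun h h' =>
    Nat.pow_le_pow_right (by omega) h'
  induction e with
  | lit v => intro M σ hM _ _; exact (le_pow_self' hM : v ≤ M ^ v).trans (up hM (by simp [deg]))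
  | var x => intro M σ hM hB _; simpa [deg, eval] using hB.var x
  | inp i ih =>
    intro M σ hM hB _
    exact (hB.raw _).trans (by simpa using up hM (one_le_deg (inp i)))
  | get a i j k _ _ _ =>
    intro M σ hM hB hok
    exact (hB.arr _ hok.1 _ _ _).trans
      (by simpa using up hM (one_le_deg (get a i j k)))
  | add e f ihe ihf => intro M σ hM hB hok; exact two hM (ihe hM hB hok.1) (ihf hM hB hok.2)
  | sub e f ihe ihf =>
    intro M σ hM hB hok
    exact (Nat.sub_le _ _).trans ((ihe hM hB hok.1).trans (up hM (by simp [deg]; omega)))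
  | mul e f ihe ihf =>
    intro M σ hM hB hok
    refine (Nat.mul_le_mul (ihe hM hB hok.1) (ihf hM hB hok.2)).trans ?_
    rw [← pow_add]
    exact up hM (by simp [deg])
  | sum x e f ihe ihf =>
    intro M σ hM hB hok
    have he := ihe hM hB hok.1
    have hM' : M ≤ M ^ e.deg := Nat.le_self_pow (by have := e.one_le_deg; omega) M
    have hf : ∀ i ∈ Finset.range (e.eval σ), f.eval (σ.setVar x i) ≤ (M ^ e.deg) ^ f.deg := by
      intro i hi
      rw [Finset.mem_range] at hi
      exact ihf (hM.trans hM') ((hB.mono hM').setVar (hi.le.trans he)) (hok.2 i hi)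
    refine (Finset.sum_le_card_nsmul _ _ _ hf).trans ?_
    rw [Finset.card_range, smul_eq_mul, ← pow_mul]
    refine (Nat.mul_le_mul_right _ he).trans ?_
    rw [← pow_add]
    refine up hM ?_
    simp only [deg]
    ring_nf
    omega

theorem State.store_setReg_regV (s : State) (base x v : ℕ) :
    (s.setReg (regV x) v).store base = (s.store base).setVar x v := by
  ext y
  · simp [State.store, Store.setVar_var, State.setReg_reg]
  · simp [State.store]
  · simp [State.store]

/-- A loop in which register `d` for intermediate results counts down. -/
theorem UnitCost.countdown (hc : UnitCost w imul κ β) {d e x : ℕ} (hed : e ≠ d) {p : Program}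
    {B : ℕ} (hB : B < 2 ^ β) (h1 : 1 < 2 ^ β) (J : ℕ → ℕ → State → Prop)
    (hJ : ∀ i t s, J i t s → s.reg (regT d) = i)
    (step : ∀ i < B, ∀ t s, J (i + 1) t s → ∃ s' t', Leads w imul p
      (((s.setReg (regT e) 1).setReg (regT d) i).setReg (regV x) i) s' t' ∧
      J i (t + (5 * κ + t')) s') :
    ∀ n ≤ B, ∀ t s, J n t s → ∃ s' t', Leads w imul (.loop (regT d) <|
      .seq (.const (regT e) 1) <| .seq (.sub (regT d) (regT d) (regT e)) <|
      .seq (copyProg (regV x) (regT d)) p) s s' (t' + κ) ∧ J 0 (t + t') s' := by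
  intro n
  induction n with
  | zero =>
    intro _ t s hs
    exact ⟨s, 0, by simpa using hc.loop_zero (hJ _ _ _ hs), hs⟩
  | succ n ih =>
    intro hn t s hs
    have hr := hJ _ _ _ hs
    obtain ⟨s1, t1, hl1, hJ1⟩ := step n hn t s hs
    obtain ⟨s2, t2, hl2, hJ2⟩ := ih (by omega) _ _ hJ1
    refine ⟨s2, 5 * κ + t1 + t2, ?_, by rwa [← Nat.add_assoc]⟩
    have c1 := hc.const s (regT e) 1 h1
    have c2 := hc.sub (s.setReg (regT e) 1) (regT d) (regT d) (regT e)
      (by simp [State.setReg_reg, hed.symm, hr]; omega) (by simpa [State.setReg_reg] using h1)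
    have e2 : (s.setReg (regT e) 1).reg (regT d) - (s.setReg (regT e) 1).reg (regT e) = n := by
      simp [State.setReg_reg, hed.symm, hr]
    rw [e2] at c2
    have c3 := hc.copy ((s.setReg (regT e) 1).setReg (regT d) n) (x := regV x) (y := regT d)
      (by simp) (by simp [State.setReg_reg]; omega)
    have e3 : ((s.setReg (regT e) 1).setReg (regT d) n).reg (regT d) = n := by
      simp [State.setReg_reg]
    rw [e3] at c3
    exact (hc.loop_pos (by rw [hr]; omega) (by rw [hr]; omega) (c1.seq (c2.seq (c3.seq hl1)))
      hl2).mono (by omega)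

/-- A subexpression compiled at depth `d` leaves the intermediate registers below `d` alone, so
operands that are already computed survive the evaluation of later ones. The factor 24 dominates the
overhead of a single node; the largest is that of an array access, with 16 instructions for the
address, a constant and a load. -/
theorem Expr.compile_spec (hc : UnitCost w imul κ β) {base : ℕ} (e : Expr) :
    ∀ {M d : ℕ} {s : State}, 2 ≤ M → base ≤ M → s.reg (regG 0) = base →
      (s.store base).Bounded M → e.Ok base (s.store base) → M ^ e.deg < 2 ^ β →
      ∃ s', Leads w imul (e.compile d) s s' (κ * (24 * e.time (s.store base))) ∧
        s'.reg (regT d) = e.eval (s.store base) ∧ Pres d s s' := by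
  have up : ∀ {M q q' : ℕ}, 2 ≤ M → M ^ q' < 2 ^ β → q ≤ q' → M ^ q < 2 ^ β := fun h h' h'' =>
    (Nat.pow_le_pow_right (by omega) h'').trans_lt h'
  have binary : ∀ (e f : Expr) (op : ℕ → ℕ → ℕ) (o : ℕ → ℕ → ℕ → Program) {M d : ℕ} {s : State},
      2 ≤ M → base ≤ M → s.reg (regG 0) = base → (s.store base).Bounded M →
      e.Ok base (s.store base) → f.Ok base (s.store base) → M ^ (e.deg + f.deg + 1) < 2 ^ β →
      (∀ s : State, s.reg (regT d) < 2 ^ β → s.reg (regT (d + 1)) < 2 ^ β →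
        Leads w imul (o (regT d) (regT d) (regT (d + 1))) s
          (s.setReg (regT d) (op (s.reg (regT d)) (s.reg (regT (d + 1))))) κ) →
      (∃ s', Leads w imul (e.compile d) s s' (κ * (24 * e.time (s.store base))) ∧
        s'.reg (regT d) = e.eval (s.store base) ∧ Pres d s s') →
      (∀ {M d : ℕ} {s : State}, 2 ≤ M → base ≤ M → s.reg (regG 0) = base →
      (s.store base).Bounded M → f.Ok base (s.store base) → M ^ f.deg < 2 ^ β →
      ∃ s', Leads w imul (f.compile d) s s' (κ * (24 * f.time (s.store base))) ∧
        s'.reg (regT d) = f.eval (s.store base) ∧ Pres d s s') →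
      ∃ s', Leads w imul (.seq (e.compile d) <| .seq (f.compile (d + 1)) <|
          o (regT d) (regT d) (regT (d + 1))) s s'
          (κ * (24 * (e.time (s.store base) + f.time (s.store base) + 1))) ∧
        s'.reg (regT d) = op (e.eval (s.store base)) (f.eval (s.store base)) ∧ Pres d s s' := by
    intro e f op o M d s hM hb hg hB hoe hof hd ho ⟨s1, h1, r1, p1⟩ ihf
    obtain ⟨s2, h2, r2, p2⟩ := ihf (d := d + 1) (s := s1) hM hb ((p1.regG 0).trans hg)
      (by rwa [p1.store]) (by rwa [p1.store]) (up hM hd (by omega))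
    rw [p1.store] at h2 r2
    have q1 : s2.reg (regT d) = e.eval (s.store base) := by rw [p2.regT _ (by omega), r1]
    have h3 := ho s2 (by rw [q1]; exact (e.eval_le hM hB hoe).trans_lt (up hM hd (by omega)))
      (by rw [r2]; exact (f.eval_le hM hB hof).trans_lt (up hM hd (by omega)))
    refine ⟨_, (h1.seq (h2.seq h3)).mono ?_, ?_, (p1.trans (p2.mono (by omega))).setReg le_rfl _⟩
    · linarith [Nat.mul_le_mul_right κ (by norm_num : 1 ≤ 24)]
    · simp [State.setReg_reg, q1, r2]
  induction e with
  | lit v =>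
    intro M d s hM _ hg hB _ hd
    have hv : v < 2 ^ β := (le_pow_self' hM).trans_lt (up hM hd (by simp [deg]))
    exact ⟨_, (hc.const s (regT d) v hv).mono (by simp [time]; omega), by
      simp [State.setReg_reg, eval], (Pres.refl d s).setReg le_rfl _⟩
  | var x =>
    intro M d s hM _ hg hB _ hd
    have hv : s.reg (regV x) < 2 ^ β := (hB.var x).trans_lt (by simpa [deg] using hd)
    exact ⟨_, (hc.copy s (by simp) hv).mono (by simp [time]; omega), by
      simp [State.setReg_reg, eval, State.store], (Pres.refl d s).setReg le_rfl _⟩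
  | inp i ih =>
    intro M d s hM hb hg hB hok hd
    obtain ⟨s1, h1, r1, p1⟩ := ih (d := d) hM hb hg hB hok.1 (up hM hd (by simp [deg]))
    have hm : s1.mem (s1.reg (regT d)) = (s.store base).raw (i.eval (s.store base)) := by
      rw [r1, p1.mem]
      exact (if_pos hok.2).symm
    have h2 := hc.load s1 (regT d) (regT d)
      (by rw [r1]; exact (i.eval_le hM hB hok.1).trans_lt (up hM hd (by simp [deg])))
      (by rw [hm]; exact (hB.raw _).trans_lt (by simpa using up hM hd (one_le_deg (inp i))))
    refine ⟨_, (h1.seq h2).mono ?_, ?_, p1.setReg le_rfl _⟩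
    · simp only [time]; linarith [Nat.mul_le_mul_right κ (by norm_num : 1 ≤ 24)]
    · rw [hm]; simp [State.setReg_reg, eval]
  | get a i j k ihi ihj ihk =>
    intro M d s hM hb hg hB hok hd
    obtain ⟨ha, hoi, hoj, hok'⟩ := hok
    have hva : a ≤ M ^ a := le_pow_self' hM
    have h0 := hc.const s (regT d) a (hva.trans_lt (up hM hd (by simp [deg]; omega)))
    set s0 := s.setReg (regT d) a with hs0
    have p0 : Pres d s s0 := (Pres.refl d s).setReg le_rfl _
    obtain ⟨s1, h1, r1, p1⟩ := ihi (d := d + 1) (s := s0) hM hb ((p0.regG 0).trans hg)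
      (by rwa [p0.store]) (by rwa [p0.store]) (up hM hd (by simp [deg]; omega))
    have q1 : Pres d s s1 := p0.trans (p1.mono (by omega))
    obtain ⟨s2, h2, r2, p2⟩ := ihj (d := d + 2) (s := s1) hM hb ((q1.regG 0).trans hg)
      (by rwa [q1.store]) (by rwa [q1.store]) (up hM hd (by simp [deg]; omega))
    have q2 : Pres d s s2 := q1.trans (p2.mono (by omega))
    obtain ⟨s3, h3, r3, p3⟩ := ihk (d := d + 3) (s := s2) hM hb ((q2.regG 0).trans hg)
      (by rwa [q2.store]) (by rwa [q2.store]) (up hM hd (by simp [deg]; omega))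
    have q3 : Pres d s s3 := q2.trans (p3.mono (by omega))
    rw [p0.store] at h1 r1
    rw [q1.store] at h2 r2
    rw [q2.store] at h3 r3
    have t0 : s3.reg (regT d) = a := by
      rw [p3.regT _ (by omega), p2.regT _ (by omega), p1.regT _ (by omega)]
      simp [hs0, State.setReg_reg]
    have t1 : s3.reg (regT (d + 1)) = i.eval (s.store base) := by
      rw [p3.regT _ (by omega), p2.regT _ (by omega), r1]
    have t2 : s3.reg (regT (d + 2)) = j.eval (s.store base) := by
      rw [p3.regT _ (by omega), r2]
    have hcell : cell base a (i.eval (s.store base)) (j.eval (s.store base))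
        (k.eval (s.store base)) < 2 ^ β := by
      refine (cell_le_pow (p := i.deg + j.deg + k.deg + a + 1) hM hb ?_ ?_ ?_ ?_).trans_lt
        (up hM hd (by simp only [deg]; omega))
      · exact hva.trans (Nat.pow_le_pow_right (by omega) (by omega))
      · exact (i.eval_le hM hB hoi).trans (Nat.pow_le_pow_right (by omega) (by omega))
      · exact (j.eval_le hM hB hoj).trans (Nat.pow_le_pow_right (by omega) (by omega))
      · exact (k.eval_le hM hB hok').trans (Nat.pow_le_pow_right (by omega) (by omega))
    obtain ⟨s4, h4, r4, p4⟩ := hc.address s3 d ((q3.regG 0).trans hg)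
      (by rw [t0, t1, t2, r3]; exact hcell)
    rw [t0, t1, t2, r3] at r4
    have q4 := q3.trans p4
    have hm : s4.mem (s4.reg (regT d)) = (get a i j k).eval (s.store base) := by
      rw [r4, q4.mem]; rfl
    have h5 := hc.load s4 (regT d) (regT d) (by rw [r4]; exact hcell)
      (by rw [hm]; exact (hB.arr _ ha _ _ _).trans_lt
            (by simpa using up hM hd (one_le_deg (get a i j k))))
    refine ⟨_, (h0.seq (h1.seq (h2.seq (h3.seq (h4.seq h5))))).mono ?_, ?_, q4.setReg le_rfl _⟩
    · simp only [time]; linarith [Nat.mul_le_mul_right κ (by norm_num : 1 ≤ 24)]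
    · rw [hm]; simp [State.setReg_reg]
  | add e f ihe ihf =>
    intro M d s hM hb hg hB hok hd
    exact binary e f (· + ·) .add hM hb hg hB hok.1 hok.2 hd
      (fun s h h' => hc.add s _ _ _ h h')
      (ihe hM hb hg hB hok.1 (up hM hd (by simp [deg]; omega))) ihf
  | sub e f ihe ihf =>
    intro M d s hM hb hg hB hok hd
    exact binary e f (· - ·) .sub hM hb hg hB hok.1 hok.2 hd
      (fun s h h' => hc.sub s _ _ _ h h')
      (ihe hM hb hg hB hok.1 (up hM hd (by simp [deg]; omega))) ihf
  | mul e f ihe ihf =>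
    intro M d s hM hb hg hB hok hd
    exact binary e f (· * ·) .mul hM hb hg hB hok.1 hok.2 hd
      (fun s h h' => hc.mul' s _ _ _ h h')
      (ihe hM hb hg hB hok.1 (up hM hd (by simp [deg]; omega))) ihf
  | sum x e f ihe ihf =>
    intro M d s hM hb hg hB hok hd
    have hval := (sum x e f).eval_le hM hB hok
    have hev := e.eval_le hM hB hok.1
    have hone : 1 < 2 ^ β := by
      have := up (q := 1) hM hd (one_le_deg _)
      simp only [pow_one] at this
      omega
    have hde : e.deg ≤ (sum x e f).deg := by
      simp only [deg]; nlinarith [e.one_le_deg]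
    obtain ⟨s1, h1, r1, p1⟩ := ihe (d := d) hM hb hg hB hok.1 (up hM hd hde)
    set n := e.eval (s.store base) with hn
    have hnβ : n < 2 ^ β := hev.trans_lt (up hM hd hde)
    have hM' : M ≤ M ^ e.deg := Nat.le_self_pow (by have := e.one_le_deg; omega) M
    have h2 := hc.const s1 (regT (d + 1)) 0 (by omega)
    set s2 := s1.setReg (regT (d + 1)) 0 with hs2
    have p2 : Pres d s s2 := p1.setReg (by omega) _
    have hxβ : s2.reg (regV x) < 2 ^ β := by
      rw [p2.regV]
      exact (hB.var x).trans_lt (by simpa using up hM hd (one_le_deg _))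
    have h3 := hc.copy s2 (x := regT (d + 2)) (y := regV x) (by simp) hxβ
    set s3 := s2.setReg (regT (d + 2)) (s2.reg (regV x)) with hs3
    have p3 : Pres d s s3 := p2.setReg (by omega) _
    let ft : ℕ → ℕ := fun i => f.time ((s.store base).setVar x i) + 1
    let fv : ℕ → ℕ := fun i => f.eval ((s.store base).setVar x i)
    -- With `i` summands still to come, accumulator plus outstanding sum is constant, and so is time
    -- spent plus outstanding time budget.
    let J : ℕ → ℕ → State → Prop := fun i t u =>
      u.reg (regT d) = i ∧ u.mem = s.mem ∧ (∀ y, y ≠ x → u.reg (regV y) = s.reg (regV y)) ∧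
      (∀ y, u.reg (regG y) = s.reg (regG y)) ∧ (∀ y < d, u.reg (regT y) = s.reg (regT y)) ∧
      u.reg (regT (d + 2)) = s.reg (regV x) ∧
      u.reg (regT (d + 1)) + ∑ j ∈ Finset.range i, fv j = ∑ j ∈ Finset.range n, fv j ∧
      t + κ * (24 * ∑ j ∈ Finset.range i, ft j) = κ * (24 * ∑ j ∈ Finset.range n, ft j)
    have step : ∀ i < n, ∀ t u, J (i + 1) t u → ∃ u' t', Leads w imul
        (.seq (f.compile (d + 3)) (.add (regT (d + 1)) (regT (d + 1)) (regT (d + 3))))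
        (((u.setReg (regT (d + 3)) 1).setReg (regT d) i).setReg (regV x) i) u' t' ∧
        J i (t + (5 * κ + t')) u' := by
      rintro i hi t u ⟨j1, j2, j3, j4, j5, j6, j7, j8⟩
      set v := ((u.setReg (regT (d + 3)) 1).setReg (regT d) i).setReg (regV x) i with hv
      have hst : v.store base = (s.store base).setVar x i := by
        ext y
        · rw [Store.setVar_var]
          by_cases hy : y = x
          · simp [State.store, hv, State.setReg_reg, hy]
          · simp [State.store, hv, State.setReg_reg, hy, j3 y hy]
        · simp [State.store, hv, j2]
        · simp [State.store, hv, j2]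
      -- The index may exceed `M`, but not `M ^ e.deg`.
      obtain ⟨v1, g1, r1, p1⟩ := ihf (M := M ^ e.deg) (d := d + 3) (s := v) (hM.trans hM')
        (hb.trans hM') (by simp [hv, State.setReg_reg, j4, hg])
        (by rw [hst]; exact (hB.mono hM').setVar (hi.le.trans hev))
        (by rw [hst]; exact hok.2 i hi)
        (by rw [← pow_mul]; exact up hM hd (by simp only [deg]; nlinarith))
      rw [hst] at g1 r1
      have hacc : v1.reg (regT (d + 1)) = u.reg (regT (d + 1)) := by
        rw [p1.regT _ (by omega)]; simp [hv, State.setReg_reg]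
      rw [Finset.sum_range_succ] at j7 j8
      -- A partial sum of natural numbers is at most the full sum, whose length is already bounded.
      have hle : u.reg (regT (d + 1)) + fv i ≤ ∑ j ∈ Finset.range n, fv j := by omega
      have hlt : u.reg (regT (d + 1)) + fv i < 2 ^ β := hle.trans_lt (hval.trans_lt hd)
      have g2 := hc.add v1 (regT (d + 1)) (regT (d + 1)) (regT (d + 3))
        (by rw [hacc]; omega) (by rw [r1]; exact lt_of_le_of_lt (Nat.le_add_left _ _) hlt)
      refine ⟨_, _, (g1.seq g2).mono (?_ : _ ≤ κ * (24 * ft i) - 5 * κ), ?_⟩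
      · have : κ * (24 * ft i) = κ * (24 * f.time ((s.store base).setVar x i)) + 24 * κ := by
          simp only [ft]; ring
        omega
      · refine ⟨?_, ?_, fun y hy => ?_, fun y => ?_, fun y hy => ?_, ?_, ?_, ?_⟩
        · simp [State.setReg_reg, p1.regT d (by omega), hv]
        · simp [p1.mem, hv, j2]
        · simp [State.setReg_reg, p1.regV, hv, hy, j3 y hy]
        · simp [State.setReg_reg, p1.regG, hv, j4 y]
        · have y1 : y ≠ d + 1 := by omega
          have y2 : y ≠ d + 3 := by omega
          have y3 : y ≠ d := by omega
          simp [State.setReg_reg, p1.regT y (by omega), hv, j5 y hy, y1, y2, y3]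
        · simp [State.setReg_reg, p1.regT (d + 2) (by omega), hv, j6]
        · rw [State.setReg_reg, if_pos rfl, hacc, r1]
          simp only [fv] at j7 ⊢
          omega
        · have hκ : 5 * κ ≤ κ * (24 * ft i) := by
            have : κ * 5 ≤ κ * (24 * ft i) := Nat.mul_le_mul_left _ (by simp only [ft]; omega)
            omega
          have e1 : κ * (24 * (∑ j ∈ Finset.range i, ft j + ft i)) =
            κ * (24 * ∑ j ∈ Finset.range i, ft j) + κ * (24 * ft i) := by ring
          have : κ * (24 * ft i) = κ * (24 * f.time ((s.store base).setVar x i)) + 24 * κ := by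
            simp only [ft]; ring
          omega
    obtain ⟨s4, t4, h4, j1, j2, j3, j4, j5, j6, j7, j8⟩ := hc.countdown (e := d + 3) (x := x)
      (by omega) hnβ hone J (fun i t u h => h.1) step n le_rfl 0 s3 (by
        refine ⟨?_, p3.mem, fun y _ => p3.regV y, p3.regG, p3.regT, ?_, ?_, ?_⟩
        · simp [hs3, hs2, State.setReg_reg, r1]
        · simp [hs3, State.setReg_reg, p2.regV]
        · simp [hs3, hs2, State.setReg_reg]
        · simp)
    simp only [Finset.range_zero, Finset.sum_empty, Nat.add_zero, Nat.zero_add, Nat.mul_zero] at j7 j8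
    have h5 := hc.copy s4 (x := regV x) (y := regT (d + 2)) (by simp)
      (by rw [j6, ← p2.regV]; exact hxβ)
    set s5 := s4.setReg (regV x) (s4.reg (regT (d + 2))) with hs5
    have r5 : s5.reg (regT (d + 1)) = ∑ j ∈ Finset.range n, fv j := by
      simp [hs5, State.setReg_reg, j7]
    have h6 := hc.copy s5 (x := regT d) (y := regT (d + 1)) (by simp)
      (by rw [r5]; exact hval.trans_lt hd)
    refine ⟨_, (h1.seq (h2.seq (h3.seq (h4.seq (h5.seq h6))))).mono ?_, ?_, ?_⟩
    · rw [j8]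
      have : κ * (24 * (sum x e f).time (s.store base)) = κ * (24 * e.time (s.store base)) +
          24 * κ + κ * (24 * ∑ j ∈ Finset.range n, ft j) := by
        simp only [time, ft, ← hn]; ring
      omega
    · rw [State.setReg_reg, if_pos rfl, r5]; rfl
    · refine ⟨by simp [hs5, j2], fun y => ?_, fun y => ?_, fun y hy => ?_⟩
      · by_cases hy : y = x
        · simp [hs5, State.setReg_reg, hy, j6]
        · simp [hs5, State.setReg_reg, hy, j3 y hy]
      · simp [hs5, State.setReg_reg, j4]
      · have y3 : y ≠ d := by omega
        simp [hs5, State.setReg_reg, j5 y hy, y3]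

end Compile

end RAM

namespace RAM

/-! ### Statements -/

/-- Statements of the structured language. -/
inductive Stmt : Type
  | set (x : ℕ) (e : Expr) : Stmt
  | put (a : ℕ) (i j k e : Expr) : Stmt
  /-- write to raw memory -/
  | out (i e : Expr) : Stmt
  | seq (p q : Stmt) : Stmt
  | ite (c : Expr) (p q : Stmt) : Stmt
  /-- run `p` for all values of the variable `x` below `e`, in decreasing order, and restore `x` -/
  | forTo (x : ℕ) (e : Expr) (p : Stmt) : Stmt

/-- `f (n - 1)`, …, `f 0`, applied one after the other. -/
def iterDown (f : ℕ → Store → Store) : ℕ → Store → Store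
  | 0, σ => σ
  | n + 1, σ => iterDown f n (f n σ)

/-- The number of steps of an iteration. -/
def iterTime (f : ℕ → Store → Store) (g : ℕ → Store → ℕ) : ℕ → Store → ℕ
  | 0, _ => 0
  | n + 1, σ => g n σ + 1 + iterTime f g n (f n σ)

/-- A property of all intermediate results of an iteration. -/
def iterAll (f : ℕ → Store → Store) (P : ℕ → Store → Prop) : ℕ → Store → Prop
  | 0, _ => True
  | n + 1, σ => P n σ ∧ iterAll f P n (f n σ)

namespace Stmt

/-- The effect of a statement. -/
def run : Stmt → Store → Store
  | set x e, σ => σ.setVar x (e.eval σ)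
  | put a i j k e, σ =>
    σ.setArr a (entryUpdate (σ.arr a) (i.eval σ) (j.eval σ) (k.eval σ) (e.eval σ))
  | out i e, σ => σ.setRaw (i.eval σ) (e.eval σ)
  | seq p q, σ => q.run (p.run σ)
  | ite c p q, σ => if c.eval σ ≠ 0 then p.run σ else q.run σ
  | forTo x e p, σ => (iterDown (fun i τ => p.run (τ.setVar x i)) (e.eval σ) σ).setVar x (σ.var x)

/-- The number of steps of a statement. -/
def time : Stmt → Store → ℕ
  | set _ e, σ => e.time σ + 1
  | put _ i j k e, σ => i.time σ + j.time σ + k.time σ + e.time σ + 1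
  | out i e, σ => i.time σ + e.time σ + 1
  | seq p q, σ => p.time σ + q.time (p.run σ)
  | ite c p q, σ => c.time σ + 1 + if c.eval σ ≠ 0 then p.time σ else q.time σ
  | forTo x e p, σ => e.time σ + 1 +
    iterTime (fun i τ => p.run (τ.setVar x i)) (fun i τ => p.time (τ.setVar x i)) (e.eval σ) σ

/-- All values that are assigned are at most `M`, and raw memory is accessed below `base` only. -/
def Ok (M base : ℕ) : Stmt → Store → Prop
  | set _ e, σ => e.Ok base σ ∧ e.eval σ ≤ M
  | put a i j k e, σ => a ≠ 0 ∧ i.Ok base σ ∧ j.Ok base σ ∧ k.Ok base σ ∧ e.Ok base σ ∧ e.eval σ ≤ M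
  | out i e, σ => i.Ok base σ ∧ e.Ok base σ ∧ i.eval σ < base ∧ e.eval σ ≤ M
  | seq p q, σ => p.Ok M base σ ∧ q.Ok M base (p.run σ)
  | ite c p q, σ => c.Ok base σ ∧ if c.eval σ ≠ 0 then p.Ok M base σ else q.Ok M base σ
  | forTo x e p, σ => e.Ok base σ ∧ e.eval σ ≤ M ∧
    iterAll (fun i τ => p.run (τ.setVar x i)) (fun i τ => p.Ok M base (τ.setVar x i)) (e.eval σ) σ

/-- If all variables and array entries are at most `M`, the numbers that occur are at most
`M ^ deg`. -/
def deg : Stmt → ℕ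
  | set _ e => e.deg
  | put a i j k e => 8 * (i.deg + j.deg + k.deg + a + 1) + 16 + e.deg
  | out i e => i.deg + e.deg
  | seq p q => p.deg + q.deg
  | ite c p q => c.deg + p.deg + q.deg
  | forTo _ e p => e.deg + p.deg

theorem one_le_deg (p : Stmt) : 1 ≤ p.deg := by
  induction p with
  | set x e => exact e.one_le_deg
  | put a i j k e => simp only [deg]; omega
  | out i e => simp only [deg]; have := i.one_le_deg; omega
  | seq p q hp hq => simp only [deg]; omega
  | ite c p q => simp only [deg]; omega
  | forTo x e p => simp only [deg]; omega

/-- Translation of statements. -/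
def compile : ℕ → Stmt → Program
  | d, set x e => .seq (e.compile d) (copyProg (regV x) (regT d))
  | d, put a i j k e =>
    .seq (.const (regT d) a) <| .seq (i.compile (d + 1)) <| .seq (j.compile (d + 2)) <|
    .seq (k.compile (d + 3)) <| .seq (addressProg d) <| .seq (e.compile (d + 1)) <|
    .store (regT d) (regT (d + 1))
  | d, out i e => .seq (i.compile d) <| .seq (e.compile (d + 1)) <| .store (regT d) (regT (d + 1))
  | d, seq p q => .seq (p.compile d) (q.compile d)
  | d, ite c p q => .seq (c.compile d) (.ite (regT d) (p.compile d) (q.compile d))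
  | d, forTo x e p =>
    .seq (e.compile d) <| .seq (copyProg (regT (d + 1)) (regV x)) <|
    .seq (.loop (regT d) <|
      .seq (.const (regT (d + 2)) 1) <| .seq (.sub (regT d) (regT d) (regT (d + 2))) <|
      .seq (copyProg (regV x) (regT d)) (p.compile (d + 2))) <|
    copyProg (regV x) (regT (d + 1))

end Stmt

/-- Registers for intermediate results below number `d` and the further registers are unchanged. -/
structure PresReg (d : ℕ) (s s' : State) : Prop where
  regG : ∀ x, s'.reg (regG x) = s.reg (regG x)
  regT : ∀ x < d, s'.reg (regT x) = s.reg (regT x)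

theorem PresReg.trans {d : ℕ} {s s' s'' : State} (h : PresReg d s s') (h' : PresReg d s' s'') :
    PresReg d s s'' :=
  ⟨fun x => (h'.regG x).trans (h.regG x), fun x hx => (h'.regT x hx).trans (h.regT x hx)⟩

theorem Pres.presReg {d : ℕ} {s s' : State} (h : Pres d s s') : PresReg d s s' := ⟨h.regG, h.regT⟩

theorem PresReg.setRegV {d : ℕ} {s s' : State} (h : PresReg d s s') (x v : ℕ) :
    PresReg d s (s'.setReg (RAM.regV x) v) :=
  ⟨fun y => by simp [State.setReg_reg, h.regG], fun y hy => by simp [State.setReg_reg, h.regT y hy]⟩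

/-- Entries live at addresses from `base` on, and `cell` is injective; hence the write affects
neither raw memory nor another entry. -/
theorem State.store_setMem_cell (s : State) (base a i j k v : ℕ) :
    (s.setMem (cell base a i j k) v).store base =
      (s.store base).setArr a (entryUpdate ((s.store base).arr a) i j k v) := by
  ext b
  · simp [State.store]
  · rename_i i' j' k'
    rw [Store.setArr_arr]
    simp only [State.store, State.setMem_mem, cell_inj]
    by_cases hb : b = a
    · subst hb; simp [entryUpdate]
    · simp [hb]
  · have : b < base → b ≠ cell base a i j k := fun h h' => by
      have := le_cell base a i j k; omega
    simp only [State.store, State.setMem_mem, Store.setArr_raw]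
    split_ifs with h1 h2
    exacts [absurd h2 (this h1), rfl, rfl]

theorem State.store_setMem_raw (s : State) {base i : ℕ} (v : ℕ) (hi : i < base) :
    (s.setMem i v).store base = (s.store base).setRaw i v := by
  ext b
  · simp [State.store]
  · rename_i i' j' k'
    have : cell base b i' j' k' ≠ i := fun h => by
      have := le_cell base b i' j' k'; omega
    simp [State.store, State.setMem_mem, this]
  · simp only [State.store, State.setMem_mem, Store.setRaw, Function.update_apply]
    split_ifs with h1 h2 h3
    exacts [rfl, rfl, by omega, rfl]

theorem Stmt.bounded_run {M base : ℕ} (p : Stmt) : ∀ {σ : Store}, σ.Bounded M → p.Ok M base σ →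
    (p.run σ).Bounded M := by
  induction p with
  | set x e => intro σ h hok; exact h.setVar hok.2
  | put a i j k e => intro σ h hok; exact h.setEntry hok.2.2.2.2.2
  | out i e => intro σ h hok; exact h.setRaw hok.2.2.2
  | seq p q ihp ihq => intro σ h hok; exact ihq (ihp h hok.1) hok.2
  | ite c p q ihp ihq =>
    intro σ h hok
    simp only [run]
    have := hok.2
    split_ifs with hcv <;> simp only [hcv, if_true, if_false, not_false_eq_true, ne_eq] at this
    exacts [ihp h this, ihq h this]
  | forTo x e p ih =>
    intro σ h hok
    obtain ⟨-, hn, hall⟩ := hok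
    simp only [run]
    refine Store.Bounded.setVar ?_ (h.var x)
    generalize e.eval σ = n at hn hall
    clear * - ih h hn hall
    induction n generalizing σ with
    | zero => exact h
    | succ n ihn =>
      exact ihn (ih (h.setVar (by omega)) hall.1) (by omega) hall.2

/-! ### Correctness and cost of translated statements -/

section Compile

variable {w : ℕ} {imul : ℕ → ℕ} {κ β : ℕ}

/-- In contrast to expressions, `M` stays fixed: `Stmt.Ok` keeps everything that is stored below
`M`, and only values inside one expression or address can grow to a power of `M`. Bounds therefore
do not accumulate over the iterations of a loop. -/
theorem Stmt.compile_spec (hc : UnitCost w imul κ β) {M base : ℕ} (hM : 2 ≤ M) (hb : base ≤ M)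
    (p : Stmt) : ∀ {d : ℕ} {s : State}, s.reg (regG 0) = base →
      (s.store base).Bounded M → p.Ok M base (s.store base) → M ^ p.deg < 2 ^ β →
      ∃ s', Leads w imul (p.compile d) s s' (κ * (24 * p.time (s.store base))) ∧
        s'.store base = p.run (s.store base) ∧ PresReg d s s' := by
  have up : ∀ {q q' : ℕ}, M ^ q' < 2 ^ β → q ≤ q' → M ^ q < 2 ^ β := fun h' h'' =>
    (Nat.pow_le_pow_right (by omega) h'').trans_lt h'
  induction p with
  | set x e =>
    intro d s hg hB hok hd
    obtain ⟨s1, h1, r1, p1⟩ := e.compile_spec hc (d := d) hM hb hg hB hok.1 hd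
    have h2 := hc.copy s1 (x := regV x) (y := regT d) (by simp)
      (by rw [r1]; exact (e.eval_le hM hB hok.1).trans_lt hd)
    refine ⟨_, (h1.seq h2).mono ?_, ?_, p1.presReg.setRegV _ _⟩
    · have : κ * (24 * (set x e).time (s.store base)) =
        κ * (24 * e.time (s.store base)) + 24 * κ := by simp only [time]; ring
      omega
    · rw [State.store_setReg_regV, p1.store, r1]; rfl
  | put a i j k e =>
    intro d s hg hB hok hd
    obtain ⟨ha, hoi, hoj, hok', hoe, hev⟩ := hok
    have hva : a ≤ M ^ a := le_pow_self' hM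
    have h0 := hc.const s (regT d) a (hva.trans_lt (up hd (by simp [deg]; omega)))
    set s0 := s.setReg (regT d) a with hs0
    have p0 : Pres d s s0 := (Pres.refl d s).setReg le_rfl _
    obtain ⟨s1, h1, r1, p1⟩ := i.compile_spec hc (d := d + 1) (s := s0) hM hb ((p0.regG 0).trans hg)
      (by rwa [p0.store]) (by rwa [p0.store]) (up hd (by simp [deg]; omega))
    have q1 : Pres d s s1 := p0.trans (p1.mono (by omega))
    obtain ⟨s2, h2, r2, p2⟩ := j.compile_spec hc (d := d + 2) (s := s1) hM hb
      ((q1.regG 0).trans hg)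
      (by rwa [q1.store]) (by rwa [q1.store]) (up hd (by simp [deg]; omega))
    have q2 : Pres d s s2 := q1.trans (p2.mono (by omega))
    obtain ⟨s3, h3, r3, p3⟩ := k.compile_spec hc (d := d + 3) (s := s2) hM hb
      ((q2.regG 0).trans hg)
      (by rwa [q2.store]) (by rwa [q2.store]) (up hd (by simp [deg]; omega))
    have q3 : Pres d s s3 := q2.trans (p3.mono (by omega))
    rw [p0.store] at h1 r1
    rw [q1.store] at h2 r2
    rw [q2.store] at h3 r3
    have t0 : s3.reg (regT d) = a := by
      rw [p3.regT _ (by omega), p2.regT _ (by omega), p1.regT _ (by omega)]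
      simp [hs0, State.setReg_reg]
    have t1 : s3.reg (regT (d + 1)) = i.eval (s.store base) := by
      rw [p3.regT _ (by omega), p2.regT _ (by omega), r1]
    have t2 : s3.reg (regT (d + 2)) = j.eval (s.store base) := by
      rw [p3.regT _ (by omega), r2]
    have hcell : cell base a (i.eval (s.store base)) (j.eval (s.store base))
        (k.eval (s.store base)) < 2 ^ β := by
      refine (cell_le_pow (p := i.deg + j.deg + k.deg + a + 1) hM hb ?_ ?_ ?_ ?_).trans_lt
        (up hd (by simp only [deg]; omega))
      · exact hva.trans (Nat.pow_le_pow_right (by omega) (by omega))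
      · exact (i.eval_le hM hB hoi).trans (Nat.pow_le_pow_right (by omega) (by omega))
      · exact (j.eval_le hM hB hoj).trans (Nat.pow_le_pow_right (by omega) (by omega))
      · exact (k.eval_le hM hB hok').trans (Nat.pow_le_pow_right (by omega) (by omega))
    obtain ⟨s4, h4, r4, p4⟩ := hc.address s3 d ((q3.regG 0).trans hg)
      (by rw [t0, t1, t2, r3]; exact hcell)
    rw [t0, t1, t2, r3] at r4
    have q4 := q3.trans p4
    obtain ⟨s5, h5, r5, p5⟩ := e.compile_spec hc (d := d + 1) (s := s4) hM hb
      ((q4.regG 0).trans hg)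
      (by rwa [q4.store]) (by rwa [q4.store]) (up hd (by simp [deg]))
    rw [q4.store] at h5 r5
    have q5 := q4.trans (p5.mono (by omega))
    have t5 : s5.reg (regT d) = _ := (p5.regT _ (by omega)).trans r4
    have h6 := hc.store s5 (regT d) (regT (d + 1)) (by rw [t5]; exact hcell)
      (by rw [r5]; exact (e.eval_le hM hB hoe).trans_lt (up hd (by simp [deg])))
    refine ⟨_, (h0.seq (h1.seq (h2.seq (h3.seq (h4.seq (h5.seq h6)))))).mono ?_, ?_,
      q5.regG, q5.regT⟩
    · have : κ * (24 * (put a i j k e).time (s.store base)) =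
        κ * (24 * i.time (s.store base)) + κ * (24 * j.time (s.store base)) +
        κ * (24 * k.time (s.store base)) +
        κ * (24 * e.time (s.store base)) + 24 * κ := by simp only [time]; ring
      omega
    · rw [t5, r5, State.store_setMem_cell, q5.store]; rfl
  | out i e =>
    intro d s hg hB hok hd
    obtain ⟨hoi, hoe, hi, hev⟩ := hok
    obtain ⟨s1, h1, r1, p1⟩ := i.compile_spec hc (d := d) hM hb hg hB hoi
      (up hd (by simp [deg]))
    obtain ⟨s2, h2, r2, p2⟩ := e.compile_spec hc (d := d + 1) (s := s1) hM hb
      ((p1.regG 0).trans hg)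
      (by rwa [p1.store]) (by rwa [p1.store]) (up hd (by simp [deg]))
    rw [p1.store] at h2 r2
    have q2 := p1.trans (p2.mono (by omega))
    have t2 : s2.reg (regT d) = _ := (p2.regT _ (by omega)).trans r1
    have h6 := hc.store s2 (regT d) (regT (d + 1))
      (by rw [t2]; exact (i.eval_le hM hB hoi).trans_lt (up hd (by simp [deg])))
      (by rw [r2]; exact (e.eval_le hM hB hoe).trans_lt (up hd (by simp [deg])))
    refine ⟨_, (h1.seq (h2.seq h6)).mono ?_, ?_, q2.regG, q2.regT⟩
    · have : κ * (24 * (out i e).time (s.store base)) =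
        κ * (24 * i.time (s.store base)) + 
        κ * (24 * e.time (s.store base)) + 24 * κ := by simp only [time]; ring
      omega
    · rw [t2, r2, State.store_setMem_raw _ _ hi, q2.store]; rfl
  | seq p q ihp ihq =>
    intro d s hg hB hok hd
    obtain ⟨s1, h1, r1, p1⟩ := ihp (d := d) hg hB hok.1 (up hd (by simp [deg]))
    obtain ⟨s2, h2, r2, p2⟩ := ihq (d := d) (s := s1) ((p1.regG 0).trans hg)
      (by rw [r1]; exact p.bounded_run hB hok.1) (by rw [r1]; exact hok.2) (up hd (by simp [deg]))
    rw [r1] at h2 r2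
    exact ⟨s2, (h1.seq h2).mono (by simp only [time]; apply le_of_eq; ring), r2, p1.trans p2⟩
  | ite c p q ihp ihq =>
    intro d s hg hB hok hd
    obtain ⟨s1, h1, r1, p1⟩ := c.compile_spec hc (d := d) hM hb hg hB hok.1
      (up hd (by simp [deg]; omega))
    have hcβ : s1.reg (regT d) < 2 ^ β := by
      rw [r1]; exact (c.eval_le hM hB hok.1).trans_lt (up hd (by simp [deg]; omega))
    have h := hok.2
    by_cases hcv : c.eval (s.store base) = 0
    · simp only [hcv, ne_eq, not_true_eq_false, if_false] at h
      obtain ⟨s2, h2, r2, p2⟩ := ihq (d := d) (s := s1) ((p1.regG 0).trans hg)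
        (by rwa [p1.store]) (by rwa [p1.store]) (up hd (by simp [deg]))
      rw [p1.store] at h2 r2
      refine ⟨s2, (h1.seq (hc.ite_zero (r1.trans hcv) h2)).mono ?_, ?_, p1.presReg.trans p2⟩
      · have : κ * (24 * (ite c p q).time (s.store base)) = κ * (24 * c.time (s.store base)) +
          24 * κ + κ * (24 * q.time (s.store base)) := by
          rw [time, if_neg (by simpa using hcv)]; ring
        omega
      · simp [run, hcv, r2]
    · simp only [hcv, ne_eq, not_false_eq_true, if_true] at h
      obtain ⟨s2, h2, r2, p2⟩ := ihp (d := d) (s := s1) ((p1.regG 0).trans hg)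
        (by rwa [p1.store]) (by rwa [p1.store]) (up hd (by simp [deg]; omega))
      rw [p1.store] at h2 r2
      refine ⟨s2, (h1.seq (hc.ite_pos hcβ (by rwa [r1]) h2)).mono ?_, ?_, p1.presReg.trans p2⟩
      · have : κ * (24 * (ite c p q).time (s.store base)) = κ * (24 * c.time (s.store base)) +
          24 * κ + κ * (24 * p.time (s.store base)) := by
          rw [time, if_pos hcv]; ring
        omega
      · simp [run, hcv, r2]
  | forTo x e p ih =>
    intro d s hg hB hok hd
    obtain ⟨hoe, hn, hall⟩ := hok
    obtain ⟨s1, h1, r1, p1⟩ := e.compile_spec hc (d := d) hM hb hg hB hoe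
      (up hd (by simp [deg]))
    set n := e.eval (s.store base) with hnn
    have hM2 : M < 2 ^ β := by simpa using up hd (one_le_deg _)
    have hxβ : s1.reg (regV x) < 2 ^ β := by
      rw [p1.regV]; exact (hB.var x).trans_lt hM2
    have h2 := hc.copy s1 (x := regT (d + 1)) (y := regV x) (by simp) hxβ
    set s2 := s1.setReg (regT (d + 1)) (s1.reg (regV x)) with hs2
    have p2 : Pres d s s2 := p1.setReg (by omega) _
    set f : ℕ → Store → Store := fun i τ => p.run (τ.setVar x i) with hf
    set g : ℕ → Store → ℕ := fun i τ => p.time (τ.setVar x i) with hgg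
    set P : ℕ → Store → Prop := fun i τ => p.Ok M base (τ.setVar x i) with hP
    -- The remaining `i` rounds lead from the present store to the same result as all `n` rounds
    -- from the initial one; the time spent plus the time of the remaining rounds is constant.
    let J : ℕ → ℕ → State → Prop := fun i t u =>
      u.reg (regT d) = i ∧ u.reg (regT (d + 1)) = s.reg (regV x) ∧ PresReg d s u ∧
      (u.store base).Bounded M ∧ iterAll f P i (u.store base) ∧
      iterDown f i (u.store base) = iterDown f n (s.store base) ∧
      t + κ * (24 * iterTime f g i (u.store base)) = κ * (24 * iterTime f g n (s.store base))
    have step : ∀ i < n, ∀ t u, J (i + 1) t u → ∃ u' t', Leads w imul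
        (p.compile (d + 2))
        (((u.setReg (regT (d + 2)) 1).setReg (regT d) i).setReg (regV x) i) u' t' ∧
        J i (t + (5 * κ + t')) u' := by
      rintro i hi t u ⟨j1, j2, j3, j4, j5, j6, j7⟩
      set v := ((u.setReg (regT (d + 2)) 1).setReg (regT d) i).setReg (regV x) i with hv
      have hst : v.store base = (u.store base).setVar x i := by
        rw [hv, State.store_setReg_regV]
        congr 1
        exact (((Pres.refl d u).setReg (by omega : d ≤ d + 2) 1).setReg le_rfl i).store base
      obtain ⟨v1, g1, r1, p1⟩ := ih (d := d + 2) (s := v)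
        (by simp [hv, State.setReg_reg, j3.regG, hg])
        (by rw [hst]; exact j4.setVar (by omega))
        (by rw [hst]; exact j5.1)
        (up hd (by simp [deg]))
      rw [hst] at g1 r1
      refine ⟨v1, _, g1.mono (?_ : _ ≤ κ * (24 * (g i (u.store base) + 1)) - 5 * κ), ?_⟩
      · rw [Nat.mul_add, Nat.mul_add]; simp only [hgg]; omega
      · refine ⟨?_, ?_, ⟨fun y => ?_, fun y hy => ?_⟩, ?_, ?_, ?_, ?_⟩
        · simp [State.setReg_reg, p1.regT d (by omega), hv]
        · simp [State.setReg_reg, p1.regT (d + 1) (by omega), hv, j2]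
        · simp [State.setReg_reg, p1.regG, hv, j3.regG y]
        · have y2 : y ≠ d + 2 := by omega
          have y3 : y ≠ d := by omega
          simp [State.setReg_reg, p1.regT y (by omega), hv, j3.regT y hy, y2, y3]
        · rw [r1]; exact p.bounded_run (j4.setVar (by omega)) j5.1
        · rw [r1]; exact j5.2
        · rw [r1, ← j6]; rfl
        · have hκ : κ * 5 ≤ κ * (24 * (g i (u.store base) + 1)) :=
            Nat.mul_le_mul_left _ (by omega)
          have e1 : iterTime f g (i + 1) (u.store base) =
            (g i (u.store base) + 1) + iterTime f g i (v1.store base) := by rw [r1]; rfl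
          rw [← j7, e1, Nat.mul_add 24 (g i _ + 1) (iterTime f g i (v1.store base)), Nat.mul_add κ]
          omega
    obtain ⟨s3, t3, h3, j1, j2, j3, j4, j5, j6, j7⟩ := hc.countdown (e := d + 2) (x := x)
      (by omega) (hn.trans_lt hM2) (by omega) J (fun i t u h => h.1) step n le_rfl 0 s2 (by
        refine ⟨?_, ?_, p2.presReg, ?_, ?_, ?_, ?_⟩
        · simp [hs2, State.setReg_reg, r1]
        · simp [hs2, State.setReg_reg, p1.regV]
        · rwa [p2.store]
        · rw [p2.store]; exact hall
        · rw [p2.store]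
        · rw [p2.store, Nat.zero_add])
    simp only [iterDown, iterTime, Nat.add_zero, Nat.zero_add, Nat.mul_zero] at j6 j7
    have h4 := hc.copy s3 (x := regV x) (y := regT (d + 1)) (by simp)
      (by rw [j2, ← p1.regV]; exact hxβ)
    refine ⟨_, (h1.seq (h2.seq (h3.seq h4))).mono ?_, ?_, j3.setRegV _ _⟩
    · rw [j7]
      have : κ * (24 * (forTo x e p).time (s.store base)) = κ * (24 * e.time (s.store base)) +
          24 * κ + κ * (24 * iterTime f g n (s.store base)) := by
        simp only [time, ← hnn, hf, hgg]; ring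
      omega
    · rw [State.store_setReg_regV, j6, j2]; rfl

end Compile

end RAM

namespace RAM

/-! ### Reasoning about statements -/

namespace Expr

/-- The expression reads no raw memory and not array `0`. -/
def pure : Expr → Bool
  | lit _ => true
  | var _ => true
  | inp _ => false
  | get a i j k => a != 0 && i.pure && j.pure && k.pure
  | add e f => e.pure && f.pure
  | sub e f => e.pure && f.pure
  | mul e f => e.pure && f.pure
  | sum _ e f => e.pure && f.pure

/-- The expression does not read the array `a`. -/
def noArr (a : ℕ) : Expr → Bool
  | lit _ => true
  | var _ => true
  | inp i => i.noArr a
  | get b i j k => b != a && i.noArr a && j.noArr a && k.noArr a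
  | add e f => e.noArr a && f.noArr a
  | sub e f => e.noArr a && f.noArr a
  | mul e f => e.noArr a && f.noArr a
  | sum _ e f => e.noArr a && f.noArr a

/-- The expression does not mention the variable `x`. -/
def noVar (x : ℕ) : Expr → Bool
  | lit _ => true
  | var y => y != x
  | inp i => i.noVar x
  | get _ i j k => i.noVar x && j.noVar x && k.noVar x
  | add e f => e.noVar x && f.noVar x
  | sub e f => e.noVar x && f.noVar x
  | mul e f => e.noVar x && f.noVar x
  | sum y e f => y != x && e.noVar x && f.noVar x

theorem pure.ok {e : Expr} : ∀ {σ : Store} {base : ℕ}, e.pure → e.Ok base σ := by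
  induction e with
  | lit | var => intros; trivial
  | inp i => intro σ base h; simp [pure] at h
  | get a i j k hi hj hk =>
    intro σ base h
    simp only [pure, Bool.and_eq_true, bne_iff_ne] at h
    exact ⟨h.1.1.1, hi h.1.1.2, hj h.1.2, hk h.2⟩
  | add e f he hf | sub e f he hf | mul e f he hf =>
    intro σ base h
    simp only [pure, Bool.and_eq_true] at h
    exact ⟨he h.1, hf h.2⟩
  | sum x e f he hf =>
    intro σ base h
    simp only [pure, Bool.and_eq_true] at h
    exact ⟨he h.1, fun i _ => hf h.2⟩

theorem eval_setArr {a : ℕ} {e : Expr} : ∀ {σ : Store} (f : ℕ → ℕ → ℕ → ℕ), e.noArr a →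
    e.eval (σ.setArr a f) = e.eval σ ∧ e.time (σ.setArr a f) = e.time σ := by
  induction e with
  | lit | var => intros; exact ⟨rfl, rfl⟩
  | inp i hi => intro σ f h; simp [eval, time, hi f h]
  | get b i j k hi hj hk =>
    intro σ g h
    simp only [noArr, Bool.and_eq_true, bne_iff_ne] at h
    simp [eval, time, hi g h.1.1.2, hj g h.1.2, hk g h.2, Store.setArr_arr, h.1.1.1]
  | add e f he hf | sub e f he hf | mul e f he hf =>
    intro σ g h
    simp only [noArr, Bool.and_eq_true] at h
    simp [eval, time, he g h.1, hf g h.2]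
  | sum x e f he hf =>
    intro σ g h
    simp only [noArr, Bool.and_eq_true] at h
    simp [eval, time, he g h.1, Store.setVar_setArr, hf g h.2]

theorem eval_setVar {x : ℕ} {e : Expr} : ∀ {σ : Store} (v : ℕ), e.noVar x →
    e.eval (σ.setVar x v) = e.eval σ ∧ e.time (σ.setVar x v) = e.time σ := by
  induction e with
  | lit => intros; exact ⟨rfl, rfl⟩
  | var y => intro σ v h; simp only [noVar, bne_iff_ne] at h; simp [eval, time, Store.setVar_var, h]
  | inp i hi => intro σ f h; simp [eval, time, hi f h]
  | get b i j k hi hj hk =>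
    intro σ v h
    simp only [noVar, Bool.and_eq_true] at h
    simp [eval, time, hi v h.1.1, hj v h.1.2, hk v h.2]
  | add e f he hf | sub e f he hf | mul e f he hf =>
    intro σ v h
    simp only [noVar, Bool.and_eq_true] at h
    simp [eval, time, he v h.1, hf v h.2]
  | sum y e f he hf =>
    intro σ v h
    simp only [noVar, Bool.and_eq_true, bne_iff_ne] at h
    simp [eval, time, he v h.1.2, Store.setVar_comm _ h.1.1.symm, hf v h.2]

end Expr

/-- The statement is executed correctly, and `Q` holds for its number of steps and its effect. -/
def Sp (M base : ℕ) (p : Stmt) (σ : Store) (Q : ℕ → Store → Prop) : Prop :=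
  p.Ok M base σ ∧ Q (p.time σ) (p.run σ)

section Sp

variable {M base : ℕ} {σ : Store} {Q : ℕ → Store → Prop}

theorem Sp.imp {p : Stmt} {Q' : ℕ → Store → Prop} (h : Sp M base p σ Q)
    (hQ : ∀ t τ, Q t τ → Q' t τ) : Sp M base p σ Q' := ⟨h.1, hQ _ _ h.2⟩

theorem Sp.set {x : ℕ} {e : Expr} (he : e.Ok base σ) (hv : e.eval σ ≤ M)
    (hQ : Q (e.time σ + 1) (σ.setVar x (e.eval σ))) : Sp M base (.set x e) σ Q :=
  ⟨⟨he, hv⟩, hQ⟩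

theorem Sp.put {a : ℕ} {i j k e : Expr} (ha : a ≠ 0) (hi : i.Ok base σ) (hj : j.Ok base σ)
    (hk : k.Ok base σ) (he : e.Ok base σ) (hv : e.eval σ ≤ M)
    (hQ : Q (i.time σ + j.time σ + k.time σ + e.time σ + 1) (σ.setArr a
      (entryUpdate (σ.arr a) (i.eval σ) (j.eval σ) (k.eval σ) (e.eval σ)))) :
    Sp M base (.put a i j k e) σ Q :=
  ⟨⟨ha, hi, hj, hk, he, hv⟩, hQ⟩

theorem Sp.out {i e : Expr} (hi : i.Ok base σ) (he : e.Ok base σ) (hb : i.eval σ < base)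
    (hv : e.eval σ ≤ M) (hQ : Q (i.time σ + e.time σ + 1) (σ.setRaw (i.eval σ) (e.eval σ))) :
    Sp M base (.out i e) σ Q :=
  ⟨⟨hi, he, hb, hv⟩, hQ⟩

theorem Sp.seq {p q : Stmt}
    (h : Sp M base p σ fun t τ => Sp M base q τ fun t' τ' => Q (t + t') τ') :
    Sp M base (.seq p q) σ Q :=
  ⟨⟨h.1, h.2.1⟩, h.2.2⟩

theorem Sp.ite_pos {c : Expr} {p q : Stmt} (hc : c.Ok base σ) (h0 : c.eval σ ≠ 0)
    (h : Sp M base p σ fun t τ => Q (c.time σ + 1 + t) τ) : Sp M base (.ite c p q) σ Q :=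
  ⟨⟨hc, by rw [if_pos h0]; exact h.1⟩, by simpa [Stmt.time, Stmt.run, h0] using h.2⟩

theorem Sp.ite_zero {c : Expr} {p q : Stmt} (hc : c.Ok base σ) (h0 : c.eval σ = 0)
    (h : Sp M base q σ fun t τ => Q (c.time σ + 1 + t) τ) : Sp M base (.ite c p q) σ Q :=
  ⟨⟨hc, by rw [if_neg (by simpa using h0)]; exact h.1⟩, by simpa [Stmt.time, Stmt.run, h0] using h.2⟩

/-- Loops: `J i t τ` is to hold when `i` iterations remain and `t` steps have been made. -/
theorem Sp.forTo {x n : ℕ} {e : Expr} {p : Stmt} (J : ℕ → ℕ → Store → Prop) (he : e.Ok base σ)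
    (hn : e.eval σ = n) (hM : n ≤ M) (init : J n 0 σ)
    (step : ∀ i < n, ∀ t τ, J (i + 1) t τ →
      Sp M base p (τ.setVar x i) fun t' τ' => J i (t + t' + 1) τ')
    (final : ∀ t τ, J 0 t τ → Q (e.time σ + 1 + t) (τ.setVar x (σ.var x))) :
    Sp M base (.forTo x e p) σ Q := by
  subst hn
  set f : ℕ → Store → Store := fun i τ => p.run (τ.setVar x i) with hf
  set g : ℕ → Store → ℕ := fun i τ => p.time (τ.setVar x i) with hg
  set P : ℕ → Store → Prop := fun i τ => p.Ok M base (τ.setVar x i) with hP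
  have key : ∀ n ≤ e.eval σ, ∀ t τ, J n t τ →
      iterAll f P n τ ∧ J 0 (t + iterTime f g n τ) (iterDown f n τ) := by
    intro n
    induction n with
    | zero => intro _ t τ h; exact ⟨trivial, h⟩
    | succ n ih =>
      intro hn t τ h
      obtain ⟨h1, h2⟩ := step n hn t τ h
      obtain ⟨h3, h4⟩ := ih (by omega) _ _ h2
      refine ⟨⟨h1, h3⟩, ?_⟩
      have : t + p.time (τ.setVar x n) + 1 + iterTime f g n (p.run (τ.setVar x n)) =
        t + iterTime f g (n + 1) τ := by simp only [iterTime, hf, hg]; omega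
      rw [← this]; exact h4
  obtain ⟨h1, h2⟩ := key _ le_rfl 0 σ init
  exact ⟨⟨he, hM, h1⟩, final _ _ (by simpa using h2)⟩

end Sp

namespace Stmt

/-- The variables that a statement may change. -/
def wVars : Stmt → List ℕ
  | set x _ => [x]
  | put _ _ _ _ _ => []
  | out _ _ => []
  | seq p q => p.wVars ++ q.wVars
  | ite _ p q => p.wVars ++ q.wVars
  | forTo _ _ p => p.wVars

/-- The arrays that a statement may change. -/
def wArrs : Stmt → List ℕ
  | set _ _ => []
  | put a _ _ _ _ => [a]
  | out _ _ => []
  | seq p q => p.wArrs ++ q.wArrs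
  | ite _ p q => p.wArrs ++ q.wArrs
  | forTo _ _ p => p.wArrs

/-- The statement does not write to raw memory. -/
def noOut : Stmt → Bool
  | set _ _ => true
  | put _ _ _ _ _ => true
  | out _ _ => false
  | seq p q => p.noOut && q.noOut
  | ite _ p q => p.noOut && q.noOut
  | forTo _ _ p => p.noOut

theorem iterDown_induction {f : ℕ → Store → Store} {P : Store → Prop} {n : ℕ} {σ : Store}
    (h0 : P σ) (hs : ∀ i τ, P τ → P (f i τ)) : P (iterDown f n σ) := by
  induction n generalizing σ with
  | zero => exact h0
  | succ n ih => exact ih (hs _ _ h0)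

theorem run_var {y : ℕ} (p : Stmt) : ∀ {σ : Store}, y ∉ p.wVars → (p.run σ).var y = σ.var y := by
  induction p with
  | set x e => intro σ h; simp [wVars] at h; simp [run, Store.setVar_var, h]
  | put | out => intros; rfl
  | seq p q hp hq =>
    intro σ h; simp only [wVars, List.mem_append, not_or] at h; simp [run, hq h.2, hp h.1]
  | ite c p q hp hq =>
    intro σ h; simp only [wVars, List.mem_append, not_or] at h; simp only [run]
    split_ifs
    exacts [hp h.1, hq h.2]
  | forTo x e p ih =>
    intro σ h
    simp only [run, Store.setVar_var]
    split_ifs with hy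
    · rw [hy]
    · refine iterDown_induction (P := fun τ => τ.var y = σ.var y) rfl fun i τ hτ => ?_
      rw [ih h, Store.setVar_var, if_neg hy, hτ]

theorem run_arr {a : ℕ} (p : Stmt) : ∀ {σ : Store}, a ∉ p.wArrs → (p.run σ).arr a = σ.arr a := by
  induction p with
  | set x e => intro σ h; rfl
  | put b => intro σ h; simp [wArrs] at h; simp [run, Store.setArr_arr, h]
  | out => intros; rfl
  | seq p q hp hq =>
    intro σ h; simp only [wArrs, List.mem_append, not_or] at h; simp [run, hq h.2, hp h.1]
  | ite c p q hp hq =>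
    intro σ h; simp only [wArrs, List.mem_append, not_or] at h; simp only [run]
    split_ifs
    exacts [hp h.1, hq h.2]
  | forTo x e p ih =>
    intro σ h
    refine iterDown_induction (P := fun τ => τ.arr a = σ.arr a) rfl fun i τ hτ => ?_
    rw [ih h, Store.setVar_arr, hτ]

theorem run_raw (p : Stmt) : ∀ {σ : Store}, p.noOut → (p.run σ).raw = σ.raw := by
  induction p with
  | set x e => intro σ h; rfl
  | put b => intros; rfl
  | out => intro σ h; simp [noOut] at h
  | seq p q hp hq =>
    intro σ h; simp only [noOut, Bool.and_eq_true] at h; simp [run, hq h.2, hp h.1]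
  | ite c p q hp hq =>
    intro σ h; simp only [noOut, Bool.and_eq_true] at h; simp only [run]
    split_ifs
    exacts [hp h.1, hq h.2]
  | forTo x e p ih =>
    intro σ h
    refine iterDown_induction (P := fun τ => τ.raw = σ.raw) rfl fun i τ hτ => ?_
    rw [ih h, Store.setVar_raw, hτ]

end Stmt

/-- What the execution of a statement leaves unchanged. -/
structure Frame (p : Stmt) (σ τ : Store) : Prop where
  var : ∀ x, x ∉ p.wVars → τ.var x = σ.var x
  arr : ∀ a, a ∉ p.wArrs → τ.arr a = σ.arr a
  raw : p.noOut → τ.raw = σ.raw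

/-- What a statement cannot change is visible from its text, so specifications need only speak about
what does change. -/
theorem Sp.frame {M base : ℕ} {σ : Store} {Q : ℕ → Store → Prop} {p : Stmt}
    (h : Sp M base p σ Q) : Sp M base p σ fun t τ => Q t τ ∧ Frame p σ τ :=
  ⟨h.1, h.2, fun _ hx => p.run_var hx, fun _ ha => p.run_arr ha, p.run_raw⟩

theorem Sp.imp_frame {M base : ℕ} {σ : Store} {Q Q' : ℕ → Store → Prop} {p : Stmt}
    (h : Sp M base p σ Q) (hQ : ∀ t τ, Frame p σ τ → Q t τ → Q' t τ) : Sp M base p σ Q' :=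
  h.frame.imp fun t τ h => hQ t τ h.2 h.1

/-! ### Parallel assignment -/

/-- Assign `v` to the entries `(I + i, j, k)` of the array `a`, for all `i < e₁`, `j < e₂` and
`k < e₃`, where `v` may refer to `i`, `j`, `k` as the variables `0`, `1`, `2`. -/
def fill (a : ℕ) (I e₁ e₂ e₃ v : Expr) : Stmt :=
  .forTo 0 e₁ <| .forTo 1 e₂ <| .forTo 2 e₃ <| .put a (.add I (.var 0)) (.var 1) (.var 2) v

/-- The expression is cheap and can be evaluated at any time during an assignment to array `a`. -/
structure Expr.Steady (a : ℕ) (e : Expr) : Prop where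
  pure : e.pure
  noArr : e.noArr a
  noVar : e.noVar 0 ∧ e.noVar 1 ∧ e.noVar 2
  time : ∀ σ, e.time σ ≤ 8

/-- The values that a parallel assignment produces. -/
def boxUpdate (f : ℕ → ℕ → ℕ → ℕ) (I n₁ n₂ n₃ : ℕ) (g : ℕ → ℕ → ℕ → ℕ) : ℕ → ℕ → ℕ → ℕ :=
  fun i j k => if I ≤ i ∧ i < I + n₁ ∧ j < n₂ ∧ k < n₃ then g (i - I) j k else f i j k

/-- The box is traversed from the highest indices down, so the state at any moment is determined by
the set of entries already written. As `v` does not read the array `a`, every entry receives the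
value that `v` has in the initial store, and the sequential loops act as a parallel assignment. -/
theorem Sp.fill {M base : ℕ} {σ : Store} {Q : ℕ → Store → Prop} {a : ℕ} {I e₁ e₂ e₃ v : Expr}
    {I' n₁ n₂ n₃ tv : ℕ} (ha : a ≠ 0) (hI : I.Steady a) (h₁ : e₁.Steady a) (h₂ : e₂.Steady a)
    (h₃ : e₃.Steady a) (hI' : I.eval σ = I') (hn₁ : e₁.eval σ = n₁) (hn₂ : e₂.eval σ = n₂)
    (hn₃ : e₃.eval σ = n₃)
    (hM₁ : n₁ ≤ M) (hM₂ : n₂ ≤ M) (hM₃ : n₃ ≤ M) (hv : v.pure) (hv' : v.noArr a)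
    (hvM : ∀ i < n₁, ∀ j < n₂, ∀ k < n₃,
      v.eval (((σ.setVar 0 i).setVar 1 j).setVar 2 k) ≤ M ∧
      v.time (((σ.setVar 0 i).setVar 1 j).setVar 2 k) ≤ tv)
    (hQ : ∀ t ≤ 40 * ((n₁ + 1) * (n₂ + 1) * (n₃ + 1) * (tv + 1)), Q t (σ.setArr a
      (boxUpdate (σ.arr a) I' n₁ n₂ n₃ fun i j k =>
        v.eval (((σ.setVar 0 i).setVar 1 j).setVar 2 k)))) :
    Sp M base (fill a I e₁ e₂ e₃ v) σ Q := by
  set g : ℕ → ℕ → ℕ → ℕ := fun i j k => v.eval (((σ.setVar 0 i).setVar 1 j).setVar 2 k) with hg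
  have ev : ∀ {e : Expr}, e.Steady a → ∀ (f : ℕ → ℕ → ℕ → ℕ) (x y z : ℕ),
      e.eval ((((σ.setArr a f).setVar 0 x).setVar 1 y).setVar 2 z) = e.eval σ ∧
      e.eval (((σ.setArr a f).setVar 0 x).setVar 1 y) = e.eval σ ∧
      e.eval ((σ.setArr a f).setVar 0 x) = e.eval σ := by
    intro e he f x y z
    simp [Expr.eval_setVar _ he.noVar.1, Expr.eval_setVar _ he.noVar.2.1,
      Expr.eval_setVar _ he.noVar.2.2, Expr.eval_setArr _ he.noArr]
  -- In `F i j k` the rows from `I' + i` on are finished. In the row before them, the lines from `j`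
  -- on are finished and line `j - 1` is finished from its entry `k` on.
  let F : (i j k : ℕ) → ℕ → ℕ → ℕ → ℕ := fun i j k i' j' k' =>
    if (I' + i ≤ i' ∧ i' < I' + n₁ ∧ j' < n₂ ∧ k' < n₃) ∨
      (i' + 1 = I' + i ∧ ((j ≤ j' ∧ j' < n₂ ∧ k' < n₃) ∨ (j' + 1 = j ∧ k ≤ k' ∧ k' < n₃)))
    then g (i' - I') j' k' else σ.arr a i' j' k'
  unfold RAM.fill
  set c₃ := n₃ * (tv + 20) + 12 with hc₃
  set c₂ := n₂ * (c₃ + 1) + 12 with hc₂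
  have hF : ∀ {f f' : ℕ → ℕ → ℕ → ℕ}, (∀ i j k, f i j k = f' i j k) → f = f' := fun h =>
    funext fun i => funext fun j => funext fun k => h i j k
  refine Sp.forTo (n := n₁) (fun i t τ => (∃ u, τ = (σ.setArr a (F i n₂ n₃)).setVar 0 u) ∧
    t + i * (c₂ + 1) ≤ n₁ * (c₂ + 1)) (Expr.pure.ok h₁.pure) hn₁ hM₁
    ⟨⟨σ.var 0, ?_⟩, by simp⟩ ?_ ?_
  · have : F n₁ n₂ n₃ = σ.arr a := hF fun i j k => by
      simp only [F]
      rw [if_neg]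
      rintro (h | ⟨_, h | h⟩) <;> omega
    rw [this]
    simp [Store.setVar, Store.setArr]
  · rintro i hi t _ ⟨⟨u, rfl⟩, ht⟩
    rw [Store.setVar_setVar]
    refine Sp.forTo (n := n₂) (fun j t' τ =>
      (∃ u, τ = ((σ.setArr a (F (i + 1) j n₃)).setVar 0 i).setVar 1 u) ∧
      t' + j * (c₃ + 1) ≤ n₂ * (c₃ + 1)) (Expr.pure.ok h₂.pure) ?_ hM₂
      ⟨⟨σ.var 1, ?_⟩, by simp⟩ ?_ ?_
    · rw [(ev h₂ _ _ 0 0).2.2, hn₂]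
    · exact (Store.setVar_var_self _ 1).symm
    · rintro j hj t' _ ⟨⟨u, rfl⟩, ht'⟩
      rw [Store.setVar_setVar]
      refine Sp.forTo (n := n₃) (fun k t'' τ =>
        (∃ u, τ = (((σ.setArr a (F (i + 1) (j + 1) k)).setVar 0 i).setVar 1 j).setVar 2 u) ∧
        t'' + k * (tv + 20) ≤ n₃ * (tv + 20)) (Expr.pure.ok h₃.pure) ?_ hM₃
        ⟨⟨σ.var 2, ?_⟩, by simp⟩ ?_ ?_
      · rw [(ev h₃ _ _ _ 0).2.1, hn₃]
      · exact (Store.setVar_var_self _ 2).symm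
      · rintro k hk t'' _ ⟨⟨u, rfl⟩, ht''⟩
        rw [Store.setVar_setVar]
        set τ := (((σ.setArr a (F (i + 1) (j + 1) (k + 1))).setVar 0 i).setVar 1 j).setVar 2 k
          with hτ
        have hve := Expr.eval_setArr (σ := ((σ.setVar 0 i).setVar 1 j).setVar 2 k)
          (F (i + 1) (j + 1) (k + 1)) hv'
        simp only [← Store.setVar_setArr, ← hτ] at hve
        obtain ⟨hv1, hv2⟩ := hvM i hi j hj k hk
        refine Sp.put ha ⟨Expr.pure.ok hI.pure, trivial⟩ trivial trivial (Expr.pure.ok hv)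
          (hve.1.trans_le hv1) ⟨⟨k, ?_⟩, ?_⟩
        · have h2 : τ.var 2 = k := by simp [hτ, Store.setVar_var]
          have h1 : τ.var 1 = j := by simp [hτ, Store.setVar_var]
          have h0 : τ.var 0 = i := by simp [hτ, Store.setVar_var]
          have hI2 : I.eval τ = I' := by rw [(ev hI _ _ _ _).1, hI']
          have hta : τ.arr a = F (i + 1) (j + 1) (k + 1) := by simp [hτ, Store.setArr_arr]
          simp only [Expr.eval, hI2, hve.1, h0, h1, h2, hta]
          have : entryUpdate (F (i + 1) (j + 1) (k + 1)) (I' + i) j k (g i j k) =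
              F (i + 1) (j + 1) k := hF fun i' j' k' => by
            simp only [entryUpdate, F]
            by_cases h : i' = I' + i ∧ j' = j ∧ k' = k
            · obtain ⟨rfl, rfl, rfl⟩ := h
              rw [if_pos ⟨rfl, rfl, rfl⟩, if_pos (Or.inr ⟨by omega, Or.inr ⟨rfl, le_rfl, hk⟩⟩)]
              rw [Nat.add_sub_cancel_left]
            · rw [if_neg h]
              congr 1
              simp only [eq_iff_iff]
              constructor
              · rintro (h | ⟨_, h | h⟩) <;> omega
              · rintro (h | ⟨_, h | h⟩) <;> omega
          rw [show v.eval (((σ.setVar 0 i).setVar 1 j).setVar 2 k) = g i j k from rfl, this, hτ]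
          simp [Store.setVar, Store.setArr]
        · have := hI.time τ
          simp only [Expr.time, hve.2]
          have e1 : (k + 1) * (tv + 20) = k * (tv + 20) + tv + 20 := by ring
          omega
      · rintro t'' _ ⟨⟨u, rfl⟩, ht''⟩
        refine ⟨⟨j, ?_⟩, ?_⟩
        · rw [Store.setVar_setVar]
          have : F (i + 1) (j + 1) 0 = F (i + 1) j n₃ := hF fun i' j' k' => by
            simp only [F]
            congr 1
            simp only [eq_iff_iff]
            constructor
            · rintro (h | ⟨_, h | h⟩) <;> omega
            · rintro (h | ⟨_, h | h⟩) <;> omega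
          rw [this]
          exact Store.setVar_var_self ((((σ.setArr a (F (i + 1) j n₃)).setVar 0 i).setVar 1 j)) 2
        · have := h₃.time (((σ.setArr a (F (i + 1) (j + 1) n₃)).setVar 0 i).setVar 1 j)
          have e1 : (j + 1) * (c₃ + 1) = j * (c₃ + 1) + c₃ + 1 := by ring
          omega
    · rintro t'' _ ⟨⟨u, rfl⟩, ht''⟩
      refine ⟨⟨i, ?_⟩, ?_⟩
      · rw [Store.setVar_setVar]
        have : F (i + 1) 0 n₃ = F i n₂ n₃ := hF fun i' j' k' => by
          simp only [F]
          congr 1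
          simp only [eq_iff_iff]
          constructor
          · rintro (h | ⟨_, h | h⟩) <;> omega
          · rintro (h | ⟨_, h | h⟩) <;> omega
        rw [this]
        exact Store.setVar_var_self ((σ.setArr a (F i n₂ n₃)).setVar 0 i) 1
      · have := h₂.time (((σ.setArr a (F (i + 1) n₂ n₃)).setVar 0 i))
        have e1 : (i + 1) * (c₂ + 1) = i * (c₂ + 1) + c₂ + 1 := by ring
        omega
  · rintro t _ ⟨⟨u, rfl⟩, ht⟩
    rw [Store.setVar_setVar]
    have : F 0 n₂ n₃ = boxUpdate (σ.arr a) I' n₁ n₂ n₃ g := hF fun i' j' k' => by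
      simp only [F, boxUpdate]
      congr 1
      simp only [eq_iff_iff]
      constructor
      · rintro (h | ⟨_, h | h⟩) <;> omega
      · rintro h; left; omega
    rw [this]
    have e : (σ.setArr a (boxUpdate (σ.arr a) I' n₁ n₂ n₃ g)).setVar 0 (σ.var 0) =
      σ.setArr a (boxUpdate (σ.arr a) I' n₁ n₂ n₃ g) := Store.setVar_var_self _ 0
    rw [e]
    refine hQ _ ?_
    have h1 := h₁.time σ
    have e3 : c₃ + 1 ≤ (n₃ + 1) * (tv + 1) * 20 := by rw [hc₃]; nlinarith
    have e2 : c₂ + 1 ≤ (n₂ + 1) * ((n₃ + 1) * (tv + 1)) * 20 := by rw [hc₂]; nlinarith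
    have e1 : n₁ * (c₂ + 1) + 20 ≤ (n₁ + 1) * ((n₂ + 1) * ((n₃ + 1) * (tv + 1))) * 20 := by nlinarith
    have e0 : 40 * ((n₁ + 1) * (n₂ + 1) * (n₃ + 1) * (tv + 1)) =
      2 * ((n₁ + 1) * ((n₂ + 1) * ((n₃ + 1) * (tv + 1))) * 20) := by ring
    omega

end RAM

/-! ### Subset convolution -/

/-- Functions on finite sets, multiplied by subset convolution. -/
def SetFun (V A : Type*) : Type _ := Finset V → A

namespace SetFun

open Finset

variable {V A : Type*} [DecidableEq V] [CommSemiring A]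

instance : Mul (SetFun V A) where
  mul f g := fun S => ∑ T ∈ S.powerset, f T * g (S \ T)

instance : One (SetFun V A) where
  one := fun S => if S = ∅ then 1 else 0

theorem mul_apply (f g : SetFun V A) (S : Finset V) :
    (f * g) S = ∑ T ∈ S.powerset, f T * g (S \ T) := rfl

theorem one_apply (S : Finset V) : (1 : SetFun V A) S = if S = ∅ then 1 else 0 := rfl

protected theorem mul_comm (f g : SetFun V A) : f * g = g * f := by
  funext S
  rw [mul_apply, mul_apply]
  refine sum_bij' (fun T _ => S \ T) (fun T _ => S \ T) ?_ ?_ ?_ ?_ ?_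
  · intro T _; simp
  · intro T _; simp
  · intro T hT; simpa using mem_powerset.1 hT
  · intro T hT; simpa using mem_powerset.1 hT
  · intro T hT
    rw [Finset.sdiff_sdiff_eq_self (mem_powerset.1 hT), _root_.mul_comm]

protected theorem one_mul (f : SetFun V A) : 1 * f = f := by
  funext S
  rw [mul_apply, sum_eq_single ∅]
  · simp [one_apply]
  · intro T _ hT; simp [one_apply, hT]
  · intro h; simp at h

/-- Both sides sum over the ordered decompositions of `S` into three disjoint parts, described on
the left by the union of two parts and one of them, on the right by two parts. -/
protected theorem mul_assoc (f g h : SetFun V A) : f * g * h = f * (g * h) := by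
  funext S
  simp only [mul_apply, sum_mul, mul_sum, sum_sigma']
  refine sum_bij' (fun p _ => (⟨p.2, p.1 \ p.2⟩ : Σ _ : Finset V, Finset V))
    (fun p _ => (⟨p.1 ∪ p.2, p.1⟩ : Σ _ : Finset V, Finset V)) ?_ ?_ ?_ ?_ ?_
  · rintro ⟨T, W⟩ hp
    simp only [mem_sigma, mem_powerset] at hp ⊢
    exact ⟨hp.2.trans hp.1, sdiff_subset_sdiff hp.1 le_rfl⟩
  · rintro ⟨W, X⟩ hp
    simp only [mem_sigma, mem_powerset] at hp ⊢
    exact ⟨union_subset hp.1 (hp.2.trans sdiff_subset), subset_union_left⟩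
  · rintro ⟨T, W⟩ hp
    simp only [mem_sigma, mem_powerset] at hp
    simp [union_sdiff_of_subset hp.2]
  · rintro ⟨W, X⟩ hp
    simp only [mem_sigma, mem_powerset] at hp
    have : Disjoint X W := (subset_sdiff.1 hp.2).2
    simp [union_sdiff_left, sdiff_eq_self_of_disjoint this]
  · rintro ⟨T, W⟩ hp
    simp only [mem_sigma, mem_powerset] at hp
    have : (S \ W) \ (T \ W) = S \ T := by
      ext v
      simp only [mem_sdiff, not_and, not_not]
      constructor
      · rintro ⟨⟨h1, h2⟩, h3⟩; exact ⟨h1, fun h => h2 (h3 h)⟩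
      · rintro ⟨h1, h2⟩; exact ⟨⟨h1, fun h => h2 (hp.2 h)⟩, fun h => absurd h h2⟩
    simp only [this, _root_.mul_assoc]

instance : CommMonoid (SetFun V A) where
  mul_assoc := SetFun.mul_assoc
  one_mul := SetFun.one_mul
  mul_one f := by rw [SetFun.mul_comm, SetFun.one_mul]
  mul_comm := SetFun.mul_comm

/-- A value of a convolution depends only on the values of the factors at subsets. Hence the tables
need to be correct only on subsets of the vertices that are left. -/
theorem mul_congr {f f' g g' : SetFun V A} {S : Finset V} (hf : ∀ T ⊆ S, f T = f' T)
    (hg : ∀ T ⊆ S, g T = g' T) : (f * g) S = (f' * g') S := by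
  rw [mul_apply, mul_apply]
  exact sum_congr rfl fun T hT => by rw [hf T (mem_powerset.1 hT), hg _ sdiff_subset]

/-- The function vanishes on all sets that contain `v`. -/
def Avoids (v : V) (f : SetFun V A) : Prop := ∀ T, v ∈ T → f T = 0

/-- The restriction of a function to the sets that do not contain `v`. -/
def avoiding (v : V) (f : SetFun V A) : SetFun V A := fun T => if v ∈ T then 0 else f T

theorem avoids_avoiding (v : V) (f : SetFun V A) : (f.avoiding v).Avoids v :=
  fun _ hT => if_pos hT

theorem Avoids.mul {v : V} {f g : SetFun V A} (hf : f.Avoids v) (hg : g.Avoids v) :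
    (f * g).Avoids v := by
  intro T hT
  rw [mul_apply]
  refine sum_eq_zero fun W _ => ?_
  by_cases hW : v ∈ W
  · rw [hf W hW, zero_mul]
  · rw [hg _ (mem_sdiff.2 ⟨hT, hW⟩), mul_zero]

theorem Avoids.one {v : V} : (1 : SetFun V A).Avoids v := by
  intro T hT
  rw [one_apply, if_neg (ne_empty_of_mem hT)]

theorem Avoids.prod {ι : Type*} {v : V} {R : Finset ι} {F : ι → SetFun V A}
    (h : ∀ x ∈ R, (F x).Avoids v) : (∏ x ∈ R, F x).Avoids v :=
  prod_induction _ _ (fun _ _ => Avoids.mul) Avoids.one h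

/-- The function vanishes on all sets that are not contained in `B`. -/
def SupportedOn (B : Finset V) (f : SetFun V A) : Prop := ∀ T, ¬ T ⊆ B → f T = 0

omit [DecidableEq V] in
theorem SupportedOn.avoids {B : Finset V} {f : SetFun V A} (h : f.SupportedOn B) {v : V}
    (hv : v ∉ B) : f.Avoids v := fun T hT => h T fun hTB => hv (hTB hT)

/-- Removal of an element that the second factor avoids. -/
theorem mul_erase {f f' g : SetFun V A} {v : V} {U : Finset V} (hv : v ∈ U) (hg : g.Avoids v)
    (hf : ∀ T ⊆ U.erase v, f' T = f (insert v T)) : (f' * g) (U.erase v) = (f * g) U := by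
  rw [mul_apply, mul_apply]
  -- If `v ∉ T`, then `v` is in the argument of `g`, and the term vanishes.
  have h1 : ∑ T ∈ U.powerset, f T * g (U \ T) =
      ∑ T ∈ U.powerset with v ∈ T, f T * g (U \ T) := by
    rw [sum_filter]
    refine sum_congr rfl fun T _ => ?_
    split_ifs with h
    · rfl
    · rw [hg _ (mem_sdiff.2 ⟨hv, h⟩), mul_zero]
  rw [h1]
  refine sum_bij' (fun T _ => insert v T) (fun T _ => T.erase v) ?_ ?_ ?_ ?_ ?_
  · intro T hT
    simp only [mem_filter, mem_powerset, mem_insert_self, and_true]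
    exact insert_subset hv ((mem_powerset.1 hT).trans (erase_subset _ _))
  · intro T hT
    simp only [mem_filter, mem_powerset] at hT ⊢
    exact erase_subset_erase _ hT.1
  · intro T hT
    exact erase_insert fun h => by simpa using mem_powerset.1 hT h
  · intro T hT
    exact insert_erase (mem_filter.1 hT).2
  · intro T hT
    rw [hf T (mem_powerset.1 hT)]
    congr 2
    ext u
    simp only [mem_sdiff, mem_erase, mem_insert, not_or]
    tauto

end SetFun

/-! ### Ranked zeta transforms -/

section Zeta

open Finset

/-- The first `k` steps of the zeta transform. -/
def zetaUpTo {A : Type*} [AddCommMonoid A] (f : Finset ℕ → A) : ℕ → Finset ℕ → A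
  | 0, s => f s
  | k + 1, s => zetaUpTo f k s + if k ∈ s then zetaUpTo f k (s.erase k) else 0

variable {A : Type*}

/-- After `k` steps the elements of `s` below `k` may be dropped and the others must be present. In
the next step, the sets containing `k` come from the value at `s` and those without `k` from the
value at `s.erase k`. -/
theorem zetaUpTo_eq_sum [AddCommMonoid A] (f : Finset ℕ → A) (k : ℕ) (s : Finset ℕ) :
    zetaUpTo f k s = ∑ t ∈ s.powerset with s \ range k ⊆ t, f t := by
  induction k generalizing s with
  | zero =>
    rw [zetaUpTo, sum_eq_single s]
    · intro t ht hts
      simp only [range_zero, sdiff_empty, mem_filter, mem_powerset] at ht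
      exact absurd (ht.1.antisymm ht.2) hts
    · intro h; simp at h
  | succ k ih =>
    have hk : s \ range k ⊆ insert k (s \ range (k + 1)) := by
      intro i hi
      simp only [mem_sdiff, mem_range, mem_insert] at hi ⊢
      by_cases h : i = k
      · exact Or.inl h
      · exact Or.inr ⟨hi.1, by omega⟩
    have hk' : s \ range (k + 1) ⊆ s \ range k := by
      intro i hi
      simp only [mem_sdiff, mem_range] at hi ⊢
      exact ⟨hi.1, by omega⟩
    rw [zetaUpTo, ih]
    by_cases hks : k ∈ s
    · rw [if_pos hks, ih, ← sum_filter_add_sum_filter_not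
        (s.powerset.filter fun t => s \ range (k + 1) ⊆ t) (fun t => k ∈ t) f]
      refine congrArg₂ (· + ·) ?_ ?_
      · refine sum_congr ?_ fun _ _ => rfl
        ext t
        simp only [mem_filter, mem_powerset]
        constructor
        · rintro ⟨h1, h2⟩
          exact ⟨⟨h1, hk'.trans h2⟩, h2 (by simp [hks])⟩
        · rintro ⟨⟨h1, h2⟩, h3⟩
          exact ⟨h1, hk.trans (insert_subset h3 h2)⟩
      · refine sum_congr ?_ fun _ _ => rfl
        ext t
        simp only [mem_filter, mem_powerset]
        constructor
        · rintro ⟨h1, h2⟩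
          refine ⟨⟨h1.trans (erase_subset _ _), fun i hi => h2 ?_⟩, fun h => by simpa using h1 h⟩
          simp only [mem_sdiff, mem_range, mem_erase] at hi ⊢
          exact ⟨⟨by omega, hi.1⟩, by omega⟩
        · rintro ⟨⟨h1, h2⟩, h3⟩
          refine ⟨subset_erase.2 ⟨h1, h3⟩, fun i hi => h2 ?_⟩
          simp only [mem_sdiff, mem_range, mem_erase] at hi ⊢
          exact ⟨hi.1.2, by omega⟩
    · rw [if_neg hks, add_zero]
      refine sum_congr ?_ fun _ _ => rfl
      have : s \ range k = s \ range (k + 1) := by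
        refine Subset.antisymm (fun i hi => ?_) hk'
        rcases mem_insert.1 (hk hi) with rfl | h
        · exact absurd (mem_sdiff.1 hi).1 hks
        · exact h
      rw [this]

theorem zetaUpTo_eq_sum_powerset [AddCommMonoid A] (f : Finset ℕ → A) {m : ℕ} {s : Finset ℕ}
    (hs : s ⊆ range m) : zetaUpTo f m s = ∑ t ∈ s.powerset, f t := by
  rw [zetaUpTo_eq_sum]
  refine sum_congr ?_ fun _ _ => rfl
  refine filter_true_of_mem fun t _ => ?_
  rw [sdiff_eq_empty_iff_subset.2 hs]
  exact empty_subset t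

/-- Pairs of sets with given union and given sum of sizes. -/
def rankedProd [CommSemiring A] (f g : Finset ℕ → A) (r : ℕ) (s : Finset ℕ) : A :=
  ∑ p ∈ s.powerset ×ˢ s.powerset with p.1 ∪ p.2 = s ∧ p.1.card + p.2.card = r, f p.1 * g p.2

/-- Two sets with union `s` whose sizes add up to `s.card` are disjoint. The rank thus singles out
the terms of the subset convolution among all pairs that cover `s`. -/
theorem rankedProd_card [CommSemiring A] (f g : Finset ℕ → A) (s : Finset ℕ) :
    rankedProd f g s.card s = ∑ t ∈ s.powerset, f t * g (s \ t) := by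
  rw [rankedProd]
  refine sum_bij' (fun p _ => p.1) (fun t _ => (t, s \ t)) ?_ ?_ ?_ ?_ ?_
  · intro p hp; simp only [mem_filter, mem_product] at hp; exact hp.1.1
  · intro t ht
    have ht' := mem_powerset.1 ht
    simp only [mem_filter, mem_product, mem_powerset]
    exact ⟨⟨ht', sdiff_subset⟩, union_sdiff_of_subset ht', by
      rw [add_comm]; exact card_sdiff_add_card_eq_card ht'⟩
  · intro p hp
    simp only [mem_filter, mem_product, mem_powerset] at hp
    obtain ⟨⟨h1, h2⟩, h3, h4⟩ := hp
    have hd : Disjoint p.1 p.2 := by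
      rw [← card_union_eq_card_add_card, h3, h4]
    have : s \ p.1 = p.2 := by
      rw [← h3, union_sdiff_left, sdiff_eq_self_of_disjoint hd.symm]
    simp [this]
  · intro t _; rfl
  · intro p hp
    simp only [mem_filter, mem_product, mem_powerset] at hp
    obtain ⟨⟨h1, h2⟩, h3, h4⟩ := hp
    have hd : Disjoint p.1 p.2 := by
      rw [← card_union_eq_card_add_card, h3, h4]
    have : s \ p.1 = p.2 := by
      rw [← h3, union_sdiff_left, sdiff_eq_self_of_disjoint hd.symm]
    simp [this]

/-- A function restricted to the sets of a given size. -/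
def ofRank [Zero A] (f : Finset ℕ → A) (r : ℕ) (s : Finset ℕ) : A := if s.card = r then f s else 0

/-- Pairs of subsets of `s` are sorted by their union `v`. This is what makes fast subset
convolution work: the zeta transform turns the ranked product into a pointwise product of
polynomials in the rank. -/
theorem sum_mul_ofRank [CommSemiring A] (f g : Finset ℕ → A) (r : ℕ) (s : Finset ℕ) :
    ∑ i ∈ range (r + 1), (∑ t ∈ s.powerset, ofRank f i t) * (∑ u ∈ s.powerset, ofRank g (r - i) u) =
      ∑ v ∈ s.powerset, rankedProd f g r v := by
  simp only [sum_mul_sum, rankedProd]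
  rw [sum_comm]
  have h1 : ∀ t ∈ s.powerset, ∑ i ∈ range (r + 1), ∑ u ∈ s.powerset,
      ofRank f i t * ofRank g (r - i) u =
      ∑ u ∈ s.powerset, if t.card + u.card = r then f t * g u else 0 := by
    intro t _
    rw [sum_comm]
    refine sum_congr rfl fun u _ => ?_
    by_cases h : t.card + u.card = r
    · rw [if_pos h, sum_eq_single t.card]
      · simp [ofRank, ← h]
      · intro i _ hi; simp [ofRank, hi.symm]
      · intro h'; simp at h'; omega
    · rw [if_neg h]
      refine sum_eq_zero fun i hi => ?_
      simp only [mem_range] at hi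
      by_cases hi' : t.card = i
      · have : u.card ≠ r - i := by omega
        simp [ofRank, this]
      · simp [ofRank, hi']
  rw [sum_congr rfl h1, ← sum_product', sum_sigma' s.powerset, ← sum_filter]
  refine (sum_bij' (fun p _ => p.2) (fun p _ => ⟨p.1 ∪ p.2, p⟩) ?_ ?_ ?_ ?_ ?_).symm
  · rintro ⟨v, p⟩ hp
    simp only [mem_sigma, mem_powerset, mem_filter, mem_product] at hp ⊢
    exact ⟨⟨hp.2.1.1.trans hp.1, hp.2.1.2.trans hp.1⟩, hp.2.2.2⟩
  · rintro p hp
    simp only [mem_sigma, mem_powerset, mem_filter, mem_product] at hp ⊢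
    exact ⟨union_subset hp.1.1 hp.1.2, ⟨subset_union_left, subset_union_right⟩, trivial, hp.2⟩
  · rintro ⟨v, p⟩ hp
    simp only [mem_sigma, mem_powerset, mem_filter, mem_product] at hp
    simp [hp.2.2.1]
  · intro p _; rfl
  · intro p _; rfl

/-- The product formula for the coefficients of power series. -/
theorem sum_zetaUpTo_mul (f g : Finset ℕ → ℕ → ℕ) {m : ℕ} (r c : ℕ) {s : Finset ℕ}
    (hs : s ⊆ range m) :
    ∑ i ∈ range (r + 1), ∑ c' ∈ range (c + 1), zetaUpTo (ofRank (f · c') i) m s *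
      zetaUpTo (ofRank (g · (c - c')) (r - i)) m s =
    zetaUpTo (fun v => PowerSeries.coeff c (rankedProd (fun t => PowerSeries.mk (f t))
      (fun t => PowerSeries.mk (g t)) r v)) m s := by
  have h : ∀ (f : Finset ℕ → ℕ → ℕ) (c i : ℕ), zetaUpTo (ofRank (f · c) i) m s =
      PowerSeries.coeff c (∑ t ∈ s.powerset, ofRank (fun t => PowerSeries.mk (f t)) i t) := by
    intro f c i
    rw [zetaUpTo_eq_sum_powerset _ hs, map_sum]
    refine sum_congr rfl fun t _ => ?_
    simp only [ofRank]
    split_ifs <;> simp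
  rw [zetaUpTo_eq_sum_powerset _ hs, ← map_sum, ← sum_mul_ofRank, map_sum]
  refine sum_congr rfl fun i _ => ?_
  rw [PowerSeries.coeff_mul, Finset.Nat.sum_antidiagonal_eq_sum_range_succ
    (fun a b => PowerSeries.coeff a (∑ t ∈ s.powerset, ofRank (fun t => PowerSeries.mk (f t)) i t) *
      PowerSeries.coeff b (∑ t ∈ s.powerset, ofRank (fun t => PowerSeries.mk (g t)) (r - i) t))]
  exact sum_congr rfl fun c' _ => by rw [h, h]

end Zeta

/-! ### Counting packings and partitionings vertex by vertex -/

section Packings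

open Finset

variable {V A : Type*} [DecidableEq V] [CommSemiring A] (γ : Set ℕ) (G : SimpleGraph V)
  (pack : Bool) (w : A)

open Classical in
/-- The sum of `w ^ κ` over all packings (`pack`) or partitionings of the subgraph induced by a set
of vertices, where `κ` is the number of cliques. -/
noncomputable def weightSum : SetFun V A := fun S =>
  ∑ 𝒞 ∈ S.powerset.powerset with IsCliquePacking γ G 𝒞 ∧ (pack = true ∨ 𝒞.sup id = S),
    w ^ 𝒞.card

open Classical in
/-- The ways to treat the vertex `v`: the sets that it may be covered by. -/
noncomputable def vertexSum (v : V) : SetFun V A := fun T =>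
  (if T = ∅ then 1 else 0) + if v ∈ T then
    (if G.IsClique (T : Set V) ∧ T.card ∈ γ then w else 0) +
      if pack = true ∧ T.card = 1 then 1 else 0
  else 0

variable {γ G pack w}

omit [DecidableEq V] in
theorem isCliquePacking_mono {𝒞 𝒟 : Finset (Finset V)} (h : IsCliquePacking γ G 𝒞) (hD : 𝒟 ⊆ 𝒞) :
    IsCliquePacking γ G 𝒟 :=
  ⟨fun C hC => h.1 C (hD hC), fun C hC C' hC' => h.2 C (hD hC) C' (hD hC')⟩

/-- The only other candidate is the collection whose single member is the empty clique, which `0 ∉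
γ` excludes. -/
theorem weightSum_empty (h0 : 0 ∉ γ) : weightSum γ G pack w ∅ = (1 : A) := by
  classical
  rw [weightSum, sum_eq_single ∅]
  · simp
  · intro 𝒞 h𝒞 hne
    exfalso
    simp only [powerset_empty, mem_filter, mem_powerset] at h𝒞
    obtain ⟨C, hC⟩ := nonempty_iff_ne_empty.2 hne
    have h1 : C = ∅ := by simpa using h𝒞.1 hC
    have h2 := (h𝒞.2.1.1 C hC).2
    rw [h1, card_empty] at h2
    exact h0 h2
  · intro h
    exfalso
    apply h
    simp only [mem_filter, mem_powerset, empty_subset, true_and]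
    exact ⟨⟨by simp [IsCliqueCollection], by simp⟩, Or.inr (by simp)⟩

-- Either no clique contains `v`, which only packings permit, or exactly one clique `C` does, and
-- removing it leaves a collection of the same kind on `S \ C`.
open Classical in
theorem weightSum_eq_add {v : V} {S : Finset V} (hv : v ∈ S) :
    weightSum γ G pack w S = (if pack = true then weightSum γ G pack w (S.erase v) else 0) +
      ∑ C ∈ S.powerset.filter fun C : Finset V => v ∈ C ∧ G.IsClique (C : Set V) ∧ C.card ∈ γ,
        w * weightSum γ G pack w (S \ C) := by
  conv_lhs => rw [weightSum]
  rw [← sum_filter_not_add_sum_filter _ (fun 𝒞 : Finset (Finset V) => v ∈ 𝒞.sup id)]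
  congr 1
  · by_cases hp : pack = true
    · rw [if_pos hp, weightSum]
      refine sum_congr ?_ fun _ _ => rfl
      ext 𝒞
      simp only [mem_filter, mem_powerset, hp, true_or, and_true, mem_sup, id_eq, not_exists, not_and]
      constructor
      · rintro ⟨⟨h1, h2⟩, h3⟩
        refine ⟨fun C hC => mem_powerset.2 (subset_erase.2 ⟨mem_powerset.1 (h1 hC), h3 C hC⟩), h2⟩
      · rintro ⟨h1, h2⟩
        refine ⟨⟨fun C hC => mem_powerset.2 ((mem_powerset.1 (h1 hC)).trans (erase_subset _ _)), h2⟩,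
          fun C hC hvC => by simpa using mem_powerset.1 (h1 hC) hvC⟩
    · rw [if_neg hp]
      refine sum_eq_zero fun 𝒞 h => ?_
      exfalso
      simp only [mem_filter, hp, false_or, Bool.false_eq_true] at h
      exact h.2 (h.1.2.2 ▸ hv)
  · simp only [weightSum, mul_sum, sum_sigma']
    symm
    have out : ∀ {C : Finset V} {𝒟 : Finset (Finset V)}, v ∈ C → 𝒟 ⊆ (S \ C).powerset →
        ∀ D ∈ 𝒟, v ∉ D := fun hvC h𝒟 D hD hvD => by
      have := mem_powerset.1 (h𝒟 hD) hvD
      simp [hvC] at this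
    -- The first component can be recovered as the only member that contains `v`.
    refine sum_bij (fun p _ => insert p.1 p.2) ?_ ?_ ?_ ?_
    · rintro ⟨C, 𝒟⟩ h
      simp only [mem_sigma, mem_filter, mem_powerset] at h ⊢
      obtain ⟨⟨hCS, hvC, hC, hCγ⟩, h𝒟, hpk, hcov⟩ := h
      refine ⟨⟨insert_subset (mem_powerset.2 hCS) fun D hD => mem_powerset.2
        ((mem_powerset.1 (h𝒟 hD)).trans sdiff_subset), ⟨?_, ?_⟩, ?_⟩, ?_⟩
      · intro D hD
        rcases mem_insert.1 hD with rfl | hD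
        exacts [⟨hC, hCγ⟩, hpk.1 D hD]
      · have dis : ∀ D ∈ 𝒟, Disjoint C D := fun D hD =>
          (subset_sdiff.1 (mem_powerset.1 (h𝒟 hD))).2.symm
        intro D hD D' hD' hne
        rcases mem_insert.1 hD with rfl | hD <;> rcases mem_insert.1 hD' with rfl | hD'
        · exact absurd rfl hne
        · exact dis _ ‹_›
        · exact (dis _ ‹_›).symm
        · exact hpk.2 D hD D' hD' hne
      · refine hcov.imp_right fun h => ?_
        rw [sup_insert, h, id, sup_eq_union, union_sdiff_of_subset hCS]
      · rw [sup_insert]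
        exact mem_union_left _ hvC
    · rintro ⟨C, 𝒟⟩ h ⟨C', 𝒟'⟩ h' heq
      simp only [mem_sigma, mem_filter, mem_powerset] at h h'
      have o := out h.1.2.1 h.2.1
      have o' := out h'.1.2.1 h'.2.1
      simp only at heq
      have hCC : C = C' := by
        have : C ∈ insert C' 𝒟' := heq ▸ mem_insert_self C 𝒟
        rcases mem_insert.1 this with h | h1
        · exact h
        · exact absurd h.1.2.1 (o' C h1)
      subst hCC
      have : 𝒟 = 𝒟' := by
        rw [← erase_insert (fun hh => o C hh h.1.2.1), heq,
          erase_insert (fun hh => o' C hh h.1.2.1)]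
      rw [this]
    · intro 𝒞 h
      simp only [mem_filter, mem_powerset, mem_sup, id_eq] at h
      obtain ⟨⟨h1, hpk, hcov⟩, C, hC, hvC⟩ := h
      refine ⟨⟨C, 𝒞.erase C⟩, ?_, insert_erase hC⟩
      simp only [mem_sigma, mem_filter, mem_powerset]
      have hsub : 𝒞.erase C ⊆ (S \ C).powerset := fun D hD => by
        rw [mem_powerset, subset_sdiff]
        exact ⟨mem_powerset.1 (h1 (mem_of_mem_erase hD)),
          hpk.2 D (mem_of_mem_erase hD) C hC (ne_of_mem_erase hD)⟩
      refine ⟨⟨mem_powerset.1 (h1 hC), hvC, (hpk.1 C hC).1, (hpk.1 C hC).2⟩, hsub,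
        isCliquePacking_mono hpk (erase_subset _ _), hcov.imp_right fun h => ?_⟩
      refine Subset.antisymm (Finset.sup_le fun D hD => mem_powerset.1 (hsub hD)) fun u hu => ?_
      rw [mem_sdiff, ← h, mem_sup] at hu
      obtain ⟨⟨D, hD, huD⟩, huC⟩ := hu
      exact mem_sup.2 ⟨D, mem_erase.2 ⟨fun hh => huC (hh ▸ huD), hD⟩, huD⟩
    · rintro ⟨C, 𝒟⟩ h
      simp only [mem_sigma, mem_filter, mem_powerset] at h
      rw [card_insert_of_notMem (fun hh => out h.1.2.1 h.2.1 C hh h.1.2.1), pow_succ, mul_comm]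

/-- This is the recursion behind the algorithm. If `v ∈ S`, the restricted factor kills all terms
with `v ∉ T`, so `T` is the clique that covers `v` or the uncovered singleton. If `v ∉ S`, only `T =
∅` contributes. -/
theorem weightSum_eq_mul (v : V) :
    weightSum γ G pack w = vertexSum γ G pack w v * (weightSum γ G pack w : SetFun V A).avoiding v := by
  classical
  funext S
  rw [SetFun.mul_apply]
  simp only [SetFun.avoiding]
  by_cases hv : v ∈ S
  · rw [weightSum_eq_add hv]
    have h1 : ∀ T ∈ S.powerset, vertexSum γ G pack w v T *
        (if v ∈ S \ T then 0 else weightSum γ G pack w (S \ T)) =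
        (if v ∈ T ∧ G.IsClique (T : Set V) ∧ T.card ∈ γ then w * weightSum γ G pack w (S \ T) else 0)
        + if T = {v} then (if pack = true then weightSum γ G pack w (S \ T) else 0) else 0 := by
      intro T _
      by_cases hT : v ∈ T
      · have h2 : v ∉ S \ T := by simp [hT]
        have h3 : T ≠ ∅ := ne_empty_of_mem hT
        have h4 : T.card = 1 ↔ T = {v} := by
          rw [card_eq_one]
          constructor
          · rintro ⟨a, rfl⟩; rw [mem_singleton.1 hT]
          · rintro rfl; exact ⟨v, rfl⟩
        simp only [vertexSum, h3, hT, h4, if_true, if_false, zero_add, true_and, h2, add_mul]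
        congr 1
        · split_ifs <;> simp
        · split_ifs <;> simp_all
      · have h2 : v ∈ S \ T := mem_sdiff.2 ⟨hv, hT⟩
        have h3 : T ≠ {v} := fun h => hT (h ▸ mem_singleton_self v)
        simp [h2, hT, h3]
    rw [sum_congr rfl h1, sum_add_distrib, add_comm, sum_filter]
    congr 1
    rw [sum_ite_eq' S.powerset {v}, if_pos (by simpa using hv : {v} ∈ S.powerset), erase_eq]
  · rw [sum_eq_single ∅]
    · simp [vertexSum, hv]
    · intro T hT hne
      have : v ∉ T := fun h => hv (mem_powerset.1 hT h)
      simp [vertexSum, hne, this]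
    · intro h; simp at h

/-- Elimination of a vertex. -/
theorem forget_mul_weightSum {F F' Q : SetFun V A} {v : V} {U : Finset V} (hv : v ∈ U)
    (hQ : Q.Avoids v)
    (hF : ∀ T ⊆ U.erase v, F' T = (F * vertexSum γ G pack w v) (insert v T)) :
    (F' * (Q * weightSum γ G pack w)) (U.erase v) = (F * (Q * weightSum γ G pack w)) U := by
  classical
  set P' : SetFun V A := (weightSum γ G pack w : SetFun V A).avoiding v with hP'
  have hP : P'.Avoids v := SetFun.avoids_avoiding v _
  -- No subset of `U.erase v` contains `v`, so the restriction of the weight sum agrees with it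
  -- there.
  have h1 : (F' * (Q * weightSum γ G pack w)) (U.erase v) = (F' * (Q * P')) (U.erase v) := by
    refine SetFun.mul_congr (fun _ _ => rfl) fun T hT => SetFun.mul_congr (fun _ _ => rfl) fun W hW => ?_
    have : v ∉ W := fun h => by simpa using hT (hW h)
    simp [hP', SetFun.avoiding, this]
  rw [h1, SetFun.mul_erase hv (hQ.mul hP) hF]
  conv_rhs => rw [weightSum_eq_mul v]
  rw [← hP']
  simp only [mul_assoc, mul_left_comm]

/-- The product of the table with `vertexSum` is supported on the bag. -/
theorem mul_vertexSum_eq_zero {F : SetFun V A} {v : V} {U B T : Finset V} (hv : v ∈ B)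
    (hFB : F.SupportedOn B) (hN : ∀ u ∈ U, G.Adj v u → u ∈ B) (hT : T ⊆ U) (hTB : ¬ T ⊆ B) :
    (F * vertexSum γ G pack w v) T = 0 := by
  classical
  rw [SetFun.mul_apply]
  refine sum_eq_zero fun W hW => ?_
  by_cases hWB : W ⊆ B
  · have hX : ¬ T \ W ⊆ B := fun h => hTB fun u hu => by
      by_cases huW : u ∈ W
      exacts [hWB huW, h (mem_sdiff.2 ⟨hu, huW⟩)]
    have h1 : T \ W ≠ ∅ := fun h => hX (h ▸ empty_subset B)
    -- A clique through `v` inside `U` consists of `v` and neighbors of `v`, all of which belong to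
    -- `B`.
    have h2 : v ∈ T \ W → ¬ G.IsClique ((T \ W : Finset V) : Set V) := fun hvX hc => hX fun u hu => by
      by_cases huv : u = v
      · rwa [huv]
      · exact hN u (hT (mem_sdiff.1 hu).1) (hc (mem_coe.2 hvX) (mem_coe.2 hu) (Ne.symm huv))
    have h3 : v ∈ T \ W → (T \ W).card ≠ 1 := fun hvX hc => by
      obtain ⟨a, ha⟩ := card_eq_one.1 hc
      rw [ha, mem_singleton] at hvX
      subst hvX
      exact hX (by rw [ha]; simpa using hv)
    simp only [vertexSum, h1, if_false, zero_add]
    split_ifs with h4 h5 h6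
    · exact absurd h5.1 (h2 h4)
    · exact absurd h5.1 (h2 h4)
    · rename_i h6; exact absurd h6.2 (h3 h4)
    · simp
    · simp
  · rw [hFB W hWB, zero_mul]

end Packings

namespace RAM

open Finset

/-! ### Bit masks -/

/-- The bit mask of a finite set of positions. -/
def code (s : Finset ℕ) : ℕ := ∑ i ∈ s, 2 ^ i

theorem code_empty : code ∅ = 0 := rfl

theorem code_insert {s : Finset ℕ} {i : ℕ} (h : i ∉ s) : code (insert i s) = code s + 2 ^ i := by
  rw [code, sum_insert h, add_comm, code]

theorem code_erase {s : Finset ℕ} {i : ℕ} (h : i ∈ s) : code (s.erase i) = code s - 2 ^ i := by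
  have := code_insert (notMem_erase i s)
  rw [insert_erase h] at this
  omega

theorem code_lt {s : Finset ℕ} {m : ℕ} (h : s ⊆ range m) : code s < 2 ^ m := by
  have h1 : code s ≤ code (range m) := sum_le_sum_of_subset h
  have h2 : code (range m) + 1 = 2 ^ m := by
    have := Nat.geomSum_eq (le_refl 2) m
    simp only [code]
    rw [this]
    have := Nat.one_le_two_pow (n := m)
    norm_num
    omega
  omega

/-- Binary expansion. A loop over the numbers below `2 ^ m` is thereby a loop over the subsets of
`range m`. -/
theorem exists_code {m X : ℕ} (h : X < 2 ^ m) : ∃ s ⊆ range m, code s = X := by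
  induction m generalizing X with
  | zero => exact ⟨∅, by simp, by rw [code_empty]; simp at h; exact h.symm⟩
  | succ m ih =>
    by_cases hX : X < 2 ^ m
    · obtain ⟨s, hs, rfl⟩ := ih hX
      exact ⟨s, hs.trans (range_subset_range.2 (by omega)), rfl⟩
    · obtain ⟨s, hs, hsX⟩ := ih (X := X - 2 ^ m) (by rw [pow_succ] at h; omega)
      have hm : m ∉ s := fun h => by simpa using hs h
      refine ⟨insert m s, insert_subset (by simp) (hs.trans (range_subset_range.2 (by omega))), ?_⟩
      rw [code_insert hm, hsX]
      omega

/-- A table of the bits of all numbers with `K` bits, and a table of the powers of two. -/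
structure BitTables (K : ℕ) (σ : Store) : Prop where
  bit : ∀ s ⊆ range K, ∀ i < K, σ.arr 7 (code s) i 0 = if i ∈ s then 1 else 0
  pow : ∀ i ≤ K, σ.arr 8 i 0 0 = 2 ^ i

theorem BitTables.congr {K : ℕ} {σ τ : Store} (h : BitTables K σ) (h7 : τ.arr 7 = σ.arr 7)
    (h8 : τ.arr 8 = σ.arr 8) : BitTables K τ :=
  ⟨by rw [h7]; exact h.bit, by rw [h8]; exact h.pow⟩

/-! ### The program for the subset convolution -/

instance : Add Expr := ⟨.add⟩
instance : Sub Expr := ⟨.sub⟩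
instance : Mul Expr := ⟨.mul⟩
instance (n : ℕ) : OfNat Expr n := ⟨.lit n⟩

namespace Expr

@[simp] theorem eval_add (e f : Expr) (σ : Store) : (e + f).eval σ = e.eval σ + f.eval σ := rfl
@[simp] theorem eval_sub (e f : Expr) (σ : Store) : (e - f).eval σ = e.eval σ - f.eval σ := rfl
@[simp] theorem eval_mul (e f : Expr) (σ : Store) : (e * f).eval σ = e.eval σ * f.eval σ := rfl
@[simp] theorem eval_ofNat (n : ℕ) (σ : Store) :
    (OfNat.ofNat n : Expr).eval σ = n := rfl
@[simp] theorem eval_zero (σ : Store) : (0 : Expr).eval σ = 0 := rfl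
@[simp] theorem eval_one (σ : Store) : (1 : Expr).eval σ = 1 := rfl
@[simp] theorem eval_lit (n : ℕ) (σ : Store) : (lit n).eval σ = n := rfl
@[simp] theorem time_lit (n : ℕ) (σ : Store) : (lit n).time σ = 1 := rfl
@[simp] theorem eval_var (x : ℕ) (σ : Store) : (var x).eval σ = σ.var x := rfl
@[simp] theorem eval_get (a : ℕ) (i j k : Expr) (σ : Store) :
    (get a i j k).eval σ = σ.arr a (i.eval σ) (j.eval σ) (k.eval σ) := rfl
@[simp] theorem eval_inp (i : Expr) (σ : Store) : (inp i).eval σ = σ.raw (i.eval σ) := rfl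
@[simp] theorem eval_sum (x : ℕ) (e f : Expr) (σ : Store) :
    (sum x e f).eval σ = ∑ i ∈ Finset.range (e.eval σ), f.eval (σ.setVar x i) := rfl
@[simp] theorem time_add (e f : Expr) (σ : Store) : (e + f).time σ = e.time σ + f.time σ + 1 := rfl
@[simp] theorem time_sub (e f : Expr) (σ : Store) : (e - f).time σ = e.time σ + f.time σ + 1 := rfl
@[simp] theorem time_mul (e f : Expr) (σ : Store) : (e * f).time σ = e.time σ + f.time σ + 1 := rfl
@[simp] theorem time_zero (σ : Store) : (0 : Expr).time σ = 1 := rfl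
@[simp] theorem time_one (σ : Store) : (1 : Expr).time σ = 1 := rfl
@[simp] theorem time_var (x : ℕ) (σ : Store) : (var x).time σ = 1 := rfl
@[simp] theorem time_get (a : ℕ) (i j k : Expr) (σ : Store) :
    (get a i j k).time σ = i.time σ + j.time σ + k.time σ + 1 := rfl
@[simp] theorem time_inp (i : Expr) (σ : Store) : (inp i).time σ = i.time σ + 1 := rfl
@[simp] theorem time_sum (x : ℕ) (e f : Expr) (σ : Store) : (sum x e f).time σ =
    e.time σ + 1 + ∑ i ∈ Finset.range (e.eval σ), (f.time (σ.setVar x i) + 1) := rfl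

/-- `1` if the values are equal, otherwise `0`. -/
def eqv (e f : Expr) : Expr := 1 - ((e - f) + (f - e))

@[simp] theorem eval_eqv (e f : Expr) (σ : Store) :
    (eqv e f).eval σ = if e.eval σ = f.eval σ then 1 else 0 := by
  simp only [eqv, eval_sub, eval_add, eval_one]
  split_ifs <;> omega

@[simp] theorem time_eqv (e f : Expr) (σ : Store) :
    (eqv e f).time σ = 2 * e.time σ + 2 * f.time σ + 5 := by
  simp only [eqv, time_sub, time_add, time_one]
  omega

section
variable (a x y n : ℕ) (e f i j k : Expr)
@[simp] theorem pure_add : (e + f).pure = (e.pure && f.pure) := rfl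
@[simp] theorem pure_sub : (e - f).pure = (e.pure && f.pure) := rfl
@[simp] theorem pure_mul : (e * f).pure = (e.pure && f.pure) := rfl
@[simp] theorem pure_var : (var x).pure = true := rfl
@[simp] theorem pure_get : (get a i j k).pure = (a != 0 && i.pure && j.pure && k.pure) := rfl
@[simp] theorem pure_sum : (sum x e f).pure = (e.pure && f.pure) := rfl
@[simp] theorem pure_eqv : (eqv e f).pure = (e.pure && f.pure) := by
  simp only [eqv, pure_sub, pure_add]
  change (true && _) = _
  cases e.pure <;> cases f.pure <;> rfl
@[simp] theorem noArr_add : (e + f).noArr a = (e.noArr a && f.noArr a) := rfl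
@[simp] theorem noArr_sub : (e - f).noArr a = (e.noArr a && f.noArr a) := rfl
@[simp] theorem noArr_mul : (e * f).noArr a = (e.noArr a && f.noArr a) := rfl
@[simp] theorem noArr_var : (var x).noArr a = true := rfl
@[simp] theorem noArr_get :
    (get x i j k).noArr a = (x != a && i.noArr a && j.noArr a && k.noArr a) := rfl
@[simp] theorem noArr_sum : (sum x e f).noArr a = (e.noArr a && f.noArr a) := rfl
@[simp] theorem noArr_eqv : (eqv e f).noArr a = (e.noArr a && f.noArr a) := by
  simp only [eqv, noArr_sub, noArr_add]
  change (true && _) = _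
  cases e.noArr a <;> cases f.noArr a <;> rfl
@[simp] theorem noVar_add : (e + f).noVar x = (e.noVar x && f.noVar x) := rfl
@[simp] theorem noVar_sub : (e - f).noVar x = (e.noVar x && f.noVar x) := rfl
@[simp] theorem noVar_zero : (0 : Expr).noVar x = true := rfl
@[simp] theorem noVar_one : (1 : Expr).noVar x = true := rfl
@[simp] theorem noArr_zero : (0 : Expr).noArr a = true := rfl
@[simp] theorem noArr_one : (1 : Expr).noArr a = true := rfl
@[simp] theorem pure_zero : (0 : Expr).pure = true := rfl
@[simp] theorem pure_one : (1 : Expr).pure = true := rfl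
@[simp] theorem noVar_var : (var y).noVar x = (y != x) := rfl
@[simp] theorem noVar_get : (get a i j k).noVar x = (i.noVar x && j.noVar x && k.noVar x) := rfl
end

theorem Steady.var {a x : ℕ} (h : 3 ≤ x) : (Expr.var x).Steady a :=
  ⟨by simp, by simp, by simp; omega, fun _ => by simp⟩

theorem Steady.zero {a : ℕ} : (0 : Expr).Steady a := ⟨by simp, by simp, by simp, fun _ => by simp⟩

theorem Steady.one {a : ℕ} : (1 : Expr).Steady a := ⟨by simp, by simp, by simp, fun _ => by simp⟩

theorem Steady.succ {a x : ℕ} (h : 3 ≤ x) : (Expr.var x + 1).Steady a :=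
  ⟨by simp, by simp, by simp; omega, fun _ => by simp⟩

theorem Steady.get {a b x : ℕ} (hb0 : b ≠ 0) (hb : b ≠ a) (h : 3 ≤ x) :
    (Expr.get b (.var x) 0 0).Steady a :=
  ⟨by simp [hb0], by simp [hb], by simp; omega, fun _ => by simp⟩

end Expr

-- Numbers of variables; 0, 1, 2 are the indices of `fill`, and 3, 4 are summation indices. `vn`,
-- `vE`, `vN` hold the head of the input, `vK` the largest bag size, `vD` the number of
-- coefficients. `vx` and `vy` are the current node and its neighbor, `vp` is a position in the bag
-- of `vx`, `vm` the size of the bag whose table is being computed, `vz` the place of this table in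
-- array 9, `vk` the number of members of the bag of `vy` to be kept, `vi` the progress of the
-- search for leaves, `vP` the reading position, `vu` a dummy; the others are loop counters. The
-- arrays are: 0 memory of the simulated decision procedure, 1 its answers, 2 members and 3 sizes of
-- the bags, 4 adjacency, 5 degrees and 6 sums of the neighbors in the remaining tree, 7 bits of
-- masks, 8 powers of two, 9 tables, 10 to 14 work space.
notation "vn" => (5 : ℕ)
notation "vE" => (6 : ℕ)
notation "vN" => (7 : ℕ)
notation "vK" => (8 : ℕ)
notation "vD" => (9 : ℕ)
notation "vp" => (10 : ℕ)
notation "vx" => (11 : ℕ)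
notation "vy" => (12 : ℕ)
notation "vi" => (13 : ℕ)
notation "vm" => (14 : ℕ)
notation "vz" => (15 : ℕ)
notation "vj" => (16 : ℕ)
notation "vq" => (17 : ℕ)
notation "vu" => (18 : ℕ)
notation "vr" => (19 : ℕ)
notation "vP" => (20 : ℕ)
notation "vk" => (21 : ℕ)

/-- The number of elements of the set with mask `X`. -/
def popE (X : Expr) : Expr := .sum 3 (.var vm) (.get 7 X (.var 3) 0)

/-- The number of masks. -/
def masksE : Expr := .get 8 (.var vm) 0 0

/-- Assignment to all entries `(X, r, c)` of array `a`, where `X` is a mask, `r` is a size and `c` is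
the number of a coefficient. -/
def fillRanked (a : ℕ) (v : Expr) : Stmt := fill a 0 masksE (.var vm + 1) (.var vD) v

/-- Array `a` becomes the ranked version of the table `src`. -/
def rankStmt (a : ℕ) (src : Expr) : Stmt := fillRanked a (Expr.eqv (popE (.var 0)) (.var 1) * src)

/-- One step of the zeta transform of array `a`, for position `j`. -/
def zetaStep (a : ℕ) (j : Expr) : Stmt :=
  .seq (fillRanked 12 (.get a (.var 0) (.var 1) (.var 2) +
      .get 7 (.var 0) j 0 * .get a (.var 0 - .get 8 j 0 0) (.var 1) (.var 2)))
    (fillRanked a (.get 12 (.var 0) (.var 1) (.var 2)))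

/-- One step of the Möbius transform of array `a`, for position `j`. -/
def moebiusStep (a : ℕ) (j : Expr) : Stmt :=
  .seq (fillRanked 12 (.get a (.var 0) (.var 1) (.var 2) -
      .get 7 (.var 0) j 0 * .get a (.var 0 - .get 8 j 0 0) (.var 1) (.var 2)))
    (fillRanked a (.get 12 (.var 0) (.var 1) (.var 2)))

/-- The zeta transform of array `a`. -/
def zetaStmt (a : ℕ) : Stmt := .forTo vj (.var vm) (zetaStep a (.var vm - (.var vj + 1)))

/-- The Möbius transform of array `a`. -/
def moebiusStmt (a : ℕ) : Stmt := .forTo vj (.var vm) (moebiusStep a (.var vj))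

/-- Array `13` becomes the ranked product of the arrays `10` and `11`. -/
def productStmt : Stmt := fillRanked 13 (.sum 3 (.var 1 + 1) (.sum 4 (.var 2 + 1)
  (.get 10 (.var 0) (.var 3) (.var 4) * .get 11 (.var 0) (.var 1 - .var 3) (.var 2 - .var 4))))

/-- The subset convolution of the tables `9` (entry `vz`) and `14`, with the result in
array `13`. -/
def convStmt : Stmt :=
  .seq (rankStmt 10 (.get 9 (.var vz) (.var 0) (.var 2))) <|
  .seq (rankStmt 11 (.get 14 0 (.var 0) (.var 2))) <|
  .seq (zetaStmt 10) <| .seq (zetaStmt 11) <| .seq productStmt (moebiusStmt 13)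

/-- The situation in which convolutions are computed. -/
structure ConvContext (M K m D : ℕ) (σ : Store) : Prop where
  bits : BitTables K σ
  m_le : m ≤ K
  var_m : σ.var vm = m
  var_D : σ.var vD = D
  D_pos : 1 ≤ D
  D_le : D ≤ M
  K_lt : K + 1 ≤ M
  pow_le : 2 ^ K ≤ M

/-! ### Correctness and cost of the fast subset convolution -/

section Conv

variable {M base K m D : ℕ} {σ : Store}

theorem ConvContext.congr {τ : Store} (h : ConvContext M K m D σ) (h7 : τ.arr 7 = σ.arr 7)
    (h8 : τ.arr 8 = σ.arr 8) (hm : τ.var vm = σ.var vm) (hD : τ.var vD = σ.var vD) :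
    ConvContext M K m D τ :=
  ⟨h.bits.congr h7 h8, h.m_le, hm.trans h.var_m, hD.trans h.var_D, h.D_pos, h.D_le, h.K_lt, h.pow_le⟩

theorem ConvContext.bit (h : ConvContext M K m D σ) {s : Finset ℕ} (hs : s ⊆ range m) {i : ℕ}
    (hi : i < m) : σ.arr 7 (code s) i 0 = if i ∈ s then 1 else 0 :=
  h.bits.bit s (hs.trans (range_subset_range.2 h.m_le)) i (hi.trans_le h.m_le)

theorem ConvContext.pow_m_le (h : ConvContext M K m D σ) : 2 ^ m ≤ M :=
  (Nat.pow_le_pow_right (by norm_num) h.m_le).trans h.pow_le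

theorem ConvContext.pop (h : ConvContext M K m D σ) {s : Finset ℕ} (hs : s ⊆ range m) {X : Expr}
    (hX : X.eval σ = code s) (h3 : X.noVar 3) : (popE X).eval σ = s.card := by
  simp only [popE, Expr.eval_sum, Expr.eval_var, h.var_m, Expr.eval_get, Expr.eval_zero,
    Expr.eval_setVar _ h3, hX, Store.setVar_arr, Store.setVar_var, if_true]
  rw [sum_congr rfl fun i hi => h.bit hs (mem_range.1 hi), ← sum_filter, sum_const, smul_eq_mul,
    mul_one, filter_mem_eq_inter, inter_eq_right.2 hs]

theorem time_popE {X : Expr} (h3 : X.noVar 3) (σ : Store) :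
    (popE X).time σ = 2 + σ.var vm * (X.time σ + 4) := by
  simp only [popE, Expr.time_sum, Expr.eval_var, Expr.time_get, Expr.time_var, Expr.time_zero,
    Expr.eval_setVar _ h3, sum_const, card_range, smul_eq_mul]

/-- Assignment to all entries of a ranked array. -/
theorem ConvContext.fillRanked (h : ConvContext M K m D σ) {Q : ℕ → Store → Prop} {a tv : ℕ}
    {v : Expr} (ha : 9 ≤ a) (hv : v.pure) (hv' : v.noArr a)
    (g : Finset ℕ → ℕ → ℕ → ℕ)
    (hvM : ∀ s ⊆ range m, ∀ r ≤ m, ∀ c < D,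
      v.eval (((σ.setVar 0 (code s)).setVar 1 r).setVar 2 c) = g s r c ∧ g s r c ≤ M ∧
      v.time (((σ.setVar 0 (code s)).setVar 1 r).setVar 2 c) ≤ tv)
    (hQ : ∀ t ≤ 320 * (2 ^ m * (m + 1) * D * (tv + 1)), ∀ f,
      (∀ s ⊆ range m, ∀ r ≤ m, ∀ c < D, f (code s) r c = g s r c) → Q t (σ.setArr a f)) :
    Sp M base (RAM.fillRanked a v) σ Q := by
  refine Sp.fill (I' := 0) (n₁ := 2 ^ m) (n₂ := m + 1) (n₃ := D) (tv := tv) (by omega)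
    .zero (Expr.Steady.get (by omega) (by omega) (by omega)) (Expr.Steady.succ (by omega))
    (Expr.Steady.var (by omega)) rfl ?_ ?_ h.var_D h.pow_m_le (by have := h.m_le; have := h.K_lt; omega)
    h.D_le hv hv' ?_ ?_
  · simp [masksE, h.var_m, h.bits.pow m h.m_le]
  · simp [h.var_m]
  · intro X hX r hr c hc
    obtain ⟨s, hs, rfl⟩ := exists_code hX
    obtain ⟨h1, h2, h3⟩ := hvM s hs r (by omega) c hc
    exact ⟨h1.trans_le h2, h3⟩
  · intro t ht
    refine hQ t (ht.trans ?_) _ fun s hs r hr c hc => ?_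
    -- Absorbing the three increments in the bound of `Sp.fill` costs a factor 2 each, and 40 * 8 =
    -- 320.
    · have e1 : 2 ^ m + 1 ≤ 2 * 2 ^ m := by have := Nat.one_le_two_pow (n := m); omega
      have e2 : m + 1 + 1 ≤ 2 * (m + 1) := by omega
      have e3 : D + 1 ≤ 2 * D := by have := h.D_pos; omega
      calc 40 * ((2 ^ m + 1) * (m + 1 + 1) * (D + 1) * (tv + 1))
          ≤ 40 * (2 * 2 ^ m * (2 * (m + 1)) * (2 * D) * (tv + 1)) := by gcongr
        _ = 320 * (2 ^ m * (m + 1) * D * (tv + 1)) := by ring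
    · have := code_lt hs
      rw [boxUpdate, if_pos ⟨by omega, by omega, by omega, hc⟩, Nat.sub_zero]
      exact (hvM s hs r hr c hc).1

theorem ConvContext.rank (h : ConvContext M K m D σ) {Q : ℕ → Store → Prop} {a : ℕ}
    {src : Expr} (ha : 9 ≤ a) (hp : src.pure) (ha' : src.noArr a) (hts : ∀ τ, src.time τ ≤ 5)
    {f : Finset ℕ → ℕ → ℕ}
    (hsrc : ∀ s ⊆ range m, ∀ r, ∀ c < D,
      src.eval (((σ.setVar 0 (code s)).setVar 1 r).setVar 2 c) = f s c ∧ f s c ≤ M)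
    (hQ : ∀ t ≤ 320 * (2 ^ m * (m + 1) * D * (20 * (m + 1))), ∀ f',
      (∀ s ⊆ range m, ∀ r ≤ m, ∀ c < D, f' (code s) r c = ofRank (f · c) r s) →
      Q t (σ.setArr a f')) :
    Sp M base (rankStmt a src) σ Q := by
  refine h.fillRanked (tv := 20 * (m + 1) - 1) ha ?_ ?_ (fun s r c => ofRank (f · c) r s) ?_ ?_
  · simp [popE, hp]
  · simp [popE, ha']; omega
  · intro s hs r hr c hc
    have h' : ConvContext M K m D (((σ.setVar 0 (code s)).setVar 1 r).setVar 2 c) :=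
      h.congr rfl rfl (by simp [Store.setVar_var]) (by simp [Store.setVar_var])
    obtain ⟨h1, h2⟩ := hsrc s hs r c hc
    have e1 : (Expr.eqv (popE (.var 0)) (.var 1) * src).eval
        (((σ.setVar 0 (code s)).setVar 1 r).setVar 2 c) = ofRank (f · c) r s := by
      rw [Expr.eval_mul, h1, Expr.eval_eqv, h'.pop hs (by simp [Store.setVar_var]) rfl]
      simp [Store.setVar_var, ofRank]
    refine ⟨e1, ?_, ?_⟩
    · simp only [ofRank]; split_ifs <;> omega
    · rw [Expr.time_mul, Expr.time_eqv, time_popE rfl, h'.var_m]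
      have := hts (((σ.setVar 0 (code s)).setVar 1 r).setVar 2 c)
      simp only [Expr.time_var]
      omega
  · intro t ht f' hf'
    exact hQ t (by rwa [Nat.sub_add_cancel (by omega)] at ht) f' hf'

/-- A step of the zeta or of the Möbius transform. -/
theorem ConvContext.step (h : ConvContext M K m D σ) {Q : ℕ → Store → Prop} {a j : ℕ}
    {e : Expr} (op : ℕ → ℕ → ℕ) (o : Expr → Expr → Expr) (ha : 9 ≤ a) (ha12 : a ≠ 12)
    (hj : j < m) (he : e.pure) (he12 : e.noArr 12)
    (hev : e.noVar 0 ∧ e.noVar 1 ∧ e.noVar 2) (het : ∀ τ, e.time τ ≤ 5) (hej : e.eval σ = j)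
    (ho : ∀ e f, (∀ τ, (o e f).eval τ = op (e.eval τ) (f.eval τ)) ∧ (o e f).pure = (e.pure && f.pure)
      ∧ (∀ b, (o e f).noArr b = (e.noArr b && f.noArr b)) ∧
      ∀ τ, (o e f).time τ = e.time τ + f.time τ + 1)
    {F F' : Finset ℕ → ℕ → ℕ → ℕ}
    (hF : ∀ s ⊆ range m, ∀ r ≤ m, ∀ c < D, σ.arr a (code s) r c = F s r c)
    (hF' : ∀ s ⊆ range m, ∀ r ≤ m, ∀ c < D,
      F' s r c = op (F s r c) (if j ∈ s then F (s.erase j) r c else 0) ∧ F' s r c ≤ M)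
    (hQ : ∀ t ≤ 320 * (2 ^ m * (m + 1) * D * 80), ∀ f g,
      (∀ s ⊆ range m, ∀ r ≤ m, ∀ c < D, f (code s) r c = F' s r c) →
      Q t ((σ.setArr 12 g).setArr a f)) :
    Sp M base (.seq (RAM.fillRanked 12 (o (.get a (.var 0) (.var 1) (.var 2))
      (.get 7 (.var 0) e 0 * .get a (.var 0 - .get 8 e 0 0) (.var 1) (.var 2))))
      (RAM.fillRanked a (.get 12 (.var 0) (.var 1) (.var 2)))) σ Q := by
  refine Sp.seq (h.fillRanked (tv := 39) (by norm_num) ?_ ?_ F' ?_ fun t ht f hf => ?_)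
  · simp [(ho _ _).2.1, he]; omega
  · simp [(ho _ _).2.2.1, he12, ha12]
  · intro s hs r hr c hc
    set τ := ((σ.setVar 0 (code s)).setVar 1 r).setVar 2 c with hτ
    have h' : ConvContext M K m D τ :=
      h.congr rfl rfl (by simp [hτ, Store.setVar_var]) (by simp [hτ, Store.setVar_var])
    have hej' : e.eval τ = j := by
      rw [hτ, (Expr.eval_setVar _ hev.2.2).1, (Expr.eval_setVar _ hev.2.1).1,
        (Expr.eval_setVar _ hev.1).1, hej]
    obtain ⟨h1, h2⟩ := hF' s hs r hr c hc
    have v0 : τ.var 0 = code s := by simp [hτ, Store.setVar_var]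
    have v1 : τ.var 1 = r := by simp [hτ, Store.setVar_var]
    have v2 : τ.var 2 = c := by simp [hτ, Store.setVar_var]
    have hta : τ.arr a = σ.arr a := rfl
    refine ⟨?_, h2, ?_⟩
    · rw [(ho _ _).1, h1]
      simp only [Expr.eval_get, Expr.eval_var, Expr.eval_mul, Expr.eval_sub, Expr.eval_zero, v0, v1,
        v2, hej', h'.bit hs hj, h'.bits.pow j (by have := h.m_le; omega), hta, hF s hs r hr c hc]
      split_ifs with hjs
      · rw [one_mul, ← code_erase hjs, hF _ ((erase_subset _ _).trans hs) r hr c hc]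
      · rw [zero_mul]
    · have := het τ
      simp only [(ho _ _).2.2.2, Expr.time_get, Expr.time_var, Expr.time_mul, Expr.time_sub,
        Expr.time_zero]
      omega
  -- The second assignment copies the result back; an assignment in place is impossible because
  -- `fill` must not read the array that it writes.
  · have h' : ConvContext M K m D (σ.setArr 12 f) :=
      h.congr (by simp [Store.setArr_arr]) (by simp [Store.setArr_arr]) rfl rfl
    refine h'.fillRanked (tv := 39) ha (by simp) (by simp; omega) F' ?_ fun t' ht' f' hf' =>
      hQ _ (by omega) _ _ hf'
    intro s hs r hr c hc
    refine ⟨?_, (hF' s hs r hr c hc).2, by simp⟩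
    rw [← hf s hs r hr c hc]
    simp [Store.setVar_var, Store.setArr_arr]

theorem zetaUpTo_le {f : Finset ℕ → ℕ} {μ : ℕ} (hf : ∀ s, f s ≤ μ) (k : ℕ) (s : Finset ℕ) :
    zetaUpTo f k s ≤ 2 ^ k * μ := by
  induction k generalizing s with
  | zero => simpa [zetaUpTo] using hf s
  | succ k ih =>
    rw [zetaUpTo, pow_succ]
    have h1 := ih s
    have h2 := ih (s.erase k)
    split_ifs <;> nlinarith

/-- While the loop counter goes down, the position `m - (vj + 1)` goes up, in the order of
`zetaUpTo`. Each step at most doubles the values, which gives the bound `2 ^ m * μ`. -/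
theorem ConvContext.zeta (h : ConvContext M K m D σ) {Q : ℕ → Store → Prop} {a μ : ℕ}
    (ha : 9 ≤ a) (ha12 : a ≠ 12) {F : ℕ → ℕ → Finset ℕ → ℕ} (hμ : ∀ r c s, F r c s ≤ μ)
    (hM : 2 ^ m * μ ≤ M)
    (hF : ∀ s ⊆ range m, ∀ r ≤ m, ∀ c < D, σ.arr a (code s) r c = F r c s)
    (hQ : ∀ t ≤ 320 * (2 ^ m * (m + 1) * D * (81 * m)) + 2, ∀ f g,
      (∀ s ⊆ range m, ∀ r ≤ m, ∀ c < D, f (code s) r c = zetaUpTo (F r c) m s) →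
      Q t ((σ.setArr 12 g).setArr a f)) :
    Sp M base (zetaStmt a) σ Q := by
  set T := 320 * (2 ^ m * (m + 1) * D * 80) with hT
  refine Sp.forTo (n := m) (fun i t τ => t + i * (T + 1) ≤ m * (T + 1) ∧
      ∃ f g u, τ = ((σ.setArr 12 g).setArr a f).setVar vj u ∧
      ∀ s ⊆ range m, ∀ r ≤ m, ∀ c < D, f (code s) r c = zetaUpTo (F r c) (m - i) s)
    trivial (by simp [h.var_m]) (by have := h.m_le; have := h.K_lt; omega)
    ⟨by simp, σ.arr a, σ.arr 12, σ.var vj, ?_, ?_⟩ ?_ ?_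
  · simp [Store.setArr, Store.setVar]
  · intro s hs r hr c hc
    rw [hF s hs r hr c hc, Nat.sub_self]; rfl
  · rintro i hi t _ ⟨ht, f, g, u, rfl, hf⟩
    rw [Store.setVar_setVar]
    set τ := ((σ.setArr 12 g).setArr a f).setVar vj i with hτ
    have h' : ConvContext M K m D τ := h.congr
      (by simp [hτ, Store.setArr_arr]; intro; omega) (by simp [hτ, Store.setArr_arr]; intro; omega)
      (by simp [hτ, Store.setVar_var]) (by simp [hτ, Store.setVar_var])
    refine h'.step (j := m - (i + 1)) (· + ·) (· + ·) ha ha12 (by omega) (by simp) (by simp)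
      (by simp) (by simp) (by simp [h'.var_m]; simp [hτ, Store.setVar_var])
      (fun _ _ => ⟨fun _ => rfl, rfl, fun _ => rfl, fun _ => rfl⟩)
      (F := fun s r c => zetaUpTo (F r c) (m - (i + 1)) s)
      (F' := fun s r c => zetaUpTo (F r c) (m - i) s) ?_ ?_ ?_
    · intro s hs r hr c hc
      rw [← hf s hs r hr c hc]
      simp [hτ, Store.setArr_arr]
    · intro s hs r hr c hc
      refine ⟨?_, (zetaUpTo_le (hμ r c) _ _).trans ((Nat.mul_le_mul_right _ (Nat.pow_le_pow_right
        (by norm_num) (by omega))).trans hM)⟩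
      have : m - i = m - (i + 1) + 1 := by omega
      simp only [this]; rfl
    · intro t' ht' f' g' hf'
      refine ⟨?_, f', g', i, ?_, hf'⟩
      · have : (i + 1) * (T + 1) = i * (T + 1) + T + 1 := by ring
        omega
      · rw [hτ]
        ext b
        · rfl
        · simp only [Store.setArr_arr, Store.setVar_arr]
          split_ifs <;> rfl
        · rfl
  · rintro t _ ⟨ht, f, g, u, rfl, hf⟩
    rw [Store.setVar_setVar]
    have e : ((σ.setArr 12 g).setArr a f).setVar vj (σ.var vj) = (σ.setArr 12 g).setArr a f :=
      Store.setVar_var_self _ _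
    rw [e]
    refine hQ _ ?_ _ _ hf
    have : 1 ≤ 2 ^ m * (m + 1) * D :=
      Nat.mul_pos (Nat.mul_pos (Nat.two_pow_pos m) (by omega)) h.D_pos
    simp only [Expr.time_var]
    have e1 : 320 * (2 ^ m * (m + 1) * D * (81 * m)) = m * T + 320 * (2 ^ m * (m + 1) * D) * m := by
      rw [hT]; ring
    have e2 : m * 1 ≤ 320 * (2 ^ m * (m + 1) * D) * m := by nlinarith
    have e3 : m * (T + 1) = m * T + m := by ring
    omega

/-- The steps of the zeta transform are undone in reverse order. As `k ∉ s.erase k`, step `k` did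
not change the value at `s.erase k`, and subtracting this value removes exactly what the step added
at `s`. Truncated subtraction is therefore exact, and no negative numbers are needed. -/
theorem ConvContext.moebius (h : ConvContext M K m D σ) {Q : ℕ → Store → Prop} {a : ℕ}
    (ha : 9 ≤ a) (ha12 : a ≠ 12) {F : ℕ → ℕ → Finset ℕ → ℕ} {B : ℕ} (hB : B ≤ M)
    (hM : ∀ s ⊆ range m, ∀ r ≤ m, ∀ c < D, zetaUpTo (F r c) m s ≤ B)
    (hF : ∀ s ⊆ range m, ∀ r ≤ m, ∀ c < D, σ.arr a (code s) r c = zetaUpTo (F r c) m s)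
    (hQ : ∀ t ≤ 320 * (2 ^ m * (m + 1) * D * (81 * m)) + 2, ∀ f g,
      (∀ s ⊆ range m, ∀ r ≤ m, ∀ c < D, f (code s) r c = F r c s ∧ F r c s ≤ B) →
      Q t ((σ.setArr 12 g).setArr a f)) :
    Sp M base (moebiusStmt a) σ Q := by
  set T := 320 * (2 ^ m * (m + 1) * D * 80) with hT
  -- Zeta steps only add natural numbers, so the intermediate values are bounded by the final ones.
  have mono : ∀ k ≤ m, ∀ s ⊆ range m, ∀ r ≤ m, ∀ c < D, zetaUpTo (F r c) k s ≤ B := by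
    intro k hk s hs r hr c hc
    refine le_trans ?_ (hM s hs r hr c hc)
    clear * - hk
    induction m, hk using Nat.le_induction with
    | base => exact le_rfl
    | succ m _ ih => exact ih.trans (Nat.le_add_right _ _)
  refine Sp.forTo (n := m) (fun i t τ => t + i * (T + 1) ≤ m * (T + 1) ∧
      ∃ f g u, τ = ((σ.setArr 12 g).setArr a f).setVar vj u ∧
      ∀ s ⊆ range m, ∀ r ≤ m, ∀ c < D, i ≤ m → f (code s) r c = zetaUpTo (F r c) i s)
    trivial (by simp [h.var_m]) (by have := h.m_le; have := h.K_lt; omega)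
    ⟨by simp, σ.arr a, σ.arr 12, σ.var vj, ?_, ?_⟩ ?_ ?_
  · simp [Store.setArr, Store.setVar]
  · intro s hs r hr c hc _
    exact hF s hs r hr c hc
  · rintro i hi t _ ⟨ht, f, g, u, rfl, hf⟩
    rw [Store.setVar_setVar]
    set τ := ((σ.setArr 12 g).setArr a f).setVar vj i with hτ
    have h' : ConvContext M K m D τ := h.congr
      (by simp [hτ, Store.setArr_arr]; intro; omega) (by simp [hτ, Store.setArr_arr]; intro; omega)
      (by simp [hτ, Store.setVar_var]) (by simp [hτ, Store.setVar_var])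
    refine h'.step (j := i) (· - ·) (· - ·) ha ha12 (by omega) (by simp) (by simp)
      (by simp) (by simp) (by simp [hτ, Store.setVar_var])
      (fun _ _ => ⟨fun _ => rfl, rfl, fun _ => rfl, fun _ => rfl⟩)
      (F := fun s r c => zetaUpTo (F r c) (i + 1) s)
      (F' := fun s r c => zetaUpTo (F r c) i s) ?_ ?_ ?_
    · intro s hs r hr c hc
      rw [← hf s hs r hr c hc hi]
      simp [hτ, Store.setArr_arr]
    · intro s hs r hr c hc
      refine ⟨?_, (mono i hi.le s hs r hr c hc).trans hB⟩
      simp only [zetaUpTo]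
      split_ifs with h1 h2
      · simp at h2
      · simp
      · simp
    · intro t' ht' f' g' hf'
      refine ⟨?_, f', g', i, ?_, fun s hs r hr c hc _ => hf' s hs r hr c hc⟩
      · have : (i + 1) * (T + 1) = i * (T + 1) + T + 1 := by ring
        omega
      · rw [hτ]
        ext b
        · rfl
        · simp only [Store.setArr_arr, Store.setVar_arr]
          split_ifs <;> rfl
        · rfl
  · rintro t _ ⟨ht, f, g, u, rfl, hf⟩
    rw [Store.setVar_setVar]
    have e : ((σ.setArr 12 g).setArr a f).setVar vj (σ.var vj) = (σ.setArr 12 g).setArr a f :=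
      Store.setVar_var_self _ _
    rw [e]
    refine hQ _ ?_ _ _ fun s hs r hr c hc => ⟨hf s hs r hr c hc (by omega),
      mono 0 (by omega) s hs r hr c hc⟩
    have : 1 ≤ 2 ^ m * (m + 1) * D :=
      Nat.mul_pos (Nat.mul_pos (Nat.two_pow_pos m) (by omega)) h.D_pos
    simp only [Expr.time_var]
    have e1 : 320 * (2 ^ m * (m + 1) * D * (81 * m)) = m * T + 320 * (2 ^ m * (m + 1) * D) * m := by
      rw [hT]; ring
    have e2 : m * 1 ≤ 320 * (2 ^ m * (m + 1) * D) * m := by nlinarith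
    have e3 : m * (T + 1) = m * T + m := by ring
    omega

/-- For every mask, polynomials in the rank and in the variable that counts cliques are multiplied
by the schoolbook method: each of the `(m + 1) * D` coefficients is a sum of at most as many
products. The order of magnitude of this step determines that of the whole convolution. -/
theorem ConvContext.product (h : ConvContext M K m D σ) {Q : ℕ → Store → Prop}
    {F G : ℕ → ℕ → Finset ℕ → ℕ} {B₁ B₂ : ℕ} (hF1 : ∀ r c s, F r c s ≤ B₁)
    (hG1 : ∀ r c s, G r c s ≤ B₂) (hM : (m + 1) * D * (B₁ * B₂) ≤ M)
    (hF : ∀ s ⊆ range m, ∀ r ≤ m, ∀ c < D, σ.arr 10 (code s) r c = F r c s)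
    (hG : ∀ s ⊆ range m, ∀ r ≤ m, ∀ c < D, σ.arr 11 (code s) r c = G r c s)
    (hQ : ∀ t ≤ 320 * (2 ^ m * (m + 1) * D * (24 * ((m + 1) * D))), ∀ f,
      (∀ s ⊆ range m, ∀ r ≤ m, ∀ c < D, f (code s) r c =
        ∑ i ∈ range (r + 1), ∑ c' ∈ range (c + 1), F i c' s * G (r - i) (c - c') s) →
      Q t (σ.setArr 13 f)) :
    Sp M base productStmt σ Q := by
  have hpos : 1 ≤ (m + 1) * D := Nat.mul_pos (by omega) h.D_pos
  refine h.fillRanked (tv := 24 * ((m + 1) * D) - 1) (by norm_num) (by simp) (by simp)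
    (fun s r c => ∑ i ∈ range (r + 1), ∑ c' ∈ range (c + 1), F i c' s * G (r - i) (c - c') s) ?_ ?_
  · intro s hs r hr c hc
    refine ⟨?_, ?_, ?_⟩
    · simp only [Expr.eval_sum, Expr.eval_add, Expr.eval_one, Expr.eval_var, Expr.eval_mul,
        Expr.eval_get, Expr.eval_sub, Store.setVar_var, Store.setVar_arr, if_true]
      simp only [show (0:ℕ) ≠ 4 by norm_num, show (0:ℕ) ≠ 3 by norm_num, show (0:ℕ) ≠ 2 by norm_num,
        show (0:ℕ) ≠ 1 by norm_num, show (1:ℕ) ≠ 4 by norm_num, show (1:ℕ) ≠ 3 by norm_num,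
        show (1:ℕ) ≠ 2 by norm_num, show (2:ℕ) ≠ 3 by norm_num, show (2:ℕ) ≠ 4 by norm_num,
        show (3:ℕ) ≠ 4 by norm_num, if_false]
      refine sum_congr rfl fun i hi => sum_congr rfl fun c' hc' => ?_
      rw [mem_range] at hi hc'
      rw [hF s hs i (by omega) c' (by omega), hG s hs _ (by omega) _ (by omega)]
    · refine le_trans ?_ hM
      refine (sum_le_card_nsmul _ _ (D * (B₁ * B₂)) fun i _ => ?_).trans ?_
      · refine (sum_le_card_nsmul _ _ (B₁ * B₂) fun c' _ => ?_).trans ?_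
        · exact Nat.mul_le_mul (hF1 _ _ _) (hG1 _ _ _)
        · rw [card_range, smul_eq_mul]; exact Nat.mul_le_mul_right _ (by omega)
      · rw [card_range, smul_eq_mul, mul_assoc]; exact Nat.mul_le_mul_right _ (by omega)
    · simp only [Expr.time_sum, Expr.eval_add, Expr.eval_one, Expr.eval_var, Expr.time_mul,
        Expr.time_get, Expr.time_sub, Expr.time_add, Expr.time_one, Expr.time_var, Store.setVar_var,
        sum_const, card_range, smul_eq_mul]
      simp only [show (2:ℕ) ≠ 3 by norm_num, show (1:ℕ) ≠ 2 by norm_num, if_false, if_true]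
      have e1 : (c + 1) * 14 + 5 ≤ D * 19 := by have := h.D_pos; omega
      have e2 : (r + 1) * (D * 19) ≤ (m + 1) * (D * 19) := Nat.mul_le_mul_right _ (by omega)
      have e3 : (r + 1) * ((c + 1) * 14 + 5) ≤ (r + 1) * (D * 19) := Nat.mul_le_mul_left _ e1
      have e4 : (m + 1) * (D * 19) = 19 * ((m + 1) * D) := by ring
      rw [sum_const, card_range, smul_eq_mul]
      have e5 : (r + 1) * (1 + 1 + 1 + 1 + (c + 1) * (1 + 1 + 1 + 1 + (1 + (1 + 1 + 1) + (1 + 1 + 1) + 1)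
        + 1 + 1) + 1) = (r + 1) * ((c + 1) * 14 + 5) := by ring
      omega
  · intro t ht f hf
    exact hQ t (by rwa [Nat.sub_add_cancel (by omega)] at ht) f hf

/-- The value that the convolution of two tables can reach. -/
def convBound (m D μ₁ μ₂ : ℕ) : ℕ := (m + 1) * D * (2 ^ m * μ₁ * (2 ^ m * μ₂))

/-- A bound on the number of steps of `convStmt`. -/
def convTime (m D : ℕ) : ℕ := 110000 * (2 ^ m * (m + 1) ^ 2 * D ^ 2)

/-- The entry of the subset convolution of the tables `f` and `g`. -/
noncomputable def convCoeff (f g : Finset ℕ → ℕ → ℕ) (s : Finset ℕ) (c : ℕ) : ℕ :=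
  PowerSeries.coeff c (∑ t ∈ s.powerset, PowerSeries.mk (f t) * PowerSeries.mk (g (s \ t)))

/-- Both tables are ranked and zeta transformed, multiplied pointwise, and transformed back. Only
the entries whose rank is the size of the mask are meaningful; the other ranks also hold
contributions of overlapping pairs. -/
theorem ConvContext.conv (h : ConvContext M K m D σ) {Q : ℕ → Store → Prop} {z μ₁ μ₂ : ℕ}
    {f g : Finset ℕ → ℕ → ℕ} (hz : σ.var vz = z)
    (hf : ∀ s ⊆ range m, ∀ c < D, σ.arr 9 z (code s) c = f s c)
    (hg : ∀ s ⊆ range m, ∀ c < D, σ.arr 14 0 (code s) c = g s c)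
    (hfμ : ∀ s c, f s c ≤ μ₁) (hgμ : ∀ s c, g s c ≤ μ₂) (hM1 : 2 ^ m * μ₁ ≤ M)
    (hM2 : 2 ^ m * μ₂ ≤ M) (hM3 : convBound m D μ₁ μ₂ ≤ M)
    (hQ : ∀ t ≤ convTime m D, ∀ τ : Store, τ.var = σ.var → τ.raw = σ.raw →
      (∀ a, a < 10 ∨ 13 < a → τ.arr a = σ.arr a) →
      (∀ s ⊆ range m, ∀ c < D, τ.arr 13 (code s) s.card c = convCoeff f g s c ∧
        convCoeff f g s c ≤ convBound m D μ₁ μ₂) → Q t τ) :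
    Sp M base convStmt σ Q := by
  have l1 : μ₁ ≤ M := le_trans (Nat.le_mul_of_pos_left _ (by positivity)) hM1
  have l2 : μ₂ ≤ M := le_trans (Nat.le_mul_of_pos_left _ (by positivity)) hM2
  have ctx : ∀ τ : Store, τ.var = σ.var → τ.arr 7 = σ.arr 7 → τ.arr 8 = σ.arr 8 →
    ConvContext M K m D τ := fun τ hv h7 h8 => h.congr h7 h8 (by rw [hv]) (by rw [hv])
  refine Sp.seq (h.rank (f := f) (a := 10) (by norm_num) (by simp) (by simp) (by simp) ?_ fun t₁ ht₁ f₁ hf₁ => ?_)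
  · intro s hs r c hc
    exact ⟨by simpa [Store.setVar_var, hz] using hf s hs c hc, (hfμ s c).trans l1⟩
  refine Sp.seq ((ctx _ (by rfl) (by simp [Store.setArr_arr]) (by simp [Store.setArr_arr])).rank (f := g) (a := 11)
    (by norm_num) (by simp) (by simp) (by simp) ?_ fun t₂ ht₂ f₂ hf₂ => ?_)
  · intro s hs r c hc
    exact ⟨by simpa [Store.setVar_var, Store.setArr_arr] using hg s hs c hc, (hgμ s c).trans l2⟩
  have rb : ∀ {f : Finset ℕ → ℕ → ℕ} {μ : ℕ}, (∀ s c, f s c ≤ μ) →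
      ∀ r c s, ofRank (f · c) r s ≤ μ := by
    intro f μ hf r c s
    simp only [ofRank]
    split_ifs
    exacts [hf s c, Nat.zero_le _]
  refine Sp.seq ((ctx _ (by rfl) (by simp [Store.setArr_arr]) (by simp [Store.setArr_arr])).zeta
    (a := 10) (F := fun r c => ofRank (f · c) r) (by norm_num) (by norm_num) (rb hfμ) hM1 ?_
    fun t₃ ht₃ f₃ g₃ hf₃ => ?_)
  · intro s hs r hr c hc
    simpa [Store.setArr_arr] using hf₁ s hs r hr c hc
  refine Sp.seq ((ctx _ (by rfl) (by simp [Store.setArr_arr]) (by simp [Store.setArr_arr])).zeta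
    (a := 11) (F := fun r c => ofRank (g · c) r) (by norm_num) (by norm_num) (rb hgμ) hM2 ?_
    fun t₄ ht₄ f₄ g₄ hf₄ => ?_)
  · intro s hs r hr c hc
    simpa [Store.setArr_arr] using hf₂ s hs r hr c hc
  refine Sp.seq ((ctx _ (by rfl) (by simp [Store.setArr_arr]) (by simp [Store.setArr_arr])).product
    (F := fun r c => zetaUpTo (ofRank (f · c) r) m) (G := fun r c => zetaUpTo (ofRank (g · c) r) m)
    (fun r c => zetaUpTo_le (rb hfμ r c) m) (fun r c => zetaUpTo_le (rb hgμ r c) m) hM3 ?_ ?_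
    fun t₅ ht₅ f₅ hf₅ => ?_)
  · intro s hs r hr c hc
    simpa [Store.setArr_arr] using hf₃ s hs r hr c hc
  · intro s hs r hr c hc
    simpa [Store.setArr_arr] using hf₄ s hs r hr c hc
  have key : ∀ s ⊆ range m, ∀ r ≤ m, ∀ c < D, f₅ (code s) r c =
      zetaUpTo (fun v => PowerSeries.coeff c (rankedProd (fun t => PowerSeries.mk (f t))
        (fun t => PowerSeries.mk (g t)) r v)) m s := fun s hs r hr c hc => by
    rw [hf₅ s hs r hr c hc, sum_zetaUpTo_mul f g r c hs]
  refine (ctx _ (by rfl) (by simp [Store.setArr_arr]) (by simp [Store.setArr_arr])).moebius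
    (a := 13) (B := convBound m D μ₁ μ₂)
    (F := fun r c v => PowerSeries.coeff c (rankedProd (fun t => PowerSeries.mk (f t))
        (fun t => PowerSeries.mk (g t)) r v)) (by norm_num) (by norm_num) hM3 ?_ ?_
    fun t₆ ht₆ f₆ g₆ hf₆ => ?_
  · intro s hs r hr c hc
    rw [← sum_zetaUpTo_mul f g r c hs]
    rw [convBound, mul_assoc]
    refine (sum_le_card_nsmul _ _ (D * (2 ^ m * μ₁ * (2 ^ m * μ₂))) fun i _ => ?_).trans ?_
    · refine (sum_le_card_nsmul _ _ (2 ^ m * μ₁ * (2 ^ m * μ₂)) fun c' _ => ?_).trans ?_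
      · exact Nat.mul_le_mul (zetaUpTo_le (rb hfμ _ _) m _) (zetaUpTo_le (rb hgμ _ _) m _)
      · rw [card_range, smul_eq_mul]; exact Nat.mul_le_mul_right _ (by omega)
    · rw [card_range, smul_eq_mul]; exact Nat.mul_le_mul_right _ (by omega)
  · intro s hs r hr c hc
    simpa [Store.setArr_arr] using key s hs r hr c hc
  · refine hQ _ ?_ _ rfl rfl ?_ ?_
    · have p1 : 1 ≤ 2 ^ m * (m + 1) := Nat.mul_pos (Nat.two_pow_pos m) (by omega)
      have e1 : 2 ^ m * (m + 1) * D * (m + 1) ≤ 2 ^ m * (m + 1) ^ 2 * D ^ 2 := by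
        rw [show 2 ^ m * (m + 1) * D * (m + 1) = 2 ^ m * (m + 1) ^ 2 * D by ring]
        exact Nat.mul_le_mul_left _ (Nat.le_self_pow (by norm_num) D)
      have e2 : 2 ^ m * (m + 1) * D * m ≤ 2 ^ m * (m + 1) * D * (m + 1) :=
        Nat.mul_le_mul_left _ (by omega)
      have e3 : 1 ≤ 2 ^ m * (m + 1) * D * (m + 1) :=
        Nat.mul_pos (Nat.mul_pos p1 h.D_pos) (by omega)
      have e4 : 2 ^ m * (m + 1) * D * (20 * (m + 1)) = 20 * (2 ^ m * (m + 1) * D * (m + 1)) := by ring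
      have e5 : 2 ^ m * (m + 1) * D * (81 * m) = 81 * (2 ^ m * (m + 1) * D * m) := by ring
      have e6 : 2 ^ m * (m + 1) * D * (24 * ((m + 1) * D)) =
        24 * (2 ^ m * (m + 1) ^ 2 * D ^ 2) := by ring
      rw [e4] at ht₁ ht₂
      rw [e5] at ht₃ ht₄ ht₆
      rw [e6] at ht₅
      rw [convTime]
      omega
    · intro a ha
      simp only [Store.setArr_arr]
      split_ifs <;> first | omega | rfl
    · intro s hs c hc
      have := hf₆ s hs s.card ((card_le_card hs).trans (card_range m).le) c hc
      rw [rankedProd_card] at this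
      simpa [Store.setArr_arr, convCoeff] using this

end Conv

end RAM

/-! ### Counting with tables on bags -/

section Forest

open Finset

variable {V A ι : Type*} [DecidableEq V] [CommSemiring A] [DecidableEq ι] {γ : Set ℕ}
  {G : SimpleGraph V} {pack : Bool} {w : A}

variable (γ G pack w) in
/-- The value of a family of tables, where `U` is the set of the vertices that are still to be
eliminated. -/
noncomputable def forestSum (R : Finset ι) (U : Finset V) (F : ι → SetFun V A) : A :=
  ((∏ x ∈ R, F x) * weightSum γ G pack w) U

theorem prod_update_mul {M : Type*} [CommMonoid M] {R : Finset ι} {x : ι} (hx : x ∈ R) (F : ι → M)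
    (f : M) : ∏ z ∈ R, Function.update F x f z = f * ∏ z ∈ R.erase x, F z := by
  rw [← mul_prod_erase R _ hx, Function.update_self]
  congr 1
  exact prod_congr rfl fun z hz => Function.update_of_ne (ne_of_mem_erase hz) _ _

/-- Elimination of a vertex that is in a single bag. -/
theorem forestSum_forget {R : Finset ι} {U : Finset V} {F : ι → SetFun V A} {B : ι → Finset V}
    {x : ι} {v : V} {f : SetFun V A} (hx : x ∈ R) (hvU : v ∈ U) (hvx : v ∈ B x)
    (hF : ∀ z ∈ R, (F z).SupportedOn (B z)) (hother : ∀ z ∈ R, z ≠ x → v ∉ B z)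
    (hedge : ∀ u ∈ U, G.Adj v u → ∃ z ∈ R, v ∈ B z ∧ u ∈ B z)
    (hf : f.SupportedOn (B x))
    (hf' : ∀ T ⊆ B x, v ∉ T → f T = (F x * vertexSum γ G pack w v) (insert v T)) :
    forestSum γ G pack w R (U.erase v) (Function.update F x f) = forestSum γ G pack w R U F := by
  rw [forestSum, forestSum, prod_update_mul hx, ← mul_prod_erase R F hx, mul_assoc, mul_assoc]
  refine forget_mul_weightSum hvU (SetFun.Avoids.prod fun z hz => ?_) fun T hT => ?_
  · exact (hF z (mem_of_mem_erase hz)).avoids (hother z (mem_of_mem_erase hz) (ne_of_mem_erase hz))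
  · have hvT : v ∉ T := fun h => by simpa using hT h
    by_cases hTB : T ⊆ B x
    · exact hf' T hTB hvT
    · rw [hf T hTB, mul_vertexSum_eq_zero hvx (hF x hx) (fun u hu hvu => ?_)
        (insert_subset hvU (hT.trans (erase_subset _ _)))
        fun h => hTB ((subset_insert v T).trans h)]
      obtain ⟨z, hz, hvz, huz⟩ := hedge u hu hvu
      by_cases hzx : z = x
      · rwa [← hzx]
      · exact absurd hvz (hother z hz hzx)

/-- Removal of a node. -/
theorem forestSum_join {R : Finset ι} {U : Finset V} {F : ι → SetFun V A} {x y : ι}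
    {f : SetFun V A} (hx : x ∈ R) (hy : y ∈ R) (hxy : x ≠ y) (hf : ∀ T ⊆ U, f T = (F x * F y) T) :
    forestSum γ G pack w (R.erase x) U (Function.update F y f) = forestSum γ G pack w R U F := by
  have hy' : y ∈ R.erase x := mem_erase.2 ⟨hxy.symm, hy⟩
  rw [forestSum, forestSum, prod_update_mul hy', ← mul_prod_erase R F hx, ← mul_prod_erase _ F hy',
    ← mul_assoc (F x)]
  exact SetFun.mul_congr (fun T hT => SetFun.mul_congr (fun W hW => hf W (hW.trans hT))
    fun _ _ => rfl) fun _ _ => rfl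

-- The start of the elimination: with unit tables the invariant is trivially true.
omit [DecidableEq ι] in
theorem forestSum_one {R : Finset ι} {U : Finset V} {F : ι → SetFun V A} (h : ∀ x, F x = 1) :
    forestSum γ G pack w R U F = weightSum γ G pack w U := by
  rw [forestSum, prod_eq_one fun x _ => h x, one_mul]

-- The end of the elimination: the answer is the entry of the last table at the empty set. This is
-- where the exclusion of empty cliques is needed.
omit [DecidableEq ι] in
theorem forestSum_singleton (h0 : 0 ∉ γ) {y : ι} {F : ι → SetFun V A} :
    forestSum γ G pack w {y} ∅ F = F y ∅ := by
  rw [forestSum, prod_singleton, SetFun.mul_apply]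
  rw [powerset_empty, sum_singleton]
  simp [weightSum_empty h0]

end Forest

/-! ### Subtrees -/

namespace SimpleGraph

variable {ι : Type*} {T : SimpleGraph ι}

/-- All paths between members of the set stay in the set. -/
def PathClosed (T : SimpleGraph ι) (R : Finset ι) : Prop :=
  ∀ x ∈ R, ∀ y ∈ R, ∀ p : T.Walk x y, p.IsPath → ∀ z ∈ p.support, z ∈ R

/-- The second node of the path lies in `R` and is adjacent to `x`, so it can only be `y`. -/
theorem PathClosed.snd {R : Finset ι} (hR : T.PathClosed R) {x y z : ι} (hx : x ∈ R) (hz : z ∈ R)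
    (hleaf : ∀ u ∈ R, T.Adj x u → u = y) (hxz : z ≠ x) (p : T.Walk x z) (hp : p.IsPath) :
    y ∈ p.support.tail := by
  cases p with
  | nil => exact absurd rfl hxz
  | cons h q =>
    have := hleaf _ (hR _ hx _ hz _ hp _ (by simp)) h
    subst this
    simp

/-- A path between other members that passes through `x` would visit `y` both immediately before and
immediately after `x`, hence twice. -/
theorem PathClosed.erase [DecidableEq ι] {R : Finset ι} (hR : T.PathClosed R) {x y : ι}
    (hx : x ∈ R) (hleaf : ∀ u ∈ R, T.Adj x u → u = y) : T.PathClosed (R.erase x) := by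
  intro u hu w hw p hp z hz
  rw [Finset.mem_erase] at hu hw ⊢
  refine ⟨?_, hR u hu.2 w hw.2 p hp z hz⟩
  rintro rfl
  have h1 := hR.snd hx hu.2 hleaf hu.1 _ (hp.takeUntil hz).reverse
  have h2 := hR.snd hx hw.2 hleaf hw.1 _ (hp.dropUntil hz)
  have h1' : y ∈ (p.takeUntil z hz).support := by
    have := List.mem_of_mem_tail h1
    simpa using this
  have hnd := hp.support_nodup
  rw [← p.take_spec hz, Walk.support_append, List.nodup_append] at hnd
  exact hnd.2.2 y h1' y h2 rfl

/-- Path-closedness makes the induced subgraph connected, hence a tree, and a tree with at least two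
vertices has a vertex of degree one. -/
theorem PathClosed.exists_leaf [DecidableEq ι] [DecidableRel T.Adj] (hT : T.IsTree) {R : Finset ι}
    (hR : T.PathClosed R) (h2 : 2 ≤ R.card) : ∃ x ∈ R, (R.filter (T.Adj x)).card = 1 := by
  classical
  have hne : Nonempty (R : Set ι) := by
    obtain ⟨x, hx⟩ := Finset.card_pos.1 (show 0 < R.card by omega)
    exact ⟨x, hx⟩
  have hnt : Nontrivial (R : Set ι) := by
    obtain ⟨x, hx, y, hy, hxy⟩ := Finset.one_lt_card.1 (show 1 < R.card by omega)
    exact ⟨⟨x, hx⟩, ⟨y, hy⟩, fun h => hxy (congrArg Subtype.val h)⟩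
  have htree : (T.induce (R : Set ι)).IsTree := by
    refine ⟨⟨fun x y => ?_⟩, hT.isAcyclic.induce _⟩
    obtain ⟨p, hp, _⟩ := hT.existsUnique_path x.1 y.1
    exact ⟨p.induce _ fun z hz => hR _ x.2 _ y.2 p hp z hz⟩
  obtain ⟨x, hx⟩ := htree.exists_vert_degree_one_of_nontrivial
  refine ⟨x, x.2, ?_⟩
  rw [degree_eq_one_iff_existsUnique_adj] at hx
  obtain ⟨y, hy, huniq⟩ := hx
  refine Finset.card_eq_one.2 ⟨y, ?_⟩
  ext u
  rw [Finset.mem_filter, Finset.mem_singleton]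
  constructor
  · rintro ⟨hu, hxu⟩
    exact congrArg Subtype.val (huniq ⟨u, hu⟩ hxu)
  · rintro rfl
    exact ⟨y.2, hy⟩

end SimpleGraph

/-- The path from `x` to `z` passes through `y`, and all bags on it contain `v`. Consequently a
vertex of a leaf bag that is missing from the neighbor's bag occurs in no other remaining bag, and
it can be eliminated. -/
theorem TreeDecomposition.mem_bag_of_leaf {V ι : Type*} {G : SimpleGraph V}
    (D : TreeDecomposition G ι) {R : Finset ι} (hR : D.tree.PathClosed R) {x y z : ι} {v : V}
    (hx : x ∈ R) (hz : z ∈ R) (hleaf : ∀ u ∈ R, D.tree.Adj x u → u = y) (hxz : z ≠ x)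
    (hvx : v ∈ D.bag x) (hvz : v ∈ D.bag z) : v ∈ D.bag y := by
  obtain ⟨p, hp, _⟩ := D.isTree.existsUnique_path x z
  exact D.mem_bag_of_path v x z p hp hvx hvz y
    (List.mem_of_mem_tail (hR.snd hx hz hleaf hxz p hp))

/-! ### Truncated power series -/

section Truncation

open PowerSeries

/-- Equality of numbers, or, for `clamp`, of their signs. -/
def valueCon (clamp : Bool) : RingCon ℕ where
  r a b := if clamp then (a = 0 ↔ b = 0) else a = b
  iseqv := by
    cases clamp
    · exact ⟨fun _ => rfl, Eq.symm, Eq.trans⟩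
    · exact ⟨fun _ => Iff.rfl, Iff.symm, Iff.trans⟩
  mul' := by
    cases clamp
    · intro a b c d h h'; simp at h h' ⊢; rw [h, h']
    · intro a b c d h h'; simp at h h' ⊢; rw [h, h']
  add' := by
    cases clamp
    · intro a b c d h h'; simp at h h' ⊢; rw [h, h']
    · intro a b c d h h'; simp at h h' ⊢; rw [h, h']

/-- Congruence of the first `D` coefficients. -/
def truncCon (κ : RingCon ℕ) (D : ℕ) : RingCon (PowerSeries ℕ) where
  r p q := ∀ c < D, κ (coeff c p) (coeff c q)
  iseqv := ⟨fun _ _ _ => κ.refl _, fun h c hc => κ.symm (h c hc),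
    fun h h' c hc => κ.trans (h c hc) (h' c hc)⟩
  mul' := by
    intro p q p' q' h h' c hc
    rw [coeff_mul, coeff_mul]
    have : ∀ s : Finset (ℕ × ℕ), s ⊆ Finset.HasAntidiagonal.antidiagonal c →
        κ (∑ x ∈ s, coeff x.1 p * coeff x.2 p') (∑ x ∈ s, coeff x.1 q * coeff x.2 q') := by
      classical
      intro s
      induction s using Finset.induction_on with
      | empty => intro _; exact κ.refl _
      | insert a s ha ih =>
        intro hs
        rw [Finset.sum_insert ha, Finset.sum_insert ha]
        have h1 := Finset.HasAntidiagonal.mem_antidiagonal.1 (hs (Finset.mem_insert_self a s))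
        exact κ.add (κ.mul (h _ (by omega)) (h' _ (by omega)))
          (ih ((Finset.subset_insert a s).trans hs))
    exact this _ Finset.Subset.rfl
  add' := by
    intro p q p' q' h h' c hc
    rw [(coeff c).map_add, (coeff c).map_add]
    exact κ.add (h c hc) (h' c hc)

/-- Power series, of which only the first `D` coefficients count, or only their signs. -/
abbrev Truncated (clamp : Bool) (D : ℕ) : Type := (truncCon (valueCon clamp) D).Quotient

/-- Truncation. -/
noncomputable def truncation (clamp : Bool) (D : ℕ) : PowerSeries ℕ →+* Truncated clamp D := RingCon.mk' _

theorem truncation_eq_iff {clamp : Bool} {D : ℕ} {p q : PowerSeries ℕ} :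
    truncation clamp D p = truncation clamp D q ↔
      ∀ c < D, valueCon clamp (coeff c p) (coeff c q) :=
  RingCon.eq _

/-- Numbers, or their signs. -/
def normal (clamp : Bool) (v : ℕ) : ℕ := if clamp then 1 - (1 - v) else v

/-- Nothing cancels in ℕ, so the sign of a sum or product depends only on the signs of its parts.
The decision algorithm may thus replace counts by signs after every convolution without leaving
their classes. -/
theorem valueCon_normal (clamp : Bool) (v : ℕ) : valueCon clamp (normal clamp v) v := by
  cases clamp
  · exact (valueCon false).refl _
  · show (_ ↔ _)
    simp only [normal, if_true]
    omega

theorem normal_le (clamp : Bool) (v : ℕ) : normal clamp v ≤ v := by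
  simp only [normal]; split_ifs <;> omega

end Truncation

/-! ### Tables -/

section Tables

open Finset

variable {V : Type*} [DecidableEq V]

/-- The positions of the members of `T` in a list. -/
def positions (l : List V) (T : Finset V) : Finset ℕ := T.image l.idxOf

theorem positions_injOn (l : List V) : Set.InjOn l.idxOf (l.toFinset : Set V) := by
  intro u hu v _ h
  exact (List.idxOf_inj (by simpa using hu)).1 h

theorem positions_subset {l : List V} {T : Finset V} (hT : T ⊆ l.toFinset) :
    positions l T ⊆ range l.length := by
  intro i hi
  obtain ⟨v, hv, rfl⟩ := mem_image.1 hi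
  exact mem_range.2 (List.idxOf_lt_length_of_mem (by simpa using hT hv))

theorem card_positions {l : List V} {T : Finset V} (hT : T ⊆ l.toFinset) :
    (positions l T).card = T.card :=
  card_image_of_injOn fun _ hu _ hv h => positions_injOn l (hT hu) (hT hv) h

theorem positions_insert (l : List V) (v : V) (T : Finset V) :
    positions l (insert v T) = insert (l.idxOf v) (positions l T) := image_insert ..

theorem idxOf_mem_positions {l : List V} {v : V} {T : Finset V} (hT : T ⊆ l.toFinset)
    (hv : v ∈ l.toFinset) : l.idxOf v ∈ positions l T ↔ v ∈ T := by
  constructor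
  · intro h
    obtain ⟨u, hu, huv⟩ := mem_image.1 h
    rwa [← positions_injOn l (hT hu) hv huv]
  · exact fun h => mem_image_of_mem _ h

/-- The members of a list at certain positions. -/
def members (l : List V) (s : Finset ℕ) : Finset V := l.toFinset.filter (l.idxOf · ∈ s)

theorem members_positions {l : List V} {T : Finset V} (hT : T ⊆ l.toFinset) :
    members l (positions l T) = T := by
  ext v
  rw [members, mem_filter]
  exact ⟨fun h => (idxOf_mem_positions hT h.1).1 h.2,
    fun h => ⟨hT h, (idxOf_mem_positions hT (hT h)).2 h⟩⟩

theorem exists_positions {l : List V} (hl : l.Nodup) {s : Finset ℕ} (hs : s ⊆ range l.length) :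
    ∃ T ⊆ l.toFinset, positions l T = s := by
  refine ⟨members l s, filter_subset _ _, ?_⟩
  ext i
  simp only [positions, members, mem_image, mem_filter, List.mem_toFinset]
  constructor
  · rintro ⟨v, ⟨_, h⟩, rfl⟩; exact h
  · intro hi
    have h : i < l.length := mem_range.1 (hs hi)
    refine ⟨l[i], ⟨List.getElem_mem h, ?_⟩, hl.idxOf_getElem i h⟩
    rwa [hl.idxOf_getElem i h]

variable {clamp : Bool} {D : ℕ}

/-- The function on sets that a table, indexed by positions, represents. -/
noncomputable def tableFun (clamp : Bool) (D : ℕ) (l : List V) (f : Finset ℕ → ℕ → ℕ) :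
    SetFun V (Truncated clamp D) :=
  fun T => if T ⊆ l.toFinset then truncation clamp D (PowerSeries.mk (f (positions l T))) else 0

theorem tableFun_supportedOn (l : List V) (f : Finset ℕ → ℕ → ℕ) :
    (tableFun clamp D l f).SupportedOn l.toFinset := fun _ hT => if_neg hT

theorem tableFun_congr {l : List V} {f g : Finset ℕ → ℕ → ℕ}
    (h : ∀ s ⊆ range l.length, ∀ c < D, valueCon clamp (f s c) (g s c)) :
    tableFun clamp D l f = tableFun clamp D l g := by
  funext T
  simp only [tableFun]
  split_ifs with hT
  · rw [truncation_eq_iff]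
    intro c hc
    rw [PowerSeries.coeff_mk, PowerSeries.coeff_mk]
    exact h _ (positions_subset hT) c hc
  · rfl

/-- The map from vertices to positions is injective on the bag, so the decompositions of `T`
correspond to those of its set of positions; truncation respects sums and products. -/
theorem tableFun_conv {l : List V} {f g : Finset ℕ → ℕ → ℕ} {T : Finset V} (hT : T ⊆ l.toFinset) :
    truncation clamp D (PowerSeries.mk (RAM.convCoeff f g (positions l T))) =
      (tableFun clamp D l f * tableFun clamp D l g) T := by
  have h1 : PowerSeries.mk (RAM.convCoeff f g (positions l T)) =
      ∑ t ∈ (positions l T).powerset, PowerSeries.mk (f t) * PowerSeries.mk (g (positions l T \ t)) := by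
    ext c
    rw [PowerSeries.coeff_mk, RAM.convCoeff]
  have hinj : Set.InjOn l.idxOf (T : Set V) := fun u hu v hv h => positions_injOn l (hT hu) (hT hv) h
  rw [h1, map_sum, SetFun.mul_apply, positions, powerset_image, sum_image]
  · refine sum_congr rfl fun W hW => ?_
    rw [mem_powerset] at hW
    rw [map_mul, tableFun, if_pos (hW.trans hT), tableFun, if_pos (sdiff_subset.trans hT),
      ← image_sdiff_of_injOn hinj hW]
    rfl
  · intro W hW W' hW' h
    exact (image_injOn_powerset_of_injOn hinj) hW hW' h

theorem tableFun_one (l : List V) :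
    tableFun clamp D l (fun s c => if s = ∅ ∧ c = 0 then 1 else 0) = 1 := by
  funext T
  rw [SetFun.one_apply, tableFun]
  by_cases hT : T = ∅
  · subst hT
    have : (PowerSeries.mk fun c => if positions l ∅ = ∅ ∧ c = 0 then 1 else 0) =
        (1 : PowerSeries ℕ) := by
      ext c
      rw [PowerSeries.coeff_mk, PowerSeries.coeff_one]
      simp [positions]
    rw [if_pos (empty_subset _), this, map_one, if_pos rfl]
  · have : (PowerSeries.mk fun c => if positions l T = ∅ ∧ c = 0 then 1 else 0) =
        (0 : PowerSeries ℕ) := by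
      ext c
      rw [PowerSeries.coeff_mk]
      simp [positions, hT]
    rw [this, map_zero, if_neg hT]
    split_ifs <;> rfl

open Classical in
/-- The table for the ways to treat a vertex. -/
noncomputable def vertexTable (γ : Set ℕ) (G : SimpleGraph V) (pack : Bool) (e : ℕ) (v : V)
    (l : List V) (s : Finset ℕ) (c : ℕ) : ℕ :=
  (if s = ∅ ∧ c = 0 then 1 else 0) + if l.idxOf v ∈ s then
    (if G.IsClique {u | u ∈ l ∧ l.idxOf u ∈ s} ∧ s.card ∈ γ ∧ c = e then 1 else 0) +
      if pack = true ∧ s.card = 1 ∧ c = 0 then 1 else 0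
  else 0

theorem vertexTable_le (γ : Set ℕ) (G : SimpleGraph V) (pack : Bool) (e : ℕ) (v : V) (l : List V)
    (s : Finset ℕ) (c : ℕ) : vertexTable γ G pack e v l s c ≤ 2 := by
  rw [vertexTable]
  split_ifs <;> simp_all

/-- The table lists the coefficients of `vertexSum` for the weight `X ^ e`: covering cliques
contribute at coefficient `e`, everything else at coefficient 0. -/
theorem tableFun_vertexTable {γ : Set ℕ} {G : SimpleGraph V} {pack : Bool} {e : ℕ} {v : V}
    {l : List V} (hv : v ∈ l.toFinset) {T : Finset V} (hT : T ⊆ l.toFinset) :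
    tableFun clamp D l (vertexTable γ G pack e v l) T =
      vertexSum γ G pack (truncation clamp D (PowerSeries.X ^ e)) v T := by
  have h1 : ({u | u ∈ l ∧ l.idxOf u ∈ positions l T} : Set V) = (T : Set V) := by
    ext u
    simp only [Set.mem_ofPred_eq, mem_coe]
    constructor
    · rintro ⟨h, h'⟩; exact (idxOf_mem_positions hT (by simpa using h)).1 h'
    · intro h; exact ⟨by simpa using hT h, (idxOf_mem_positions hT (hT h)).2 h⟩
  have h2 : positions l T = ∅ ↔ T = ∅ := image_eq_empty
  have h3 : PowerSeries.mk (vertexTable γ G pack e v l (positions l T)) =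
      vertexSum γ G pack (PowerSeries.X ^ e) v T := by
    ext c
    rw [PowerSeries.coeff_mk, vertexTable, h1, card_positions hT, vertexSum]
    simp only [h2, idxOf_mem_positions hT hv, map_add, apply_ite (PowerSeries.coeff c), map_zero, PowerSeries.coeff_one,
      PowerSeries.coeff_X_pow, ite_and]
    congr!
  rw [tableFun, if_pos hT, h3, vertexSum, vertexSum]
  simp only [map_add, apply_ite (truncation clamp D), map_zero, map_one]

end Tables

namespace RAM

open Finset

/-! ### The programs for single steps of the algorithm -/

/-- Numbers, or their signs. -/
def normalE (clamp : Bool) (e : Expr) : Expr := if clamp then 1 - (1 - e) else e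

section

variable (clamp : Bool) (e : Expr)

@[simp] theorem eval_normalE (σ : Store) : (normalE clamp e).eval σ = normal clamp (e.eval σ) := by
  cases clamp <;> rfl

theorem time_normalE (σ : Store) : (normalE clamp e).time σ ≤ e.time σ + 4 := by
  cases clamp
  · simp [normalE]
  · simp only [normalE, if_true, Expr.time_sub, Expr.time_one]; omega

@[simp] theorem pure_normalE : (normalE clamp e).pure = e.pure := by
  cases clamp <;> simp [normalE]

@[simp] theorem noArr_normalE (a : ℕ) : (normalE clamp e).noArr a = e.noArr a := by
  cases clamp <;> simp [normalE]

end

/-- Assignment to the entries `(I, X, c)` of array `a`, where `X` is a mask and `c` is the number of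
a coefficient. -/
def fillTable (a : ℕ) (I v : Expr) : Stmt := fill a I 1 masksE (.var vD) v

/-- Whether the set with the mask in variable `1` is a clique. -/
def cliqueE : Expr := .eqv (.sum 3 (.var vm) (.sum 4 (.var vm)
  (.get 7 (.var 1) (.var 3) 0 * .get 7 (.var 1) (.var 4) 0 *
    (1 - .get 4 (.get 2 (.var vx) (.var 3) 0) (.get 2 (.var vx) (.var 4) 0) 0)))) 0

/-- The entries of `vertexTable`. -/
def vertexE (pack : Bool) (e : ℕ) : Expr :=
  .eqv (popE (.var 1)) 0 * .eqv (.var 2) 0 + .get 7 (.var 1) (.var vp) 0 *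
    (cliqueE * .get 1 (popE (.var 1)) 0 0 * .eqv (.var 2) (.lit e) +
      .lit pack.toNat * .eqv (popE (.var 1)) 1 * .eqv (.var 2) 0)

/-- Elimination of the vertex at position `vp` of the bag `vx` from the table of the bag. -/
def forgetStmt (pack clamp : Bool) (e : ℕ) : Stmt :=
  .seq (.set vm (.get 3 (.var vx) 0 0)) <| .seq (.set vz (.var vx)) <|
  .seq (fillTable 14 0 (vertexE pack e)) <| .seq convStmt <|
  fillTable 9 (.var vz) (normalE clamp ((1 - .get 7 (.var 1) (.var vp) 0) *
    .get 13 (.var 1 + .get 8 (.var vp) 0 0) (popE (.var 1) + 1) (.var 2)))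

/-- One plus the position, in the bag `vx`, of the vertex at position `q` of the bag `vy`, and `0`
if there is none. -/
def positionE (q : Expr) : Expr := .sum 4 (.get 3 (.var vx) 0 0)
  (.eqv (.get 2 (.var vx) (.var 4) 0) (.get 2 (.var vy) q 0) * (.var 4 + 1))

/-- The source of `joinStmt`. -/
def joinE : Expr := .eqv (.sum 3 (.var vm)
      (.get 7 (.var 1) (.var 3) 0 * .eqv (positionE (.var 3)) 0)) 0 *
    .get 9 (.var vx) (.sum 3 (.var vm) (.get 7 (.var 1) (.var 3) 0 *
      .get 8 (positionE (.var 3) - 1) 0 0)) (.var 2)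

/-- Multiplication of the table of the bag `vy` by the table of the bag `vx`. -/
def joinStmt (clamp : Bool) : Stmt :=
  .seq (.set vm (.get 3 (.var vy) 0 0)) <| .seq (.set vz (.var vy)) <|
  .seq (fillTable 14 0 joinE) <| .seq convStmt <|
  fillTable 9 (.var vz) (normalE clamp (.get 13 (.var 1) (popE (.var 1)) (.var 2)))

/-- The data of a problem instance that the algorithm does not change. -/
structure Env {n N : ℕ} (γ : Set ℕ) (G : SimpleGraph (Fin n)) (l : Fin N → List (Fin n))
    (K D M : ℕ) (σ : Store) : Prop where
  gam : ∀ j ≤ K, σ.arr 1 j 0 0 = answer (j ∈ γ)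
  bag : ∀ x (p : ℕ) (hp : p < (l x).length), σ.arr 2 x p 0 = (l x)[p]
  size : ∀ x : Fin N, σ.arr 3 x 0 0 = (l x).length
  adj_pos : ∀ u v, u = v ∨ G.Adj u v → σ.arr 4 u v 0 = 1
  adj_zero : ∀ u v, ¬ (u = v ∨ G.Adj u v) → σ.arr 4 u v 0 = 0
  bits : BitTables K σ
  var_D : σ.var vD = D
  length_le : ∀ x, (l x).length ≤ K
  nodup : ∀ x, (l x).Nodup
  D_pos : 1 ≤ D
  D_le : D ≤ M
  K_lt : K + 1 ≤ M
  pow_le : 2 ^ K ≤ M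
  N_le : N * N + 2 * N ≤ M

/-- The table of the bag `z`. -/
def tableOf (σ : Store) (z : ℕ) (s : Finset ℕ) (c : ℕ) : ℕ := σ.arr 9 z (code s) c

/-! ### Specifications of a single elimination and of a single join -/

section

variable {n N K D M base : ℕ} {γ : Set ℕ} {G : SimpleGraph (Fin n)} {l : Fin N → List (Fin n)}
  {σ τ : Store}

theorem Env.congr (h : Env γ G l K D M σ) (ha : ∀ a < 9, a ≠ 5 → a ≠ 6 → τ.arr a = σ.arr a)
    (hv : τ.var vD = σ.var vD) : Env γ G l K D M τ where
  gam := by rw [ha 1 (by norm_num) (by norm_num) (by norm_num)]; exact h.gam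
  bag := by rw [ha 2 (by norm_num) (by norm_num) (by norm_num)]; exact h.bag
  size := by rw [ha 3 (by norm_num) (by norm_num) (by norm_num)]; exact h.size
  adj_pos := by rw [ha 4 (by norm_num) (by norm_num) (by norm_num)]; exact h.adj_pos
  adj_zero := by rw [ha 4 (by norm_num) (by norm_num) (by norm_num)]; exact h.adj_zero
  bits := h.bits.congr (ha 7 (by norm_num) (by norm_num) (by norm_num))
    (ha 8 (by norm_num) (by norm_num) (by norm_num))
  var_D := hv.trans h.var_D
  length_le := h.length_le
  nodup := h.nodup
  D_pos := h.D_pos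
  D_le := h.D_le
  K_lt := h.K_lt
  pow_le := h.pow_le
  N_le := h.N_le

theorem Env.context (h : Env γ G l K D M σ) {m : ℕ} (hm : σ.var vm = m) (hmK : m ≤ K) :
    ConvContext M K m D σ :=
  ⟨h.bits, hmK, hm, h.var_D, h.D_pos, h.D_le, h.K_lt, h.pow_le⟩

theorem ConvContext.fillTable {m : ℕ} (h : ConvContext M K m D σ) {Q : ℕ → Store → Prop}
    {a tv I' : ℕ} {I v : Expr} (ha : 9 ≤ a) (hI : I.Steady a) (hI' : I.eval σ = I') (hv : v.pure)
    (hv' : v.noArr a) (g : Finset ℕ → ℕ → ℕ)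
    (hvM : ∀ s ⊆ range m, ∀ c < D,
      v.eval (((σ.setVar 0 0).setVar 1 (code s)).setVar 2 c) = g s c ∧ g s c ≤ M ∧
      v.time (((σ.setVar 0 0).setVar 1 (code s)).setVar 2 c) ≤ tv)
    (hQ : ∀ t ≤ 320 * (2 ^ m * D * (tv + 1)), ∀ f, (∀ i, i ≠ I' → f i = σ.arr a i) →
      (∀ s ⊆ range m, ∀ c < D, f I' (code s) c = g s c) → Q t (σ.setArr a f)) :
    Sp M base (RAM.fillTable a I v) σ Q := by
  refine Sp.fill (I' := I') (n₁ := 1) (n₂ := 2 ^ m) (n₃ := D) (tv := tv) (by omega)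
    hI .one (Expr.Steady.get (by omega) (by omega) (by omega))
    (Expr.Steady.var (by omega)) hI' rfl ?_ h.var_D ?_ h.pow_m_le
    h.D_le hv hv' ?_ ?_
  · simp [masksE, h.var_m, h.bits.pow m h.m_le]
  · have := h.K_lt; omega
  · intro i hi X hX c hc
    obtain rfl : i = 0 := by omega
    obtain ⟨s, hs, rfl⟩ := exists_code hX
    obtain ⟨h1, h2, h3⟩ := hvM s hs c hc
    exact ⟨h1.trans_le h2, h3⟩
  · intro t ht
    refine hQ t (ht.trans ?_) _ (fun i hi => ?_) fun s hs c hc => ?_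
    · have e1 : 2 ^ m + 1 ≤ 2 * 2 ^ m := by have := Nat.one_le_two_pow (n := m); omega
      have e3 : D + 1 ≤ 2 * D := by have := h.D_pos; omega
      calc 40 * ((1 + 1) * (2 ^ m + 1) * (D + 1) * (tv + 1))
          ≤ 40 * (2 * (2 * 2 ^ m) * (2 * D) * (tv + 1)) := by gcongr
        _ = 320 * (2 ^ m * D * (tv + 1)) := by ring
    · funext j k
      rw [boxUpdate, if_neg]
      omega
    · have := code_lt hs
      rw [boxUpdate, if_pos ⟨le_rfl, by omega, by omega, hc⟩, Nat.sub_self]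
      exact (hvM s hs c hc).1

/-- The double sum counts the ordered pairs of members that are neither equal nor adjacent. Equal
pairs do not count because the matrix in array 4 has ones on its diagonal. -/
theorem Env.eval_cliqueE (h : Env γ G l K D M σ) {x : Fin N} {s : Finset ℕ}
    (hx : σ.var vx = x) (hm : σ.var vm = (l x).length) (hs : s ⊆ range (l x).length)
    (h1 : σ.var 1 = code s) [Decidable (G.IsClique {u | u ∈ l x ∧ (l x).idxOf u ∈ s})] :
    cliqueE.eval σ = if G.IsClique {u | u ∈ l x ∧ (l x).idxOf u ∈ s} then 1 else 0 := by
  have hc := h.context hm (h.length_le x)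
  have key : (∑ a ∈ range (l x).length, ∑ b ∈ range (l x).length,
      (if a ∈ s then 1 else 0) * (if b ∈ s then 1 else 0) *
        (1 - σ.arr 4 (σ.arr 2 x a 0) (σ.arr 2 x b 0) 0)) = 0 ↔
      G.IsClique {u | u ∈ l x ∧ (l x).idxOf u ∈ s} := by
    simp only [sum_eq_zero_iff, mem_range]
    constructor
    · rintro H u ⟨hu, hus⟩ v ⟨hv, hvs⟩ huv
      have hul := List.idxOf_lt_length_of_mem hu
      have hvl := List.idxOf_lt_length_of_mem hv
      have := H _ hul _ hvl
      rw [if_pos hus, if_pos hvs, h.bag x _ hul, h.bag x _ hvl, List.getElem_idxOf,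
        List.getElem_idxOf] at this
      by_contra hadj
      rw [h.adj_zero u v (by tauto)] at this
      omega
    · intro H a ha b hb
      by_cases has : a ∈ s
      · by_cases hbs : b ∈ s
        · rw [h.bag x a ha, h.bag x b hb, h.adj_pos]
          · simp
          · by_cases hab : (l x)[a] = (l x)[b]
            · exact Or.inl hab
            · refine Or.inr (H ⟨List.getElem_mem ha, ?_⟩ ⟨List.getElem_mem hb, ?_⟩ hab)
              · rwa [(h.nodup x).idxOf_getElem a ha]
              · rwa [(h.nodup x).idxOf_getElem b hb]
        · simp [hbs]
      · simp [has]
  have e : cliqueE.eval σ = if (∑ a ∈ range (l x).length, ∑ b ∈ range (l x).length,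
      (if a ∈ s then 1 else 0) * (if b ∈ s then 1 else 0) *
        (1 - σ.arr 4 (σ.arr 2 x a 0) (σ.arr 2 x b 0) 0)) = 0 then 1 else 0 := by
    rw [cliqueE, Expr.eval_eqv]
    congr 2
    simp only [Expr.eval_sum, Expr.eval_var, hm, Store.setVar_var]
    refine sum_congr rfl fun a ha => sum_congr (by simp) fun b hb => ?_
    rw [mem_range] at ha hb
    simp [Store.setVar_var, hx, h1, hc.bit hs ha, hc.bit hs hb]
  rw [e]
  simp only [key]

theorem time_cliqueE (σ : Store) : cliqueE.time σ ≤ 70 * (σ.var vm + 1) ^ 2 := by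
  rw [cliqueE, Expr.time_eqv]
  simp [Store.setVar_var]
  nlinarith

theorem Env.eval_vertexE (h : Env γ G l K D M σ) {pack : Bool} {e : ℕ} {x : Fin N} {s : Finset ℕ}
    {p c : ℕ} (hx : σ.var vx = x) (hm : σ.var vm = (l x).length) (hs : s ⊆ range (l x).length)
    (h1 : σ.var 1 = code s) (hp : σ.var vp = p) (hpl : p < (l x).length) (h2 : σ.var 2 = c) :
    (vertexE pack e).eval σ = vertexTable γ G pack e (l x)[p] (l x) s c := by
  classical
  have hc := h.context hm (h.length_le x)
  have hs' : s.card ≤ K := (card_le_card hs).trans ((card_range _).trans_le (h.length_le x))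
  have hpop : (popE (.var 1)).eval σ = s.card := hc.pop hs h1 rfl
  rw [vertexTable, (h.nodup x).idxOf_getElem p hpl]
  simp only [vertexE, Expr.eval_add, Expr.eval_mul, Expr.eval_eqv, hpop, Expr.eval_get, Expr.eval_var,
    h1, hp, hc.bit hs hpl, h.eval_cliqueE hx hm hs h1, h2, Expr.eval_zero, Expr.eval_one,
    Expr.eval_lit, h.gam _ hs', answer, card_eq_zero]
  cases pack <;> by_cases hps : p ∈ s <;> simp [hps] <;> split_ifs <;> simp_all

theorem time_vertexE (pack : Bool) (e : ℕ) (σ : Store) :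
    (vertexE pack e).time σ ≤ 200 * (σ.var vm + 1) ^ 2 := by
  have := time_cliqueE σ
  simp only [vertexE, Expr.time_add, Expr.time_mul, Expr.time_eqv, Expr.time_get, Expr.time_var,
    Expr.time_zero, Expr.time_one, Expr.time_lit]
  have e1 : (σ.var vm + 1) ^ 2 = σ.var vm * σ.var vm + 2 * σ.var vm + 1 := by ring
  rw [time_popE rfl]
  simp only [Expr.time_var]
  nlinarith

/-- A bound, up to a constant factor, on the number of steps of a single elimination. -/
def stepTime (K D : ℕ) : ℕ := 2 ^ K * (K + 1) ^ 2 * D ^ 2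

theorem le_stepTime {m c : ℕ} (hm : m ≤ K) (hD : 1 ≤ D) :
    2 ^ m * D * (c * (m + 1) ^ 2) ≤ c * stepTime K D := by
  calc 2 ^ m * D * (c * (m + 1) ^ 2) ≤ 2 ^ K * D * (c * (K + 1) ^ 2) := by
        gcongr
        norm_num
    _ = c * (2 ^ K * (K + 1) ^ 2 * D ^ 1) := by ring
    _ ≤ c * stepTime K D := by
        rw [stepTime]
        gcongr
        norm_num

theorem one_le_stepTime (hD : 1 ≤ D) : 1 ≤ stepTime K D :=
  Nat.mul_pos (Nat.mul_pos (Nat.two_pow_pos K) (by positivity)) (by positivity)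

theorem convTime_le {m : ℕ} (hm : m ≤ K) : convTime m D ≤ 110000 * stepTime K D := by
  rw [convTime, stepTime]
  gcongr
  norm_num

/-- The table of the bag `z`, extended by zero. -/
def clippedTable (σ : Store) (z m D : ℕ) (s : Finset ℕ) (c : ℕ) : ℕ :=
  if s ⊆ range m ∧ c < D then tableOf σ z s c else 0

theorem tableFun_clippedTable (clamp : Bool) {V : Type*} [DecidableEq V] (l : List V) (z : ℕ) :
    tableFun clamp D l (clippedTable σ z l.length D) = tableFun clamp D l (tableOf σ z) :=
  tableFun_congr fun s hs c hc => by
    rw [clippedTable, if_pos ⟨hs, hc⟩]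
    exact (valueCon clamp).refl _

variable {Q : ℕ → Store → Prop} {pack clamp : Bool} {e : ℕ}

theorem normal_le_bound {v b : ℕ} (h : v ≤ b) : normal clamp v ≤ if clamp then 1 else b := by
  cases clamp
  · exact h
  · simp [normal]

theorem forget_time {m t₁ t₂ t₃ : ℕ} (hm : m ≤ K) (hD : 1 ≤ D)
    (h₁ : t₁ ≤ 320 * (2 ^ m * D * (200 * (m + 1) ^ 2 + 1))) (h₂ : t₂ ≤ convTime m D)
    (h₃ : t₃ ≤ 320 * (2 ^ m * D * (200 * (m + 1) ^ 2 + 1))) :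
    5 + (2 + (t₁ + (t₂ + t₃))) ≤ 330000 * stepTime K D := by
  have b1 := le_stepTime (c := 201) hm hD
  have b3 := convTime_le (D := D) hm
  have b4 := one_le_stepTime (K := K) hD
  have b5 : 2 ^ m * D * (200 * (m + 1) ^ 2 + 1) ≤ 2 ^ m * D * (201 * (m + 1) ^ 2) :=
    Nat.mul_le_mul_left _ (by nlinarith)
  omega

/-- The table is multiplied by that of the vertex, and the product is read at masks extended by `p`.
The bag keeps the position of the eliminated vertex, so entries at masks that contain `p` have to be
cleared. -/
theorem Env.forget_run (h : Env γ G l K D M σ) {x : Fin N} {p μ : ℕ} (hx : σ.var vx = x)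
    (hp : σ.var vp = p) (hpl : p < (l x).length)
    (hμ : ∀ s ⊆ range (l x).length, ∀ c < D, tableOf σ x s c ≤ μ)
    (hM1 : 2 ^ (l x).length * μ ≤ M) (hM2 : 2 ^ (l x).length * 2 ≤ M)
    (hM3 : convBound (l x).length D μ 2 ≤ M) (hxM : N ≤ M)
    (hQ : ∀ t ≤ 330000 * stepTime K D, ∀ τ,
      (∀ z, z ≠ (x : ℕ) → τ.arr 9 z = σ.arr 9 z) →
      (∀ s ⊆ range (l x).length, ∀ c < D, tableOf τ x s c = (if p ∈ s then 0 else
        normal clamp (convCoeff (clippedTable σ x (l x).length D)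
          (vertexTable γ G pack e (l x)[p] (l x)) (insert p s) c)) ∧
        tableOf τ x s c ≤ if clamp then 1 else convBound (l x).length D μ 2) → Q t τ) :
    Sp M base (forgetStmt pack clamp e) σ Q := by
  set m := (l x).length with hm
  have hmK : m ≤ K := h.length_le x
  have h1D := h.D_pos
  refine Sp.seq (Sp.set ⟨by norm_num, trivial, trivial, trivial⟩ ?_ ?_)
  · rw [Expr.eval_get, Expr.eval_var, hx]
    exact (h.size x).trans_le (hmK.trans (by have := h.K_lt; omega))
  rw [Expr.eval_get, Expr.eval_var, hx, Expr.eval_zero, h.size x, ← hm]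
  refine Sp.seq (Sp.set trivial ?_ ?_)
  · simp only [Expr.eval_var, Store.setVar_var, hx]
    have := x.2
    norm_num
    omega
  set σ₁ := (σ.setVar vm m).setVar vz ((Expr.var vx).eval (σ.setVar vm m)) with hσ₁
  have hz₁ : σ₁.var vz = x := by simp [hσ₁, Store.setVar_var, hx]
  have hx₁ : σ₁.var vx = x := by simp [hσ₁, Store.setVar_var, hx]
  have hp₁ : σ₁.var vp = p := by simp [hσ₁, Store.setVar_var, hp]
  have hm₁ : σ₁.var vm = m := by simp [hσ₁, Store.setVar_var]
  have E₁ : Env γ G l K D M σ₁ := h.congr (fun _ _ _ _ => rfl) (by simp [hσ₁, Store.setVar_var])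
  have C₁ := E₁.context hm₁ hmK
  refine Sp.seq (C₁.fillTable (tv := 200 * (m + 1) ^ 2) (by norm_num) .zero rfl (by rfl) (by rfl)
    (vertexTable γ G pack e (l x)[p] (l x)) ?_ fun t₁ ht₁ f₁ _ hf₁ => ?_)
  · intro s hs c hc
    set τ := ((σ₁.setVar 0 0).setVar 1 (code s)).setVar 2 c with hτ
    have E' : Env γ G l K D M τ :=
      E₁.congr (fun _ _ _ _ => rfl) (by simp [hτ, Store.setVar_var])
    refine ⟨E'.eval_vertexE (by simp [hτ, Store.setVar_var, hx₁])
      (by simp [hτ, Store.setVar_var, hm₁, hm]) hs (by simp [hτ, Store.setVar_var])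
      (by simp [hτ, Store.setVar_var, hp₁]) hpl (by simp [hτ, Store.setVar_var]), ?_, ?_⟩
    · refine (vertexTable_le ..).trans (le_trans ?_ hM2)
      exact Nat.le_mul_of_pos_left _ (Nat.two_pow_pos m)
    · refine (time_vertexE pack e τ).trans ?_
      rw [show τ.var vm = m by simp [hτ, Store.setVar_var, hm₁]]
  set σ₂ := σ₁.setArr 14 f₁ with hσ₂
  have C₂ : ConvContext M K m D σ₂ := C₁.congr (by simp [hσ₂, Store.setArr_arr])
    (by simp [hσ₂, Store.setArr_arr]) rfl rfl
  refine Sp.seq (C₂.conv (z := x) (μ₁ := μ) (μ₂ := 2) (f := clippedTable σ x m D)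
    (g := vertexTable γ G pack e (l x)[p] (l x)) hz₁ ?_ ?_ ?_ (fun _ _ => vertexTable_le ..)
    hM1 hM2 hM3 fun t₂ ht₂ σ₃ hv₃ _ ha₃ hc₃ => ?_)
  · intro s hs c hc
    rw [clippedTable, if_pos ⟨hs, hc⟩]
    simp [hσ₂, Store.setArr_arr, hσ₁, tableOf]
  · intro s hs c hc
    simpa [hσ₂, Store.setArr_arr] using hf₁ s hs c hc
  · intro s c
    rw [clippedTable]
    split_ifs with hsc
    exacts [hμ s hsc.1 c hsc.2, Nat.zero_le _]
  have C₃ : ConvContext M K m D σ₃ := C₂.congr (ha₃ 7 (by norm_num)) (ha₃ 8 (by norm_num))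
    (by rw [hv₃]) (by rw [hv₃])
  have hz₃ : σ₃.var vz = x := by rw [hv₃]; exact hz₁
  have hp₃ : σ₃.var vp = p := by rw [hv₃]; exact hp₁
  refine C₃.fillTable (tv := 200 * (m + 1) ^ 2) (by norm_num) (Expr.Steady.var (by norm_num)) hz₃
    (by simp [popE]) (by simp [popE])
    (fun s c => if p ∈ s then 0 else normal clamp (convCoeff (clippedTable σ x m D)
      (vertexTable γ G pack e (l x)[p] (l x)) (insert p s) c)) ?_ ?_
  · intro s hs c hc
    set τ := ((σ₃.setVar 0 0).setVar 1 (code s)).setVar 2 c with hτ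
    have C' : ConvContext M K m D τ := C₃.congr rfl rfl (by simp [hτ, Store.setVar_var])
      (by simp [hτ, Store.setVar_var])
    have v1 : τ.var 1 = code s := by simp [hτ, Store.setVar_var]
    have v2 : τ.var 2 = c := by simp [hτ, Store.setVar_var]
    have vp' : τ.var vp = p := by simp [hτ, Store.setVar_var, hp₃]
    have e1 : (popE (.var 1)).eval τ = s.card := C'.pop hs v1 rfl
    refine ⟨?_, ?_, ?_⟩
    · rw [eval_normalE]
      simp only [Expr.eval_mul, Expr.eval_sub, Expr.eval_one, Expr.eval_get, Expr.eval_var,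
        Expr.eval_add, e1, v1, v2, vp', C'.bit hs hpl, C'.bits.pow p (hpl.le.trans hmK),
        Expr.eval_zero]
      split_ifs with hps
      · rw [Nat.sub_self, zero_mul]; cases clamp <;> rfl
      -- Adding `2 ^ p` to a mask without `p` inserts `p`, and the rank to be read goes up by one.
      · rw [← code_insert hps, ← card_insert_of_notMem hps, show τ.arr 13 = σ₃.arr 13 from rfl,
          (hc₃ _ (insert_subset (mem_range.2 hpl) hs) c hc).1, Nat.sub_zero, one_mul]
    · split_ifs with hps
      · exact Nat.zero_le _
      · exact (normal_le _ _).trans ((hc₃ _ (insert_subset (mem_range.2 hpl) hs) c hc).2.trans hM3)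
    · refine (time_normalE _ _ _).trans ?_
      simp only [Expr.time_mul, Expr.time_sub, Expr.time_one, Expr.time_get, Expr.time_var,
        Expr.time_add, Expr.time_zero]
      rw [time_popE rfl, C'.var_m]
      simp only [Expr.time_var]
      nlinarith
  · intro t₃ ht₃ f₃ hf₃ hf₃'
    refine hQ _ ?_ _ ?_ ?_
    · exact forget_time hmK h1D (by simpa using ht₁) ht₂ ht₃
    · intro z hz
      rw [Store.setArr_arr, if_pos rfl, hf₃ z hz, ha₃ 9 (by norm_num)]
      simp [hσ₂, Store.setArr_arr, hσ₁]
    · intro s hs c hc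
      have : tableOf (σ₃.setArr 9 f₃) x s c = _ := (by
        rw [tableOf, Store.setArr_arr, if_pos rfl, hf₃' s hs c hc])
      rw [this]
      refine ⟨rfl, ?_⟩
      split_ifs with hps hcl hcl
      · exact Nat.zero_le _
      · exact Nat.zero_le _
      · have := normal_le_bound (clamp := clamp)
          (hc₃ _ (insert_subset (mem_range.2 hpl) hs) c hc).2
        rwa [if_pos hcl] at this
      · have := normal_le_bound (clamp := clamp)
          (hc₃ _ (insert_subset (mem_range.2 hpl) hs) c hc).2
        rwa [if_neg hcl] at this

theorem Env.forget (h : Env γ G l K D M σ) {x : Fin N} {p μ : ℕ} (hx : σ.var vx = x)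
    (hp : σ.var vp = p) (hpl : p < (l x).length)
    (hμ : ∀ s ⊆ range (l x).length, ∀ c < D, tableOf σ x s c ≤ μ)
    (hM1 : 2 ^ (l x).length * μ ≤ M) (hM2 : 2 ^ (l x).length * 2 ≤ M)
    (hM3 : convBound (l x).length D μ 2 ≤ M) (hxM : N ≤ M)
    (hQ : ∀ t ≤ 330000 * stepTime K D, ∀ τ, Frame (forgetStmt pack clamp e) σ τ →
      (∀ z, z ≠ (x : ℕ) → τ.arr 9 z = σ.arr 9 z) →
      (∀ s ⊆ range (l x).length, ∀ c < D,
        tableOf τ x s c ≤ if clamp then 1 else convBound (l x).length D μ 2) →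
      (∀ T ⊆ (l x).toFinset, (l x)[p] ∉ T → tableFun clamp D (l x) (tableOf τ x) T =
        (tableFun clamp D (l x) (tableOf σ x) *
          vertexSum γ G pack (truncation clamp D (PowerSeries.X ^ e)) (l x)[p])
          (insert (l x)[p] T)) → Q t τ) :
    Sp M base (forgetStmt pack clamp e) σ Q := by
  refine Sp.imp_frame (h.forget_run (Q := fun t τ => t ≤ 330000 * stepTime K D ∧
    (∀ z, z ≠ (x : ℕ) → τ.arr 9 z = σ.arr 9 z) ∧ ∀ s ⊆ range (l x).length, ∀ c < D,
      tableOf τ x s c = (if p ∈ s then 0 else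
        normal clamp (convCoeff (clippedTable σ x (l x).length D)
          (vertexTable γ G pack e (l x)[p] (l x)) (insert p s) c)) ∧
        tableOf τ x s c ≤ if clamp then 1 else convBound (l x).length D μ 2)
    hx hp hpl hμ hM1 hM2 hM3 hxM fun t ht τ hz htab => ⟨ht, hz, htab⟩) ?_
  rintro t τ hfr ⟨ht, hz, htab⟩
  refine hQ t ht τ hfr hz (fun s hs c hc => (htab s hs c hc).2) fun T hT hv => ?_
  have hvl : (l x)[p] ∈ (l x).toFinset := by simp
  have hidx : (l x).idxOf (l x)[p] = p := (h.nodup x).idxOf_getElem p hpl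
  have hT' : insert (l x)[p] T ⊆ (l x).toFinset := insert_subset hvl hT
  have hpT : p ∉ positions (l x) T := by
    rw [← hidx, idxOf_mem_positions hT hvl]; exact hv
  rw [← tableFun_clippedTable (σ := σ) clamp (l x) x]
  have e1 : (tableFun clamp D (l x) (clippedTable σ x (l x).length D) *
      vertexSum γ G pack (truncation clamp D (PowerSeries.X ^ e)) (l x)[p]) (insert (l x)[p] T) =
      (tableFun clamp D (l x) (clippedTable σ x (l x).length D) *
        tableFun clamp D (l x) (vertexTable γ G pack e (l x)[p] (l x))) (insert (l x)[p] T) :=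
    SetFun.mul_congr (fun _ _ => rfl) fun W hW => (tableFun_vertexTable hvl (hW.trans hT')).symm
  rw [e1, ← tableFun_conv hT', tableFun, if_pos hT, truncation_eq_iff]
  intro c hc
  rw [PowerSeries.coeff_mk, PowerSeries.coeff_mk, (htab _ (positions_subset hT) c hc).1, if_neg hpT,
    positions_insert, hidx]
  exact valueCon_normal _ _

/-- The members of a bag are distinct, so at most one summand is nonzero. The shift by one
distinguishes position 0 from absence. -/
theorem Env.eval_positionE (h : Env γ G l K D M σ) {x y : Fin N} {q : ℕ} {e : Expr}
    (hx : σ.var vx = x) (hy : σ.var vy = y) (he : e.eval σ = q) (he4 : e.noVar 4)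
    (hq : q < (l y).length) :
    (positionE e).eval σ = if (l y)[q] ∈ l x then (l x).idxOf (l y)[q] + 1 else 0 := by
  simp only [positionE, Expr.eval_sum, Expr.eval_get, Expr.eval_var, hx, Expr.eval_zero, h.size x,
    Expr.eval_mul, Expr.eval_eqv, Expr.eval_add, Expr.eval_one, Store.setVar_var, Store.setVar_arr,
    Expr.eval_setVar _ he4, he, if_true, show (11 : ℕ) ≠ 4 by norm_num, show (12 : ℕ) ≠ 4 by norm_num,
    if_false, hy, h.bag y q hq]
  have key : ∀ r ∈ range (l x).length, ((if σ.arr 2 x r 0 = ((l y)[q] : ℕ) then 1 else 0) * (r + 1)) =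
      if r = (l x).idxOf (l y)[q] then r + 1 else 0 := by
    intro r hr
    rw [mem_range] at hr
    rw [h.bag x r hr]
    by_cases hrq : (l x)[r] = (l y)[q]
    · rw [if_pos (by rw [hrq]), one_mul, if_pos (by rw [← hrq, (h.nodup x).idxOf_getElem r hr])]
    · rw [if_neg fun h' => hrq (Fin.ext h'), zero_mul, if_neg]
      rintro rfl
      exact hrq (List.getElem_idxOf hr)
  rw [sum_congr rfl key, sum_ite_eq']
  simp only [mem_range, List.idxOf_lt_length_iff]

theorem Env.time_positionE (h : Env γ G l K D M σ) {x : Fin N} {e : Expr} (hx : σ.var vx = x)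
    (he : e.time σ ≤ 1) (he4 : e.noVar 4) : (positionE e).time σ ≤ 30 * (K + 1) := by
  simp only [positionE, Expr.time_sum, Expr.eval_get, Expr.time_get, Expr.time_var, hx,
    Expr.eval_zero, h.size x, Expr.time_mul, Expr.time_eqv, Expr.time_add, Expr.time_one,
    Expr.time_zero, Expr.eval_setVar _ he4, Expr.eval_var, sum_const, card_range, smul_eq_mul]
  have := h.length_le x
  nlinarith

/-- The table of the bag `x`, indexed by the positions in `ly`. -/
def translatedTable {V : Type*} [DecidableEq V] (lx ly : List V) (f : Finset ℕ → ℕ → ℕ)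
    (s : Finset ℕ) (c : ℕ) : ℕ :=
  if members ly s ⊆ lx.toFinset then f (positions lx (members ly s)) c else 0

theorem tableFun_translatedTable (clamp : Bool) {V : Type*} [DecidableEq V] (lx ly : List V)
    (f : Finset ℕ → ℕ → ℕ) {T : Finset V} (hT : T ⊆ ly.toFinset) :
    tableFun clamp D ly (translatedTable lx ly f) T = tableFun clamp D lx f T := by
  have : translatedTable lx ly f (positions ly T) =
      fun c => if T ⊆ lx.toFinset then f (positions lx T) c else 0 := by
    funext c; rw [translatedTable, members_positions hT]
  rw [tableFun, if_pos hT, this, tableFun]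
  split_ifs with h
  · rfl
  · rw [show (PowerSeries.mk fun _ => 0) = (0 : PowerSeries ℕ) from rfl, map_zero]

theorem sum_positions {V : Type*} [DecidableEq V] {ly : List V} {T : Finset V}
    (hT : T ⊆ ly.toFinset) {m : ℕ} (hm : ly.length ≤ m) (f : ℕ → ℕ) :
    ∑ q ∈ range m, (if q ∈ positions ly T then 1 else 0) * f q = ∑ v ∈ T, f (ly.idxOf v) := by
  simp only [ite_mul, one_mul, zero_mul]
  rw [← sum_filter, filter_mem_eq_inter, inter_eq_right.2
    ((positions_subset hT).trans (range_subset_range.2 hm)), positions, sum_image]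
  exact fun u hu v hv h => positions_injOn ly (hT hu) (hT hv) h

theorem join_time {m t₁ t₂ t₃ : ℕ} (hm : m ≤ K) (hD : 1 ≤ D)
    (h₁ : t₁ ≤ 320 * (2 ^ m * D * (200 * (K + 1) ^ 2 + 1))) (h₂ : t₂ ≤ convTime m D)
    (h₃ : t₃ ≤ 320 * (2 ^ m * D * (200 * (K + 1) ^ 2 + 1))) :
    5 + (2 + (t₁ + (t₂ + t₃))) ≤ 330000 * stepTime K D := by
  have b1 := le_stepTime (c := 201) (le_refl K) hD
  have b3 := convTime_le (D := D) hm
  have b4 := one_le_stepTime (K := K) hD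
  have b5 : 2 ^ m * D * (200 * (K + 1) ^ 2 + 1) ≤ 2 ^ K * D * (201 * (K + 1) ^ 2) := by
    have : 2 ^ m ≤ 2 ^ K := Nat.pow_le_pow_right (by norm_num) hm
    have : 200 * (K + 1) ^ 2 + 1 ≤ 201 * (K + 1) ^ 2 := by nlinarith
    gcongr
  omega

/-- The first sum counts the members of the set that are missing from the bag of `x`; if there are
any, the table of `x` vanishes at the set. Otherwise the second sum assembles the mask of the same
set with respect to the bag of `x`. -/
theorem Env.eval_joinE (h : Env γ G l K D M σ) {x y : Fin N} {s : Finset ℕ} {c : ℕ}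
    (hx : σ.var vx = x) (hy : σ.var vy = y) (hm : σ.var vm = (l y).length)
    (hs : s ⊆ range (l y).length) (h1 : σ.var 1 = code s) (h2 : σ.var 2 = c) (hc : c < D) :
    joinE.eval σ = translatedTable (l x) (l y) (clippedTable σ x (l x).length D) s c := by
  obtain ⟨T, hT, rfl⟩ := exists_positions (h.nodup y) hs
  have hcx := h.context hm (h.length_le y)
  have epos : ∀ q ∈ range (l y).length, (positionE (.var 3)).eval (σ.setVar 3 q) =
      if h : q < (l y).length then if (l y)[q] ∈ l x then (l x).idxOf (l y)[q] + 1 else 0 else 0 := by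
    intro q hq
    have hq' := mem_range.1 hq
    have h' : Env γ G l K D M (σ.setVar 3 q) := h.congr (fun _ _ _ _ => rfl) (by simp [Store.setVar_var])
    rw [dif_pos hq']
    exact h'.eval_positionE (by simp [Store.setVar_var, hx]) (by simp [Store.setVar_var, hy])
      (by simp [Store.setVar_var]) rfl hq'
  have e1 : (Expr.sum 3 (.var vm)
      (.get 7 (.var 1) (.var 3) 0 * .eqv (positionE (.var 3)) 0)).eval σ =
      ∑ v ∈ T, if v ∈ l x then 0 else 1 := by
    set F : ℕ → ℕ := fun q => if (if h : q < (l y).length then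
        if (l y)[q] ∈ l x then (l x).idxOf (l y)[q] + 1 else 0 else 0) = 0 then 1 else 0 with hF
    have : ∀ v ∈ T, (if v ∈ l x then 0 else 1) = F ((l y).idxOf v) := by
      intro v hv
      have hvl : v ∈ l y := by simpa using hT hv
      simp only [hF, List.idxOf_lt_length_of_mem hvl, dif_pos, List.getElem_idxOf]
      split_ifs <;> simp_all
    rw [sum_congr rfl this, ← sum_positions hT le_rfl F]
    simp only [Expr.eval_sum, Expr.eval_var, hm, Expr.eval_mul, Expr.eval_eqv, Expr.eval_zero,
      Expr.eval_get]
    refine sum_congr rfl fun q hq => ?_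
    rw [epos q hq, ← hcx.bit hs (mem_range.1 hq)]
    simp [Store.setVar_var, h1, hF]
  have e2 : T ⊆ (l x).toFinset → (Expr.sum 3 (.var vm) (.get 7 (.var 1) (.var 3) 0 *
      .get 8 (positionE (.var 3) - 1) 0 0)).eval σ = code (positions (l x) T) := by
    intro hTx
    set F : ℕ → ℕ := fun q => σ.arr 8 ((if h : q < (l y).length then
        if (l y)[q] ∈ l x then (l x).idxOf (l y)[q] + 1 else 0 else 0) - 1) 0 0 with hF
    have : ∀ v ∈ T, 2 ^ (l x).idxOf v = F ((l y).idxOf v) := by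
      intro v hv
      have hvl : v ∈ l y := by simpa using hT hv
      have hvx : v ∈ l x := by simpa using hTx hv
      simp only [hF, List.idxOf_lt_length_of_mem hvl, dif_pos, List.getElem_idxOf, hvx, if_true,
        Nat.add_sub_cancel]
      rw [h.bits.pow]
      exact (List.idxOf_lt_length_of_mem hvx).le.trans (h.length_le x)
    rw [code, positions, sum_image fun u hu v hv h' => positions_injOn (l x) (hTx hu) (hTx hv) h',
      sum_congr rfl this, ← sum_positions hT le_rfl F]
    simp only [Expr.eval_sum, Expr.eval_var, hm, Expr.eval_mul, Expr.eval_zero, Expr.eval_get,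
      Expr.eval_sub, Expr.eval_one]
    refine sum_congr rfl fun q hq => ?_
    rw [epos q hq, ← hcx.bit hs (mem_range.1 hq)]
    simp [Store.setVar_var, h1, hF]
  have e3 : (∑ v ∈ T, if v ∈ l x then 0 else 1) = 0 ↔ T ⊆ (l x).toFinset := by
    rw [sum_eq_zero_iff]
    simp [subset_iff]
  rw [joinE, Expr.eval_mul, Expr.eval_eqv, e1, Expr.eval_zero, Expr.eval_get, translatedTable,
    members_positions hT, Expr.eval_var, Expr.eval_var, hx, h2]
  simp only [e3]
  split_ifs with hTx
  · rw [one_mul, e2 hTx, clippedTable, if_pos ⟨positions_subset hTx, hc⟩, tableOf]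
  · rw [zero_mul]

theorem time_sum_le {x m B : ℕ} {y : ℕ} {f : Expr} (hm : σ.var y = m)
    (h : ∀ q, f.time (σ.setVar x q) + 1 ≤ B) : (Expr.sum x (.var y) f).time σ ≤ 2 + m * B := by
  rw [Expr.time_sum, Expr.time_var, Expr.eval_var, hm]
  have := sum_le_card_nsmul (range m) (fun q => f.time (σ.setVar x q) + 1) B fun q _ => h q
  rw [card_range, smul_eq_mul] at this
  omega

theorem Env.time_joinE (h : Env γ G l K D M σ) {x : Fin N} {m : ℕ} (hx : σ.var vx = x)
    (hm : σ.var vm = m) (hmK : m ≤ K) : joinE.time σ ≤ 200 * (K + 1) ^ 2 := by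
  have b : ∀ q, (positionE (.var 3)).time (σ.setVar 3 q) ≤ 30 * (K + 1) := fun q => by
    have h' : Env γ G l K D M (σ.setVar 3 q) :=
      h.congr (fun _ _ _ _ => rfl) (by simp [Store.setVar_var])
    exact h'.time_positionE (x := x) (e := .var 3) (by simp [Store.setVar_var, hx]) (by simp) (by simp)
  have b1 : (Expr.sum 3 (.var vm) (.get 7 (.var 1) (.var 3) 0 * .eqv (positionE (.var 3)) 0)).time σ
      ≤ 2 + m * (60 * (K + 1) + 20) := by
    refine time_sum_le hm fun q => ?_
    have := b q
    simp only [Expr.time_mul, Expr.time_eqv, Expr.time_var, Expr.time_get, Expr.time_zero]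
    omega
  have b2 : (Expr.sum 3 (.var vm) (.get 7 (.var 1) (.var 3) 0 * .get 8 (positionE (.var 3) - 1) 0 0)).time
      σ ≤ 2 + m * (60 * (K + 1) + 20) := by
    refine time_sum_le hm fun q => ?_
    have := b q
    simp only [Expr.time_mul, Expr.time_sub, Expr.time_var, Expr.time_get, Expr.time_zero,
      Expr.time_one]
    omega
  have b3 : m * (60 * (K + 1) + 20) ≤ K * (60 * (K + 1) + 20) := Nat.mul_le_mul_right _ hmK
  have b4 : 200 * (K + 1) ^ 2 = 3 * (K * (60 * (K + 1) + 20)) + 20 * (K * K) + 160 * K + 200 := by ring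
  simp only [joinE, Expr.time_mul, Expr.time_eqv, Expr.time_var, Expr.time_get, Expr.time_zero]
  omega

theorem Env.join_run (h : Env γ G l K D M σ) {x y : Fin N} {μ ν : ℕ} (hx : σ.var vx = x)
    (hy : σ.var vy = y)
    (hμ : ∀ s ⊆ range (l y).length, ∀ c < D, tableOf σ y s c ≤ μ)
    (hν : ∀ s ⊆ range (l x).length, ∀ c < D, tableOf σ x s c ≤ ν)
    (hM1 : 2 ^ (l y).length * μ ≤ M) (hM2 : 2 ^ (l y).length * ν ≤ M)
    (hM3 : convBound (l y).length D μ ν ≤ M) (hxM : N ≤ M)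
    (hQ : ∀ t ≤ 330000 * stepTime K D, ∀ τ,
      (∀ z, z ≠ (y : ℕ) → τ.arr 9 z = σ.arr 9 z) →
      (∀ s ⊆ range (l y).length, ∀ c < D, tableOf τ y s c =
        normal clamp (convCoeff (clippedTable σ y (l y).length D)
          (translatedTable (l x) (l y) (clippedTable σ x (l x).length D)) s c) ∧
        tableOf τ y s c ≤ if clamp then 1 else convBound (l y).length D μ ν) → Q t τ) :
    Sp M base (joinStmt clamp) σ Q := by
  set m := (l y).length with hm
  have hmK : m ≤ K := h.length_le y
  have h1D := h.D_pos
  have hgν : ∀ s c, translatedTable (l x) (l y) (clippedTable σ x (l x).length D) s c ≤ ν := by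
    intro s c
    rw [translatedTable, clippedTable]
    split_ifs with h1 h2
    exacts [hν _ h2.1 _ h2.2, Nat.zero_le _, Nat.zero_le _]
  refine Sp.seq (Sp.set ⟨by norm_num, trivial, trivial, trivial⟩ ?_ ?_)
  · rw [Expr.eval_get, Expr.eval_var, hy]
    exact (h.size y).trans_le (hmK.trans (by have := h.K_lt; omega))
  rw [Expr.eval_get, Expr.eval_var, hy, Expr.eval_zero, h.size y, ← hm]
  refine Sp.seq (Sp.set trivial ?_ ?_)
  · simp only [Expr.eval_var, Store.setVar_var, hy]
    have := y.2
    norm_num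
    omega
  set σ₁ := (σ.setVar vm m).setVar vz ((Expr.var vy).eval (σ.setVar vm m)) with hσ₁
  have hz₁ : σ₁.var vz = y := by simp [hσ₁, Store.setVar_var, hy]
  have hx₁ : σ₁.var vx = x := by simp [hσ₁, Store.setVar_var, hx]
  have hy₁ : σ₁.var vy = y := by simp [hσ₁, Store.setVar_var, hy]
  have hm₁ : σ₁.var vm = m := by simp [hσ₁, Store.setVar_var]
  have E₁ : Env γ G l K D M σ₁ := h.congr (fun _ _ _ _ => rfl) (by simp [hσ₁, Store.setVar_var])
  have C₁ := E₁.context hm₁ hmK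
  refine Sp.seq (C₁.fillTable (tv := 200 * (K + 1) ^ 2) (by norm_num) .zero rfl (by rfl) (by rfl)
    (translatedTable (l x) (l y) (clippedTable σ x (l x).length D)) ?_ fun t₁ ht₁ f₁ _ hf₁ => ?_)
  · intro s hs c hc
    set τ := ((σ₁.setVar 0 0).setVar 1 (code s)).setVar 2 c with hτ
    have E' : Env γ G l K D M τ :=
      E₁.congr (fun _ _ _ _ => rfl) (by simp [hτ, Store.setVar_var])
    have hxτ : τ.var vx = x := by simp [hτ, Store.setVar_var, hx₁]
    have hmτ : τ.var vm = m := by simp [hτ, Store.setVar_var, hm₁]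
    refine ⟨E'.eval_joinE hxτ (by simp [hτ, Store.setVar_var, hy₁])
      (by rw [hmτ, hm]) hs (by simp [hτ, Store.setVar_var])
      (by simp [hτ, Store.setVar_var]) hc, ?_, E'.time_joinE hxτ hmτ hmK⟩
    refine (hgν _ _).trans (le_trans ?_ hM2)
    exact Nat.le_mul_of_pos_left _ (Nat.two_pow_pos m)
  set σ₂ := σ₁.setArr 14 f₁ with hσ₂
  have C₂ : ConvContext M K m D σ₂ := C₁.congr (by simp [hσ₂, Store.setArr_arr])
    (by simp [hσ₂, Store.setArr_arr]) rfl rfl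
  refine Sp.seq (C₂.conv (z := y) (μ₁ := μ) (μ₂ := ν) (f := clippedTable σ y m D)
    (g := translatedTable (l x) (l y) (clippedTable σ x (l x).length D)) hz₁ ?_ ?_ ?_ hgν
    hM1 hM2 hM3 fun t₂ ht₂ σ₃ hv₃ _ ha₃ hc₃ => ?_)
  · intro s hs c hc
    rw [clippedTable, if_pos ⟨hs, hc⟩]
    simp [hσ₂, Store.setArr_arr, hσ₁, tableOf]
  · intro s hs c hc
    simpa [hσ₂, Store.setArr_arr] using hf₁ s hs c hc
  · intro s c
    rw [clippedTable]
    split_ifs with hsc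
    exacts [hμ s hsc.1 c hsc.2, Nat.zero_le _]
  have C₃ : ConvContext M K m D σ₃ := C₂.congr (ha₃ 7 (by norm_num)) (ha₃ 8 (by norm_num))
    (by rw [hv₃]) (by rw [hv₃])
  have hz₃ : σ₃.var vz = y := by rw [hv₃]; exact hz₁
  refine C₃.fillTable (tv := 200 * (K + 1) ^ 2) (by norm_num) (Expr.Steady.var (by norm_num)) hz₃
    (by simp [popE]) (by simp [popE])
    (fun s c => normal clamp (convCoeff (clippedTable σ y m D)
      (translatedTable (l x) (l y) (clippedTable σ x (l x).length D)) s c)) ?_ ?_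
  · intro s hs c hc
    set τ := ((σ₃.setVar 0 0).setVar 1 (code s)).setVar 2 c with hτ
    have C' : ConvContext M K m D τ := C₃.congr rfl rfl (by simp [hτ, Store.setVar_var])
      (by simp [hτ, Store.setVar_var])
    have v1 : τ.var 1 = code s := by simp [hτ, Store.setVar_var]
    have v2 : τ.var 2 = c := by simp [hτ, Store.setVar_var]
    have e1 : (popE (.var 1)).eval τ = s.card := C'.pop hs v1 rfl
    refine ⟨?_, (normal_le _ _).trans ((hc₃ _ hs c hc).2.trans hM3), ?_⟩
    · rw [eval_normalE, Expr.eval_get, e1, Expr.eval_var, v1, Expr.eval_var, v2,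
        show τ.arr 13 = σ₃.arr 13 from rfl, (hc₃ _ hs c hc).1]
    · refine (time_normalE _ _ _).trans ?_
      rw [Expr.time_get, time_popE rfl, C'.var_m]
      simp only [Expr.time_var]
      nlinarith
  · intro t₃ ht₃ f₃ hf₃ hf₃'
    refine hQ _ ?_ _ ?_ ?_
    · exact join_time hmK h1D (by simpa using ht₁) ht₂ ht₃
    · intro z hz
      rw [Store.setArr_arr, if_pos rfl, hf₃ z hz, ha₃ 9 (by norm_num)]
      simp [hσ₂, Store.setArr_arr, hσ₁]
    · intro s hs c hc
      have : tableOf (σ₃.setArr 9 f₃) y s c = _ := (by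
        rw [tableOf, Store.setArr_arr, if_pos rfl, hf₃' s hs c hc])
      rw [this]
      exact ⟨rfl, normal_le_bound (hc₃ _ hs c hc).2⟩

theorem Env.join (h : Env γ G l K D M σ) {x y : Fin N} {μ ν : ℕ} (hx : σ.var vx = x)
    (hy : σ.var vy = y)
    (hμ : ∀ s ⊆ range (l y).length, ∀ c < D, tableOf σ y s c ≤ μ)
    (hν : ∀ s ⊆ range (l x).length, ∀ c < D, tableOf σ x s c ≤ ν)
    (hM1 : 2 ^ (l y).length * μ ≤ M) (hM2 : 2 ^ (l y).length * ν ≤ M)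
    (hM3 : convBound (l y).length D μ ν ≤ M) (hxM : N ≤ M)
    (hQ : ∀ t ≤ 330000 * stepTime K D, ∀ τ, Frame (joinStmt clamp) σ τ →
      (∀ z, z ≠ (y : ℕ) → τ.arr 9 z = σ.arr 9 z) →
      (∀ s ⊆ range (l y).length, ∀ c < D,
        tableOf τ y s c ≤ if clamp then 1 else convBound (l y).length D μ ν) →
      (∀ T ⊆ (l y).toFinset, tableFun clamp D (l y) (tableOf τ y) T =
        (tableFun clamp D (l x) (tableOf σ x) * tableFun clamp D (l y) (tableOf σ y)) T) → Q t τ) :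
    Sp M base (joinStmt clamp) σ Q := by
  refine Sp.imp_frame (h.join_run (Q := fun t τ => t ≤ 330000 * stepTime K D ∧
    (∀ z, z ≠ (y : ℕ) → τ.arr 9 z = σ.arr 9 z) ∧
      (∀ s ⊆ range (l y).length, ∀ c < D, tableOf τ y s c =
        normal clamp (convCoeff (clippedTable σ y (l y).length D)
          (translatedTable (l x) (l y) (clippedTable σ x (l x).length D)) s c) ∧
        tableOf τ y s c ≤ if clamp then 1 else convBound (l y).length D μ ν))
    hx hy hμ hν hM1 hM2 hM3 hxM fun t ht τ hz htab => ⟨ht, hz, htab⟩) ?_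
  rintro t τ hfr ⟨ht, hz, htab⟩
  refine hQ t ht τ hfr hz (fun s hs c hc => (htab s hs c hc).2) fun T hT => ?_
  rw [← tableFun_clippedTable (σ := σ) clamp (l x) x, ← tableFun_clippedTable (σ := σ) clamp (l y) y]
  have e1 : (tableFun clamp D (l x) (clippedTable σ x (l x).length D) *
      tableFun clamp D (l y) (clippedTable σ y (l y).length D)) T =
      (tableFun clamp D (l y) (clippedTable σ y (l y).length D) * tableFun clamp D (l y)
        (translatedTable (l x) (l y) (clippedTable σ x (l x).length D))) T := by
    rw [mul_comm]
    exact SetFun.mul_congr (fun _ _ => rfl) fun W hW =>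
      (tableFun_translatedTable clamp (l x) (l y) _ (hW.trans hT)).symm
  rw [e1, ← tableFun_conv hT, tableFun, if_pos hT, truncation_eq_iff]
  intro c hc
  rw [PowerSeries.coeff_mk, PowerSeries.coeff_mk, (htab _ (positions_subset hT) c hc).1]
  exact valueCon_normal _ _

end

end RAM

namespace RAM

open Finset

/-! ### Elimination of the vertices of a bag -/

/-- Whether the vertex at position `vp` of the bag `vx` is among the first `vk` members of the
bag `vy`. -/
def keepE : Expr :=
  .sum 3 (.var vk) (.eqv (.get 2 (.var vy) (.var 3) 0) (.get 2 (.var vx) (.var vp) 0))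

/-- Elimination of all vertices of the bag `vx` except the first `vk` members of the bag `vy`. -/
def forgetAllStmt (pack clamp : Bool) (e : ℕ) : Stmt :=
  .forTo vp (.get 3 (.var vx) 0 0) (.ite keepE (.set vu 0) (forgetStmt pack clamp e))

/-- A number whose powers bound the entries of the tables. -/
def growth (K D : ℕ) : ℕ := 2 * 4 ^ K * (K + 1) * D

/-- The spare factor 2 is meant for eliminations, where the second table is bounded by `ν = 2`: they
multiply a bound by at most `growth K D`. A join multiplies the bounds of both tables with each
other and with at most `growth K D`. -/
theorem convBound_le {m K D μ ν : ℕ} (hm : m ≤ K) :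
    2 * convBound m D μ ν ≤ growth K D * μ * ν := by
  have h1 : 2 ^ m * 2 ^ m ≤ 4 ^ K := by
    rw [← mul_pow]
    exact Nat.pow_le_pow_right (by norm_num) hm
  calc 2 * convBound m D μ ν = 2 * (2 ^ m * 2 ^ m) * (m + 1) * D * μ * ν := by
        rw [convBound]; ring
    _ ≤ 2 * 4 ^ K * (K + 1) * D * μ * ν := by gcongr
    _ = growth K D * μ * ν := by rw [growth]

theorem le_convBound {m D μ ν : ℕ} (hD : 1 ≤ D) (hν : 1 ≤ ν) : 2 ^ m * μ ≤ convBound m D μ ν := by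
  have h1 : 1 ≤ (m + 1) * D * (2 ^ m * ν) :=
    Nat.mul_pos (Nat.mul_pos (by omega) hD) (Nat.mul_pos (Nat.two_pow_pos m) hν)
  calc 2 ^ m * μ = 1 * (2 ^ m * μ) := (one_mul _).symm
    _ ≤ (m + 1) * D * (2 ^ m * ν) * (2 ^ m * μ) := Nat.mul_le_mul_right _ h1
    _ = convBound m D μ ν := by rw [convBound]; ring

theorem one_le_growth {K D : ℕ} (hD : 1 ≤ D) : 1 ≤ growth K D :=
  Nat.mul_pos (Nat.mul_pos (by positivity) (by omega)) hD

/-- The exponents in the bounds for the tables. -/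
def Budget {n N : ℕ} (clamp : Bool) (lim : ℕ) (h : Fin N → ℕ) (R : Finset (Fin N))
    (U : Finset (Fin n)) : Prop :=
  if clamp then 1 ≤ lim ∧ ∀ x, h x = 0 else ∑ x ∈ R, h x + U.card + R.card ≤ lim

/-! ### Bounds on the tables, and preservation of the invariant -/

section

variable {n N K D M base lim e : ℕ} {γ : Set ℕ} {G : SimpleGraph (Fin n)}
  {l : Fin N → List (Fin n)} {σ τ : Store} {pack clamp : Bool} {Q : ℕ → Store → Prop}
  {R : Finset (Fin N)} {U : Finset (Fin n)} {h : Fin N → ℕ}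

/-- Without clamping, the exponent of `x` grows by one while `U` loses a vertex. With clamping, the
new table is bounded by 1 and all exponents stay 0; even then `lim` has to be positive, because
values before normalization may reach the first power. -/
theorem Budget.forget (hb : Budget clamp lim h R U) {x : Fin N} {v : Fin n} (hx : x ∈ R)
    (hv : v ∈ U) (g : ℕ) :
    h x + 1 ≤ lim ∧ ∃ h' : Fin N → ℕ, Budget clamp lim h' R (U.erase v) ∧ (∀ z, z ≠ x → h' z = h z) ∧
      (if clamp then 1 else g ^ (h x + 1)) ≤ g ^ h' x := by
  cases clamp
  · simp only [Budget, Bool.false_eq_true, if_false] at hb ⊢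
    have h1 := card_pos.2 ⟨v, hv⟩
    have h2 := card_erase_of_mem hv
    have h3 := single_le_sum (f := h) (fun _ _ => Nat.zero_le _) hx
    refine ⟨by omega, Function.update h x (h x + 1), ?_,
      fun z hz => Function.update_of_ne hz _ _, by simp⟩
    rw [sum_update_of_mem hx, ← erase_eq]
    have h4 := add_sum_erase R h hx
    omega
  · simp only [Budget, if_true] at hb ⊢
    exact ⟨by rw [hb.2 x]; exact hb.1, h, hb, fun _ _ => rfl, by rw [hb.2 x, pow_zero]⟩

/-- The exponents of the two tables are added, which leaves their sum over the nodes unchanged; the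
additional one is paid for by the loss of the node `x`. -/
theorem Budget.join (hb : Budget clamp lim h R U) {x y : Fin N} (hx : x ∈ R)
    (hy : y ∈ R) (hxy : x ≠ y) (g : ℕ) :
    h y + h x + 1 ≤ lim ∧ ∃ h' : Fin N → ℕ, Budget clamp lim h' (R.erase x) U ∧
      (∀ z, z ≠ y → h' z = h z) ∧ (if clamp then 1 else g ^ (h y + h x + 1)) ≤ g ^ h' y := by
  cases clamp
  · simp only [Budget, Bool.false_eq_true, if_false] at hb ⊢
    have hy' : y ∈ R.erase x := mem_erase.2 ⟨hxy.symm, hy⟩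
    have h1 := card_pos.2 ⟨x, hx⟩
    have h2 := card_erase_of_mem hx
    have h3 := add_sum_erase R h hx
    have h4 := add_sum_erase (R.erase x) h hy'
    refine ⟨by omega, Function.update h y (h y + h x + 1), ?_,
      fun z hz => Function.update_of_ne hz _ _, by simp⟩
    rw [sum_update_of_mem hy', ← erase_eq]
    omega
  · simp only [Budget, if_true] at hb ⊢
    exact ⟨by rw [hb.2 x, hb.2 y]; exact hb.1, h, hb, fun _ _ => rfl, by rw [hb.2 y, pow_zero]⟩

/-- The table of the bag `z`, as a function on sets of vertices. -/
noncomputable def nodeFun (clamp : Bool) (D : ℕ) (l : Fin N → List (Fin n)) (σ : Store) (z : Fin N) :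
    SetFun (Fin n) (Truncated clamp D) := tableFun clamp D (l z) (tableOf σ z)

/-- The tables represent the wanted number, where `R` is the set of the nodes that are left and `U`
is the set of the vertices that are left. -/
structure Tables (γ : Set ℕ) (G : SimpleGraph (Fin n)) (l : Fin N → List (Fin n)) (K D M lim e : ℕ)
    (pack clamp : Bool) (R : Finset (Fin N)) (U : Finset (Fin n)) (σ : Store) : Prop where
  env : Env γ G l K D M σ
  bound : ∃ h : Fin N → ℕ, Budget clamp lim h R U ∧
    ∀ x ∈ R, ∀ s ⊆ range (l x).length, ∀ c < D, tableOf σ x s c ≤ growth K D ^ h x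
  growth_le : growth K D ^ lim ≤ M
  value : forestSum γ G pack (truncation clamp D (PowerSeries.X ^ e)) R U (nodeFun clamp D l σ) =
    weightSum γ G pack (truncation clamp D (PowerSeries.X ^ e)) univ

theorem Tables.congr (hT : Tables γ G l K D M lim e pack clamp R U σ)
    (ha : ∀ a < 10, a ≠ 5 → a ≠ 6 → τ.arr a = σ.arr a) (hv : τ.var vD = σ.var vD) :
    Tables γ G l K D M lim e pack clamp R U τ := by
  have h1 : ∀ z, tableOf τ z = tableOf σ z := fun z => by
    funext s c; rw [tableOf, ha 9 (by norm_num) (by norm_num) (by norm_num), tableOf]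
  have h2 : nodeFun clamp D l τ = nodeFun clamp D l σ := by
    funext z; rw [nodeFun, h1, nodeFun]
  refine ⟨hT.env.congr (fun a h => ha a (by omega)) hv, ?_, hT.growth_le, by rw [h2]; exact hT.value⟩
  simp only [h1]
  exact hT.bound

theorem forgetStmt_wVars : (forgetStmt pack clamp e).wVars = [vm, vz] := rfl

theorem forgetStmt_wArrs : (forgetStmt pack clamp e).wArrs =
    [14, 10, 11, 12, 10, 12, 11, 13, 12, 13, 9] := rfl

theorem joinStmt_wVars : (joinStmt clamp).wVars = [vm, vz] := rfl

theorem joinStmt_wArrs : (joinStmt clamp).wArrs =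
    [14, 10, 11, 12, 10, 12, 11, 13, 12, 13, 9] := rfl

theorem nodeFun_update {x : Fin N} (hz : ∀ z, z ≠ (x : ℕ) → τ.arr 9 z = σ.arr 9 z) :
    nodeFun clamp D l τ = Function.update (nodeFun clamp D l σ) x (nodeFun clamp D l τ x) := by
  funext z
  by_cases h : z = x
  · subst h; rw [Function.update_self]
  · rw [Function.update_of_ne h, nodeFun, nodeFun]
    congr 1
    funext s c
    rw [tableOf, tableOf, hz z fun h' => h (Fin.ext h')]

theorem Tables.forget (hT : Tables γ G l K D M lim e pack clamp R U σ) {x : Fin N} {p : ℕ}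
    (hxR : x ∈ R) (hx : σ.var vx = x) (hp : σ.var vp = p) (hpl : p < (l x).length)
    (hvU : (l x)[p] ∈ U) (hother : ∀ z ∈ R, z ≠ x → (l x)[p] ∉ l z)
    (hedge : ∀ u ∈ U, G.Adj (l x)[p] u → ∃ z ∈ R, (l x)[p] ∈ l z ∧ u ∈ l z)
    (hQ : ∀ t ≤ 330000 * stepTime K D, ∀ τ, Frame (forgetStmt pack clamp e) σ τ →
      Tables γ G l K D M lim e pack clamp R (U.erase (l x)[p]) τ → Q t τ) :
    Sp M base (forgetStmt pack clamp e) σ Q := by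
  obtain ⟨h, hb, hbd⟩ := hT.bound
  obtain ⟨hlim, h', hb', hh', hle⟩ := hb.forget hxR hvU (growth K D)
  have hD := hT.env.D_pos
  have hm := hT.env.length_le x
  have hg : 1 ≤ growth K D := one_le_growth hD
  have hcb : convBound (l x).length D (growth K D ^ h x) 2 ≤ growth K D ^ (h x + 1) := by
    have := convBound_le (D := D) (μ := growth K D ^ h x) (ν := 2) hm
    rw [pow_succ]
    nlinarith
  have hM3 : convBound (l x).length D (growth K D ^ h x) 2 ≤ M :=
    hcb.trans ((Nat.pow_le_pow_right hg hlim).trans hT.growth_le)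
  have hM2 : 2 ^ (l x).length * 2 ≤ M := by
    refine le_trans (le_convBound (D := D) hD (Nat.one_le_pow (h x) _ hg)) ?_
    refine le_trans (le_of_eq ?_) hM3
    rw [convBound, convBound]; ring
  refine hT.env.forget hx hp hpl (hbd x hxR) ((le_convBound hD (by norm_num)).trans hM3) hM2 hM3
    (by have := hT.env.N_le; omega) fun t ht τ hfr hz hbτ hval => hQ t ht τ hfr ?_
  refine ⟨hT.env.congr (fun a ha _ _ => hfr.arr a ?_) (hfr.var vD ?_), ⟨h', hb', ?_⟩,
    hT.growth_le, ?_⟩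
  · rw [forgetStmt_wArrs]
    simp only [List.mem_cons, List.not_mem_nil, or_false]
    omega
  · rw [forgetStmt_wVars]; decide
  · intro z hzR s hs c hc
    by_cases hzx : z = x
    · subst hzx
      refine (hbτ s hs c hc).trans (le_trans ?_ hle)
      split_ifs
      exacts [le_rfl, hcb]
    · rw [hh' z hzx, tableOf, hz z fun h' => hzx (Fin.ext h')]
      exact hbd z hzR s hs c hc
  · rw [nodeFun_update hz, ← hT.value]
    refine forestSum_forget (B := fun z => (l z).toFinset) hxR hvU (by simp)
      (fun z _ => tableFun_supportedOn _ _) (fun z hz hzx => by simpa using hother z hz hzx)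
      (fun u hu huv => by simpa using hedge u hu huv) (tableFun_supportedOn _ _)
      fun T hT hv => hval T hT hv

theorem Tables.join (hT : Tables γ G l K D M lim e pack clamp R U σ) {x y : Fin N}
    (hxR : x ∈ R) (hyR : y ∈ R) (hxy : x ≠ y) (hx : σ.var vx = x) (hy : σ.var vy = y)
    (hsub : ∀ v ∈ U, v ∈ l x → v ∈ l y)
    (hQ : ∀ t ≤ 330000 * stepTime K D, ∀ τ, Frame (joinStmt clamp) σ τ →
      Tables γ G l K D M lim e pack clamp (R.erase x) U τ → Q t τ) :
    Sp M base (joinStmt clamp) σ Q := by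
  obtain ⟨h, hb, hbd⟩ := hT.bound
  obtain ⟨hlim, h', hb', hh', hle⟩ := hb.join hxR hyR hxy (growth K D)
  have hD := hT.env.D_pos
  have hm := hT.env.length_le y
  have hg : 1 ≤ growth K D := one_le_growth hD
  have hcb : convBound (l y).length D (growth K D ^ h y) (growth K D ^ h x) ≤
      growth K D ^ (h y + h x + 1) := by
    have := convBound_le (D := D) (μ := growth K D ^ h y) (ν := growth K D ^ h x) hm
    rw [pow_succ, pow_add]
    nlinarith
  have hM3 : convBound (l y).length D (growth K D ^ h y) (growth K D ^ h x) ≤ M :=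
    hcb.trans ((Nat.pow_le_pow_right hg hlim).trans hT.growth_le)
  have hM2 : 2 ^ (l y).length * growth K D ^ h x ≤ M := by
    refine le_trans (le_convBound (D := D) hD (Nat.one_le_pow (h y) _ hg)) ?_
    refine le_trans (le_of_eq ?_) hM3
    rw [convBound, convBound]; ring
  refine hT.env.join hx hy (hbd y hyR) (hbd x hxR)
    ((le_convBound hD (Nat.one_le_pow (h x) _ hg)).trans hM3) hM2 hM3
    (by have := hT.env.N_le; omega) fun t ht τ hfr hz hbτ hval => hQ t ht τ hfr ?_
  refine ⟨hT.env.congr (fun a ha _ _ => hfr.arr a ?_) (hfr.var vD ?_), ⟨h', hb', ?_⟩,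
    hT.growth_le, ?_⟩
  · rw [joinStmt_wArrs]
    simp only [List.mem_cons, List.not_mem_nil, or_false]
    omega
  · rw [joinStmt_wVars]; decide
  · intro z hzR s hs c hc
    by_cases hzx : z = y
    · subst hzx
      refine (hbτ s hs c hc).trans (le_trans ?_ hle)
      split_ifs
      exacts [le_rfl, hcb]
    · rw [hh' z hzx, tableOf, hz z fun h' => hzx (Fin.ext h')]
      exact hbd z (mem_of_mem_erase hzR) s hs c hc
  · rw [nodeFun_update hz, ← hT.value]
    refine forestSum_join hxR hyR hxy fun T hTU => ?_
    -- Outside the bag of `y` the new table is zero. So is the product, since by `hsub` the part of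
    -- the bag of `x` that is still in `U` lies in the bag of `y`.
    by_cases hTy : T ⊆ (l y).toFinset
    · exact hval T hTy
    · rw [nodeFun, tableFun_supportedOn _ _ T hTy, SetFun.mul_apply]
      symm
      refine sum_eq_zero fun W hW => ?_
      rw [mem_powerset] at hW
      by_cases hWx : W ⊆ (l x).toFinset
      · have : ¬ T \ W ⊆ (l y).toFinset := fun h'' => hTy fun v hv => by
          by_cases hvW : v ∈ W
          · have := hWx hvW
            rw [List.mem_toFinset] at this ⊢
            exact hsub v (hTU hv) this
          · exact h'' (mem_sdiff.2 ⟨hv, hvW⟩)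
        rw [nodeFun, nodeFun, tableFun_supportedOn (l y) _ _ this, mul_zero]
      · rw [nodeFun, tableFun_supportedOn _ _ W hWx, zero_mul]

theorem Env.eval_keepE (henv : Env γ G l K D M σ) {x : Fin N} {p : ℕ} {Y : Finset (Fin n)}
    (hx : σ.var vx = x) (hp : σ.var vp = p) (hpl : p < (l x).length)
    (hY : σ.var vk = 0 ∧ Y = ∅ ∨
      ∃ y : Fin N, σ.var vy = y ∧ σ.var vk = (l y).length ∧ Y = (l y).toFinset) :
    keepE.eval σ ≠ 0 ↔ (l x)[p] ∈ Y := by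
  simp only [keepE, Expr.eval_sum, Expr.eval_var, Expr.eval_eqv, Expr.eval_get, Expr.eval_zero,
    Store.setVar_var, Store.setVar_arr, show (12 : ℕ) ≠ 3 by norm_num, show (11 : ℕ) ≠ 3 by norm_num,
    show (10 : ℕ) ≠ 3 by norm_num, if_false, if_true, hx, hp, henv.bag x p hpl]
  rcases hY with ⟨hk, rfl⟩ | ⟨y, hy, hk, rfl⟩
  · simp [hk]
  · rw [hk, hy, Ne, sum_eq_zero_iff, List.mem_toFinset, List.mem_iff_getElem]
    push Not
    constructor
    · rintro ⟨q, hq, hq'⟩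
      rw [mem_range] at hq
      rw [henv.bag y q hq] at hq'
      exact ⟨q, hq, by by_contra h'; exact hq' (if_neg fun h'' => h' (Fin.ext h''))⟩
    · rintro ⟨q, hq, hq'⟩
      exact ⟨q, mem_range.2 hq, by rw [henv.bag y q hq, hq', if_pos rfl]; norm_num⟩

/-- By `hother` the vertices of the bag outside `Y` are in no other remaining bag, so they can be
eliminated one after the other. Each elimination pays for itself by making `U` smaller; only the
tests for membership in `Y` are charged separately. -/
theorem Tables.forgetAll (hT : Tables γ G l K D M lim e pack clamp R U σ) {x : Fin N}
    {Y : Finset (Fin n)} (hxR : x ∈ R) (hx : σ.var vx = x)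
    (hY : σ.var vk = 0 ∧ Y = ∅ ∨
      ∃ y : Fin N, σ.var vy = y ∧ σ.var vk = (l y).length ∧ Y = (l y).toFinset)
    (hU : ∀ v ∈ l x, v ∈ U) (hother : ∀ z ∈ R, z ≠ x → ∀ v ∈ l x, v ∈ l z → v ∈ Y)
    (hedge : ∀ u ∈ U, ∀ v ∈ U, G.Adj u v → ∃ z ∈ R, u ∈ l z ∧ v ∈ l z)
    (hQ : ∀ t τ, Frame (forgetAllStmt pack clamp e) σ τ →
      Tables γ G l K D M lim e pack clamp R (U \ ((l x).toFinset \ Y)) τ →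
      t + 330000 * stepTime K D * (U \ ((l x).toFinset \ Y)).card ≤
        330000 * stepTime K D * U.card + 50 * (K + 1) ^ 2 → Q t τ) :
    Sp M base (forgetAllStmt pack clamp e) σ Q := by
  set C := 330000 * stepTime K D with hC
  -- The vertices that are left when the positions from `i` on have been treated.
  set W : ℕ → Finset (Fin n) := fun i => U.filter fun v => ¬ (v ∈ l x ∧ v ∉ Y ∧ i ≤ (l x).idxOf v)
    with hW
  have hk : σ.var vk ≤ K := by
    rcases hY with ⟨hk, _⟩ | ⟨y, _, hk, _⟩
    · omega
    · rw [hk]; exact hT.env.length_le y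
  have hWlen : W (l x).length = U := by
    refine filter_true_of_mem fun v _ ⟨h1, _, h2⟩ => ?_
    have := List.idxOf_lt_length_of_mem h1
    omega
  have hW0 : W 0 = U \ ((l x).toFinset \ Y) := by
    ext v
    simp only [hW, mem_filter, mem_sdiff, List.mem_toFinset, Nat.zero_le, and_true]
  refine Sp.imp_frame (Q := fun t τ => Tables γ G l K D M lim e pack clamp R (W 0) τ ∧
    t + C * (W 0).card ≤ C * U.card + 50 * (K + 1) ^ 2) ?_ ?_
  swap
  · rintro t τ hfr ⟨h1, h2⟩
    rw [hW0] at h1 h2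
    exact hQ t τ hfr h1 h2
  refine Sp.forTo (n := (l x).length) (fun i t τ => Tables γ G l K D M lim e pack clamp R (W i) τ ∧
      t + C * (W i).card + i * (30 * (K + 1)) ≤ C * U.card + (l x).length * (30 * (K + 1)) ∧
      τ.var vx = x ∧ τ.var vy = σ.var vy ∧ τ.var vk = σ.var vk)
    ⟨by norm_num, trivial, trivial, trivial⟩ (by simp [hx, hT.env.size]) ?_ ?_ ?_ ?_
  · have := hT.env.length_le x
    have := hT.env.K_lt
    omega
  · rw [hWlen]
    exact ⟨hT, by omega, hx, rfl, rfl⟩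
  · rintro i hi t τ ⟨hτ, ht, hxτ, hyτ, hkτ⟩
    have hT' : Tables γ G l K D M lim e pack clamp R (W (i + 1)) (τ.setVar vp i) :=
      hτ.congr (fun _ _ _ _ => rfl) (by simp [Store.setVar_var])
    have hx' : (τ.setVar vp i).var vx = x := by simp [Store.setVar_var, hxτ]
    have hp' : (τ.setVar vp i).var vp = i := by simp [Store.setVar_var]
    have hkeep := hT'.env.eval_keepE hx' hp' hi (Y := Y) (by simpa [Store.setVar_var, hyτ, hkτ] using hY)
    have htime : keepE.time (τ.setVar vp i) ≤ 22 * (K + 1) := by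
      rw [keepE]
      refine (time_sum_le (m := σ.var vk) (B := 22) (by simp [Store.setVar_var, hkτ]) fun q => ?_).trans ?_
      · simp
      · omega
    have hidx : (l x).idxOf (l x)[i] = i := (hT.env.nodup x).idxOf_getElem i hi
    have hok : keepE.Ok base (τ.setVar vp i) := Expr.pure.ok (by rfl)
    have hmem : (l x)[i] ∈ l x := List.getElem_mem hi
    by_cases hiY : (l x)[i] ∈ Y
    · refine Sp.ite_pos hok (hkeep.2 hiY) (Sp.set trivial (Nat.zero_le _) ?_)
      have hWi : W i = W (i + 1) := by
        refine filter_congr fun v _ => not_congr ⟨?_, ?_⟩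
        · rintro ⟨h1, h2, h3⟩
          refine ⟨h1, h2, ?_⟩
          by_contra h4
          have : (l x).idxOf v = i := by omega
          apply h2
          have h5 : (l x)[i] = v := by
            subst this; exact List.getElem_idxOf _
          rwa [← h5]
        · rintro ⟨h1, h2, h3⟩; exact ⟨h1, h2, by omega⟩
      rw [hWi]
      refine ⟨hT'.congr (fun _ _ _ _ => rfl) (by simp [Store.setVar_var]), ?_, ?_, ?_, ?_⟩
      · have : (i + 1) * (30 * (K + 1)) = i * (30 * (K + 1)) + 30 * (K + 1) := by ring
        simp only [Expr.time_zero]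
        omega
      all_goals simp [Store.setVar_var, hxτ, hyτ, hkτ]
    · refine Sp.ite_zero hok (by by_contra h'; exact hiY (hkeep.1 h')) ?_
      have hWi : W i = (W (i + 1)).erase (l x)[i] := by
        ext v
        simp only [hW, mem_filter, mem_erase]
        constructor
        · rintro ⟨h1, h2⟩
          refine ⟨?_, h1, fun h3 => h2 ⟨h3.1, h3.2.1, by omega⟩⟩
          rintro rfl
          exact h2 ⟨hmem, hiY, hidx.ge⟩
        · rintro ⟨h1, h2, h3⟩
          refine ⟨h2, fun h4 => h3 ⟨h4.1, h4.2.1, ?_⟩⟩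
          by_contra h5
          have : (l x).idxOf v = i := by omega
          apply h1
          subst this
          exact (List.getElem_idxOf _).symm
      have hvW : (l x)[i] ∈ W (i + 1) := by
        simp only [hW, mem_filter]
        exact ⟨hU _ hmem, fun h' => by omega⟩
      refine hT'.forget hxR hx' hp' hi hvW (fun z hz hzx hvz => hiY (hother z hz hzx _ hmem hvz))
        (fun u hu huv => hedge _ (hU _ hmem) u (filter_subset _ _ hu) huv) fun t' ht' τ' hfr hT'' => ?_
      rw [hWi]
      refine ⟨hT'', ?_, ?_, ?_, ?_⟩
      · have h1 : (i + 1) * (30 * (K + 1)) = i * (30 * (K + 1)) + 30 * (K + 1) := by ring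
        have h2 := card_erase_add_one hvW
        have h3 : C * (W (i + 1)).card = C * ((W (i + 1)).erase (l x)[i]).card + C := by
          rw [← h2]; ring
        omega
      · rw [hfr.var vx (by rw [forgetStmt_wVars]; decide), hx']
      · rw [hfr.var vy (by rw [forgetStmt_wVars]; decide)]; simp [Store.setVar_var, hyτ]
      · rw [hfr.var vk (by rw [forgetStmt_wVars]; decide)]; simp [Store.setVar_var, hkτ]
  · rintro t τ ⟨hτ, ht, _⟩
    refine ⟨hτ.congr (fun _ _ _ _ => rfl) (by simp [Store.setVar_var]), ?_⟩
    have h1 := hT.env.length_le x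
    have h2 : (l x).length * (30 * (K + 1)) ≤ K * (30 * (K + 1)) := Nat.mul_le_mul_right _ h1
    have h3 : 50 * (K + 1) ^ 2 = K * (30 * (K + 1)) + 20 * (K * K) + 70 * K + 50 := by ring
    simp only [Expr.time_get, Expr.time_var, Expr.time_zero]
    omega

end

end RAM

namespace RAM

open Finset

/-! ### The elimination of all nodes -/

/-- Elimination of the node `vx`, whose only neighbor is `vy`. -/
def leafStmt (pack clamp : Bool) (e : ℕ) : Stmt :=
  .seq (.set vy (.get 6 (.var vx) 0 0)) <| .seq (.set vk (.get 3 (.var vy) 0 0)) <|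
  .seq (forgetAllStmt pack clamp e) <| .seq (joinStmt clamp) <|
  .seq (.put 5 (.var vx) 0 0 0) <|
  .seq (.put 5 (.var vy) 0 0 (.get 5 (.var vy) 0 0 - 1)) <|
  .seq (.put 6 (.var vy) 0 0 (.get 6 (.var vy) 0 0 - .var vx)) (.set vx (.var vy))

/-- Elimination of leaves until a single node is left. -/
def pruneStmt (pack clamp : Bool) (e : ℕ) : Stmt :=
  .forTo vr (.var vN + .var vN) <| .ite (.var vN - .var vi)
    (.ite (.eqv (.get 5 (.var vx) 0 0) 1) (leafStmt pack clamp e)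
      (.seq (.set vi (.var vi + 1)) (.set vx (.var vi))))
    (.set vu 0)

/-- The second part of the algorithm: the computation of the result from the tables. -/
def eliminateStmt (pack clamp : Bool) (e : ℕ) : Stmt :=
  .seq (pruneStmt pack clamp e) <| .seq (.set vx (.var vy)) <| .seq (.set vk 0) <|
  .seq (forgetAllStmt pack clamp e) <| .forTo vq (.var vD) (.out (.var vq) (.get 9 (.var vx) 0 (.var vq)))

/-- The state of the elimination of leaves, when `R` is the set of the remaining nodes. -/
structure Forest {n N : ℕ} (T : SimpleGraph (Fin N)) [DecidableRel T.Adj] (G : SimpleGraph (Fin n))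
    (l : Fin N → List (Fin n)) (R : Finset (Fin N)) (U : Finset (Fin n)) (σ : Store) : Prop where
  pathClosed : T.PathClosed R
  sub : ∀ z ∈ R, ∀ v ∈ l z, v ∈ U
  cover : ∀ v ∈ U, ∃ z ∈ R, v ∈ l z
  edge : ∀ u ∈ U, ∀ v ∈ U, G.Adj u v → ∃ z ∈ R, u ∈ l z ∧ v ∈ l z
  deg : ∀ z : Fin N, σ.arr 5 z 0 0 = if z ∈ R then (R.filter (T.Adj z)).card else 0
  nbr : ∀ z ∈ R, σ.arr 6 z 0 0 = ∑ u ∈ R.filter (T.Adj z), (u : ℕ)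

/-! ### Pruning the tree to a single node, and the result -/

section

variable {n N K D M base lim e : ℕ} {γ : Set ℕ} {G : SimpleGraph (Fin n)}
  {l : Fin N → List (Fin n)} {σ τ : Store} {pack clamp : Bool} {Q : ℕ → Store → Prop}
  {R : Finset (Fin N)} {U : Finset (Fin n)} {T : SimpleGraph (Fin N)} [DecidableRel T.Adj]

theorem forgetAllStmt_wVars : (forgetAllStmt pack clamp e).wVars = [vu, vm, vz] := rfl

theorem forgetAllStmt_wArrs : (forgetAllStmt pack clamp e).wArrs =
    [14, 10, 11, 12, 10, 12, 11, 13, 12, 13, 9] := rfl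

theorem Forest.congr (hF : Forest T G l R U σ) (h5 : τ.arr 5 = σ.arr 5) (h6 : τ.arr 6 = σ.arr 6) :
    Forest T G l R U τ :=
  ⟨hF.pathClosed, hF.sub, hF.cover, hF.edge, by rw [h5]; exact hF.deg, by rw [h6]; exact hF.nbr⟩

/-- Among the remaining nodes only `y` is adjacent to `x`, so no other one loses a neighbor. -/
theorem filter_erase_leaf {x y : Fin N} (hxy : R.filter (T.Adj x) = {y}) {z : Fin N} (hz : z ∈ R)
    (hzy : z ≠ y) : (R.erase x).filter (T.Adj z) = R.filter (T.Adj z) := by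
  ext u
  simp only [mem_filter, mem_erase]
  refine ⟨fun h => ⟨h.1.2, h.2⟩, fun h => ⟨⟨?_, h.1⟩, h.2⟩⟩
  rintro rfl
  have : z ∈ R.filter (T.Adj u) := mem_filter.2 ⟨hz, h.2.symm⟩
  rw [hxy, mem_singleton] at this
  exact hzy this

theorem filter_erase_nbr (x y : Fin N) :
    (R.erase x).filter (T.Adj y) = (R.filter (T.Adj y)).erase x := filter_erase ..

/-- The effect of the removal of the leaf `x` with neighbor `y`. -/
theorem Forest.erase (hF : Forest T G l R U σ) {x y : Fin N} (hx : x ∈ R) 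
    (hxy : R.filter (T.Adj x) = {y})
    (hother : ∀ z ∈ R, z ≠ x → ∀ v ∈ l x, v ∈ l z → v ∈ l y)
    (h5 : τ.arr 5 = entryUpdate (entryUpdate (σ.arr 5) x 0 0 0) y 0 0 (σ.arr 5 y 0 0 - 1))
    (h6 : τ.arr 6 = entryUpdate (σ.arr 6) y 0 0 (σ.arr 6 y 0 0 - x)) :
    Forest T G l (R.erase x) (U \ ((l x).toFinset \ (l y).toFinset)) τ := by
  have hy : y ∈ R.filter (T.Adj x) := by rw [hxy]; exact mem_singleton_self y
  rw [mem_filter] at hy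
  have hyx : y ≠ x := hy.2.ne'
  have hxfy : x ∈ R.filter (T.Adj y) := mem_filter.2 ⟨hx, hy.2.symm⟩
  have hU : ∀ v ∈ U \ ((l x).toFinset \ (l y).toFinset), v ∈ U ∧ (v ∈ l x → v ∈ l y) := by
    intro v hv
    simp only [mem_sdiff, List.mem_toFinset, not_and, not_not] at hv
    exact hv
  refine ⟨hF.pathClosed.erase (y := y) hx fun u hu hxu => ?_, ?_, ?_, ?_, ?_, ?_⟩
  · have : u ∈ R.filter (T.Adj x) := mem_filter.2 ⟨hu, hxu⟩
    rwa [hxy, mem_singleton] at this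
  · intro z hz v hv
    rw [mem_erase] at hz
    simp only [mem_sdiff, List.mem_toFinset, not_and, not_not]
    exact ⟨hF.sub z hz.2 v hv, fun hvx => hother z hz.2 hz.1 v hvx hv⟩
  · intro v hv
    obtain ⟨hv, hv'⟩ := hU v hv
    obtain ⟨z, hz, hvz⟩ := hF.cover v hv
    by_cases hzx : z = x
    · exact ⟨y, mem_erase.2 ⟨hyx, hy.1⟩, hv' (hzx ▸ hvz)⟩
    · exact ⟨z, mem_erase.2 ⟨hzx, hz⟩, hvz⟩
  · intro u hu v hv huv
    obtain ⟨hu, hu'⟩ := hU u hu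
    obtain ⟨hv, hv'⟩ := hU v hv
    obtain ⟨z, hz, huz, hvz⟩ := hF.edge u hu v hv huv
    by_cases hzx : z = x
    · exact ⟨y, mem_erase.2 ⟨hyx, hy.1⟩, hu' (hzx ▸ huz), hv' (hzx ▸ hvz)⟩
    · exact ⟨z, mem_erase.2 ⟨hzx, hz⟩, huz, hvz⟩
  · intro z
    rw [h5]
    by_cases hzy : z = y
    · subst hzy
      rw [entryUpdate, if_pos ⟨rfl, rfl, rfl⟩, if_pos (mem_erase.2 ⟨hyx, hy.1⟩), filter_erase_nbr,
        card_erase_of_mem hxfy, hF.deg, if_pos hy.1]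
    · rw [entryUpdate, if_neg fun h => hzy (Fin.ext h.1), entryUpdate]
      by_cases hzx : z = x
      · rw [hzx, if_pos ⟨rfl, rfl, rfl⟩, if_neg (by simp)]
      · rw [if_neg fun h => hzx (Fin.ext h.1), hF.deg]
        by_cases hz : z ∈ R
        · rw [if_pos hz, if_pos (mem_erase.2 ⟨hzx, hz⟩), filter_erase_leaf hxy hz hzy]
        · rw [if_neg hz, if_neg fun h => hz (mem_of_mem_erase h)]
  · intro z hz
    rw [mem_erase] at hz
    rw [h6]
    by_cases hzy : z = y
    · subst hzy
      have := add_sum_erase _ (fun u : Fin N => (u : ℕ)) hxfy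
      rw [entryUpdate, if_pos ⟨rfl, rfl, rfl⟩, filter_erase_nbr, hF.nbr _ hz.2]
      omega
    · rw [entryUpdate, if_neg fun h => hzy (Fin.ext h.1), hF.nbr _ hz.2,
        filter_erase_leaf hxy hz.2 hzy]

/-- A bound on the number of steps for the elimination of one node or vertex. -/
def unitTime (K D : ℕ) : ℕ := 330100 * stepTime K D

theorem sq_le_stepTime (hD : 1 ≤ D) : (K + 1) ^ 2 ≤ stepTime K D := by
  calc (K + 1) ^ 2 = 1 * (K + 1) ^ 2 * 1 := by ring
    _ ≤ stepTime K D := by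
        rw [stepTime]
        gcongr
        · exact Nat.one_le_two_pow
        · exact Nat.one_le_pow _ _ hD

/-- The sum of the neighbors of a leaf is its only neighbor, which is how `y` is found without
adjacency lists. Once the vertices missing from the bag of `y` are eliminated, what remains of the
bag of `x` is contained in it, and the tables can be multiplied. -/
theorem leafStmt_spec (hT : Tables γ G l K D M lim e pack clamp R U σ) (hF : Forest T G l R U σ)
    {x y : Fin N} (hx : x ∈ R) (hxy : R.filter (T.Adj x) = {y}) (hvx' : σ.var vx = x)
    (hother : ∀ z ∈ R, z ≠ x → ∀ v ∈ l x, v ∈ l z → v ∈ l y)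
    (hQ : ∀ t τ U', Tables γ G l K D M lim e pack clamp (R.erase x) U' τ →
      Forest T G l (R.erase x) U' τ → τ.var vx = y → τ.var vy = y → τ.var vi = σ.var vi →
      τ.var vN = σ.var vN → t + unitTime K D * U'.card ≤ unitTime K D * (U.card + 1) → Q t τ) :
    Sp M base (leafStmt pack clamp e) σ Q := by
  have hy : y ∈ R.filter (T.Adj x) := by rw [hxy]; exact mem_singleton_self y
  rw [mem_filter] at hy
  have hyx : x ≠ y := hy.2.ne
  have hnbr : σ.arr 6 x 0 0 = y := by rw [hF.nbr x hx, hxy, sum_singleton]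
  have hN := hT.env.N_le
  have hNM : ∀ z : Fin N, (z : ℕ) ≤ M := fun z => by have := z.2; omega
  refine Sp.seq (Sp.set ⟨by norm_num, trivial, trivial, trivial⟩ ?_ ?_)
  · simpa [hvx', hnbr] using hNM y
  rw [Expr.eval_get, Expr.eval_var, Expr.eval_zero, hvx', hnbr]
  set σ₁ := σ.setVar vy y with hσ₁
  have hy₁ : σ₁.var vy = y := by simp [hσ₁, Store.setVar_var]
  have hs₁ : σ₁.arr 3 y 0 0 = (l y).length := hT.env.size y
  refine Sp.seq (Sp.set ⟨by norm_num, trivial, trivial, trivial⟩ ?_ ?_)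
  · have := hT.env.length_le y
    have := hT.env.K_lt
    rw [Expr.eval_get, Expr.eval_var, Expr.eval_zero, hy₁, hs₁]
    omega
  rw [Expr.eval_get, Expr.eval_var, Expr.eval_zero, hy₁, hs₁]
  set σ₂ := σ₁.setVar vk (l y).length with hσ₂
  have hy₂ : σ₂.var vy = y := by simp [hσ₂, Store.setVar_var, hy₁]
  have hx₂ : σ₂.var vx = x := by simp [hσ₂, hσ₁, Store.setVar_var, hvx']
  have hT₂ : Tables γ G l K D M lim e pack clamp R U σ₂ :=
    hT.congr (fun _ _ _ _ => rfl) (by simp [hσ₂, hσ₁, Store.setVar_var])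
  refine Sp.seq (hT₂.forgetAll (Y := (l y).toFinset) hx hx₂
    (Or.inr ⟨y, hy₂, by simp [hσ₂, Store.setVar_var], rfl⟩) (hF.sub x hx)
    (by simpa using hother) hF.edge fun t₁ σ₃ hfr hT₃ ht₁ => ?_)
  set U' := U \ ((l x).toFinset \ (l y).toFinset) with hU'
  have v₃ : ∀ a, a ≠ vu → a ≠ vm → a ≠ vz → σ₃.var a = σ₂.var a := fun a h1 h2 h3 =>
    hfr.var a (by rw [forgetAllStmt_wVars]; simp [h1, h2, h3])
  have a₃ : ∀ a < 9, σ₃.arr a = σ.arr a := fun a h1 => by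
    rw [hfr.arr a (by rw [forgetAllStmt_wArrs]; simp; omega)]; rfl
  refine Sp.seq (hT₃.join (base := base) hx hy.1 hyx (by rw [v₃ vx (by decide) (by decide) (by decide), hx₂])
    (by rw [v₃ vy (by decide) (by decide) (by decide), hy₂]) ?_ fun t₂ ht₂ σ₄ hfr₄ hT₄ => ?_)
  · intro v hv
    simp only [hU', mem_sdiff, List.mem_toFinset, not_and, not_not] at hv
    exact hv.2
  have v₄ : ∀ a, a ≠ vu → a ≠ vm → a ≠ vz → σ₄.var a = σ₂.var a := fun a h1 h2 h3 => by
    rw [hfr₄.var a (by rw [joinStmt_wVars]; simp [h2, h3]), v₃ a h1 h2 h3]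
  have a₄ : ∀ a < 9, σ₄.arr a = σ.arr a := fun a h1 => by
    rw [hfr₄.arr a (by rw [joinStmt_wArrs]; simp; omega), a₃ a h1]
  have hx₄ : σ₄.var vx = x := by rw [v₄ vx (by decide) (by decide) (by decide), hx₂]
  have hy₄ : σ₄.var vy = y := by rw [v₄ vy (by decide) (by decide) (by decide), hy₂]
  have hdeg : σ.arr 5 y 0 0 ≤ N := by
    rw [hF.deg, if_pos hy.1]
    exact (card_le_univ _).trans (by simp)
  have hne : ¬ (y : ℕ) = x := fun h => hyx (Fin.ext h.symm)
  -- A sum of at most `N` node numbers is at most `N * N`; this is the reason for the quadratic term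
  -- in `Env.N_le`.
  have hbound : σ.arr 6 y 0 0 - x ≤ M := by
    have h1 : ∑ u ∈ R.filter (T.Adj y), (u : ℕ) ≤ (R.filter (T.Adj y)).card • N :=
      sum_le_card_nsmul _ _ _ fun u _ => u.2.le
    have h2 : (R.filter (T.Adj y)).card ≤ N := (card_le_univ _).trans (by simp)
    have h3 := Nat.mul_le_mul_right N h2
    rw [smul_eq_mul] at h1
    rw [hF.nbr y hy.1]
    omega
  refine Sp.seq (Sp.put (by norm_num) trivial trivial trivial trivial (Nat.zero_le _) ?_)
  refine Sp.seq (Sp.put (by norm_num) trivial trivial trivial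
    ⟨⟨by norm_num, trivial, trivial, trivial⟩, trivial⟩ ?_ ?_)
  · simp [hx₄, hy₄, Store.setArr_arr, entryUpdate, a₄ 5, hne]
    omega
  refine Sp.seq (Sp.put (by norm_num) trivial trivial trivial
    ⟨⟨by norm_num, trivial, trivial, trivial⟩, trivial⟩ ?_ ?_)
  · simp only [Expr.eval_sub, Expr.eval_get, Expr.eval_var, Store.setArr_var, hy₄, hx₄,
      Expr.eval_zero, Store.setArr_arr, show (6 : ℕ) ≠ 5 by norm_num, if_false, a₄ 6 (by norm_num)]
    exact hbound
  refine Sp.set trivial ?_ ?_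
  · simp only [Expr.eval_var, Store.setArr_var, hy₄]
    exact hNM y
  refine hQ _ _ U' (hT₄.congr ?_ ?_) (hF.erase hx hxy hother ?_ ?_) ?_ ?_ ?_ ?_ ?_
  · intro a _ h5 h6
    simp [Store.setArr_arr, h5, h6]
  · simp [Store.setVar_var]
  · simp [Store.setArr_arr, hx₄, hy₄, a₄ 5, entryUpdate, hne]
  · simp [Store.setArr_arr, hx₄, hy₄, a₄ 6]
  · simp [Store.setVar_var, hy₄]
  · simp [Store.setVar_var, hy₄]
  · simp [Store.setVar_var, v₄ vi, hσ₂, hσ₁]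
  · simp [Store.setVar_var, v₄ vN, hσ₂, hσ₁]
  · have h1 := sq_le_stepTime (K := K) hT.env.D_pos
    have h2 := one_le_stepTime (K := K) hT.env.D_pos
    have h3 : U'.card ≤ U.card := card_le_card sdiff_subset
    simp only [Expr.time_get, Expr.time_var, Expr.time_zero, Expr.time_sub, Expr.time_one]
    have h4 : unitTime K D * U'.card = 330000 * stepTime K D * U'.card + 100 * stepTime K D * U'.card := by
      rw [unitTime]; ring
    have h5 : unitTime K D * (U.card + 1) = 330000 * stepTime K D * U.card +
      100 * stepTime K D * U.card + 330100 * stepTime K D := by rw [unitTime]; ring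
    have h6 := Nat.mul_le_mul_left (100 * stepTime K D) h3
    omega

/-- Leaves are found as in the linear-time computation of a Prüfer code: the position `vi` of the
scan only increases, and the neighbor of a removed leaf is examined immediately. The invariant is
that each leaf is beyond `vi` or equal to `vx`. Until the scan is complete, every round advances
`vi` or removes a node, so `N + N` rounds suffice. -/
theorem pruneStmt_spec (hT : Tables γ G l K D M lim e pack clamp univ univ σ)
    (hF : Forest T G l univ univ σ) (hTree : T.IsTree) (hN : 1 ≤ N) (hvN : σ.var vN = N)
    (hvi : σ.var vi = 0) (hvx' : σ.var vx = 0) (hvy' : σ.var vy = 0)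
    (hleaf : ∀ R, T.PathClosed R → ∀ x ∈ R, ∀ y, (∀ u ∈ R, T.Adj x u → u = y) →
      ∀ z ∈ R, z ≠ x → ∀ v ∈ l x, v ∈ l z → v ∈ l y)
    (hQ : ∀ t τ (y : Fin N) U, Tables γ G l K D M lim e pack clamp {y} U τ → Forest T G l {y} U τ →
      τ.var vy = y → t + unitTime K D * U.card ≤ unitTime K D * (n + 4 * N) → Q t τ) :
    Sp M base (pruneStmt pack clamp e) σ Q := by
  have hu : 330100 ≤ unitTime K D := by
    have := one_le_stepTime (K := K) hT.env.D_pos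
    rw [unitTime]; omega
  refine Sp.forTo (n := N + N) (fun i t τ => ∃ R U, Tables γ G l K D M lim e pack clamp R U τ ∧
      Forest T G l R U τ ∧ τ.var vN = N ∧ (∃ y : Fin N, τ.var vy = y ∧ y ∈ R) ∧
      τ.var vi ≤ N ∧ (τ.var vi < N → τ.var vx < N) ∧ (τ.var vi = N → τ.var vx = N) ∧
      (∀ z ∈ R, (R.filter (T.Adj z)).card = 1 → τ.var vi < z ∨ (z : ℕ) = τ.var vx) ∧
      (N - τ.var vi) + (R.card - 1) ≤ i ∧
      t + unitTime K D * (U.card + R.card) + i * 40 ≤ unitTime K D * (n + N) + 2 * N * 40)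
    ⟨trivial, trivial⟩ (by simp [hvN]) (by have := hT.env.N_le; omega) ?_ ?_ ?_
  -- The initial value 0 of `vy` matters when the tree has one node only: then no leaf is ever
  -- removed, and `vy` must already name the last node.
  · refine ⟨univ, univ, hT, hF, hvN, ⟨⟨0, hN⟩, by simp [hvy'], mem_univ _⟩, by omega, by omega,
      by omega, fun z _ _ => ?_, ?_, ?_⟩
    · rw [hvi, hvx']; omega
    · rw [card_univ, Fintype.card_fin]; omega
    · rw [card_univ, card_univ, Fintype.card_fin, Fintype.card_fin]; omega
  · rintro i hi t τ ⟨R, U, hT, hF, hvN, ⟨y₀, hy₀, hy₀R⟩, hiN, hxN, hxN', hlf, hpot, ht⟩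
    set τ' := τ.setVar vr i with hτ'
    have hT' : Tables γ G l K D M lim e pack clamp R U τ' :=
      hT.congr (fun _ _ _ _ => rfl) (by simp [hτ', Store.setVar_var])
    have hF' : Forest T G l R U τ' := hF.congr rfl rfl
    have hv' : ∀ a, a ≠ vr → τ'.var a = τ.var a := fun a ha => by simp [hτ', Store.setVar_var, ha]
    have vN' : τ'.var vN = N := by rw [hv' _ (by norm_num), hvN]
    have vi' : τ'.var vi = τ.var vi := hv' _ (by norm_num)
    have vx' : τ'.var vx = τ.var vx := hv' _ (by norm_num)
    have hRpos : 1 ≤ R.card := card_pos.2 ⟨y₀, hy₀R⟩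
    by_cases hiN' : τ.var vi < N
    · have hxlt := hxN hiN'
      set x : Fin N := ⟨τ.var vx, hxlt⟩ with hx
      refine Sp.ite_pos ⟨trivial, trivial⟩ (by simp [vN', vi']; omega) ?_
      have hdeg : τ'.arr 5 (τ'.var vx) 0 0 = if x ∈ R then (R.filter (T.Adj x)).card else 0 := by
        rw [vx']; exact hF'.deg x
      by_cases hd : τ'.arr 5 (τ'.var vx) 0 0 = 1
      · refine Sp.ite_pos (Expr.pure.ok (by rfl)) (by simp [hd]) ?_
        rw [hd] at hdeg
        have hxR : x ∈ R := by by_contra h; rw [if_neg h] at hdeg; omega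
        rw [if_pos hxR] at hdeg
        obtain ⟨y, hy⟩ := card_eq_one.1 hdeg.symm
        have hyR : y ∈ R.filter (T.Adj x) := by rw [hy]; exact mem_singleton_self y
        rw [mem_filter] at hyR
        have hyx : y ≠ x := hyR.2.ne'
        have hcard := card_erase_add_one hxR
        have hpos : 1 ≤ (R.erase x).card := card_pos.2 ⟨y, mem_erase.2 ⟨hyx, hyR.1⟩⟩
        refine leafStmt_spec hT' hF' hxR hy (by rw [vx']) (hleaf R hF.pathClosed x hxR y ?_) ?_
        · intro u huR hxu
          have : u ∈ R.filter (T.Adj x) := mem_filter.2 ⟨huR, hxu⟩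
          rwa [hy, mem_singleton] at this
        · intro t' ρ U' hTρ hFρ hρx hρy hρi hρN ht'
          refine ⟨R.erase x, U', hTρ, hFρ, by rw [hρN, vN'], ⟨y, hρy, mem_erase.2 ⟨hyx, hyR.1⟩⟩,
            by rw [hρi, vi']; exact hiN, fun _ => by rw [hρx]; exact y.2,
            fun h => by rw [hρi, vi'] at h; omega, ?_, ?_, ?_⟩
          · intro z hz hz1
            rw [mem_erase] at hz
            rw [hρi, vi', hρx]
            by_cases hzy : z = y
            · exact Or.inr (by rw [hzy])
            · rw [filter_erase_leaf hy hz.2 hzy] at hz1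
              rcases hlf z hz.2 hz1 with h | h
              · exact Or.inl h
              · exact absurd (Fin.ext h) hz.1
          · rw [hρi, vi']; omega
          · simp only [Expr.time_sub, Expr.time_var, Expr.time_eqv, Expr.time_get, Expr.time_zero,
              Expr.time_one]
            have h1 : unitTime K D * (U'.card + (R.erase x).card) =
              unitTime K D * U'.card + unitTime K D * (R.erase x).card := by ring
            have h2 : unitTime K D * (U.card + R.card) =
              unitTime K D * (U.card + 1) + unitTime K D * (R.erase x).card := by rw [← hcard]; ring
            omega
      · refine Sp.ite_zero (Expr.pure.ok (by rfl)) (by simp [hd]) ?_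
        refine Sp.seq (Sp.set ⟨trivial, trivial⟩ (by simp [vi']; have := hT.env.N_le; omega) ?_)
        refine Sp.set trivial (by simp [vi', Store.setVar_var]; have := hT.env.N_le; omega) ?_
        simp only [Expr.eval_add, Expr.eval_var, Expr.eval_one, Store.setVar_var, if_true, vi']
        refine ⟨R, U, hT'.congr (fun _ _ _ _ => rfl) (by simp [Store.setVar_var]), hF'.congr rfl rfl,
          by simp [vN'], ⟨y₀, by simp [hv', hy₀], hy₀R⟩, ?_, ?_, ?_,
          ?_, ?_, ?_⟩
        · simp; omega
        · simp
        · simp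
        · intro z hz hz1
          norm_num
          rcases hlf z hz hz1 with h | h
          · omega
          · exfalso
            have hzx : z = x := Fin.ext h
            subst hzx
            rw [if_pos hz, hz1] at hdeg
            exact hd hdeg
        · simp; omega
        · simp only [Expr.time_sub, Expr.time_var, Expr.time_eqv, Expr.time_get, Expr.time_zero,
            Expr.time_one, Expr.time_add]
          omega
    · refine Sp.ite_zero ⟨trivial, trivial⟩ (by simp [vN', vi']; omega) ?_
      refine Sp.set trivial (Nat.zero_le _) ?_
      refine ⟨R, U, hT'.congr (fun _ _ _ _ => rfl) (by simp [Store.setVar_var]), hF'.congr rfl rfl,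
        by simp [Store.setVar_var, vN'], ⟨y₀, by simp [Store.setVar_var, hv', hy₀], hy₀R⟩,
        by simpa [Store.setVar_var, vi'] using hiN, by simpa [Store.setVar_var, vi', vx'] using hxN,
        by simpa [Store.setVar_var, vi', vx'] using hxN',
        by simpa [Store.setVar_var, vi', vx'] using hlf, ?_, ?_⟩
      · simp [Store.setVar_var, vi']
        -- When the scan is complete, `vi = vx = N`, and the invariant leaves no room for a leaf;
        -- two or more remaining nodes would have one.
        have : R.card = 1 := by
          by_contra hne
          obtain ⟨z, hz, hz1⟩ := hF.pathClosed.exists_leaf hTree (by omega)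
          have h1 := hlf z hz hz1
          have h2 := hxN' (by omega)
          have := z.2
          omega
        omega
      · simp only [Expr.time_sub, Expr.time_var, Expr.time_zero]
        omega
  · rintro t τ ⟨R, U, hT, hF, hvN, ⟨y, hy, hyR⟩, hiN, hxN, hxN', hlf, hpot, ht⟩
    have hR1 : R.card = 1 := by
      have := card_pos.2 ⟨y, hyR⟩
      omega
    obtain ⟨y', rfl⟩ := card_eq_one.1 hR1
    obtain rfl := mem_singleton.1 hyR
    refine hQ _ _ y U (hT.congr (fun _ _ _ _ => rfl) (by simp [Store.setVar_var])) (hF.congr rfl rfl)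
      (by simp [Store.setVar_var, hy]) ?_
    simp only [Expr.time_add, Expr.time_var]
    rw [hR1] at ht
    have h1 : unitTime K D * (U.card + 1) = unitTime K D * U.card + unitTime K D := by ring
    have h2 : unitTime K D * (n + 4 * N) = unitTime K D * (n + N) + 3 * (N * unitTime K D) := by ring
    have h3 : N * 330100 ≤ N * unitTime K D := Nat.mul_le_mul_left _ hu
    omega

theorem map_weightSum {V A B : Type*} [DecidableEq V] [CommSemiring A] [CommSemiring B] (φ : A →+* B)
    (γ : Set ℕ) (G : SimpleGraph V) (pack : Bool) (w : A) (S : Finset V) :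
    φ (weightSum γ G pack w S) = weightSum γ G pack (φ w) S := by
  simp only [weightSum, map_sum, map_pow]

theorem outputStmt_spec (hy : ∃ y, σ.var vx = y ∧ ∀ c < D, σ.arr 9 y 0 c ≤ M) (hD : σ.var vD = D)
    (hDM : D ≤ M) (hDb : D ≤ base)
    (hQ : ∀ t ≤ 10 * (D + 1), ∀ τ, (∀ c < D, τ.raw c = σ.arr 9 (σ.var vx) 0 c) → Q t τ) :
    Sp M base (.forTo vq (.var vD) (.out (.var vq) (.get 9 (.var vx) 0 (.var vq)))) σ Q := by
  obtain ⟨y, hy, hM⟩ := hy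
  refine Sp.forTo (n := D) (fun i t τ => (∀ c < D, i ≤ c → τ.raw c = σ.arr 9 y 0 c) ∧
    τ.arr = σ.arr ∧ τ.var vx = y ∧ t + i * 10 ≤ D * 10) trivial hD hDM
    ⟨fun c hc hc' => by omega, rfl, hy, by omega⟩ ?_ ?_
  · rintro i hi t τ ⟨hraw, harr, hx, ht⟩
    refine Sp.out trivial ⟨by norm_num, trivial, trivial, trivial⟩ ?_ ?_ ?_
    · simp [Store.setVar_var]; omega
    · simp [Store.setVar_var, hx, harr]; exact hM i hi
    · refine ⟨fun c hc hic => ?_, harr, ?_, ?_⟩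
      · simp only [Store.setRaw, Function.update_apply, Expr.eval_var, Store.setVar_var, if_true,
          Store.setVar_raw, Expr.eval_get, Store.setVar_arr, harr, show (11 : ℕ) ≠ 17 by norm_num,
          if_false, hx, Expr.eval_zero]
        split_ifs with h
        · rw [h]
        · exact hraw c hc (by omega)
      · simp [Store.setVar_var, hx]
      · simp only [Expr.time_var, Expr.time_get, Expr.time_zero]; omega
  · rintro t τ ⟨hraw, -, -, ht⟩
    refine hQ _ (by simp only [Expr.time_var]; omega) _ fun c hc => ?_
    rw [hy]
    exact hraw c hc (Nat.zero_le c)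

/-- After the pruning, all vertices left are in the last bag. Setting `vk` to 0 means that none of
them is kept, so `U` becomes empty and the answer stands at the mask 0 of the last table. -/
theorem eliminateStmt_spec (hT : Tables γ G l K D M lim e pack clamp univ univ σ)
    (hF : Forest T G l univ univ σ) (hTree : T.IsTree) (hN : 1 ≤ N) (hvN : σ.var vN = N)
    (hvi : σ.var vi = 0) (hvx' : σ.var vx = 0) (hvy' : σ.var vy = 0)
    (hleaf : ∀ R, T.PathClosed R → ∀ x ∈ R, ∀ y, (∀ u ∈ R, T.Adj x u → u = y) →
      ∀ z ∈ R, z ≠ x → ∀ v ∈ l x, v ∈ l z → v ∈ l y) (h0 : 0 ∉ γ) (hDb : D ≤ base)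
    (hQ : ∀ t ≤ unitTime K D * (n + 4 * N + 1), ∀ τ, (∀ c < D,
      valueCon clamp (τ.raw c)
        (PowerSeries.coeff c (weightSum γ G pack (PowerSeries.X ^ e : PowerSeries ℕ) univ)) ∧
      (clamp → τ.raw c ≤ 1)) → Q t τ) :
    Sp M base (eliminateStmt pack clamp e) σ Q := by
  refine Sp.seq (pruneStmt_spec hT hF hTree hN hvN hvi hvx' hvy' hleaf fun t σ₁ y U hT₁ hF₁ hy ht => ?_)
  have hN' := hT.env.N_le
  refine Sp.seq (Sp.set trivial (by simp only [Expr.eval_var, hy]; have := y.2; omega) ?_)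
  refine Sp.seq (Sp.set trivial (Nat.zero_le _) ?_)
  simp only [Expr.eval_var, hy, Expr.eval_zero]
  have hT₂ : Tables γ G l K D M lim e pack clamp {y} U ((σ₁.setVar vx y).setVar vk 0) :=
    hT₁.congr (fun _ _ _ _ => rfl) (by simp [Store.setVar_var])
  have hxy : ∀ z ∈ ({y} : Finset (Fin N)), z ≠ y → False := fun z hz h => h (mem_singleton.1 hz)
  refine Sp.seq (hT₂.forgetAll (Y := ∅) (mem_singleton_self y) (by simp [Store.setVar_var])
    (Or.inl ⟨by simp [Store.setVar_var], rfl⟩) (hF₁.sub y (mem_singleton_self y))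
    (fun z hz hzy => (hxy z hz hzy).elim) hF₁.edge fun t' σ₂ hfr hT₃ ht' => ?_)
  have hU : U \ ((l y).toFinset \ ∅) = ∅ := by
    rw [sdiff_empty, sdiff_eq_empty_iff_subset]
    intro v hv
    obtain ⟨z, hz, hvz⟩ := hF₁.cover v hv
    rw [mem_singleton] at hz
    simpa [hz] using hvz
  rw [hU] at hT₃ ht'
  have hx₂ : σ₂.var vx = y := by
    rw [hfr.var vx (by rw [forgetAllStmt_wVars]; decide)]; simp [Store.setVar_var]
  obtain ⟨h, hb, hbd⟩ := hT₃.bound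
  have hbd' : ∀ c < D, σ₂.arr 9 y 0 c ≤ growth K D ^ h y := fun c hc =>
    hbd y (mem_singleton_self y) ∅ (empty_subset _) c hc
  have hlim : h y ≤ lim := by
    cases clamp
    · simp only [Budget, Bool.false_eq_true, if_false, sum_singleton] at hb
      omega
    · simp only [Budget, if_true] at hb
      rw [hb.2 y]; exact Nat.zero_le _
  have hg : 1 ≤ growth K D := one_le_growth hT.env.D_pos
  refine outputStmt_spec ⟨y, hx₂, fun c hc => (hbd' c hc).trans
    ((Nat.pow_le_pow_right hg hlim).trans hT.growth_le)⟩ hT₃.env.var_D hT.env.D_le hDb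
    fun t'' ht'' τ hτ => hQ _ ?_ _ ?_
  · have h1 := sq_le_stepTime (K := K) hT.env.D_pos
    have h2 : D ≤ stepTime K D := by
      rw [stepTime]
      have : D ≤ D ^ 2 := Nat.le_self_pow (by norm_num) D
      exact this.trans (Nat.le_mul_of_pos_left _ (by positivity))
    have h3 := one_le_stepTime (K := K) hT.env.D_pos
    simp only [Expr.time_var, Expr.time_zero, card_empty, mul_zero, add_zero] at ht' ⊢
    have h4 : unitTime K D * U.card = 330000 * stepTime K D * U.card + 100 * stepTime K D * U.card := by
      rw [unitTime]; ring
    have h5 : unitTime K D * (n + 4 * N + 1) = unitTime K D * (n + 4 * N) + 330100 * stepTime K D := by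
      rw [unitTime]; ring
    omega
  · intro c hc
    rw [hτ c hc, hx₂]
    constructor
    · have := hT₃.value
      rw [forestSum_singleton h0, nodeFun, tableFun, if_pos (empty_subset _), ← map_weightSum,
        truncation_eq_iff] at this
      have := this c hc
      rwa [PowerSeries.coeff_mk] at this
    · intro hcl
      subst hcl
      simp only [Budget, if_true] at hb
      have := hbd' c hc
      rwa [hb.2 y, pow_zero] at this

end

end RAM

namespace RAM

open Finset

/-! ### Reading the input -/

/-- The first cells of the input. -/
def headStmt (e : ℕ) : Stmt :=
  .seq (.set vn (.inp 0)) <| .seq (.set vE (.inp 1)) <| .seq (.set vN (.inp (.lit 2))) <|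
  .set vD (.lit e * .var vn + 1)

/-- The adjacency matrix. -/
def adjacencyStmt : Stmt :=
  .seq (.forTo vr (.var vn) (.put 4 (.var vr) (.var vr) 0 1)) <|
  .forTo vr (.var vE) <|
    .seq (.put 4 (.inp (.lit 3 + .lit 2 * .var vr)) (.inp (.lit 4 + .lit 2 * .var vr)) 0 1)
      (.put 4 (.inp (.lit 4 + .lit 2 * .var vr)) (.inp (.lit 3 + .lit 2 * .var vr)) 0 1)

/-- Registration of the neighbor `v` of the node `u`. -/
def neighborStmt (u v : Expr) : Stmt :=
  .seq (.put 5 u 0 0 (.get 5 u 0 0 + 1)) (.put 6 u 0 0 (.get 6 u 0 0 + v))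

/-- The numbers and the sums of the neighbors in the tree. -/
def treeStmt : Stmt :=
  .forTo vr (.var vN - 1) <|
    .seq (neighborStmt (.inp (.lit 3 + .lit 2 * .var vE + .lit 2 * .var vr)) (.inp (.lit 4 + .lit 2 * .var vE + .lit 2 * .var vr)))
      (neighborStmt (.inp (.lit 4 + .lit 2 * .var vE + .lit 2 * .var vr)) (.inp (.lit 3 + .lit 2 * .var vE + .lit 2 * .var vr)))

/-- The bag `vx`, which starts at cell `vP`, the size of the largest bag, and an initial table. -/
def oneBagStmt : Stmt :=
  .seq (.put 3 (.var vx) 0 0 (.inp (.var vP))) <|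
  .seq (.forTo vq (.inp (.var vP)) (.put 2 (.var vx) (.var vq) 0 (.inp (.var vP + 1 + .var vq)))) <|
  .seq (.put 9 (.var vx) 0 0 1) <| .seq (.set vK (.var vK + (.inp (.var vP) - .var vK))) <|
  .set vP (.var vP + 1 + .inp (.var vP))

/-- The bags, the size of the largest bag, and the initial tables. -/
def bagStmt : Stmt :=
  .seq (.set vP (1 + .lit 2 * .var vE + .lit 2 * .var vN)) <| .forTo vr (.var vN) <|
  .seq (.set vx (.var vN - (.var vr + 1))) oneBagStmt

/-- The tables of the bits and of the powers of two. -/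
def bitStmt : Stmt :=
  .seq (.put 8 0 0 0 1) <| .forTo vr (.var vK) <|
  .seq (.set vm (.var vK - (.var vr + 1))) <|
  .seq (fill 12 0 (.get 8 (.var vm) 0 0) (.var vK) 1 (.get 7 (.var 0) (.var 1) 0)) <|
  .seq (fill 7 (.get 8 (.var vm) 0 0) (.get 8 (.var vm) 0 0) (.var vK) 1
    (.get 12 (.var 0) (.var 1) 0 + .eqv (.var 1) (.var vm))) <|
  .put 8 (.var vm + 1) 0 0 (.lit 2 * .get 8 (.var vm) 0 0)

/-- The first part of the algorithm. -/
def readStmt (e : ℕ) : Stmt :=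
  .seq (headStmt e) <| .seq adjacencyStmt <| .seq treeStmt <| .seq bagStmt <| .seq bitStmt <|
  .set vx 0

/-- The contents of the input cells. The bag `x` starts at cell `ptr x`. -/
structure Layout {n N : ℕ} (es : List (Fin n × Fin n)) (ts : List (Fin N × Fin N))
    (l : Fin N → List (Fin n)) (ptr : ℕ → ℕ) (base : ℕ) (raw : ℕ → ℕ) : Prop where
  head : raw 0 = n ∧ raw 1 = es.length ∧ raw 2 = N
  edge : ∀ i (hi : i < es.length), raw (3 + 2 * i) = es[i].1 ∧ raw (4 + 2 * i) = es[i].2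
  treeEdge : ∀ i (hi : i < ts.length), raw (3 + 2 * es.length + 2 * i) = ts[i].1 ∧
    raw (4 + 2 * es.length + 2 * i) = ts[i].2
  ptr_zero : ptr 0 = 3 + 2 * es.length + 2 * ts.length
  ptr_succ : ∀ x : Fin N, ptr (x + 1) = ptr x + 1 + (l x).length
  bag : ∀ x : Fin N, raw (ptr x) = (l x).length ∧
    ∀ p (hp : p < (l x).length), raw (ptr x + 1 + p) = (l x)[p]
  ptr_le : ∀ x ≤ N, ptr x ≤ base

/-! ### Correctness and cost of reading the input -/

section

variable {n N K D M base e : ℕ} {γ : Set ℕ} {G : SimpleGraph (Fin n)} {T : SimpleGraph (Fin N)}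
  {l : Fin N → List (Fin n)} {σ : Store} {Q : ℕ → Store → Prop} {es : List (Fin n × Fin n)}
  {ts : List (Fin N × Fin N)} {ptr : ℕ → ℕ}

theorem Layout.head_lt (hL : Layout es ts l ptr base σ.raw) :
    3 + 2 * es.length + 2 * ts.length ≤ base := by
  rw [← hL.ptr_zero]; exact hL.ptr_le 0 (Nat.zero_le _)

/-- The diagonal is filled as well, because the clique test compares each vertex with itself too.
Every edge is entered in both directions, since its end points are listed in an arbitrary order. -/
theorem adjacencyStmt_spec (hL : Layout es ts l ptr base σ.raw) (hes : TreeDecomposition.ListsEdges G es)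
    (hbM : base ≤ M) (hnM : n ≤ M) (hn : σ.var vn = n) (hE : σ.var vE = es.length)
    (h4 : ∀ i j k, σ.arr 4 i j k = 0)
    (hQ : ∀ t ≤ 10 * n + 40 * es.length + 10, ∀ f, (∀ u v : Fin n, u = v ∨ G.Adj u v → f u v 0 = 1) →
      (∀ u v : Fin n, ¬ (u = v ∨ G.Adj u v) → f u v 0 = 0) → Q t (σ.setArr 4 f)) :
    Sp M base adjacencyStmt σ Q := by
  have hb := hL.head_lt
  refine Sp.seq (Sp.forTo (n := n) (fun i t τ => t + i * 10 ≤ n * 10 ∧ ∃ f u,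
    τ = (σ.setArr 4 f).setVar vr u ∧
    ∀ a b : Fin n, f a b 0 = if a = b ∧ i ≤ a then 1 else 0) trivial hn hnM ?_ ?_ ?_)
  · refine ⟨by omega, σ.arr 4, σ.var vr, by simp [Store.setArr, Store.setVar], fun a b => ?_⟩
    rw [h4, if_neg]
    rintro ⟨-, h⟩
    have := a.2
    omega
  · rintro i hi t _ ⟨ht, f, u, rfl, hf⟩
    refine Sp.put (by norm_num) trivial trivial trivial trivial (by simp; omega)
      ⟨by simp; omega, entryUpdate f i i 0 1, i, ?_, fun a b => ?_⟩
    · simp [Store.setVar, Store.setArr]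
    · rw [entryUpdate, hf]
      by_cases h : (a : ℕ) = i ∧ (b : ℕ) = i
      · have : a = b := Fin.ext (h.1.trans h.2.symm)
        rw [if_pos ⟨h.1, h.2, rfl⟩, if_pos ⟨this, h.1.ge⟩]
      · rw [if_neg fun h' => h ⟨h'.1, h'.2.1⟩]
        refine if_congr ⟨fun h' => ⟨h'.1, by omega⟩, fun h' => ⟨h'.1, ?_⟩⟩ rfl rfl
        have : (a : ℕ) ≠ i := fun h'' => h ⟨h'', by rw [← h'.1, h'']⟩
        omega
  rintro t _ ⟨ht, f₀, u, rfl, hf₀⟩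
  rw [Store.setVar_setVar, show ((σ.setArr 4 f₀).setVar vr (σ.var vr)) = σ.setArr 4 f₀ from
    Store.setVar_var_self _ _]
  refine Sp.forTo (n := es.length) (fun i t τ => t + i * 40 ≤ es.length * 40 ∧ ∃ f u,
    τ = (σ.setArr 4 f).setVar vr u ∧ ∀ a b : Fin n, f a b 0 =
      if a = b ∨ s(a, b) ∈ (es.drop i).map (fun e => s(e.1, e.2)) then 1 else 0) trivial hE
    (by omega) ?_ ?_ ?_
  · refine ⟨by omega, f₀, σ.var vr, (Store.setVar_var_self _ _).symm, fun a b => ?_⟩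
    rw [hf₀]
    simp
  · rintro i hi t _ ⟨ht, f, u, rfl, hf⟩
    obtain ⟨e1, e2⟩ := hL.edge i hi
    rw [Store.setVar_setVar]
    set a := es[i].1
    set b := es[i].2
    refine Sp.seq (Sp.put (by norm_num) ?_ ?_ trivial trivial (by simp; omega) ?_)
    · exact ⟨⟨trivial, trivial, trivial⟩, by simp [Store.setVar_var]; omega⟩
    · exact ⟨⟨trivial, trivial, trivial⟩, by simp [Store.setVar_var]; omega⟩
    refine Sp.put (by norm_num) ?_ ?_ trivial trivial (by simp; omega) ?_
    · exact ⟨⟨trivial, trivial, trivial⟩, by simp [Store.setVar_var]; omega⟩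
    · exact ⟨⟨trivial, trivial, trivial⟩, by simp [Store.setVar_var]; omega⟩
    refine ⟨by simp; omega, entryUpdate (entryUpdate f a b 0 1) b a 0 1, i, ?_, fun x y => ?_⟩
    · simp [Store.setVar, Store.setArr, e1, e2]
    · simp only [List.drop_eq_getElem_cons hi, List.map_cons, List.mem_cons, Sym2.eq_iff, entryUpdate, hf, and_true, Fin.val_inj]
      split_ifs <;> first | rfl | tauto
  · rintro t' _ ⟨ht', f, u, rfl, hf⟩
    rw [Store.setVar_setVar, show ((σ.setArr 4 f).setVar vr ((σ.setArr 4 f₀).var vr)) = σ.setArr 4 f from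
      Store.setVar_var_self _ _]
    have key : ∀ a b : Fin n, s(a, b) ∈ (es.drop 0).map (fun e => s(e.1, e.2)) ↔ G.Adj a b := fun a b => by
      rw [List.drop_zero, hes.2, SimpleGraph.mem_edgeSet]
    refine hQ _ (by simp; omega) f (fun a b h => ?_) fun a b h => ?_
    · rw [hf, if_pos (h.imp id (key a b).2)]
    · rw [hf, if_neg fun h' => h (h'.imp id (key a b).1)]

/-- The sum of `f` over the neighbors of `z`, for a list of edges. -/
def neighborSum (L : List (Fin N × Fin N)) (f : Fin N → ℕ) (z : Fin N) : ℕ :=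
  (L.map fun e => (if z = e.1 then f e.2 else 0) + if z = e.2 then f e.1 else 0).sum

/-- Every edge is listed once, so no neighbor is counted twice; its ends are distinct, so at most
one of the two terms of an edge applies to `z`. -/
theorem neighborSum_eq (f : Fin N → ℕ) (z : Fin N) : ∀ {L : List (Fin N × Fin N)},
    (∀ e ∈ L, e.1 ≠ e.2) → (L.map fun e => s(e.1, e.2)).Nodup →
    neighborSum L f z = ∑ u ∈ univ.filter fun u => s(z, u) ∈ L.map (fun e => s(e.1, e.2)), f u
  | [], _, _ => by simp [neighborSum]
  | a :: L, hne, hnd => by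
    rw [List.map_cons, List.nodup_cons] at hnd
    have ih := neighborSum_eq f z (fun e he => hne e (List.mem_cons_of_mem _ he)) hnd.2
    have h1 : (univ.filter fun u => s(z, u) ∈ (a :: L).map (fun e => s(e.1, e.2))) =
        (univ.filter fun u => s(z, u) = s(a.1, a.2)) ∪
          univ.filter fun u => s(z, u) ∈ L.map (fun e => s(e.1, e.2)) := by
      ext u; simp only [List.map_cons, List.mem_cons, mem_filter, mem_union, mem_univ, true_and]
    rw [h1, sum_union, ← ih]
    · rw [neighborSum, List.map_cons, List.sum_cons]
      congr 1
      have h2 := hne a List.mem_cons_self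
      simp only [Sym2.eq_iff]
      by_cases hz1 : z = a.1
      · have hz2 : z ≠ a.2 := fun h => h2 (hz1.symm.trans h)
        simp [hz1, h2, filter_eq']
      · by_cases hz2 : z = a.2
        · simp [hz2, Ne.symm h2, filter_eq']
        · simp [hz1, hz2]
    · rw [disjoint_left]
      intro u hu hu'
      rw [mem_filter] at hu hu'
      rw [hu.2] at hu'
      exact hnd.1 hu'.2

theorem neighborSum_le {f : Fin N → ℕ} {z : Fin N} {L : List (Fin N × Fin N)} {B : ℕ}
    (hne : ∀ e ∈ L, e.1 ≠ e.2) (hnd : (L.map fun e => s(e.1, e.2)).Nodup) (hf : ∀ u, f u ≤ B) :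
    neighborSum L f z ≤ N * B := by
  rw [neighborSum_eq f z hne hnd]
  refine (sum_le_card_nsmul _ _ B fun u _ => hf u).trans ?_
  rw [smul_eq_mul]
  exact Nat.mul_le_mul_right _ ((card_le_univ _).trans (by simp))

theorem treeStmt_spec [DecidableRel T.Adj] (hL : Layout es ts l ptr base σ.raw)
    (hts : TreeDecomposition.ListsEdges T ts) (hlen : ts.length + 1 = N)
    (hbM : base ≤ M) (hNM : N * N + 2 * N ≤ M) (hN : σ.var vN = N) (hE : σ.var vE = es.length)
    (h5 : ∀ i j k, σ.arr 5 i j k = 0) (h6 : ∀ i j k, σ.arr 6 i j k = 0)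
    (hQ : ∀ t ≤ 150 * N, ∀ f g,
      (∀ z : Fin N, f z 0 0 = (univ.filter (T.Adj z)).card) →
      (∀ z : Fin N, g z 0 0 = ∑ u ∈ univ.filter (T.Adj z), (u : ℕ)) →
      Q t ((σ.setArr 5 f).setArr 6 g)) :
    Sp M base treeStmt σ Q := by
  have hb := hL.head_lt
  have hne : ∀ e ∈ ts, e.1 ≠ e.2 := fun e he => by
    have : s(e.1, e.2) ∈ T.edgeSet := (hts.2 _).1 (List.mem_map_of_mem he)
    exact ((SimpleGraph.mem_edgeSet T).1 this).ne
  have hdrop : ∀ i, (∀ e ∈ ts.drop i, e.1 ≠ e.2) ∧ ((ts.drop i).map fun e => s(e.1, e.2)).Nodup :=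
    fun i => ⟨fun e he => hne e (List.mem_of_mem_drop he),
      hts.1.sublist ((List.drop_sublist i ts).map _)⟩
  have hb5 : ∀ i z, neighborSum (ts.drop i) (fun _ => 1) z ≤ N := fun i z => by
    simpa using neighborSum_le (z := z) (hdrop i).1 (hdrop i).2 (fun _ => le_refl 1)
  have hb6 : ∀ i z, neighborSum (ts.drop i) (fun u => u) z ≤ N * N := fun i z =>
    neighborSum_le (hdrop i).1 (hdrop i).2 fun u => u.2.le
  refine Sp.forTo (n := ts.length) (fun i t τ => t + i * 140 ≤ ts.length * 140 ∧ ∃ f g u,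
      τ = ((σ.setArr 5 f).setArr 6 g).setVar vr u ∧
      (∀ z : Fin N, f z 0 0 = neighborSum (ts.drop i) (fun _ => 1) z) ∧
      ∀ z : Fin N, g z 0 0 = neighborSum (ts.drop i) (fun u => u) z) ⟨trivial, trivial⟩
    (by simp [hN]; omega) (by omega) ?_ ?_ ?_
  · refine ⟨by omega, σ.arr 5, σ.arr 6, σ.var vr, by simp [Store.setArr, Store.setVar], fun z => ?_,
      fun z => ?_⟩
    · simp [h5, neighborSum]
    · simp [h6, neighborSum]
  · rintro i hi t _ ⟨ht, f, g, u, rfl, hf, hg⟩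
    obtain ⟨e1, e2⟩ := hL.treeEdge i hi
    rw [Store.setVar_setVar]
    have hab : ts[i].1 ≠ ts[i].2 := hne _ (List.getElem_mem hi)
    have hcons : ∀ (f : Fin N → ℕ) z, neighborSum (ts.drop i) f z =
        ((if z = ts[i].1 then f ts[i].2 else 0) + if z = ts[i].2 then f ts[i].1 else 0) +
          neighborSum (ts.drop (i + 1)) f z := fun f z => by
      rw [neighborSum, List.drop_eq_getElem_cons hi, List.map_cons, List.sum_cons, neighborSum]
    set a := ts[i].1
    set b := ts[i].2
    have hab' : ¬ (b : ℕ) = a := fun h => hab (Fin.ext h.symm)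
    have c5a := hb5 i a
    have c5b := hb5 i b
    have c6a := hb6 i a
    have c6b := hb6 i b
    rw [hcons, ← hf] at c5a c5b
    rw [hcons, ← hg] at c6a c6b
    simp only [hab, hab.symm, if_true, if_false] at c5a c5b c6a c6b
    have ok : ∀ (τ : Store) (c : ℕ), τ.var vE = es.length → τ.var vr = i → c ≤ 4 →
        (Expr.inp (.lit c + .lit 2 * .var vE + .lit 2 * .var vr)).Ok base τ := by
      intro τ c h1 h2 hc
      refine ⟨⟨⟨trivial, trivial, trivial⟩, trivial, trivial⟩, ?_⟩
      simp [h1, h2]; omega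
    have ok3 : ∀ τ : Store, τ.var vE = es.length → τ.var vr = i →
      (Expr.inp (.lit 3 + .lit 2 * .var vE + .lit 2 * .var vr)).Ok base τ := fun τ h1 h2 => ok τ 3 h1 h2 (by norm_num)
    have ok4 : ∀ τ : Store, τ.var vE = es.length → τ.var vr = i →
      (Expr.inp (.lit 4 + .lit 2 * .var vE + .lit 2 * .var vr)).Ok base τ := fun τ h1 h2 => ok τ 4 h1 h2 (by norm_num)
    have hE' : ∀ f g, (((σ.setArr 5 f).setArr 6 g).setVar vr i).var vE = es.length := fun f g => by
      simp [Store.setVar_var, hE]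
    have hr' : ∀ f g, (((σ.setArr 5 f).setArr 6 g).setVar vr i).var vr = i := fun f g => by
      simp [Store.setVar_var]
    refine Sp.seq (Sp.seq (Sp.put (by norm_num) (ok3 _ (hE' f g) (hr' f g)) trivial trivial
      ⟨⟨by norm_num, ok3 _ (hE' f g) (hr' f g), trivial, trivial⟩, trivial⟩ ?_
      (Sp.put (by norm_num) (ok3 _ (hE' f g) (hr' f g)) trivial trivial
      ⟨⟨by norm_num, ok3 _ (hE' f g) (hr' f g), trivial, trivial⟩, ok4 _ (hE' f g) (hr' f g)⟩ ?_
      (Sp.seq (Sp.put (by norm_num) (ok4 _ (hE' f g) (hr' f g)) trivial trivial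
      ⟨⟨by norm_num, ok4 _ (hE' f g) (hr' f g), trivial, trivial⟩, trivial⟩ ?_
      (Sp.put (by norm_num) (ok4 _ (hE' f g) (hr' f g)) trivial trivial
      ⟨⟨by norm_num, ok4 _ (hE' f g) (hr' f g), trivial, trivial⟩, ok3 _ (hE' f g) (hr' f g)⟩ ?_ ?_))))))
    · simp [Store.setVar_var, Store.setArr_arr, hE, e1]; omega
    · simp [Store.setVar_var, Store.setArr_arr, hE, e1, e2]; omega
    · simp [Store.setVar_var, Store.setArr_arr, hE, e1, e2, entryUpdate, hab']; omega
    · simp [Store.setVar_var, Store.setArr_arr, hE, e1, e2, entryUpdate, hab']; omega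
    · refine ⟨by simp; omega, entryUpdate (entryUpdate f a 0 0 (f a 0 0 + 1)) b 0 0 (f b 0 0 + 1),
        entryUpdate (entryUpdate g a 0 0 (g a 0 0 + b)) b 0 0 (g b 0 0 + a), i, ?_, fun z => ?_,
        fun z => ?_⟩
      · ext c
        · simp [Store.setVar_var]
        · simp [Store.setVar_var, Store.setArr_arr, hE, e1, e2, entryUpdate, hab']
          split_ifs <;> rfl
        · rfl
      · rw [hcons, ← hf]
        simp only [entryUpdate, and_true, Fin.val_inj]
        split_ifs with h1 h2 h2
        · exact absurd (h2.symm.trans h1) hab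
        · rw [h1]; omega
        · rw [h2]; omega
        · omega
      · rw [hcons, ← hg]
        simp only [entryUpdate, and_true, Fin.val_inj]
        split_ifs with h1 h2 h2
        · exact absurd (h2.symm.trans h1) hab
        · rw [h1]; omega
        · rw [h2]; omega
        · omega
  · rintro t _ ⟨ht, f, g, u, rfl, hf, hg⟩
    rw [Store.setVar_setVar, show (((σ.setArr 5 f).setArr 6 g).setVar vr (σ.var vr)) =
      (σ.setArr 5 f).setArr 6 g from Store.setVar_var_self _ _]
    have key : ∀ (f : Fin N → ℕ) z, neighborSum (ts.drop 0) f z = ∑ u ∈ univ.filter (T.Adj z), f u :=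
      fun f z => by
        rw [neighborSum_eq f z (hdrop 0).1 (hdrop 0).2]
        refine sum_congr (filter_congr fun u _ => ?_) fun _ _ => rfl
        rw [List.drop_zero, hts.2, SimpleGraph.mem_edgeSet]
    refine hQ _ (by simp; omega) f g (fun z => ?_) fun z => ?_
    · rw [hf, key]; simp
    · rw [hg, key]

theorem oneBagStmt_spec (hL : Layout es ts l ptr base σ.raw) (hbM : base ≤ M) (hnM : n ≤ M) (x : Fin N)
    (hx : σ.var vx = x) (hP : σ.var vP = ptr x)
    (hQ : ∀ t ≤ 40 + 20 * (l x).length, ∀ τ : Store, τ.raw = σ.raw → τ.var vN = σ.var vN →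
      τ.var vP = ptr (x + 1) → τ.var vK = max (σ.var vK) (l x).length →
      τ.arr 3 = entryUpdate (σ.arr 3) x 0 0 (l x).length →
      τ.arr 9 = entryUpdate (σ.arr 9) x 0 0 1 →
      (∀ p (hp : p < (l x).length), τ.arr 2 x p 0 = (l x)[p]) →
      (∀ z ≠ (x : ℕ), τ.arr 2 z = σ.arr 2 z) → Q t τ) (hKM : σ.var vK ≤ M) :
    Sp M base oneBagStmt σ Q := by
  obtain ⟨h1, h2⟩ := hL.bag x
  have hle := hL.ptr_le (x + 1) x.2
  have hs := hL.ptr_succ x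
  refine Sp.seq (Sp.put (by norm_num) trivial trivial trivial ⟨trivial, ?_⟩ ?_ ?_)
  · simp [hP]; omega
  · simp [hP, h1]; omega
  simp only [Expr.eval_inp, Expr.eval_var, Expr.eval_zero, hx, hP, h1]
  set σ₁ := σ.setArr 3 (entryUpdate (σ.arr 3) x 0 0 (l x).length) with hσ₁
  refine Sp.seq (Sp.forTo (n := (l x).length) (fun i t τ => t + i * 12 ≤ (l x).length * 12 ∧ ∃ f u,
    τ = (σ₁.setArr 2 f).setVar vq u ∧ (∀ p (hp : p < (l x).length), i ≤ p → f x p 0 = (l x)[p]) ∧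
      ∀ z ≠ (x : ℕ), f z = σ.arr 2 z) ⟨trivial, ?_⟩ ?_ (by omega) ?_ ?_ ?_)
  · simp [hσ₁, hP]; omega
  · simp [hσ₁, hP, h1]
  · refine ⟨by omega, σ.arr 2, σ.var vq, ?_, fun p hp hp' => by omega, fun _ _ => rfl⟩
    ext a <;> simp [hσ₁, Store.setVar_var, Store.setArr_arr]
    · rintro rfl; rfl
    · split_ifs with h1 h2 h2 <;> first | rfl | omega | rw [h2]
  · rintro i hi t _ ⟨ht, f, u, rfl, hf, hf'⟩
    rw [Store.setVar_setVar]
    refine Sp.put (by norm_num) trivial trivial trivial ⟨⟨⟨trivial, trivial⟩, trivial⟩, ?_⟩ ?_ ?_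
    · simp [hσ₁, Store.setVar_var, hP]; omega
    · simp [hσ₁, Store.setVar_var, hP, h2 i hi]
      exact ((l x)[i].2.le).trans hnM
    · refine ⟨by simp; omega, entryUpdate f x i 0 (l x)[i], i, ?_, fun p hp hp' => ?_, fun z hz => ?_⟩
      · ext <;> simp [hσ₁, Store.setVar_var, Store.setArr_arr, hx, hP, h2 i hi]
        split_ifs <;> rfl
      · by_cases h : p = i
        · subst h; simp [entryUpdate]
        · rw [entryUpdate, if_neg fun h' => h h'.2.1, hf p hp (by omega)]
      · funext p c
        rw [entryUpdate, if_neg fun h' => hz h'.1, hf' z hz]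
  · rintro t _ ⟨ht, f, u, rfl, hf, hf'⟩
    rw [Store.setVar_setVar, show ((σ₁.setArr 2 f).setVar vq (σ₁.var vq)) = σ₁.setArr 2 f from
      Store.setVar_var_self _ _]
    refine Sp.seq (Sp.put (by norm_num) trivial trivial trivial trivial (by simp; omega) ?_)
    refine Sp.seq (Sp.set ⟨trivial, ⟨trivial, ?_⟩, trivial⟩ ?_ ?_)
    · simp [hσ₁, hP]; omega
    · simp [hσ₁, hP, h1]; omega
    refine Sp.set ⟨⟨trivial, trivial⟩, trivial, ?_⟩ ?_ ?_
    · simp [hσ₁, hP, Store.setVar_var]; omega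
    · simp [hσ₁, hP, h1, Store.setVar_var]; omega
    · refine hQ _ ?_ _ rfl ?_ ?_ ?_ ?_ ?_ (fun p hp => ?_) (fun z hz => ?_)
      · simp; omega
      all_goals simp [hσ₁, hP, h1, Store.setVar_var, Store.setArr_arr, hx, hs]
      · omega
      · exact hf p hp (Nat.zero_le _)
      · exact hf' z hz

/-- The first cell of a bag depends on the sizes of all bags before it. The bags are therefore read
in increasing order although the loop counts down. By `hKmin`, the maximum of the sizes found is
exactly `K`. -/
theorem bagStmt_spec (hL : Layout es ts l ptr base σ.raw) (hlen : ts.length + 1 = N)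
    (hbM : base ≤ M) (hnM : n ≤ M) (hNM : N ≤ M) (hN : σ.var vN = N) (hE : σ.var vE = es.length)
    (hK : σ.var vK = 0) (hlK : ∀ x, (l x).length ≤ K) (hKmin : ∀ B, (∀ x, (l x).length ≤ B) → K ≤ B)
    (hKM : K ≤ M) (h9 : ∀ i j k, σ.arr 9 i j k = 0)
    (hQ : ∀ t ≤ N * (60 + 20 * K) + 20, ∀ τ : Store, τ.var vK = K →
      (∀ x p (hp : p < (l x).length), τ.arr 2 x p 0 = (l x)[p]) →
      (∀ x : Fin N, τ.arr 3 x 0 0 = (l x).length) →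
      (∀ (x : Fin N) X c, τ.arr 9 x X c = if X = 0 ∧ c = 0 then 1 else 0) → Q t τ) :
    Sp M base bagStmt σ Q := by
  have hp0 := hL.ptr_zero
  have hb := hL.head_lt
  refine Sp.seq (Sp.set ⟨⟨trivial, trivial, trivial⟩, trivial, trivial⟩ (by simp [hN, hE]; omega) ?_)
  refine Sp.forTo (n := N) (fun i t τ => i ≤ N ∧ t + i * (60 + 20 * K) ≤ N * (60 + 20 * K) ∧
    τ.raw = σ.raw ∧ τ.var vN = N ∧ τ.var vP = ptr (N - i) ∧ τ.var vK ≤ K ∧ ∀ x : Fin N,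
      (if (x : ℕ) < N - i then (l x).length ≤ τ.var vK ∧
        (∀ p (hp : p < (l x).length), τ.arr 2 x p 0 = (l x)[p]) ∧ τ.arr 3 x 0 0 = (l x).length ∧
        ∀ X c, τ.arr 9 x X c = if X = 0 ∧ c = 0 then 1 else 0 else ∀ X c, τ.arr 9 x X c = 0))
      trivial (by simp [hN, Store.setVar_var]) hNM ?_ ?_ ?_
  · refine ⟨le_rfl, by omega, rfl, by simp [Store.setVar_var, hN], ?_, ?_, fun x => ?_⟩
    · simp [Store.setVar_var, hN, hE, hp0]; omega
    · simp [Store.setVar_var, hK]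
    · rw [if_neg (by omega)]
      intro X c
      exact h9 _ _ _
  · rintro i hi t τ ⟨-, ht, hraw, hvN, hvP, hvK, hx⟩
    refine Sp.seq (Sp.set ⟨trivial, trivial, trivial⟩ (by simp [Store.setVar_var, hvN]; omega) ?_)
    set x : Fin N := ⟨N - (i + 1), by omega⟩ with hxd
    refine oneBagStmt_spec (l := l) (es := es) (ts := ts) (ptr := ptr) (by simpa [hraw] using hL) hbM hnM x
      (by simp [Store.setVar_var, hvN, hxd]) (by simp [Store.setVar_var, hvP, hxd]) ?_
      (by simp [Store.setVar_var]; omega)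
    intro t' ht' τ' h1 h2 h3 h4 h5 h6 h7 h8
    simp only [Store.setVar_arr, Store.setVar_raw, Store.setVar_var] at h1 h2 h4 h5 h6 h8
    norm_num at h2 h4
    have e1 : (i + 1) * (60 + 20 * K) = i * (60 + 20 * K) + (60 + 20 * K) := by ring
    have e2 := hlK x
    refine ⟨by omega, by simp; omega, h1.trans hraw, h2.trans hvN, ?_, ?_, fun z => ?_⟩
    · rw [h3]; congr 1; simp only [hxd]; omega
    · rw [h4]; exact max_le hvK e2
    · by_cases hz : z = x
      · subst hz
        have := hx x
        rw [if_neg (by simp [hxd])] at this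
        rw [if_pos (by simp only [hxd]; omega)]
        refine ⟨h4 ▸ le_max_right _ _, h7, by rw [h5]; simp [entryUpdate], fun X c => ?_⟩
        rw [h6, entryUpdate, this]
        simp
      · have hz' : (z : ℕ) ≠ x := fun h => hz (Fin.ext h)
        have := hx z
        have hz2 : (z : ℕ) ≠ N - (i + 1) := hz'
        simp only [h8 z hz', h5, h6, entryUpdate, hz', false_and, if_false, h4]
        split_ifs with hlt
        · rw [if_pos (by omega)] at this
          exact ⟨this.1.trans (le_max_left _ _), this.2⟩
        · rw [if_neg (by omega)] at this
          exact this
  · rintro t τ ⟨-, ht, hraw, hvN, hvP, hvK, hx⟩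
    have hx' : ∀ x : Fin N, _ := fun x => by
      have := hx x
      rw [if_pos (by omega)] at this
      exact this
    have hKK : τ.var vK = K := le_antisymm hvK (hKmin _ fun x => (hx' x).1)
    refine hQ _ (by simp; omega) _ ?_ (fun x => (hx' x).2.1) (fun x => (hx' x).2.2.1)
      fun x => (hx' x).2.2.2
    simpa [Store.setVar_var] using hKK

/-- The machine has no bit operations, so the table is built by doubling: the mask `2 ^ m + X` with
`X < 2 ^ m` has the bits of `X` and, in addition, the bit `m`. Array 12 serves as a buffer, since an
assignment cannot read its own target. -/
theorem bitStmt_spec (hK : σ.var vK = K) (hM : 2 ≤ M) (hKM : K + 1 ≤ M) (hpow : 2 ^ K ≤ M)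
    (h7 : ∀ i j k, σ.arr 7 i j k = 0)
    (hQ : ∀ t ≤ 10000 * ((K + 1) * 2 ^ K), ∀ τ, BitTables K τ → Q t τ) :
    Sp M base bitStmt σ Q := by
  refine Sp.seq (Sp.put (by norm_num) trivial trivial trivial trivial (by simp; omega) ?_)
  -- The costs of the rounds form a geometric progression; with the summand `9000 * (K + 1)`
  -- included, the bound on the total simply doubles in each round.
  refine Sp.forTo (n := K) (fun i t τ => i ≤ K ∧ t + 9000 * (K + 1) ≤ 9000 * ((K + 1) * 2 ^ (K - i)) ∧
    τ.var vK = K ∧ (∀ s ⊆ range (K - i), ∀ j < K, τ.arr 7 (code s) j 0 = if j ∈ s then 1 else 0) ∧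
    ∀ j ≤ K - i, τ.arr 8 j 0 0 = 2 ^ j) trivial (by simp [hK]) (by omega) ?_ ?_ ?_
  · refine ⟨le_rfl, by simp, hK, fun s hs j hj => ?_, fun j hj => ?_⟩
    · rw [Nat.sub_self, range_zero, subset_empty] at hs
      subst hs
      simp [Store.setArr_arr, h7]
    · obtain rfl : j = 0 := by omega
      simp [Store.setArr_arr, entryUpdate]
  · rintro i hi t τ ⟨-, ht, hvK, hb, hp⟩
    obtain ⟨m, hm⟩ : ∃ m, m = K - (i + 1) := ⟨_, rfl⟩
    rw [← hm] at ht hb hp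
    have hmK : K - i = m + 1 := by omega
    have hp2 : 2 ^ m ≤ M := (Nat.pow_le_pow_right (by norm_num) (by omega)).trans hpow
    refine Sp.seq (Sp.set ⟨trivial, trivial, trivial⟩ (by simp [Store.setVar_var, hvK]; omega) ?_)
    have e1 : (Expr.var vK - (.var vr + 1)).eval (τ.setVar vr i) = m := by
      simp [Store.setVar_var, hvK, hm]
    rw [e1]
    set τ₁ := (τ.setVar vr i).setVar vm m with hτ₁
    have e8 : (Expr.get 8 (.var vm) 0 0).eval τ₁ = 2 ^ m := by
      simp [hτ₁, Store.setVar_var, hp m le_rfl]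
    have eK : (Expr.var vK).eval τ₁ = K := by simp [hτ₁, Store.setVar_var, hvK]
    have hb1 : ∀ X < 2 ^ m, ∀ j < K, τ.arr 7 X j 0 ≤ 1 := fun X hX j hj => by
      obtain ⟨s, hs, rfl⟩ := exists_code hX
      rw [hb s hs j hj]; split_ifs <;> omega
    refine Sp.seq (Sp.fill (I' := 0) (n₁ := 2 ^ m) (n₂ := K) (n₃ := 1) (tv := 4) (by norm_num)
      Expr.Steady.zero (Expr.Steady.get (by norm_num) (by norm_num) (by norm_num))
      (Expr.Steady.var (by norm_num)) Expr.Steady.one rfl e8 eK rfl hp2 (by omega) (by omega) rfl rfl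
      (fun X hX j hj c hc => ⟨?_, by simp⟩) fun t₁ ht₁ => ?_)
    · have := hb1 X hX j hj
      simp [hτ₁, Store.setVar_var]; omega
    set τ₂ := τ₁.setArr 12 (boxUpdate (τ₁.arr 12) 0 (2 ^ m) K 1 fun i j k =>
      (Expr.get 7 (.var 0) (.var 1) 0).eval (((τ₁.setVar 0 i).setVar 1 j).setVar 2 k))
    have h12 : ∀ X < 2 ^ m, ∀ j < K, τ₂.arr 12 X j 0 = τ.arr 7 X j 0 := fun X hX j hj => by
      simp [τ₂, hτ₁, Store.setArr_arr, Store.setVar_var, boxUpdate, hX, hj]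
    have h7₂ : τ₂.arr 7 = τ.arr 7 := rfl
    have h8₂ : τ₂.arr 8 = τ.arr 8 := rfl
    have hvm : τ₂.var vm = m := rfl
    have hvK₂ : τ₂.var vK = K := hvK
    clear_value τ₂
    have e8' : (Expr.get 8 (.var vm) 0 0).eval τ₂ = 2 ^ m := by simp [hvm, h8₂, hp m le_rfl]
    have eK' : (Expr.var vK).eval τ₂ = K := hvK₂
    refine Sp.seq (Sp.fill (I' := 2 ^ m) (n₁ := 2 ^ m) (n₂ := K) (n₃ := 1) (tv := 20) (by norm_num)
      (Expr.Steady.get (by norm_num) (by norm_num) (by norm_num))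
      (Expr.Steady.get (by norm_num) (by norm_num) (by norm_num))
      (Expr.Steady.var (by norm_num)) Expr.Steady.one e8' e8' eK' rfl hp2 (by omega) (by omega) (by rfl)
      (by rfl) (fun X hX j hj c hc => ⟨?_, by simp⟩) fun t₂ ht₂ => ?_)
    · have := hb1 X hX j hj
      rw [← h12 X hX j hj] at this
      simp [Store.setVar_var]
      split_ifs <;> omega
    refine Sp.put (by norm_num) ⟨trivial, trivial⟩ trivial trivial ⟨trivial, by norm_num, trivial, trivial, trivial⟩
      ?_ ?_
    · have : 2 * 2 ^ m ≤ M := by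
        rw [← pow_succ']; exact (Nat.pow_le_pow_right (by norm_num) (by omega)).trans hpow
      simp [Store.setArr_arr, hvm, h8₂, hp m le_rfl, this]
    · rw [hmK]
      refine ⟨by omega, ?_, ?_, fun s hs j hj => ?_, fun j hj => ?_⟩
      · simp
        have h1 : (2 ^ m + 1) * (K + 1) * (1 + 1) * (4 + 1) ≤ 20 * ((K + 1) * 2 ^ m) := by
          have : 1 ≤ 2 ^ m := Nat.one_le_two_pow
          nlinarith
        have h2 : (2 ^ m + 1) * (K + 1) * (1 + 1) * (20 + 1) ≤ 84 * ((K + 1) * 2 ^ m) := by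
          have : 1 ≤ 2 ^ m := Nat.one_le_two_pow
          nlinarith
        have h3 : 1 ≤ (K + 1) * 2 ^ m := Nat.mul_pos (by omega) (by positivity)
        have h4 : (K + 1) * 2 ^ (m + 1) = 2 * ((K + 1) * 2 ^ m) := by ring
        rw [h4]
        replace ht₁ := ht₁.trans (Nat.mul_le_mul_left 40 h1)
        replace ht₂ := ht₂.trans (Nat.mul_le_mul_left 40 h2)
        clear h1 h2 h4
        generalize (K + 1) * 2 ^ m = Y at *
        generalize 9000 * (K + 1) = Z at *
        omega
      · simp [hvK₂]
      · rw [Store.setArr_arr, if_neg (by norm_num), Store.setArr_arr, if_pos rfl, h7₂]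
        by_cases hms : m ∈ s
        · have hs' : s.erase m ⊆ range m := fun x hx => by
            have := mem_range.1 (hs (mem_of_mem_erase hx))
            have := ne_of_mem_erase hx
            simp; omega
          have hc := code_erase hms
          have hlt := code_lt hs'
          have hge : 2 ^ m ≤ code s := single_le_sum (f := fun i => 2 ^ i) (fun _ _ => Nat.zero_le _) hms
          rw [boxUpdate, if_pos ⟨hge, by omega, hj, by omega⟩]
          have := h12 _ hlt j hj
          rw [hb _ hs' j hj, hc] at this
          simp only [Expr.eval_add, Expr.eval_get, Expr.eval_eqv, Expr.eval_var, Expr.eval_zero,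
            Store.setVar_var, Store.setVar_arr]
          norm_num
          rw [this, hvm]
          by_cases hjm : j = m
          · simp [hjm, hms]
          · simp [hjm]
        · have hs' : s ⊆ range m := fun x hx => by
            have := mem_range.1 (hs hx)
            have : x ≠ m := fun h => hms (h ▸ hx)
            simp; omega
          have hlt := code_lt hs'
          rw [boxUpdate, if_neg (by omega), hb s hs' j hj]
      · simp [Store.setArr_arr, entryUpdate, h8₂, hvm, hp m le_rfl]
        split_ifs with h
        · rw [h, pow_succ']
        · exact hp j (by omega)
  · rintro t τ ⟨-, ht, hvK, hb, hp⟩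
    refine hQ _ ?_ _ ⟨hb, hp⟩
    have : 1 ≤ (K + 1) * 2 ^ K := Nat.mul_pos (by omega) (by positivity)
    simp only [Nat.sub_zero] at ht
    simp
    omega

/-- A bound on the time for reading the input. -/
def readTime (n E N K : ℕ) : ℕ := 10 * n + 40 * E + 250 * (N * (K + 1)) + 10100 * ((K + 1) * 2 ^ K)

/-- The answers to the questions `j ∈ γ` are written by machine code outside the structured
language. The invariant is thus promised for every later store that contains these answers, has the
same `vD` and agrees with the present store except on the arrays 0 and 1. -/
theorem readStmt_spec [DecidableRel T.Adj] {lim : ℕ} {pack clamp : Bool}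
    (hL : Layout es ts l ptr base σ.raw) (hes : TreeDecomposition.ListsEdges G es)
    (hts : TreeDecomposition.ListsEdges T ts) (hlen : ts.length + 1 = N)
    (hbM : base ≤ M) (hnM : n ≤ M) (hD : e * n + 1 = D) (hDM : D ≤ M) (hKM : K + 1 ≤ M)
    (hpow : 2 ^ K ≤ M) (hNM : N * N + 2 * N ≤ M) (hlK : ∀ x, (l x).length ≤ K)
    (hKmin : ∀ B, (∀ x, (l x).length ≤ B) → K ≤ B) (hnd : ∀ x, (l x).Nodup)
    (hcover : ∀ v, ∃ z, v ∈ l z) (hedge : ∀ u v, G.Adj u v → ∃ z, u ∈ l z ∧ v ∈ l z)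
    (hbud : Budget clamp lim (fun _ => 0) (univ : Finset (Fin N)) (univ : Finset (Fin n)))
    (hgrow : growth K D ^ lim ≤ M)
    (hv : ∀ x, σ.var x = 0) (ha : ∀ a i j k, σ.arr a i j k = 0)
    (hQ : ∀ t ≤ readTime n es.length N K, ∀ τ : Store, τ.raw = σ.raw → τ.var vK = K → τ.var vN = N →
      τ.var vx = 0 → τ.var vy = 0 → τ.var vi = 0 → (∀ τ' : Store, (∀ a, a ≠ 0 → a ≠ 1 → τ'.arr a = τ.arr a) →
        τ'.var vD = τ.var vD → (∀ j ≤ K, τ'.arr 1 j 0 0 = answer (j ∈ γ)) →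
        Tables γ G l K D M lim e pack clamp univ univ τ' ∧ Forest T G l univ univ τ') → Q t τ) :
    Sp M base (readStmt e) σ Q := by
  have hb := hL.head_lt
  obtain ⟨r0, r1, r2⟩ := hL.head
  have hN1 : 1 ≤ N := by omega
  have hM3 : 3 ≤ M := by nlinarith
  have hNM' : N ≤ M := by nlinarith
  refine Sp.seq (Sp.imp_frame (Q := fun t τ => t ≤ 20 ∧ τ.var vn = n ∧ τ.var vE = es.length ∧
    τ.var vN = N ∧ τ.var vD = D) ?_ fun t₀ σ₀ hf₀ ⟨ht₀, hvn, hvE, hvN, hvD⟩ => ?_)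
  · refine Sp.seq (Sp.set ⟨trivial, by simp; omega⟩ (by simp [r0]; omega) ?_)
    refine Sp.seq (Sp.set ⟨trivial, by simp; omega⟩ (by simp [r1]; omega) ?_)
    refine Sp.seq (Sp.set ⟨trivial, by simp; omega⟩ (by simp [r2]; omega) ?_)
    refine Sp.set ⟨⟨trivial, trivial⟩, trivial⟩ (by simp [Store.setVar_var, r0]; omega) ⟨?_, ?_, ?_, ?_, ?_⟩
    all_goals simp [Store.setVar_var, r0, r1, r2, hD]
  have w0 : ∀ x, x ≠ vn → x ≠ vE → x ≠ vN → x ≠ vD → σ₀.var x = 0 := fun x h1 h2 h3 h4 => by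
    rw [hf₀.var x (by simp [headStmt, Stmt.wVars, h1, h2, h3, h4]), hv]
  have a0 : ∀ a, σ₀.arr a = σ.arr a := fun a => hf₀.arr a (by simp [headStmt, Stmt.wArrs])
  have R0 : σ₀.raw = σ.raw := hf₀.raw rfl
  rw [← R0] at hL
  refine Sp.seq ((adjacencyStmt_spec (Q := fun t τ => t ≤ 10 * n + 40 * es.length + 10 ∧
    (∀ u v : Fin n, u = v ∨ G.Adj u v → τ.arr 4 u v 0 = 1) ∧
    (∀ u v : Fin n, ¬ (u = v ∨ G.Adj u v) → τ.arr 4 u v 0 = 0)) hL hes hbM hnM hvn hvE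
    (by rw [a0]; exact ha 4) fun t ht f h1 h2 => ⟨ht, by simpa [Store.setArr_arr] using h1,
      by simpa [Store.setArr_arr] using h2⟩).imp_frame fun t₁ σ₁ hf₁ ⟨ht₁, adj₁, adj₀⟩ => ?_)
  have w1 : ∀ x, σ₁.var x = σ₀.var x := fun x => hf₁.var x (by simp [adjacencyStmt, Stmt.wVars])
  have a1 : ∀ a, a ≠ 4 → σ₁.arr a = σ.arr a := fun a h =>
    (hf₁.arr a (by simp [adjacencyStmt, Stmt.wArrs, h])).trans (a0 a)
  have R1 : σ₁.raw = σ₀.raw := hf₁.raw rfl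
  rw [← R1] at hL
  refine Sp.seq ((treeStmt_spec (T := T) (Q := fun t τ => t ≤ 150 * N ∧
    (∀ z : Fin N, τ.arr 5 z 0 0 = (univ.filter (T.Adj z)).card) ∧
    (∀ z : Fin N, τ.arr 6 z 0 0 = ∑ u ∈ univ.filter (T.Adj z), (u : ℕ))) hL hts hlen hbM hNM
    ((w1 _).trans hvN) ((w1 _).trans hvE) (by rw [a1 5 (by norm_num)]; exact ha 5)
    (by rw [a1 6 (by norm_num)]; exact ha 6) fun t ht f g h1 h2 => ⟨ht,
      by simpa [Store.setArr_arr] using h1, by simpa [Store.setArr_arr] using h2⟩).imp_frame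
    fun t₂ σ₂ hf₂ ⟨ht₂, deg, nbr⟩ => ?_)
  have w2 : ∀ x, σ₂.var x = σ₀.var x := fun x =>
    (hf₂.var x (by simp [treeStmt, neighborStmt, Stmt.wVars])).trans (w1 x)
  have a2 : ∀ a, a ≠ 5 → a ≠ 6 → σ₂.arr a = σ₁.arr a := fun a h h' =>
    hf₂.arr a (by simp [treeStmt, neighborStmt, Stmt.wArrs, h, h'])
  have R2 : σ₂.raw = σ₁.raw := hf₂.raw rfl
  rw [← R2] at hL
  refine Sp.seq ((bagStmt_spec (Q := fun t τ => t ≤ N * (60 + 20 * K) + 20 ∧ τ.var vK = K ∧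
      (∀ x p (hp : p < (l x).length), τ.arr 2 x p 0 = (l x)[p]) ∧
      (∀ x : Fin N, τ.arr 3 x 0 0 = (l x).length) ∧
      (∀ (x : Fin N) X c, τ.arr 9 x X c = if X = 0 ∧ c = 0 then 1 else 0)) hL hlen hbM hnM hNM'
    ((w2 _).trans hvN) ((w2 _).trans hvE)
    ((w2 _).trans (w0 _ (by norm_num) (by norm_num) (by norm_num) (by norm_num))) hlK hKmin (by omega)
    (by rw [a2 9 (by norm_num) (by norm_num), a1 9 (by norm_num)]; exact ha 9)
    fun t ht τ h1 h2 h3 h4 => ⟨ht, h1, h2, h3, h4⟩).imp_frame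
    fun t₃ σ₃ hf₃ ⟨ht₃, hvK, bag, size, tab⟩ => ?_)
  have w3 : ∀ x, x ≠ vP → x ≠ vx → x ≠ vK → σ₃.var x = σ₀.var x := fun x h1 h2 h3 =>
    (hf₃.var x (by simp [bagStmt, oneBagStmt, Stmt.wVars, h1, h2, h3])).trans (w2 x)
  have a3 : ∀ a, a ≠ 2 → a ≠ 3 → a ≠ 9 → σ₃.arr a = σ₂.arr a := fun a h1 h2 h3 =>
    hf₃.arr a (by simp [bagStmt, oneBagStmt, Stmt.wArrs, h1, h2, h3])
  have R3 : σ₃.raw = σ₂.raw := hf₃.raw rfl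
  refine Sp.seq ((bitStmt_spec (K := K) (Q := fun t τ => t ≤ 10000 * ((K + 1) * 2 ^ K) ∧ BitTables K τ)
    hvK (by omega) hKM hpow (by
      rw [a3 7 (by norm_num) (by norm_num) (by norm_num), a2 7 (by norm_num) (by norm_num),
        a1 7 (by norm_num)]
      exact ha 7)
    fun t ht τ h1 => ⟨ht, h1⟩).imp_frame fun t₄ σ₄ hf₄ ⟨ht₄, bits⟩ => ?_)
  have w4 : ∀ x, x ≠ vm → σ₄.var x = σ₃.var x := fun x h1 =>
    hf₄.var x (by simp [bitStmt, fill, Stmt.wVars, h1])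
  have a4 : ∀ a, a ≠ 7 → a ≠ 8 → a ≠ 12 → σ₄.arr a = σ₃.arr a := fun a h1 h2 h3 =>
    hf₄.arr a (by simp [bitStmt, fill, Stmt.wArrs, h1, h2, h3])
  have R4 : σ₄.raw = σ₃.raw := hf₄.raw rfl
  have w : ∀ x, x ≠ vm → x ≠ vP → x ≠ vx → x ≠ vK → σ₄.var x = σ₀.var x := fun x h1 h2 h3 h4 =>
    (w4 x h1).trans (w3 x h2 h3 h4)
  have b4 : σ₄.arr 4 = σ₁.arr 4 := ((a4 4 (by norm_num) (by norm_num) (by norm_num)).trans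
    (a3 4 (by norm_num) (by norm_num) (by norm_num))).trans (a2 4 (by norm_num) (by norm_num))
  have b5 : σ₄.arr 5 = σ₂.arr 5 := (a4 5 (by norm_num) (by norm_num) (by norm_num)).trans
    (a3 5 (by norm_num) (by norm_num) (by norm_num))
  have b6 : σ₄.arr 6 = σ₂.arr 6 := (a4 6 (by norm_num) (by norm_num) (by norm_num)).trans
    (a3 6 (by norm_num) (by norm_num) (by norm_num))
  have b2 := a4 2 (by norm_num) (by norm_num) (by norm_num)
  have b3 := a4 3 (by norm_num) (by norm_num) (by norm_num)
  have b9 := a4 9 (by norm_num) (by norm_num) (by norm_num)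
  refine Sp.set trivial (Nat.zero_le _) (hQ _ ?_ _ ?_ ?_ ?_ ?_ ?_ ?_ fun τ hτ hτD hγ => ?_)
  · have h1 : 1 ≤ (K + 1) * 2 ^ K := Nat.mul_pos (by omega) (by positivity)
    have h2 : N * (60 + 20 * K) ≤ 60 * (N * (K + 1)) := by nlinarith
    have h3 : N ≤ N * (K + 1) := Nat.le_mul_of_pos_right _ (by omega)
    rw [readTime]
    simp only [Expr.time_zero]
    generalize (K + 1) * 2 ^ K = Y at *
    generalize N * (K + 1) = Z at *
    omega
  · exact R4.trans (R3.trans (R2.trans (R1.trans R0)))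
  · simp [Store.setVar_var, w4, hvK]
  · simp [Store.setVar_var, w, hvN]
  · simp [Store.setVar_var]
  · simp [Store.setVar_var, w, w0]
  · simp [Store.setVar_var, w, w0]
  · have c : ∀ a, a ≠ 0 → a ≠ 1 → τ.arr a = σ₄.arr a := hτ
    have hEnv : Env γ G l K D M τ :=
      { gam := hγ
        bag := by rw [c 2 (by norm_num) (by norm_num), b2]; exact bag
        size := by rw [c 3 (by norm_num) (by norm_num), b3]; exact size
        adj_pos := by rw [c 4 (by norm_num) (by norm_num), b4]; exact adj₁
        adj_zero := by rw [c 4 (by norm_num) (by norm_num), b4]; exact adj₀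
        bits := bits.congr (c 7 (by norm_num) (by norm_num)) (c 8 (by norm_num) (by norm_num))
        var_D := by rw [hτD]; simp [Store.setVar_var, w, hvD]
        length_le := hlK
        nodup := hnd
        D_pos := by omega
        D_le := hDM
        K_lt := hKM
        pow_le := hpow
        N_le := hNM }
    have htab : ∀ z : Fin N, tableOf τ z = fun s c => if s = ∅ ∧ c = 0 then 1 else 0 := fun z => by
      funext s d
      rw [tableOf, c 9 (by norm_num) (by norm_num), b9, tab]
      refine if_congr (and_congr_left fun _ => ⟨fun h => ?_, fun h => by rw [h, code_empty]⟩) rfl rfl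
      rw [code, sum_eq_zero_iff] at h
      exact eq_empty_of_forall_notMem fun i hi => absurd (h i hi) (by positivity)
    refine ⟨⟨hEnv, ⟨fun _ => 0, hbud, fun x _ s _ d _ => ?_⟩, hgrow, forestSum_one fun z => ?_⟩, ?_⟩
    · rw [htab, pow_zero]; dsimp only; split_ifs <;> omega
    · rw [nodeFun, htab]; exact tableFun_one _
    · refine ⟨?_, fun _ _ v _ => mem_univ v, fun v _ => ?_, fun u _ v _ h => ?_, fun z => ?_, fun z _ => ?_⟩
      · exact fun _ _ _ _ _ _ _ _ => mem_univ _
      · obtain ⟨z, hz⟩ := hcover v; exact ⟨z, mem_univ z, hz⟩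
      · obtain ⟨z, hz⟩ := hedge u v h; exact ⟨z, mem_univ z, hz⟩
      · rw [c 5 (by norm_num) (by norm_num), b5, deg, if_pos (mem_univ z)]
      · rw [c 6 (by norm_num) (by norm_num), b6, nbr]

end

end RAM

namespace RAM

/-! ### Simulation of another program -/

/-- Put the address of the cell `x` of the simulated memory into register `0` for intermediate
results, where `x` is the content of the given register. The further register `1` numbers the
simulations. -/
def simAddress (y : ℕ) : Program :=
  .seq (.const (regT 0) 0) <| .seq (copyProg (regT 1) y) <| .seq (copyProg (regT 2) (regG 1)) <|
  .seq (.const (regT 3) 0) (addressProg 0)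

namespace Program

/-- The largest register of a program. -/
def maxReg : Program → ℕ
  | skip => 0
  | const x _ => x
  | add x y z | sub x y z | mul x y z => max x (max y z)
  | load x y | store x y => max x y
  | seq p q => max p.maxReg q.maxReg
  | ite x p q => max x (max p.maxReg q.maxReg)
  | loop x p => max x p.maxReg

/-- The program that simulates another program. -/
def simulation : Program → Program
  | skip => .skip
  | const x v => .const (regG (x + 2)) v
  | add x y z => .add (regG (x + 2)) (regG (y + 2)) (regG (z + 2))
  | sub x y z => .sub (regG (x + 2)) (regG (y + 2)) (regG (z + 2))
  | mul x y z => .mul (regG (x + 2)) (regG (y + 2)) (regG (z + 2))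
  | load x y => .seq (simAddress (regG (y + 2))) (.load (regG (x + 2)) (regT 0))
  | store x y => .seq (simAddress (regG (x + 2))) (.store (regT 0) (regG (y + 2)))
  | seq p q => .seq p.simulation q.simulation
  | ite x p q => .ite (regG (x + 2)) p.simulation q.simulation
  | loop x p => .loop (regG (x + 2)) p.simulation

end Program

/-- The configuration `u` represents the configuration `s` of simulation number `j`. -/
structure Simulates (base j r : ℕ) (u₀ s u : State) : Prop where
  reg : ∀ y ≤ r, u.reg (regG (y + 2)) = s.reg y
  mem : ∀ x, u.mem (cell base 0 x j 0) = s.mem x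
  base_eq : u.reg (regG 0) = base
  index_eq : u.reg (regG 1) = j
  var : ∀ x, u.reg (regV x) = u₀.reg (regV x)
  frame : ∀ a, (∀ x, a ≠ cell base 0 x j 0) → u.mem a = u₀.mem a

/-! ### Faithfulness and cost of the simulation -/

section

variable {w κ β base j r : ℕ} {imul : ℕ → ℕ} {u₀ s u u' : State}

theorem Simulates.pres (h : Simulates base j r u₀ s u) {d : ℕ} (hp : Pres d u u') :
    Simulates base j r u₀ s u' where
  reg y hy := (hp.regG _).trans (h.reg y hy)
  mem x := by rw [hp.mem, h.mem]
  base_eq := (hp.regG _).trans h.base_eq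
  index_eq := (hp.regG _).trans h.index_eq
  var x := (hp.regV x).trans (h.var x)
  frame a ha := by rw [hp.mem, h.frame a ha]

theorem Simulates.setReg (h : Simulates base j r u₀ s u) (x v : ℕ) :
    Simulates base j r u₀ (s.setReg x v) (u.setReg (regG (x + 2)) v) where
  reg y hy := by simp [State.setReg_reg, h.reg y hy]
  mem := h.mem
  base_eq := by simp [State.setReg_reg, h.base_eq]
  index_eq := by simp [State.setReg_reg, h.index_eq]
  var y := by simp [State.setReg_reg, h.var]
  frame := h.frame

theorem Simulates.setMem (h : Simulates base j r u₀ s u) (x v : ℕ) :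
    Simulates base j r u₀ (s.setMem x v) (u.setMem (cell base 0 x j 0) v) where
  reg := h.reg
  mem y := by simp [State.setMem_mem, cell_inj, h.mem]
  base_eq := h.base_eq
  index_eq := h.index_eq
  var := h.var
  frame a ha := by rw [State.setMem_mem, if_neg (ha x), h.frame a ha]

theorem UnitCost.simAddress (hc : UnitCost w imul κ β) {y : ℕ} (hy : ∀ d, y ≠ regT d)
    (hbase : u.reg (regG 0) = base) (hj : u.reg (regG 1) = j)
    (h : cell base 0 (u.reg y) j 0 < 2 ^ β) :
    ∃ u', Leads w imul (simAddress y) u u' (22 * κ) ∧ u'.reg (regT 0) = cell base 0 (u.reg y) j 0 ∧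
      Pres 0 u u' := by
  have hj' : j < 2 ^ β := by
    refine lt_of_le_of_lt ?_ h
    exact (Nat.left_le_pair j 0).trans <| (Nat.right_le_pair _ _).trans <|
      (Nat.right_le_pair _ _).trans (Nat.le_add_left _ _)
  have hx' : u.reg y < 2 ^ β := by
    refine lt_of_le_of_lt ?_ h
    exact (Nat.left_le_pair _ _).trans <| (Nat.right_le_pair _ _).trans (Nat.le_add_left _ _)
  have h1 := hc.const u (regT 0) 0 (Nat.two_pow_pos β)
  set u1 := u.setReg (regT 0) 0
  have h2 := hc.copy u1 (x := regT 1) (y := y) (hy 1).symm (by simp [u1, State.setReg_reg, hy, hx'])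
  have r1 : u1.reg y = u.reg y := by simp [u1, State.setReg_reg, hy]
  rw [r1] at h2
  set u2 := u1.setReg (regT 1) (u.reg y)
  have r2 : u2.reg (regG 1) = j := by simp [u2, u1, State.setReg_reg, hj]
  have h3 := hc.copy u2 (x := regT 2) (y := regG 1) (by simp) (by rwa [r2])
  rw [r2] at h3
  set u3 := u2.setReg (regT 2) j
  have h4 := hc.const u3 (regT 3) 0 (Nat.two_pow_pos β)
  set u4 := u3.setReg (regT 3) 0
  have P4 : Pres 0 u u4 := ((((Pres.refl 0 u).setReg le_rfl _).setReg (by omega) _).setReg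
    (by omega) _).setReg (by omega) _
  have t0 : u4.reg (regT 0) = 0 := by simp [u4, u3, u2, u1, State.setReg_reg]
  have t1 : u4.reg (regT 1) = u.reg y := by simp [u4, u3, u2, State.setReg_reg]
  have t2 : u4.reg (regT 2) = j := by simp [u4, u3, State.setReg_reg]
  have t3 : u4.reg (regT 3) = 0 := by simp [u4, State.setReg_reg]
  obtain ⟨u5, h5, r5, P5⟩ := hc.address u4 0 ((P4.regG 0).trans hbase)
    (by simpa only [Nat.zero_add, t0, t1, t2, t3] using h)
  simp only [Nat.zero_add, t0, t1, t2, t3] at r5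
  exact ⟨u5, (h1.seq (h2.seq (h3.seq (h4.seq h5)))).mono (by omega), r5, P4.trans P5⟩

/-- The numbers in a configuration have at most `B` bits. -/
def State.Size (B : ℕ) (s : State) : Prop :=
  (∀ y, Nat.size (s.reg y) ≤ B) ∧ ∀ x, Nat.size (s.mem x) ≤ B

theorem State.Size.setReg {B B' v : ℕ} (h : s.Size B) (hB : B ≤ B') (x : ℕ) (hv : Nat.size v ≤ B') :
    (s.setReg x v).Size B' :=
  ⟨fun y => by rw [State.setReg_reg]; split_ifs; exacts [hv, (h.1 y).trans hB],
    fun y => (h.2 y).trans hB⟩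

theorem State.Size.setMem {B B' v : ℕ} (h : s.Size B) (hB : B ≤ B') (x : ℕ) (hv : Nat.size v ≤ B') :
    (s.setMem x v).Size B' :=
  ⟨fun y => (h.1 y).trans hB,
    fun y => by rw [State.setMem_mem]; split_ifs; exacts [hv, (h.2 y).trans hB]⟩

theorem one_le_linCost (w b : ℕ) : 1 ≤ linCost w b := by
  rw [linCost]; split_ifs <;> omega

theorem le_linCost_zero (b : ℕ) : b ≤ linCost 0 b := by
  rw [linCost]; split_ifs <;> omega

theorem one_le_mulCost_zero (b : ℕ) : 1 ≤ mulCost 0 (fun b => b ^ 2) b := by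
  rw [mulCost]; split_ifs
  · rfl
  · exact Nat.one_le_pow _ _ (by omega)

theorem le_mulCost_zero (b : ℕ) : b ≤ mulCost 0 (fun b => b ^ 2) b := by
  rw [mulCost]; split_ifs
  · omega
  · nlinarith

theorem size_mul_le (a b : ℕ) : Nat.size (a * b) ≤ Nat.size a + Nat.size b := by
  rw [Nat.size_le, pow_add]
  exact Nat.mul_lt_mul'' (Nat.lt_size_self a) (Nat.lt_size_self b)

theorem size_add_le (a b : ℕ) : Nat.size (a + b) ≤ max (Nat.size a) (Nat.size b) + 1 := by
  rw [Nat.size_le, pow_succ]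
  have h1 : a < 2 ^ max (Nat.size a) (Nat.size b) := Nat.size_le.1 (le_max_left _ _)
  have h2 : b < 2 ^ max (Nat.size a) (Nat.size b) := Nat.size_le.1 (le_max_right _ _)
  omega

/-- The simulated program is charged for every bit that it handles, so within `t` units of time its
numbers grow by at most `t` bits, and all addresses and values stay below `2 ^ L`. Simulating a
memory access takes 22 instructions for the address and one for the access itself, which the factor
30 covers. -/
theorem Simulates.exec (hc : UnitCost w imul κ β) {L : ℕ} (hL : L ≤ β)
    (hadr : ∀ x < 2 ^ L, cell base 0 x j 0 < 2 ^ β) {p : Program} {t : ℕ} {s' : State}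
    (he : Exec 0 (fun b => b ^ 2) p s t s') : ∀ {B : ℕ} {u : State}, p.maxReg ≤ r → s.Size B →
      B + t ≤ L → Simulates base j r u₀ s u → ∃ u', Leads w imul p.simulation u u' (30 * κ * t) ∧
        Simulates base j r u₀ s' u' ∧ s'.Size (B + t) := by
  have lt : ∀ {v B t : ℕ}, Nat.size v ≤ B → B + t ≤ L → v < 2 ^ β := fun h h' =>
    Nat.size_le.1 (h.trans (by omega))
  have ltL : ∀ {v B t : ℕ}, Nat.size v ≤ B → B + t ≤ L → v < 2 ^ L := fun h h' =>
    Nat.size_le.1 (h.trans (by omega))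
  have cost : ∀ {t : ℕ}, 1 ≤ t → 30 * κ ≤ 30 * κ * t := fun h => Nat.le_mul_of_pos_right _ h
  have reg_lt : ∀ {s u : State} {y B t : ℕ}, Simulates base j r u₀ s u → s.Size B → y ≤ r →
      B + t ≤ L → u.reg (regG (y + 2)) < 2 ^ β := fun h hs hy hB => by
    rw [h.reg _ hy]; exact lt (hs.1 _) hB
  induction he with
  | skip s =>
    intro B u _ hs hB hu
    exact ⟨u, (hc.skip u).mono (by omega), hu, (hs.1 · |>.trans (by omega)), (hs.2 · |>.trans (by omega))⟩
  | const s x v =>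
    intro B u hr hs hB hu
    have h1 := one_le_linCost 0 (Nat.size v)
    have h2 := le_linCost_zero (Nat.size v)
    exact ⟨_, (hc.const u _ v (Nat.size_le.1 (by omega))).mono (by have := cost h1; omega),
      hu.setReg x v, hs.setReg (by omega) x (by omega)⟩
  | add s x y z =>
    intro B u hr hs hB hu
    simp only [Program.maxReg, max_le_iff] at hr
    have h1 := one_le_linCost 0 (max (Nat.size (s.reg y)) (Nat.size (s.reg z)))
    have h2 := size_add_le (s.reg y) (s.reg z)
    have h3 := max_le (hs.1 y) (hs.1 z)
    have h := hc.add u (regG (x + 2)) (regG (y + 2)) (regG (z + 2)) (reg_lt hu hs hr.2.1 hB)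
      (reg_lt hu hs hr.2.2 hB)
    rw [hu.reg y hr.2.1, hu.reg z hr.2.2] at h
    exact ⟨_, h.mono (by have := cost h1; omega), hu.setReg x _, hs.setReg (by omega) x (by omega)⟩
  | sub s x y z =>
    intro B u hr hs hB hu
    simp only [Program.maxReg, max_le_iff] at hr
    have h1 := one_le_linCost 0 (max (Nat.size (s.reg y)) (Nat.size (s.reg z)))
    have h2 : Nat.size (s.reg y - s.reg z) ≤ B := (Nat.size_le_size (Nat.sub_le _ _)).trans (hs.1 y)
    have h := hc.sub u (regG (x + 2)) (regG (y + 2)) (regG (z + 2)) (reg_lt hu hs hr.2.1 hB)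
      (reg_lt hu hs hr.2.2 hB)
    rw [hu.reg y hr.2.1, hu.reg z hr.2.2] at h
    exact ⟨_, h.mono (by have := cost h1; omega), hu.setReg x _, hs.setReg (by omega) x (by omega)⟩
  | mul s x y z =>
    intro B u hr hs hB hu
    simp only [Program.maxReg, max_le_iff] at hr
    have h1 := one_le_mulCost_zero (max (Nat.size (s.reg y)) (Nat.size (s.reg z)))
    have h2 := le_mulCost_zero (max (Nat.size (s.reg y)) (Nat.size (s.reg z)))
    have h3 := size_mul_le (s.reg y) (s.reg z)
    have h4 := hs.1 y
    have h5 := le_max_right (Nat.size (s.reg y)) (Nat.size (s.reg z))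
    have h := hc.mul' u (regG (x + 2)) (regG (y + 2)) (regG (z + 2)) (reg_lt hu hs hr.2.1 hB)
      (reg_lt hu hs hr.2.2 hB)
    rw [hu.reg y hr.2.1, hu.reg z hr.2.2] at h
    exact ⟨_, h.mono (by have := cost h1; omega), hu.setReg x _, hs.setReg (by omega) x (by omega)⟩
  | load s x y =>
    intro B u hr hs hB hu
    simp only [Program.maxReg, max_le_iff] at hr
    have h1 := one_le_linCost 0 (max (Nat.size (s.reg y)) (Nat.size (s.mem (s.reg y))))
    have ha := hadr _ (ltL (hs.1 y) hB)
    obtain ⟨u1, g1, r1, p1⟩ := hc.simAddress (y := regG (y + 2)) (u := u) (by simp) hu.base_eq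
      hu.index_eq (by rwa [hu.reg y hr.2])
    rw [hu.reg y hr.2] at r1
    have hu1 := hu.pres p1
    have h := hc.load u1 (regG (x + 2)) (regT 0) (by rwa [r1]) (by
      rw [r1, hu1.mem]; exact lt (hs.2 _) hB)
    rw [r1, hu1.mem] at h
    exact ⟨_, (g1.seq h).mono (by have := cost h1; omega), hu1.setReg x _,
      hs.setReg (by omega) x ((hs.2 _).trans (by omega))⟩
  | store s x y =>
    intro B u hr hs hB hu
    simp only [Program.maxReg, max_le_iff] at hr
    have h1 := one_le_linCost 0 (max (Nat.size (s.reg x)) (Nat.size (s.reg y)))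
    have ha := hadr _ (ltL (hs.1 x) hB)
    obtain ⟨u1, g1, r1, p1⟩ := hc.simAddress (y := regG (x + 2)) (u := u) (by simp) hu.base_eq
      hu.index_eq (by rwa [hu.reg x hr.1])
    rw [hu.reg x hr.1] at r1
    have hu1 := hu.pres p1
    have h := hc.store u1 (regT 0) (regG (y + 2)) (by rwa [r1]) (reg_lt hu1 hs hr.2 hB)
    rw [r1, hu1.reg y hr.2] at h
    exact ⟨_, (g1.seq h).mono (by have := cost h1; omega), hu1.setMem _ _,
      hs.setMem (by omega) _ ((hs.1 _).trans (by omega))⟩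
  | seq _ _ ih1 ih2 =>
    intro B u hr hs hB hu
    simp only [Program.maxReg, max_le_iff] at hr
    obtain ⟨u1, g1, hu1, hs1⟩ := ih1 hr.1 hs (by omega) hu
    obtain ⟨u2, g2, hu2, hs2⟩ := ih2 hr.2 hs1 (by omega) hu1
    exact ⟨u2, (g1.seq g2).mono (by rw [Nat.mul_add]), hu2, by rwa [← Nat.add_assoc]⟩
  | @ite_pos x _ _ s _ t hx _ ih =>
    intro B u hr hs hB hu
    simp only [Program.maxReg, max_le_iff] at hr
    have h1 := cost (one_le_linCost 0 (Nat.size (s.reg x)))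
    obtain ⟨u1, g1, hu1, hs1⟩ := ih hr.2.1 (B := B + linCost 0 (Nat.size (s.reg x)))
      ⟨(hs.1 · |>.trans (by omega)), (hs.2 · |>.trans (by omega))⟩ (by omega) hu
    refine ⟨u1, (hc.ite_pos (reg_lt hu hs hr.1 hB) (by rwa [hu.reg x hr.1]) g1).mono ?_, hu1,
      by rwa [← Nat.add_assoc]⟩
    rw [Nat.mul_add]; omega
  | @ite_zero x _ _ s _ t hx _ ih =>
    intro B u hr hs hB hu
    simp only [Program.maxReg, max_le_iff] at hr
    have h1 := cost (one_le_linCost 0 (Nat.size (s.reg x)))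
    obtain ⟨u1, g1, hu1, hs1⟩ := ih hr.2.2 (B := B + linCost 0 (Nat.size (s.reg x)))
      ⟨(hs.1 · |>.trans (by omega)), (hs.2 · |>.trans (by omega))⟩ (by omega) hu
    refine ⟨u1, (hc.ite_zero (by rwa [hu.reg x hr.1]) g1).mono ?_, hu1, by rwa [← Nat.add_assoc]⟩
    rw [Nat.mul_add]; omega
  | @loop_pos x p s s' s'' t t' hx _ _ ih1 ih2 =>
    intro B u hr hs hB hu
    have h1 := cost (one_le_linCost 0 (Nat.size (s.reg x)))
    have hr' := hr
    simp only [Program.maxReg, max_le_iff] at hr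
    obtain ⟨u1, g1, hu1, hs1⟩ := ih1 hr.2 (B := B + linCost 0 (Nat.size (s.reg x)))
      ⟨(hs.1 · |>.trans (by omega)), (hs.2 · |>.trans (by omega))⟩ (by omega) hu
    obtain ⟨u2, g2, hu2, hs2⟩ := ih2 hr' hs1 (by omega) hu1
    refine ⟨u2, (hc.loop_pos (reg_lt hu hs hr.1 hB) (by rwa [hu.reg x hr.1]) g1 g2).mono ?_, hu2, ?_⟩
    · rw [Nat.mul_add, Nat.mul_add]; omega
    · rwa [← Nat.add_assoc, ← Nat.add_assoc]
  | @loop_zero x p s hx =>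
    intro B u hr hs hB hu
    have h1 := cost (one_le_linCost 0 (Nat.size (s.reg x)))
    simp only [Program.maxReg, max_le_iff] at hr
    exact ⟨u, (hc.loop_zero (by rwa [hu.reg x hr.1])).mono (by omega), hu,
      (hs.1 · |>.trans (by omega)), (hs.2 · |>.trans (by omega))⟩

/-- Set the registers of the simulated machine to zero. -/
def clearProg : ℕ → Program
  | 0 => .const (regG 2) 0
  | r + 1 => .seq (clearProg r) (.const (regG (r + 3)) 0)

theorem UnitCost.clear (hc : UnitCost w imul κ β) (u : State) : ∀ r, ∃ u',
    Leads w imul (clearProg r) u u' ((r + 1) * κ) ∧ u'.mem = u.mem ∧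
    (∀ y, y < 2 → u'.reg (regG y) = u.reg (regG y)) ∧ (∀ x, u'.reg (regV x) = u.reg (regV x)) ∧
    ∀ y ≤ r, u'.reg (regG (y + 2)) = 0
  | 0 => ⟨_, (hc.const u _ 0 (Nat.two_pow_pos β)).mono (by omega), rfl,
      fun y hy => by simp [State.setReg_reg]; omega, fun x => by simp [State.setReg_reg],
      fun y hy => by simp [State.setReg_reg]; omega⟩
  | r + 1 => by
    obtain ⟨u1, h1, m1, g1, v1, z1⟩ := hc.clear u r
    refine ⟨_, (h1.seq (hc.const u1 _ 0 (Nat.two_pow_pos β))).mono (by linarith), m1,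
      fun y hy => ?_, fun x => by simp [State.setReg_reg, v1], fun y hy => ?_⟩
    · have : y ≠ r + 3 := by omega
      simp [State.setReg_reg, g1 y hy, this]
    · simp only [State.setReg_reg, regG_inj]
      split_ifs with h
      · rfl
      · exact z1 y (by omega)

/-- One simulation. The result becomes an entry of array `1`. -/
def simulateProg (p : Program) : Program :=
  .seq (clearProg p.maxReg) <| .seq (simAddress (regG 2)) <| .seq (.store (regT 0) (regG 1)) <|
  .seq p.simulation <| .seq (.const (regG 2) 0) <| .seq (simAddress (regG 2)) <|
  .seq (.load (regG 2) (regT 0)) <|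
  .seq (.const (regT 0) 1) <| .seq (copyProg (regT 1) (regG 1)) <| .seq (.const (regT 2) 0) <|
  .seq (.const (regT 3) 0) <| .seq (addressProg 0) (.store (regT 0) (regG 2))

/-- Simulation `j` uses only the entries `(x, j, 0)` of array 0. Its memory is therefore initially
zero whatever the other simulations have left behind, and only the registers have to be cleared. -/
theorem UnitCost.simulate (hc : UnitCost w imul κ β) {p : Program} {L T v : ℕ} (hL : L ≤ β)
    (hadr : ∀ x < 2 ^ L, cell base 0 x j 0 < 2 ^ β) (hadr' : cell base 1 j 0 0 < 2 ^ β)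
    (hT : Nat.size j + T ≤ L)
    (hp : ComputesWithin 0 (fun b => b ^ 2) p [j] T [v]) (hbase : u.reg (regG 0) = base)
    (hj : u.reg (regG 1) = j) (hzero : ∀ x, u.mem (cell base 0 x j 0) = 0) :
    ∃ u', Leads w imul (simulateProg p) u u' (κ * (30 * T + p.maxReg + 100)) ∧
      u'.reg (regG 0) = base ∧ u'.reg (regG 1) = j ∧ (∀ x, u'.reg (regV x) = u.reg (regV x)) ∧
      (∀ a, (∀ x, a ≠ cell base 0 x j 0) → a ≠ cell base 1 j 0 0 → u'.mem a = u.mem a) ∧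
      u'.mem (cell base 1 j 0 0) = v := by
  obtain ⟨t, s, he, ht, hout⟩ := hp
  have hv : s.mem 0 = v := hout 0 (by simp)
  have hjβ : j < 2 ^ β := Nat.size_le.1 (by omega)
  have h0β := hadr 0 (Nat.two_pow_pos L)
  obtain ⟨u1, h1, m1, g1, v1, z1⟩ := hc.clear u p.maxReg
  obtain ⟨u2, h2, r2, P2⟩ := hc.simAddress (y := regG 2) (u := u1) (by simp)
    ((g1 0 (by norm_num)).trans hbase) ((g1 1 (by norm_num)).trans hj)
    (by rw [z1 0 (Nat.zero_le _)]; exact h0β)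
  rw [z1 0 (Nat.zero_le _)] at r2
  have hj2 : u2.reg (regG 1) = j := (P2.regG 1).trans ((g1 1 (by norm_num)).trans hj)
  have h3 := hc.store u2 (regT 0) (regG 1) (by rwa [r2]) (by rwa [hj2])
  rw [r2, hj2] at h3
  set u3 := u2.setMem (cell base 0 0 j 0) j with hu3
  have S3 : Simulates base j p.maxReg u (initState [j]) u3 :=
    { reg := fun y hy => (P2.regG _).trans (z1 y hy)
      mem := fun x => by
        rw [hu3, State.setMem_mem, P2.mem, m1, hzero]
        cases x <;> simp [cell_inj, initState]
      base_eq := (P2.regG 0).trans ((g1 0 (by norm_num)).trans hbase)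
      index_eq := hj2
      var := fun x => (P2.regV x).trans (v1 x)
      frame := fun a ha => by rw [hu3, State.setMem_mem, if_neg (ha 0), P2.mem, m1] }
  have hsize : (initState [j]).Size (Nat.size j) := ⟨fun y => by simp [initState], fun x => by
    cases x <;> simp [initState]⟩
  obtain ⟨u4, h4, S4, s4⟩ := S3.exec hc hL hadr he le_rfl hsize (by omega)
  have h5 := hc.const u4 (regG 2) 0 (Nat.two_pow_pos β)
  have S5 := S4.setReg 0 0
  set u5 := u4.setReg (regG 2) 0
  have z5 : u5.reg (regG 2) = 0 := by simp [u5, State.setReg_reg]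
  obtain ⟨u6, h6, r6, P6⟩ := hc.simAddress (y := regG 2) (u := u5) (by simp) S5.base_eq S5.index_eq
    (by rwa [z5])
  rw [z5] at r6
  have S6 := S5.pres P6
  have hvβ : v < 2 ^ β := by rw [← hv]; exact Nat.size_le.1 ((s4.2 0).trans (by omega))
  have m6 : u6.mem (cell base 0 0 j 0) = v := (S6.mem 0).trans hv
  have h7 := hc.load u6 (regG 2) (regT 0) (by rwa [r6]) (by rwa [r6, m6])
  rw [r6, m6] at h7
  have S7 := S6.setReg 0 v
  have h1β : 1 < 2 ^ β ∨ β = 0 := by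
    rcases Nat.eq_zero_or_pos β with h | h
    · exact Or.inr h
    · exact Or.inl (Nat.one_lt_two_pow (by omega))
  have h1β' : 1 < 2 ^ β := lt_of_le_of_lt ((Nat.left_le_pair 1 _).trans (Nat.le_add_left _ _)) hadr'
  set u7 := u6.setReg (regG (0 + 2)) v
  have h8 := hc.const u7 (regT 0) 1 h1β'
  set u8 := u7.setReg (regT 0) 1
  have g8 : u8.reg (regG 1) = j := by simp [u8, State.setReg_reg, S7.index_eq]
  have h9 := hc.copy u8 (x := regT 1) (y := regG 1) (by simp) (by rwa [g8])
  rw [g8] at h9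
  set u9 := u8.setReg (regT 1) j
  have h10 := hc.const u9 (regT 2) 0 (Nat.two_pow_pos β)
  set u10 := u9.setReg (regT 2) 0
  have h11 := hc.const u10 (regT 3) 0 (Nat.two_pow_pos β)
  set u11 := u10.setReg (regT 3) 0
  have P11 : Pres 0 u7 u11 := ((((Pres.refl 0 u7).setReg le_rfl _).setReg (by omega) _).setReg
    (by omega) _).setReg (by omega) _
  have t0 : u11.reg (regT 0) = 1 := by simp [u11, u10, u9, u8, State.setReg_reg]
  have t1 : u11.reg (regT 1) = j := by simp [u11, u10, u9, State.setReg_reg]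
  have t2 : u11.reg (regT 2) = 0 := by simp [u11, u10, State.setReg_reg]
  have t3 : u11.reg (regT 3) = 0 := by simp [u11, State.setReg_reg]
  have S11 := S7.pres P11
  obtain ⟨u12, h12, r12, P12⟩ := hc.address u11 0 S11.base_eq
    (by simpa only [Nat.zero_add, t0, t1, t2, t3] using hadr')
  simp only [Nat.zero_add, t0, t1, t2, t3] at r12
  have S12 := S11.pres P12
  have g12 : u12.reg (regG 2) = v := by
    simpa [State.setReg_reg] using S12.reg 0 (Nat.zero_le _)
  have h13 := hc.store u12 (regT 0) (regG 2) (by rwa [r12]) (by rwa [g12])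
  rw [r12, g12] at h13
  refine ⟨_, (h1.seq <| h2.seq <| h3.seq <| h4.seq <| h5.seq <| h6.seq <| h7.seq <| h8.seq <| h9.seq <|
    h10.seq <| h11.seq <| h12.seq h13).mono ?_, S12.base_eq, S12.index_eq, S12.var, fun a h h' => ?_,
    by simp [State.setMem_mem]⟩
  · have e1 : 30 * κ * t ≤ 30 * κ * T := Nat.mul_le_mul_left _ ht
    have e2 : κ * (30 * T + p.maxReg + 100) = 30 * κ * T + (p.maxReg + 1) * κ + 99 * κ := by ring
    omega
  · rw [State.setMem_mem, if_neg h', S12.frame a h]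

/-- The simulations for all numbers up to `vK`. -/
def decideProg (p : Program) : Program :=
  .seq (.const (regT 0) 1) <| .seq (.add (regG 1) (regV vK) (regT 0)) <| .loop (regG 1) <|
    .seq (.const (regT 0) 1) <| .seq (.sub (regG 1) (regG 1) (regT 0)) (simulateProg p)

/-- Price and bit length are functions of `j`: simulation `j` must be charged according to `j`
alone, so that the total is a sum of polynomially bounded terms. -/
theorem simulateLoop {κ β L T v : ℕ → ℕ} {p : Program} (hc : ∀ j, UnitCost w imul (κ j) (β j))
    (hL : ∀ j, L j ≤ β j) (hadr : ∀ j, ∀ x < 2 ^ L j, cell base 0 x j 0 < 2 ^ β j)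
    (hadr' : ∀ j, cell base 1 j 0 0 < 2 ^ β j) (hT : ∀ j, Nat.size j + T j ≤ L j)
    (hp : ∀ j, ComputesWithin 0 (fun b => b ^ 2) p [j] (T j) [v j]) : ∀ i u, u.reg (regG 0) = base →
      u.reg (regG 1) = i → (∀ x, ∀ j < i, u.mem (cell base 0 x j 0) = 0) → ∃ u',
      Leads w imul (.loop (regG 1) <| .seq (.const (regT 0) 1) <|
        .seq (.sub (regG 1) (regG 1) (regT 0)) (simulateProg p)) u u'
        (∑ j ∈ Finset.range i, κ j * (30 * T j + p.maxReg + 110) + κ 0) ∧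
      u'.reg (regG 0) = base ∧ (∀ x, u'.reg (regV x) = u.reg (regV x)) ∧
      (∀ a, (∀ x j, a ≠ cell base 0 x j 0) → (∀ j, a ≠ cell base 1 j 0 0) → u'.mem a = u.mem a) ∧
      (∀ j < i, u'.mem (cell base 1 j 0 0) = v j) ∧
      (∀ j, i ≤ j → u'.mem (cell base 1 j 0 0) = u.mem (cell base 1 j 0 0))
  | 0, u, hb, hi, _ => ⟨u, by simpa using (hc 0).loop_zero hi, hb, fun _ => rfl, fun _ _ _ => rfl,
      fun j hj => absurd hj (by omega), fun _ _ => rfl⟩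
  | i + 1, u, hb, hi, hz => by
    have hiβ : i + 1 < 2 ^ β i := by
      refine lt_of_le_of_lt ?_ (hadr' i)
      have h1 := Nat.add_le_pair 1 (Nat.pair i (Nat.pair 0 0))
      have h2 := Nat.left_le_pair i (Nat.pair 0 0)
      rw [cell]; omega
    have h1 := (hc i).const u (regT 0) 1 (by omega)
    set u1 := u.setReg (regT 0) 1
    have h2 := (hc i).sub u1 (regG 1) (regG 1) (regT 0) (by simp [u1, State.setReg_reg, hi, hiβ])
      (by
        have : 1 < 2 ^ β i := by omega
        simpa [u1, State.setReg_reg] using this)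
    have r1 : u1.reg (regG 1) - u1.reg (regT 0) = i := by simp [u1, State.setReg_reg, hi]
    rw [r1] at h2
    set u2 := u1.setReg (regG 1) i
    obtain ⟨u3, h3, b3, g3, v3, f3, a3⟩ := (hc i).simulate (u := u2) (hL i) (hadr i) (hadr' i) (hT i) (hp i)
      (by simp [u2, u1, State.setReg_reg, hb]) (by simp [u2, State.setReg_reg]) (fun x => hz x i (by omega))
    have v3' : ∀ x, u3.reg (regV x) = u.reg (regV x) := fun x => (v3 x).trans (by
      simp [u2, u1, State.setReg_reg])
    have f3' : ∀ x j, j < i → u3.mem (cell base 0 x j 0) = 0 := fun x j hj =>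
      (f3 _ (fun y h => by simp only [cell_inj] at h; omega) (by simp [cell_inj])).trans (hz x j (by omega))
    obtain ⟨u4, h4, b4, v4, f4, a4, c4⟩ := simulateLoop hc hL hadr hadr' hT hp i u3 b3 g3 f3'
    refine ⟨u4, ((hc i).loop_pos (by rwa [hi]) (by rw [hi]; omega) (h1.seq (h2.seq h3)) h4).mono ?_, b4,
      fun x => (v4 x).trans (v3' x), fun a h h' => (f4 a h h').trans (f3 a (fun x => h x i) (h' i)),
      fun j hj => ?_, fun j hj => (c4 j (by omega)).trans
        (f3 _ (fun x => by simp [cell_inj]) (by simp [cell_inj]; omega))⟩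
    · rw [Finset.sum_range_succ]
      have : κ i * (30 * T i + p.maxReg + 110) = κ i * (30 * T i + p.maxReg + 100) + 10 * κ i := by ring
      omega
    · rcases Nat.lt_succ_iff_lt_or_eq.1 hj with h | rfl
      · exact a4 j h
      · rw [c4 j le_rfl, a3]

theorem cell_lt {L a i j k : ℕ} (ha : a ≤ 2 ^ L) (hi : i ≤ 2 ^ L) (hj : j ≤ 2 ^ L) (hk : k ≤ 2 ^ L) :
    cell base a i j k < 2 ^ (8 * L + 16 + Nat.size base) := by
  have mono : ∀ {L' : ℕ}, L ≤ L' → 2 ^ L ≤ 2 ^ L' := fun h => Nat.pow_le_pow_right (by norm_num) h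
  have h1 := pair_le_pow le_rfl hj hk
  have h2 := pair_le_pow le_rfl (hi.trans (mono (by omega : L ≤ 2 * L + 2))) h1
  have h3 := pair_le_pow le_rfl (ha.trans (mono (by omega : L ≤ 2 * (2 * L + 2) + 2))) h2
  have h4 : base < 2 ^ Nat.size base := Nat.lt_size_self base
  have h5 : 2 ^ (2 * (2 * (2 * L + 2) + 2) + 2) ≤ 2 ^ (8 * L + 15 + Nat.size base) :=
    Nat.pow_le_pow_right (by norm_num) (by omega)
  have h6 : 2 ^ Nat.size base ≤ 2 ^ (8 * L + 15 + Nat.size base) :=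
    Nat.pow_le_pow_right (by norm_num) (by omega)
  have h7 : 2 ^ (8 * L + 16 + Nat.size base) = 2 * 2 ^ (8 * L + 15 + Nat.size base) := by
    rw [← pow_succ']; congr 1; omega
  rw [cell]
  omega

/-- Lengths within the word size cost one unit. For longer ones, monotonicity and `b ≤ imul b` bound
both kinds of costs by `imul X`. -/
theorem IsMulTime.unitCost (hi : IsMulTime imul) {X : ℕ} (h : ∀ b ≤ β, w < b → b ≤ X) :
    UnitCost w imul (1 + imul X) β where
  lin b hb := by
    rw [linCost]
    split_ifs with hw
    · omega
    · have := h b hb (by omega)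
      have := hi.le_self X
      omega
  mul b hb := by
    rw [mulCost]
    split_ifs with hw
    · omega
    · have := hi.mono (h b hb (by omega))
      omega

end

/-! ### Polynomially bounded functions -/

/-- Functions that are at most `c * (j + 1) ^ e`. -/
def PolyBounded (f : ℕ → ℕ) : Prop := ∃ c e, ∀ j, f j ≤ c * (j + 1) ^ e

section

variable {f g : ℕ → ℕ}

theorem PolyBounded.const (c : ℕ) : PolyBounded fun _ => c := ⟨c, 0, fun j => by simp⟩

theorem PolyBounded.id : PolyBounded fun j => j := ⟨1, 1, fun j => by simp⟩

theorem PolyBounded.mono (hg : PolyBounded g) (h : ∀ j, f j ≤ g j) : PolyBounded f :=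
  let ⟨c, e, hc⟩ := hg
  ⟨c, e, fun j => (h j).trans (hc j)⟩

theorem PolyBounded.add (hf : PolyBounded f) (hg : PolyBounded g) : PolyBounded fun j => f j + g j := by
  obtain ⟨c, e, hc⟩ := hf
  obtain ⟨d, e', hd⟩ := hg
  refine ⟨c + d, e + e', fun j => (Nat.add_le_add (hc j) (hd j)).trans ?_⟩
  have h1 : (j + 1) ^ e ≤ (j + 1) ^ (e + e') := Nat.pow_le_pow_right (by omega) (by omega)
  have h2 : (j + 1) ^ e' ≤ (j + 1) ^ (e + e') := Nat.pow_le_pow_right (by omega) (by omega)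
  rw [Nat.add_mul]
  exact Nat.add_le_add (Nat.mul_le_mul_left _ h1) (Nat.mul_le_mul_left _ h2)

theorem PolyBounded.mul (hf : PolyBounded f) (hg : PolyBounded g) : PolyBounded fun j => f j * g j := by
  obtain ⟨c, e, hc⟩ := hf
  obtain ⟨d, e', hd⟩ := hg
  refine ⟨c * d, e + e', fun j => (Nat.mul_le_mul (hc j) (hd j)).trans ?_⟩
  rw [pow_add]
  exact (by ring : _ = _).le

theorem PolyBounded.pow (hf : PolyBounded f) : ∀ m, PolyBounded fun j => f j ^ m
  | 0 => by simpa using PolyBounded.const 1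
  | m + 1 => by simpa only [pow_succ] using (hf.pow m).mul hf

theorem PolyBounded.eval (P : Polynomial ℕ) : PolyBounded fun j => P.eval j := by
  induction P using Polynomial.induction_on' with
  | add p q hp hq => simpa using hp.add hq
  | monomial m c => simpa using (PolyBounded.const c).mul (PolyBounded.id.pow m)

/-- Doubling the length costs a factor `d ≤ 2 ^ d`, so the time grows at most like the `d`-th power;
rounding the length up to a power of two costs another constant factor. -/
theorem IsMulTime.polyBounded {imul : ℕ → ℕ} (hi : IsMulTime imul) : PolyBounded imul := by
  obtain ⟨d, hd⟩ := hi.doubling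
  have h1 : ∀ m, imul (2 ^ m) ≤ imul 1 * (2 ^ m) ^ d := fun m => by
    induction m with
    | zero => simp
    | succ m ih =>
      have h2 : d ≤ 2 ^ d := Nat.lt_two_pow_self.le
      calc imul (2 ^ (m + 1)) = imul (2 * 2 ^ m) := by rw [pow_succ']
        _ ≤ d * imul (2 ^ m) := hd _
        _ ≤ 2 ^ d * (imul 1 * (2 ^ m) ^ d) := Nat.mul_le_mul h2 ih
        _ = imul 1 * (2 ^ (m + 1)) ^ d := by rw [pow_succ', mul_pow]; ring
  refine ⟨imul 1 * 2 ^ d, d, fun b => ?_⟩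
  have h2 : 2 ^ Nat.size b ≤ 2 * (b + 1) := by
    rcases Nat.eq_zero_or_pos b with rfl | hb
    · simp
    · have h3 : 2 ^ (Nat.size b - 1) ≤ b :=
        Nat.lt_size.1 (by have := Nat.size_pos.2 hb; omega)
      have h4 : 2 ^ Nat.size b = 2 * 2 ^ (Nat.size b - 1) := by
        rw [← pow_succ']; congr 1; have := Nat.size_pos.2 hb; omega
      omega
  calc imul b ≤ imul (2 ^ Nat.size b) := hi.mono (Nat.lt_size_self b).le
    _ ≤ imul 1 * (2 ^ Nat.size b) ^ d := h1 _
    _ ≤ imul 1 * (2 * (b + 1)) ^ d := by gcongr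
    _ = imul 1 * 2 ^ d * (b + 1) ^ d := by rw [mul_pow]; ring

theorem PolyBounded.comp (hf : PolyBounded f) (hg : PolyBounded g) : PolyBounded fun j => f (g j) := by
  obtain ⟨c, e, hc⟩ := hf
  exact ((PolyBounded.const c).mul ((hg.add (PolyBounded.const 1)).pow e)).mono fun j => hc _

/-- The power `(j + 1) ^ e` is at most a rising factorial, which equals `e!` times a binomial
coefficient of `j + e`, and that is at most `2 ^ (j + e)`. -/
theorem PolyBounded.le_two_pow (hf : PolyBounded f) : ∃ C, ∀ j, f j ≤ C * 2 ^ j := by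
  obtain ⟨c, e, hc⟩ := hf
  refine ⟨c * (e.factorial * 2 ^ e), fun j => (hc j).trans ?_⟩
  have h1 : (j + 1) ^ e ≤ e.factorial * 2 ^ (j + e) := by
    calc (j + 1) ^ e ≤ (j + 1).ascFactorial e := Nat.pow_succ_le_ascFactorial (j + 1) e
      _ = e.factorial * (j + e).choose e := Nat.ascFactorial_eq_factorial_mul_choose j e
      _ ≤ e.factorial * 2 ^ (j + e) := Nat.mul_le_mul_left _ (Nat.choose_le_two_pow _ _)
  calc c * (j + 1) ^ e ≤ c * (e.factorial * 2 ^ (j + e)) := Nat.mul_le_mul_left _ h1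
    _ = c * (e.factorial * 2 ^ e) * 2 ^ j := by rw [pow_add]; ring

/-- Termwise comparison with a geometric series, whose sum is of the order of its last term. -/
theorem PolyBounded.sum_le (hf : PolyBounded f) :
    ∃ C, ∀ K, ∑ j ∈ Finset.range (K + 1), f j ≤ C * 2 ^ K := by
  obtain ⟨C, hC⟩ := hf.le_two_pow
  refine ⟨2 * C, fun K => ?_⟩
  calc ∑ j ∈ Finset.range (K + 1), f j ≤ ∑ j ∈ Finset.range (K + 1), C * 2 ^ j :=
        Finset.sum_le_sum fun j _ => hC j
    _ = C * ∑ j ∈ Finset.range (K + 1), 2 ^ j := by rw [Finset.mul_sum]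
    _ ≤ C * 2 ^ (K + 1) := by
        refine Nat.mul_le_mul_left _ ?_
        have := Nat.geomSum_eq (le_refl 2) (K + 1)
        rw [this]; simp
    _ = 2 * C * 2 ^ K := by ring

end

/-- The price of simulation `j` is polynomially bounded in `j`, independently of the size of the
instance, so all simulations up to `K` together take O(2^K) time. The last clause is needed
afterwards to bound the entries of array 1 beyond `K`. -/
theorem decideProg_spec {γ : Set ℕ} (hγ : PolyTimeDecidable γ) : ∃ p : Program, ∀ imul, IsMulTime imul →
    ∃ C, ∀ w base K u, 2 * Nat.size base ≤ w → u.reg (regG 0) = base → u.reg (regV vK) = K → K < base →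
      (∀ x j, u.mem (cell base 0 x j 0) = 0) → ∃ u', Leads w imul p u u' (C * 2 ^ K) ∧
      u'.reg (regG 0) = base ∧ (∀ x, u'.reg (regV x) = u.reg (regV x)) ∧
      (∀ a, (∀ x j, a ≠ cell base 0 x j 0) → (∀ j, a ≠ cell base 1 j 0 0) → u'.mem a = u.mem a) ∧
      (∀ j ≤ K, u'.mem (cell base 1 j 0 0) = answer (j ∈ γ)) ∧
      (∀ j, K < j → u'.mem (cell base 1 j 0 0) = u.mem (cell base 1 j 0 0)) := by
  obtain ⟨p, P, hp⟩ := hγ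
  refine ⟨decideProg p, fun imul hi => ?_⟩
  set L : ℕ → ℕ := fun j => Nat.size j + P.eval j with hL
  -- A length `b ≤ 8 * L j + 16 + Nat.size base` beyond the word size satisfies `b > w ≥ 2 *
  -- Nat.size base`, hence `b ≤ 16 * L j + 32`. In this way the price does not depend on `base`.
  set κ : ℕ → ℕ := fun j => 1 + imul (16 * L j + 32) with hκ
  have hLP : PolyBounded L := by
    refine PolyBounded.add (PolyBounded.id.mono fun j => Nat.size_le.2 Nat.lt_two_pow_self) (.eval P)
  have hκP : PolyBounded κ := (PolyBounded.const 1).add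
    (hi.polyBounded.comp (((PolyBounded.const 16).mul hLP).add (PolyBounded.const 32)))
  obtain ⟨C, hC⟩ := (hκP.mul (((((PolyBounded.const 30).mul (.eval P)).add (.const p.maxReg)).add
    (.const 110)))).sum_le
  refine ⟨C + 4 * κ 0, fun w base K u hw hb hK hKb hz => ?_⟩
  set β : ℕ → ℕ := fun j => 8 * L j + 16 + Nat.size base with hβ
  have hc : ∀ j, UnitCost w imul (κ j) (β j) := fun j => hi.unitCost fun b hb hwb => by
    simp only [hβ] at hb; omega
  have h2L : ∀ j, j ≤ 2 ^ L j ∧ 1 ≤ 2 ^ L j := fun j =>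
    ⟨(Nat.lt_size_self j).le.trans (Nat.pow_le_pow_right (by norm_num) (by simp [hL])),
      Nat.one_le_two_pow⟩
  have h1β : 1 < 2 ^ β 0 := Nat.one_lt_two_pow (by simp only [hβ]; omega)
  have hKβ : K < 2 ^ β 0 := hKb.trans <| (Nat.lt_size_self base).trans_le
    (Nat.pow_le_pow_right (by norm_num) (by simp only [hβ]; omega))
  have h1 := (hc 0).const u (regT 0) 1 h1β
  set u1 := u.setReg (regT 0) 1
  have h2 := (hc 0).add u1 (regG 1) (regV vK) (regT 0) (by
    simpa [u1, State.setReg_reg, hK] using hKβ) (by rw [State.setReg_reg, if_pos rfl]; exact h1β)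
  have r1 : u1.reg (regV vK) + u1.reg (regT 0) = K + 1 := by simp [u1, State.setReg_reg, hK]
  rw [r1] at h2
  obtain ⟨u2, h3, b3, v3, f3, a3, c3⟩ := simulateLoop (base := base) (L := L) (T := fun j => P.eval j)
    (v := fun j => answer (j ∈ γ)) hc (fun j => by simp only [hβ]; omega)
    (fun j x hx => cell_lt (Nat.zero_le _) hx.le (h2L j).1 (Nat.zero_le _))
    (fun j => cell_lt (h2L j).2 (h2L j).1 (Nat.zero_le _) (Nat.zero_le _)) (fun j => le_rfl) hp (K + 1)
    (u1.setReg (regG 1) (K + 1)) (by simp [u1, State.setReg_reg, hb]) (by simp [State.setReg_reg])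
    (fun x j _ => hz x j)
  refine ⟨u2, (h1.seq (h2.seq h3)).mono ?_, b3, fun x => (v3 x).trans (by simp [u1, State.setReg_reg]),
    f3, fun j hj => a3 j (by omega), fun j hj => c3 j hj⟩
  have h4 := hC K
  have h5 : κ 0 ≤ κ 0 * 2 ^ K := Nat.le_mul_of_pos_right _ (by positivity)
  have h6 : (C + 4 * κ 0) * 2 ^ K = C * 2 ^ K + 4 * (κ 0 * 2 ^ K) := by ring
  rw [h6]
  refine le_trans ?_ (Nat.add_le_add_right h4 _)
  omega

end RAM

/-! ### The representation of the input -/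

theorem List.getD_append_length_add (l l' : List ℕ) (j : ℕ) :
    (l ++ l').getD (l.length + j) 0 = l'.getD j 0 := by
  rw [List.getD_append_right _ _ _ _ (Nat.le_add_right _ _), Nat.add_sub_cancel_left]

theorem List.getD_flatMap {α : Type*} (g : α → List ℕ) (l : List α) {i j : ℕ} (hi : i < l.length)
    (hj : j < (g l[i]).length) :
    (l.flatMap g).getD (((l.take i).flatMap g).length + j) 0 = (g l[i])[j] := by
  have h : l.flatMap g = (l.take i).flatMap g ++ (g l[i] ++ (l.drop (i + 1)).flatMap g) := by
    conv_lhs => rw [← List.take_append_drop i l, List.drop_eq_getElem_cons hi]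
    rw [List.flatMap_append, List.flatMap_cons]
  rw [h, List.getD_append_length_add, List.getD_append _ _ _ _ hj, List.getD_eq_getElem]

namespace TreeDecomposition

theorem length_encodePairs {n : ℕ} (l : List (Fin n × Fin n)) : (encodePairs l).length = 2 * l.length := by
  simp [encodePairs, List.length_flatMap, mul_comm]

theorem getD_encodePairs {n : ℕ} (l : List (Fin n × Fin n)) {i : ℕ} (hi : i < l.length) :
    (encodePairs l).getD (2 * i) 0 = l[i].1 ∧ (encodePairs l).getD (2 * i + 1) 0 = l[i].2 := by
  have h1 : (encodePairs (l.take i)).length = 2 * i := by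
    rw [length_encodePairs, List.length_take, min_eq_left hi.le]
  have h2 := List.getD_flatMap (fun e : Fin n × Fin n => [(e.1 : ℕ), (e.2 : ℕ)]) l hi (j := 0) (by simp)
  have h3 := List.getD_flatMap (fun e : Fin n × Fin n => [(e.1 : ℕ), (e.2 : ℕ)]) l hi (j := 1) (by simp)
  rw [← encodePairs, ← encodePairs, h1] at h2 h3
  exact ⟨h2, h3⟩

theorem ListsEdges.length {n : ℕ} {H : SimpleGraph (Fin n)} [Fintype H.edgeSet]
    {l : List (Fin n × Fin n)} (h : ListsEdges H l) : l.length = H.edgeFinset.card := by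
  rw [← List.length_map (f := fun e : Fin n × Fin n => s(e.1, e.2)), ← List.toFinset_card_of_nodup h.1]
  congr 1
  ext e
  rw [List.mem_toFinset, h.2, SimpleGraph.mem_edgeFinset]

theorem card_bag_le {V ι : Type*} [Fintype ι] {G : SimpleGraph V} (D : TreeDecomposition G ι) (x : ι) :
    (D.bag x).card ≤ D.width + 1 := by
  have := Finset.le_sup (f := fun x => (D.bag x).card) (Finset.mem_univ x)
  rw [width]
  omega

theorem sup_card_bag {V ι : Type*} [Fintype ι] {G : SimpleGraph V} (D : TreeDecomposition G ι) (v : V) :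
    (Finset.univ.sup fun x => (D.bag x).card) = D.width + 1 := by
  obtain ⟨x, hx⟩ := D.exists_mem_bag v
  have h1 := Finset.le_sup (f := fun x => (D.bag x).card) (Finset.mem_univ x)
  have h2 := Finset.card_pos.2 ⟨v, hx⟩
  rw [width]
  omega

/-- Every edge has both ends in some bag, and a bag provides at most `(D.width + 1) ^ 2` ordered
pairs. So the edges of the graph can be read within the time bound. -/
theorem card_edgeFinset_le {n N : ℕ} {G : SimpleGraph (Fin n)} [Fintype G.edgeSet]
    (D : TreeDecomposition G (Fin N)) : G.edgeFinset.card ≤ N * (D.width + 1) ^ 2 := by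
  classical
  have h : G.edgeFinset ⊆ Finset.univ.biUnion fun x =>
      (D.bag x ×ˢ D.bag x).image fun e => s(e.1, e.2) := by
    intro e
    induction e with
    | _ u v =>
      intro h
      rw [SimpleGraph.mem_edgeFinset, SimpleGraph.mem_edgeSet] at h
      obtain ⟨x, hu, hv⟩ := D.exists_edge_bag u v h
      exact Finset.mem_biUnion.2 ⟨x, Finset.mem_univ x, Finset.mem_image.2 ⟨(u, v),
        Finset.mem_product.2 ⟨hu, hv⟩, rfl⟩⟩
  refine (Finset.card_le_card h).trans (Finset.card_biUnion_le.trans ?_)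
  refine (Finset.sum_le_card_nsmul _ _ ((D.width + 1) ^ 2) fun x _ => ?_).trans (by simp)
  refine Finset.card_image_le.trans ?_
  rw [Finset.card_product, sq]
  exact Nat.mul_le_mul (D.card_bag_le x) (D.card_bag_le x)

end TreeDecomposition

namespace RAM

open Finset TreeDecomposition

/-- Numbers from this one on are addresses of arrays. -/
def baseOf (n E N : ℕ) : ℕ := (n + E + N + 3) * (n + E + N + 3)

section

variable {n N : ℕ} {es : List (Fin n × Fin n)} {ts : List (Fin N × Fin N)} {bs : Fin N → List (Fin n)}
  {inp : List ℕ}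

/-- The list of numbers that represents a bag. -/
def encodeBag (bs : Fin N → List (Fin n)) (x : Fin N) : List ℕ := (bs x).length :: (bs x).map Fin.val

/-- The list of numbers that represents a graph and a tree decomposition. -/
def encodeInput (es : List (Fin n × Fin n)) (ts : List (Fin N × Fin N)) (bs : Fin N → List (Fin n)) :
    List ℕ :=
  [n, es.length, N] ++ (encodePairs es ++ (encodePairs ts ++ (List.finRange N).flatMap (encodeBag bs)))

/-- The address of a bag. -/
def bagPtr (es : List (Fin n × Fin n)) (ts : List (Fin N × Fin N)) (bs : Fin N → List (Fin n)) (x : ℕ) : ℕ :=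
  3 + 2 * es.length + 2 * ts.length + (((List.finRange N).take x).flatMap (encodeBag bs)).length

theorem bagPtr_succ (x : Fin N) : bagPtr es ts bs (x + 1) = bagPtr es ts bs x + 1 + (bs x).length := by
  rw [bagPtr, bagPtr, List.take_succ_eq_append_getElem (by simp), List.flatMap_append]
  simp [encodeBag]
  omega

theorem bagPtr_last : bagPtr es ts bs N = (encodeInput es ts bs).length := by
  rw [bagPtr, List.take_of_length_le (by simp)]
  simp only [encodeInput, List.length_append, length_encodePairs, List.length_cons, List.length_nil]
  omega

theorem bagPtr_mono : Monotone (bagPtr es ts bs) := fun x y h => by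
  refine Nat.add_le_add_left (List.Sublist.length_le ?_) _
  exact (List.take_sublist_take_left h).flatMap _

theorem layout_encodeInput {raw : ℕ → ℕ} {base : ℕ} (hraw : ∀ i, raw i = (encodeInput es ts bs).getD i 0)
    (hbase : (encodeInput es ts bs).length ≤ base) :
    Layout es ts bs (bagPtr es ts bs) base raw := by
  have r1 : ∀ i, raw (3 + i) = (encodePairs es ++ (encodePairs ts ++
      (List.finRange N).flatMap (encodeBag bs))).getD i 0 := fun i => by
    rw [hraw]; exact List.getD_append_length_add [n, es.length, N] _ i
  have r2 : ∀ i, raw (3 + 2 * es.length + i) = (encodePairs ts ++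
      (List.finRange N).flatMap (encodeBag bs)).getD i 0 := fun i => by
    rw [Nat.add_assoc, r1, ← length_encodePairs, List.getD_append_length_add]
  have r3 : ∀ i, raw (3 + 2 * es.length + 2 * ts.length + i) =
      ((List.finRange N).flatMap (encodeBag bs)).getD i 0 := fun i => by
    rw [Nat.add_assoc, r2, ← length_encodePairs, List.getD_append_length_add]
  have r4 : ∀ (x : Fin N) j (hj : j < (encodeBag bs x).length), raw (bagPtr es ts bs x + j) =
      (encodeBag bs x)[j] := fun x j hj => by
    have := List.getD_flatMap (encodeBag bs) (List.finRange N) (i := x) (j := j) (by simp) (by simpa using hj)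
    rw [bagPtr, Nat.add_assoc, r3, this]
    simp
  refine ⟨⟨by rw [hraw]; rfl, by rw [hraw]; rfl, by rw [hraw]; rfl⟩, fun i hi => ?_, fun i hi => ?_,
    by simp [bagPtr], bagPtr_succ, fun x => ⟨?_, fun p hp => ?_⟩, fun x hx =>
      (bagPtr_mono hx).trans (bagPtr_last.trans_le hbase)⟩
  · obtain ⟨h1, h2⟩ := getD_encodePairs es hi
    refine ⟨?_, ?_⟩
    · rw [r1, List.getD_append _ _ _ _ (by rw [length_encodePairs]; omega), h1]
    · rw [show 4 + 2 * i = 3 + (2 * i + 1) by omega, r1,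
        List.getD_append _ _ _ _ (by rw [length_encodePairs]; omega), h2]
  · obtain ⟨h1, h2⟩ := getD_encodePairs ts hi
    refine ⟨?_, ?_⟩
    · rw [r2, List.getD_append _ _ _ _ (by rw [length_encodePairs]; omega), h1]
    · rw [show 4 + 2 * es.length + 2 * i = 3 + 2 * es.length + (2 * i + 1) by omega, r2,
        List.getD_append _ _ _ _ (by rw [length_encodePairs]; omega), h2]
  · exact r4 x 0 (by simp [encodeBag])
  · rw [Nat.add_assoc, Nat.add_comm 1 p, r4 x (p + 1) (by simp [encodeBag, hp])]
    simp [encodeBag]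

/-- The input consists of the head, the edges, and `N` blocks of at most `n + 1` numbers each, which
is quadratic in `n + E + N`. Hence the arrays can start at a square that is computable from the head
alone. -/
theorem length_encodeInput_le (hlen : ts.length + 1 = N) (hnd : ∀ x, (bs x).Nodup) :
    (encodeInput es ts bs).length ≤ baseOf n es.length N := by
  have h1 : ((List.finRange N).flatMap (encodeBag bs)).length ≤ N * (n + 1) := by
    rw [List.length_flatMap]
    refine (List.sum_le_card_nsmul _ (n + 1) fun a ha => ?_).trans (by simp)
    obtain ⟨x, -, rfl⟩ := List.mem_map.1 ha
    have := (hnd x).length_le_card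
    simp [encodeBag] at this ⊢
    exact this
  simp only [encodeInput, List.length_append, length_encodePairs, List.length_cons, List.length_nil, baseOf]
  nlinarith

theorem mem_encodeInput_le (hnd : ∀ x, (bs x).Nodup) {v : ℕ} (hv : v ∈ encodeInput es ts bs) :
    v ≤ n + es.length + N := by
  simp only [encodeInput, encodePairs, encodeBag, List.mem_append, List.mem_flatMap, List.mem_cons,
    List.mem_map, List.not_mem_nil, or_false] at hv
  rcases hv with (h | h | h) | ⟨e, -, h | h⟩ | ⟨e, -, h | h⟩ | ⟨x, -, h | ⟨u, -, h⟩⟩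
  · omega
  · omega
  · omega
  · have := e.1.2; omega
  · have := e.2.2; omega
  · have := e.1.2; omega
  · have := e.2.2; omega
  · have := (hnd x).length_le_card
    simp at this; omega
  · have := u.2; omega

/-- Each vertex occurs in a bag, and each node and each edge of the graph takes up cells of the
input. Thus `n + E + N + 3` is at most three times the input length, and its square has O(log L)
bits. -/
theorem size_baseOf_le (hcover : ∀ v, ∃ x, v ∈ bs x) :
    Nat.size (baseOf n es.length N) ≤ 8 * Nat.size (encodeInput es ts bs).length := by
  have h1 : n ≤ ((List.finRange N).flatMap (encodeBag bs)).length := by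
    rw [List.length_flatMap, ← Fin.sum_univ_def]
    have h : (univ : Finset (Fin n)) ⊆ univ.biUnion fun x => (bs x).toFinset := fun v _ => by
      obtain ⟨x, hx⟩ := hcover v
      exact mem_biUnion.2 ⟨x, mem_univ x, List.mem_toFinset.2 hx⟩
    calc n = (univ : Finset (Fin n)).card := by simp
      _ ≤ ∑ x, (bs x).toFinset.card := (card_le_card h).trans card_biUnion_le
      _ ≤ ∑ x, (encodeBag bs x).length := sum_le_sum fun x _ =>
        ((bs x).toFinset_card_le).trans (by simp [encodeBag])
  have hL : n + es.length + N + 3 ≤ 3 * (encodeInput es ts bs).length := by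
    have h2 : N ≤ ((List.finRange N).flatMap (encodeBag bs)).length := by
      rw [List.length_flatMap, ← Fin.sum_univ_def]
      calc N = ∑ _x : Fin N, 1 := by simp
        _ ≤ ∑ x, (encodeBag bs x).length := sum_le_sum fun x _ => by simp [encodeBag]
    simp only [encodeInput, List.length_append, length_encodePairs, List.length_cons, List.length_nil]
    omega
  set L := (encodeInput es ts bs).length
  have hL0 : 0 < Nat.size L := Nat.size_pos.2 (by omega)
  have h3 : n + es.length + N + 3 < 2 ^ (2 + Nat.size L) := by
    have := Nat.lt_size_self L
    rw [pow_add]; omega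
  rw [Nat.size_le, baseOf]
  calc _ < 2 ^ (2 + Nat.size L) * 2 ^ (2 + Nat.size L) := Nat.mul_lt_mul'' h3 h3
    _ = 2 ^ (4 + 2 * Nat.size L) := by rw [← pow_add]; congr 1; ring
    _ ≤ _ := Nat.pow_le_pow_right (by norm_num) (by omega)

theorem isInput_iff {G : SimpleGraph (Fin n)} (D : TreeDecomposition G (Fin N)) :
    D.IsInput inp ↔ ∃ (es : List (Fin n × Fin n)) (ts : List (Fin N × Fin N)) (bs : Fin N → List (Fin n)),
      ListsEdges G es ∧ ListsEdges D.tree ts ∧ (∀ x, (bs x).Nodup ∧ ∀ v, v ∈ bs x ↔ v ∈ D.bag x) ∧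
      inp = encodeInput es ts bs := by
  have h : ∀ bs : Fin N → List (Fin n), encodeBag bs = fun x => (bs x).length ::
      List.map (fun v => v) (do let a ← bs x; pure a.val) := fun bs => by
    funext x; simpa [encodeBag] using List.map_eq_flatMap
  simp only [IsInput, encodeInput, h, List.append_assoc]

end

end RAM

namespace RAM

open Finset TreeDecomposition

/-! ### The algorithm -/

/-- Put `baseOf n E N` into the further register `0`. -/
def preludeProg : Program :=
  .seq (.load (regT 1) (regT 0)) <| .seq (.const (regT 0) 1) <| .seq (.load (regT 2) (regT 0)) <|
  .seq (.const (regT 0) 2) <| .seq (.load (regT 3) (regT 0)) <|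
  .seq (.add (regT 1) (regT 1) (regT 2)) <| .seq (.add (regT 1) (regT 1) (regT 3)) <|
  .seq (.const (regT 0) 3) <| .seq (.add (regT 1) (regT 1) (regT 0)) <|
  .mul (regG 0) (regT 1) (regT 1)

/-- The whole algorithm, where `q` writes the answers to the questions `j ∈ γ` to array `1`. -/
def algorithm (pack clamp : Bool) (e : ℕ) (q : Program) : Program :=
  .seq preludeProg <| .seq ((readStmt e).compile 0) <| .seq q ((eliminateStmt pack clamp e).compile 0)

section

variable {w κ β : ℕ} {imul : ℕ → ℕ}

theorem UnitCost.prelude (hc : UnitCost w imul κ β) {n E N : ℕ} {s : State} (h0 : s.mem 0 = n)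
    (h1 : s.mem 1 = E) (h2 : s.mem 2 = N) (hs : ∀ x, s.reg x = 0) (hβ : baseOf n E N < 2 ^ β) :
    ∃ s', Leads w imul preludeProg s s' (10 * κ) ∧ s'.mem = s.mem ∧ (∀ x, s'.reg (regV x) = 0) ∧
      s'.reg (regG 0) = baseOf n E N := by
  have hb : n + E + N + 3 ≤ baseOf n E N := Nat.le_mul_self _
  have l1 := hc.load s (regT 1) (regT 0) (by rw [hs]; omega) (by rw [hs, h0]; omega)
  rw [hs, h0] at l1
  set s1 := s.setReg (regT 1) n
  have l2 := hc.const s1 (regT 0) 1 (by omega)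
  set s2 := s1.setReg (regT 0) 1
  have r2 : s2.reg (regT 0) = 1 := by simp [s2, State.setReg_reg]
  have m2 : s2.mem = s.mem := rfl
  have l3 := hc.load s2 (regT 2) (regT 0) (by rw [r2]; omega) (by rw [r2, m2, h1]; omega)
  rw [r2, m2, h1] at l3
  set s3 := s2.setReg (regT 2) E
  have l4 := hc.const s3 (regT 0) 2 (by omega)
  set s4 := s3.setReg (regT 0) 2
  have r4 : s4.reg (regT 0) = 2 := by simp [s4, State.setReg_reg]
  have m4 : s4.mem = s.mem := rfl
  have l5 := hc.load s4 (regT 3) (regT 0) (by rw [r4]; omega) (by rw [r4, m4, h2]; omega)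
  rw [r4, m4, h2] at l5
  set s5 := s4.setReg (regT 3) N
  have r51 : s5.reg (regT 1) = n := by simp [s5, s4, s3, s2, s1, State.setReg_reg]
  have r52 : s5.reg (regT 2) = E := by simp [s5, s4, s3, State.setReg_reg]
  have r53 : s5.reg (regT 3) = N := by simp [s5, State.setReg_reg]
  have l6 := hc.add s5 (regT 1) (regT 1) (regT 2) (by rw [r51]; omega) (by rw [r52]; omega)
  rw [r51, r52] at l6
  set s6 := s5.setReg (regT 1) (n + E)
  have r61 : s6.reg (regT 1) = n + E := by simp [s6, State.setReg_reg]
  have r63 : s6.reg (regT 3) = N := by simp [s6, State.setReg_reg, r53]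
  have l7 := hc.add s6 (regT 1) (regT 1) (regT 3) (by rw [r61]; omega) (by rw [r63]; omega)
  rw [r61, r63] at l7
  set s7 := s6.setReg (regT 1) (n + E + N)
  have l8 := hc.const s7 (regT 0) 3 (by omega)
  set s8 := s7.setReg (regT 0) 3
  have r81 : s8.reg (regT 1) = n + E + N := by simp [s8, s7, State.setReg_reg]
  have r80 : s8.reg (regT 0) = 3 := by simp [s8, State.setReg_reg]
  have l9 := hc.add s8 (regT 1) (regT 1) (regT 0) (by rw [r81]; omega) (by rw [r80]; omega)
  rw [r81, r80] at l9
  set s9 := s8.setReg (regT 1) (n + E + N + 3)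
  have r91 : s9.reg (regT 1) = n + E + N + 3 := by simp [s9, State.setReg_reg]
  have l10 := hc.mul' s9 (regG 0) (regT 1) (regT 1) (by rw [r91]; omega) (by rw [r91]; omega)
  rw [r91] at l10
  refine ⟨_, (l1.seq <| l2.seq <| l3.seq <| l4.seq <| l5.seq <| l6.seq <| l7.seq <| l8.seq <|
    l9.seq l10).mono (by omega), rfl, fun x => ?_, by simp [State.setReg_reg, baseOf]⟩
  simp [s9, s8, s7, s6, s5, s4, s3, s2, s1, State.setReg_reg, hs]

/-- The program writes the answers to the questions `j ∈ γ` for `j ≤ vK` to array `1`. -/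
def Decides (γ : Set ℕ) (imul : ℕ → ℕ) (C : ℕ) (q : Program) : Prop :=
  ∀ w base K u, 2 * Nat.size base ≤ w → u.reg (regG 0) = base → u.reg (regV vK) = K → K < base →
    (∀ x j, u.mem (cell base 0 x j 0) = 0) → ∃ u', Leads w imul q u u' (C * 2 ^ K) ∧
    u'.reg (regG 0) = base ∧ (∀ x, u'.reg (regV x) = u.reg (regV x)) ∧
    (∀ a, (∀ x j, a ≠ cell base 0 x j 0) → (∀ j, a ≠ cell base 1 j 0 0) → u'.mem a = u.mem a) ∧
    (∀ j ≤ K, u'.mem (cell base 1 j 0 0) = answer (j ∈ γ)) ∧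
    (∀ j, K < j → u'.mem (cell base 1 j 0 0) = u.mem (cell base 1 j 0 0))

theorem algorithm_spec (hc : UnitCost w imul κ β) {γ : Set ℕ} (h0 : 0 ∉ γ) {C : ℕ} {q : Program}
    (hq : Decides γ imul C q) {n N E D K M lim e : ℕ} {pack clamp : Bool} (hn : 1 ≤ n)
    {G : SimpleGraph (Fin n)} {T : TreeDecomposition G (Fin N)} {inp : List ℕ} (hT : T.IsInput inp)
    (hE : inp.getD 1 0 = E) (hK : K = T.width + 1) (hD : e * n + 1 = D) (he : e ≤ 1)
    (hw : 2 * Nat.size (baseOf n E N) ≤ w) (hbM : baseOf n E N ≤ M) (hpow : 2 ^ K ≤ M)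
    (hgrow : growth K D ^ lim ≤ M) (hlim : if clamp then 1 ≤ lim else n + N ≤ lim)
    (hβ : M ^ ((readStmt e).deg + (eliminateStmt pack clamp e).deg) < 2 ^ β) :
    ∃ s, Leads w imul (algorithm pack clamp e q) (initState inp) s
      (κ * (10 + 24 * readTime n E N K + 24 * (unitTime K D * (n + 4 * N + 1))) + C * 2 ^ K) ∧
      ∀ c < D, valueCon clamp (s.mem c)
        (PowerSeries.coeff c (weightSum γ G pack (PowerSeries.X ^ e : PowerSeries ℕ) univ)) ∧
        (clamp → s.mem c ≤ 1) := by
  classical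
  obtain ⟨es, ts, bs, hes, hts, hbs, rfl⟩ := (isInput_iff T).1 hT
  obtain rfl : E = es.length := by rw [← hE]; rfl
  set base := baseOf n es.length N with hbase
  have hlen : ts.length + 1 = N := by
    rw [hts.length, T.isTree.card_edgeFinset, Fintype.card_fin]
  have hL := length_encodeInput_le (es := es) hlen fun x => (hbs x).1
  rw [← hbase] at hL
  have hsum : n + es.length + N + 3 ≤ base := Nat.le_mul_self _
  have hNb : N * N + 2 * N ≤ base := by rw [hbase, baseOf]; nlinarith
  have hN1 : 1 ≤ N := by omega
  have hlK : ∀ x, (bs x).length = (T.bag x).card := fun x => by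
    rw [← List.toFinset_card_of_nodup (hbs x).1]
    congr 1
    ext v
    rw [List.mem_toFinset, (hbs x).2]
  have hKn : K ≤ n := by
    rw [hK, ← T.sup_card_bag ⟨0, hn⟩]
    exact Finset.sup_le fun x _ => (card_le_univ _).trans (by simp)
  have hd1 : M ^ (readStmt e).deg < 2 ^ β :=
    (Nat.pow_le_pow_right (by omega) (Nat.le_add_right _ _)).trans_lt hβ
  have hd2 : M ^ (eliminateStmt pack clamp e).deg < 2 ^ β :=
    (Nat.pow_le_pow_right (by omega) (Nat.le_add_left _ _)).trans_lt hβ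
  have hMβ : M < 2 ^ β :=
    (Nat.le_self_pow (by have := (readStmt e).one_le_deg; omega) M).trans_lt hd1
  obtain ⟨s1, l1, m1, v1, g1⟩ := hc.prelude (s := initState (encodeInput es ts bs)) (n := n)
    (E := es.length) (N := N) rfl rfl rfl (fun _ => rfl) (by omega)
  rw [← hbase] at g1
  have hcell : ∀ a i j k, s1.mem (cell base a i j k) = 0 := fun a i j k => by
    rw [m1]
    exact List.getD_eq_default _ _ (hL.trans (le_cell _ _ _ _ _))
  have hraw : ∀ i, (s1.store base).raw i = (encodeInput es ts bs).getD i 0 := fun i => by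
    simp only [State.store, m1]
    split_ifs with h
    · rfl
    · exact (List.getD_eq_default _ _ (by omega)).symm
  have hB1 : (s1.store base).Bounded M := by
    refine ⟨fun x => (v1 x).trans_le (Nat.zero_le _), fun a _ i j k => (hcell a i j k).trans_le
      (Nat.zero_le _), fun i => ?_⟩
    rw [hraw]
    rcases lt_or_ge i (encodeInput es ts bs).length with h | h
    · rw [List.getD_eq_getElem _ _ h]
      have := mem_encodeInput_le (fun x => (hbs x).1) (List.getElem_mem h)
      omega
    · rw [List.getD_eq_default _ _ h]; exact Nat.zero_le _
  have hlay : Layout es ts bs (bagPtr es ts bs) base (s1.store base).raw := layout_encodeInput hraw hL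
  have hDb : D ≤ base := by
    have : e * n ≤ 1 * n := Nat.mul_le_mul_right _ he
    omega
  obtain ⟨ok1, ht1, hraw2, hvK, hvN, hvx, hvy, hvi, htab⟩ := readStmt_spec (M := M) (e := e) (D := D) (K := K)
    (γ := γ) (lim := lim) (pack := pack) (clamp := clamp) (T := T.tree)
    (Q := fun t τ => t ≤ readTime n es.length N K ∧ τ.raw = (s1.store base).raw ∧ τ.var vK = K ∧
      τ.var vN = N ∧ τ.var vx = 0 ∧ τ.var vy = 0 ∧ τ.var vi = 0 ∧ ∀ τ' : Store,
        (∀ a, a ≠ 0 → a ≠ 1 → τ'.arr a = τ.arr a) → τ'.var vD = τ.var vD →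
        (∀ j ≤ K, τ'.arr 1 j 0 0 = answer (j ∈ γ)) →
        Tables γ G bs K D M lim e pack clamp univ univ τ' ∧ Forest T.tree G bs univ univ τ')
    hlay hes hts hlen hbM (by omega) hD (by omega) (by omega) hpow (by omega)
    (fun x => by rw [hlK, hK]; exact T.card_bag_le x)
    (fun B hB => by
      rw [hK, ← T.sup_card_bag ⟨0, hn⟩]
      exact Finset.sup_le fun x _ => (hlK x).symm.trans_le (hB x))
    (fun x => (hbs x).1)
    (fun v => (T.exists_mem_bag v).imp fun x hx => ((hbs x).2 v).2 hx)
    (fun u v h => (T.exists_edge_bag u v h).imp fun x hx => ⟨((hbs x).2 u).2 hx.1, ((hbs x).2 v).2 hx.2⟩)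
    (by
      rw [Budget]
      cases clamp
      · simpa using hlim
      · simpa using hlim)
    hgrow v1 hcell fun t h1 τ h2 h3 h4 h5 h6 h7 h8 => ⟨h1, h2, h3, h4, h5, h6, h7, h8⟩
  obtain ⟨s2, l2, st2, p2⟩ := (readStmt e).compile_spec hc (by omega) hbM (d := 0) g1 hB1 ok1 hd1
  have hB2 : (s2.store base).Bounded M := by rw [st2]; exact (readStmt e).bounded_run hB1 ok1
  rw [← st2] at hraw2 hvK hvN hvx hvy hvi htab
  -- Reading never writes to array 0, so the memory of the simulations is still blank.
  have hz : ∀ x j, s2.mem (cell base 0 x j 0) = 0 := fun x j => by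
    have h1 : (s2.store base).arr 0 = (s1.store base).arr 0 := by
      rw [st2]; exact (readStmt e).run_arr (by
        simp [readStmt, headStmt, adjacencyStmt, treeStmt, neighborStmt, bagStmt, oneBagStmt, bitStmt, fill,
          Stmt.wArrs])
    exact (congrFun (congrFun (congrFun h1 x) j) 0).trans (hcell 0 x j 0)
  obtain ⟨s3, l3, g3, v3, f3, a3, c3⟩ := hq w base K s2 hw ((p2.regG 0).trans g1) hvK (by omega) hz
  have hvar3 : (s3.store base).var = (s2.store base).var := funext v3
  have hne : ∀ {a i j k}, a ≠ 0 → a ≠ 1 → s3.mem (cell base a i j k) = s2.mem (cell base a i j k) :=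
    fun h h' => f3 _ (fun x j => by simp [cell_inj, h]) fun j => by simp [cell_inj, h']
  have hB3 : (s3.store base).Bounded M := by
    refine ⟨fun x => by rw [hvar3]; exact hB2.var x, fun a ha i j k => ?_, fun i => ?_⟩
    · have hold := hB2.arr a ha i j k
      -- Array 1 was written outside the structured language, so its bound has to be checked by
      -- hand: answers are 0 or 1, and all other entries are as before.
      by_cases ha1 : a = 1
      · subst ha1
        by_cases h : j = 0 ∧ k = 0
        · obtain ⟨rfl, rfl⟩ := h
          rcases le_or_gt i K with hi | hi
          · refine (a3 i hi).trans_le ?_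
            rw [answer]; split_ifs <;> omega
          · exact (c3 i hi).trans_le hold
        · refine (f3 _ (fun x j => by simp [cell_inj]) fun j' => ?_).trans_le hold
          simp only [ne_eq, cell_inj]
          rintro ⟨-, -, rfl, rfl⟩
          exact h ⟨rfl, rfl⟩
      · exact (hne ha ha1).trans_le hold
    · have hold := hB2.raw i
      simp only [State.store] at hold ⊢
      split_ifs with hi
      · rw [if_pos hi] at hold
        have hcl : ∀ {a x y z}, i ≠ cell base a x y z := fun {a x y z} h => by
          have := le_cell base a x y z; omega
        rwa [f3 i (fun _ _ => hcl) fun _ => hcl]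
      · exact Nat.zero_le _
  obtain ⟨hTab, hFor⟩ := htab (s3.store base) (fun a h h' => by
      funext i j k; exact hne h h') (by rw [hvar3]) a3
  obtain ⟨ok3, ht3, hres⟩ := eliminateStmt_spec (base := base) (Q := fun t τ =>
      t ≤ unitTime K D * (n + 4 * N + 1) ∧ ∀ c < D, valueCon clamp (τ.raw c)
        (PowerSeries.coeff c (weightSum γ G pack (PowerSeries.X ^ e : PowerSeries ℕ) univ)) ∧
      (clamp → τ.raw c ≤ 1)) hTab hFor T.isTree hN1 (by rw [hvar3, hvN]) (by rw [hvar3, hvi])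
    (by rw [hvar3, hvx]) (by rw [hvar3, hvy])
    (fun R hR x hx y hy z hz hzx v hvx hvz => ((hbs y).2 v).2
      (T.mem_bag_of_leaf hR hx hz hy hzx (((hbs x).2 v).1 hvx) (((hbs z).2 v).1 hvz))) h0 hDb
    fun t ht τ h => ⟨ht, h⟩
  obtain ⟨s4, l4, st4, p4⟩ := (eliminateStmt pack clamp e).compile_spec hc (by omega) hbM (d := 0) g3 hB3
    ok3 hd2
  refine ⟨s4, (l1.seq (l2.seq (l3.seq l4))).mono ?_, fun c hcD => ?_⟩
  · have e1 : κ * (10 + 24 * readTime n es.length N K + 24 * (unitTime K D * (n + 4 * N + 1))) =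
        10 * κ + κ * (24 * readTime n es.length N K) + κ * (24 * (unitTime K D * (n + 4 * N + 1))) := by
      ring
    have e2 := Nat.mul_le_mul_left κ (Nat.mul_le_mul_left 24 ht1)
    have e3 := Nat.mul_le_mul_left κ (Nat.mul_le_mul_left 24 ht3)
    omega
  · have h := hres c hcD
    rw [← st4] at h
    simpa only [State.store, if_pos (hcD.trans_le hDb)] using h

end

end RAM

namespace RAM

open Finset TreeDecomposition

/-! ### Numbers of packings and of partitionings -/

theorem coeff_weightSum {n : ℕ} {γ : Set ℕ} {G : SimpleGraph (Fin n)} {pack : Bool} {e c : ℕ}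
    {P : Finset (Finset (Fin n)) → Prop}
    (hP : ∀ 𝒞, IsCliquePacking γ G 𝒞 ∧ (pack = true ∨ 𝒞.sup id = univ) ↔ P 𝒞) :
    PowerSeries.coeff c (weightSum γ G pack (PowerSeries.X ^ e : PowerSeries ℕ) univ) =
      {𝒞 | P 𝒞 ∧ e * 𝒞.card = c}.ncard := by
  classical
  have h : {𝒞 | P 𝒞 ∧ e * 𝒞.card = c} = ((univ.filter P).filter fun 𝒞 => c = e * 𝒞.card : Finset _) := by
    ext 𝒞; simp [eq_comm]
  rw [h, Set.ncard_coe_finset, weightSum, map_sum, card_filter]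
  refine sum_congr ?_ fun 𝒞 _ => by rw [← pow_mul, PowerSeries.coeff_X_pow]
  ext 𝒞
  simp [hP]

theorem packing_iff {n : ℕ} {γ : Set ℕ} {G : SimpleGraph (Fin n)} (𝒞 : Finset (Finset (Fin n))) :
    IsCliquePacking γ G 𝒞 ∧ (true = true ∨ 𝒞.sup id = univ) ↔ IsCliquePacking γ G 𝒞 := by simp

theorem partitioning_iff {n : ℕ} {γ : Set ℕ} {G : SimpleGraph (Fin n)} (𝒞 : Finset (Finset (Fin n))) :
    IsCliquePacking γ G 𝒞 ∧ (false = true ∨ 𝒞.sup id = univ) ↔ IsCliquePartitioning γ G 𝒞 := by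
  simp only [Bool.false_eq_true, false_or, eq_univ_iff_forall, mem_sup, id, IsCliquePartitioning,
    IsCliqueCover]
  exact ⟨fun h => ⟨⟨h.1.1, h.2⟩, h.1⟩, fun h => ⟨h.2, h.1.2⟩⟩

/-! ### Bounds on the time and on the numbers -/

theorem isInput_bounds {n N E : ℕ} {G : SimpleGraph (Fin n)} {T : TreeDecomposition G (Fin N)}
    {inp : List ℕ} (hT : T.IsInput inp) (hE : inp.getD 1 0 = E) :
    E ≤ N * (T.width + 1) ^ 2 ∧ Nat.size (baseOf n E N) ≤ 8 * Nat.size inp.length ∧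
      1 ≤ Nat.size inp.length := by
  classical
  obtain ⟨es, ts, bs, hes, -, hbs, rfl⟩ := (isInput_iff T).1 hT
  obtain rfl : E = es.length := by rw [← hE]; rfl
  refine ⟨hes.length.trans_le T.card_edgeFinset_le, size_baseOf_le fun v =>
    (T.exists_mem_bag v).imp fun x hx => ((hbs x).2 v).2 hx, Nat.size_pos.2 ?_⟩
  simp [encodeInput]

/-- Passing from `K = k + 1` back to `k` costs a factor 8 in `2 ^ K * (K + 1) ^ 2`, and the number
of moves is at most `(4 * a + 2) * n`. The time for reading is of lower or equal order because of
the bound on the number of edges. -/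
theorem time_le {n N E K D k a : ℕ} (hn : 1 ≤ n) (hN : N ≤ a * n) (hE : E ≤ N * (k + 1) ^ 2)
    (hK : K = k + 1) (hD : 1 ≤ D) :
    10 + 24 * readTime n E N K + 24 * (unitTime K D * (n + 4 * N + 1)) ≤
      (10 + 24 * (40410 + 540 * a) + 63379200 * (4 * a + 2)) * (n * ((k + 1) ^ 2 * 2 ^ k) * D ^ 2) := by
  subst hK
  have h2 : 1 ≤ 2 ^ k := Nat.one_le_two_pow
  have hk : k + 1 ≤ (k + 1) ^ 2 := Nat.le_self_pow (by norm_num) _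
  have hD2 : 1 ≤ D ^ 2 := Nat.one_le_pow _ _ hD
  set S := n * ((k + 1) ^ 2 * 2 ^ k) with hS
  set Y := S * D ^ 2 with hY
  have hSY : S ≤ Y := Nat.le_mul_of_pos_right _ hD2
  have hq : (k + 1) ^ 2 ≤ (k + 1) ^ 2 * 2 ^ k := Nat.le_mul_of_pos_right _ h2
  have i1 : n ≤ S := Nat.le_mul_of_pos_right _ (by positivity)
  have i2 : E ≤ a * S := by
    calc E ≤ (a * n) * ((k + 1) ^ 2 * 2 ^ k) := hE.trans (Nat.mul_le_mul hN hq)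
      _ = a * S := by rw [hS]; ring
  have i3 : N * (k + 1 + 1) ≤ 2 * a * S := by
    calc N * (k + 1 + 1) ≤ (a * n) * (2 * ((k + 1) ^ 2 * 2 ^ k)) := Nat.mul_le_mul hN (by omega)
      _ = 2 * a * S := by rw [hS]; ring
  have i4 : (k + 1 + 1) * 2 ^ (k + 1) ≤ 4 * S := by
    calc (k + 1 + 1) * 2 ^ (k + 1) ≤ 2 * (k + 1) ^ 2 * 2 ^ (k + 1) := Nat.mul_le_mul_right _ (by omega)
      _ = 1 * (4 * ((k + 1) ^ 2 * 2 ^ k)) := by ring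
      _ ≤ n * (4 * ((k + 1) ^ 2 * 2 ^ k)) := Nat.mul_le_mul_right _ hn
      _ = 4 * S := by rw [hS]; ring
  have i5 : unitTime (k + 1) D * (n + 4 * N + 1) ≤ 2640800 * (4 * a + 2) * Y := by
    have j1 : n + 4 * N + 1 ≤ (4 * a + 2) * n := by nlinarith
    have j2 : (k + 1 + 1) ^ 2 ≤ 4 * (k + 1) ^ 2 := by nlinarith
    calc unitTime (k + 1) D * (n + 4 * N + 1)
        ≤ (330100 * (2 ^ (k + 1) * (4 * (k + 1) ^ 2) * D ^ 2)) * ((4 * a + 2) * n) := by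
          rw [unitTime, stepTime]; gcongr
      _ = 2640800 * (4 * a + 2) * Y := by rw [hY, hS]; ring
  have i6 : readTime n E N (k + 1) ≤ (40410 + 540 * a) * S := by
    rw [readTime]
    linarith
  have i7 : (40410 + 540 * a) * S ≤ (40410 + 540 * a) * Y := Nat.mul_le_mul_left _ hSY
  have i8 : 1 ≤ Y := hn.trans (i1.trans hSY)
  linarith

/-- A bound on the numbers that occur. -/
def numberBound (b K D lim : ℕ) : ℕ := b * growth K D ^ lim

section

variable {b K D lim : ℕ}

theorem two_pow_le_growth (hD : 1 ≤ D) : 2 ^ K ≤ growth K D := by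
  have h : 2 ^ K ≤ 4 ^ K := Nat.pow_le_pow_left (by norm_num) K
  calc 2 ^ K = 1 * 2 ^ K * 1 * 1 := by ring
    _ ≤ growth K D := by
      rw [growth]
      gcongr <;> omega

theorem numberBound_spec (hb : 1 ≤ b) (hD : 1 ≤ D) (hlim : 1 ≤ lim) :
    b ≤ numberBound b K D lim ∧ 2 ^ K ≤ numberBound b K D lim ∧ growth K D ^ lim ≤ numberBound b K D lim := by
  have h := two_pow_le_growth (K := K) hD
  have h1 : 1 ≤ growth K D := Nat.one_le_two_pow.trans h
  have h3 : growth K D ^ lim ≤ numberBound b K D lim := Nat.le_mul_of_pos_left _ hb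
  exact ⟨Nat.le_mul_of_pos_right _ (by positivity), h.trans ((Nat.le_self_pow (by omega) _).trans h3), h3⟩

/-- One factor `growth K D` contributes 1 + 2K bits for `2 * 4 ^ K`, at most K bits for `K + 1`, and
the bits of `D`. -/
theorem numberBound_lt : numberBound b K D lim < 2 ^ (Nat.size b + lim * (3 * K + 1 + Nat.size D)) := by
  have h : growth K D ≤ 2 ^ (3 * K + 1 + Nat.size D) := by
    calc growth K D = 2 * 4 ^ K * (K + 1) * D := rfl
      _ ≤ 2 * 4 ^ K * 2 ^ K * 2 ^ Nat.size D := by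
        gcongr
        · exact Nat.lt_two_pow_self
        · exact (Nat.lt_size_self D).le
      _ = 2 ^ (3 * K + 1 + Nat.size D) := by
        rw [show (4 : ℕ) = 2 ^ 2 by norm_num, ← pow_mul]; ring
  calc numberBound b K D lim ≤ b * (2 ^ (3 * K + 1 + Nat.size D)) ^ lim :=
        Nat.mul_le_mul_left _ (Nat.pow_le_pow_left h _)
    _ < 2 ^ Nat.size b * (2 ^ (3 * K + 1 + Nat.size D)) ^ lim :=
        Nat.mul_lt_mul_of_pos_right (Nat.lt_size_self b) (by positivity)
    _ = _ := by rw [← pow_mul, ← pow_add, mul_comm lim]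

theorem numberBound_pow_lt {d : ℕ} (hd : 1 ≤ d) :
    numberBound b K D lim ^ d < 2 ^ (d * (Nat.size b + lim * (3 * K + 1 + Nat.size D))) := by
  rw [mul_comm, pow_mul]
  exact Nat.pow_lt_pow_left numberBound_lt (by omega)

end

/-- The degree of the numbers that occur. -/
def degree (pack clamp : Bool) (e : ℕ) : ℕ := (readStmt e).deg + (eliminateStmt pack clamp e).deg

theorem one_le_degree (pack clamp : Bool) (e : ℕ) : 1 ≤ degree pack clamp e :=
  (readStmt e).one_le_deg.trans (Nat.le_add_right _ _)

theorem one_le_baseOf (n E N : ℕ) : 1 ≤ baseOf n E N := Nat.mul_pos (by omega) (by omega)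

/-! ### The existence of a partitioning -/

/-- The entries are clamped to 0 and 1, so `lim = 1` suffices, and all numbers that occur have O(k +
log L) bits. They fit into a word, and the price of every instruction is 1. -/
theorem computable_decision {γ : Set ℕ} (h0 : 0 ∉ γ) (hγ : PolyTimeDecidable γ) :
    ComputableOnTreeDecompositions
      (fun n G => [answer (∃ 𝒞 : Finset (Finset (Fin n)), IsCliquePartitioning γ G 𝒞)])
      (fun _ n k => n * (k + 1) ^ 2 * 2 ^ k) := by
  obtain ⟨q, hq⟩ := decideProg_spec hγ
  set d := degree false true 0 with hd
  -- The base has at most 8 * size(L) bits, and `3 * K + 2` is 3 * width + 5; since size(L) is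
  -- positive, the sum is at most 13 * (width + size(L)). The summand 16 provides the room `2 *
  -- Nat.size base ≤ w` that the simulation requires.
  refine ⟨algorithm false true 0 q, 13 * d + 16, fun imul hi a => ?_⟩
  obtain ⟨C, hC⟩ := hq imul hi
  refine ⟨10 + 24 * (40410 + 540 * a) + 63379200 * (4 * a + 2) + 2 * C, fun n N G T inp hn hN hT => ?_⟩
  obtain ⟨hE, hb, hL⟩ := isInput_bounds hT rfl
  set E := inp.getD 1 0 with hE'
  set K := T.width + 1 with hK
  set β := d * (Nat.size (baseOf n E N) + 1 * (3 * K + 1 + Nat.size 1)) with hβ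
  have hβw : β ≤ (13 * d + 16) * (T.width + Nat.size inp.length) := by
    calc β ≤ d * (13 * (T.width + Nat.size inp.length)) :=
          Nat.mul_le_mul_left _ (by rw [Nat.size_one]; omega)
      _ = 13 * d * (T.width + Nat.size inp.length) := by ring
      _ ≤ _ := Nat.mul_le_mul_right _ (by omega)
  have hc : UnitCost ((13 * d + 16) * (T.width + Nat.size inp.length)) imul 1 β :=
    ⟨fun b hb => by rw [linCost, if_pos (hb.trans hβw)], fun b hb => by rw [mulCost, if_pos (hb.trans hβw)]⟩
  have hw : 2 * Nat.size (baseOf n E N) ≤ (13 * d + 16) * (T.width + Nat.size inp.length) := by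
    have : 16 * (T.width + Nat.size inp.length) ≤ (13 * d + 16) * (T.width + Nat.size inp.length) :=
      Nat.mul_le_mul_right _ (by omega)
    omega
  obtain ⟨m1, m2, m3⟩ := numberBound_spec (K := K) (D := 1) (lim := 1) (one_le_baseOf n E N) le_rfl le_rfl
  obtain ⟨s, ⟨t, ht, hs⟩, hres⟩ := algorithm_spec (D := 1) (lim := 1) (e := 0) (pack := false) (clamp := true)
    hc h0 hC hn hT hE'.symm hK (by omega) (by omega) hw m1 m2 m3 (by simp)
    (numberBound_pow_lt (one_le_degree _ _ _))
  refine ⟨t, s, hs, ht.trans ?_, fun i hi' => ?_⟩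
  · have h1 := time_le hn hN hE hK le_rfl
    have h2 : 2 ^ K ≤ 2 * (n * (T.width + 1) ^ 2 * 2 ^ T.width) := by
      calc 2 ^ K = 2 * (1 * 2 ^ T.width) := by rw [hK, pow_succ]; ring
        _ ≤ _ := Nat.mul_le_mul_left _ (Nat.mul_le_mul_right _ (Nat.mul_pos hn (by positivity)))
    have h3 := Nat.mul_le_mul_left C h2
    simp only [one_pow, mul_one, ← mul_assoc] at h1 h3 ⊢
    linarith
  · obtain rfl : i = 0 := by simpa using hi'
    obtain ⟨h1, h2⟩ := hres 0 Nat.one_pos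
    rw [coeff_weightSum partitioning_iff] at h1
    have h3 : s.mem 0 = 0 ↔ ¬ ∃ 𝒞, IsCliquePartitioning γ G 𝒞 := by
      refine (show s.mem 0 = 0 ↔ _ from h1).trans ?_
      rw [Set.ncard_eq_zero (Set.toFinite _), Set.eq_empty_iff_forall_notMem, not_exists]
      simp
    have h4 := h2 rfl
    simp only [answer, List.getElem_cons_zero]
    split_ifs with h
    · have := mt h3.1 (not_not.2 h); omega
    · exact h3.2 h

/-! ### Counting -/

theorem IsMulTime.mul_le {imul : ℕ → ℕ} (hi : IsMulTime imul) (c : ℕ) :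
    ∃ C, ∀ b, imul (c * b) ≤ C * imul b := by
  obtain ⟨d, hd⟩ := hi.doubling
  have h : ∀ m b, imul (2 ^ m * b) ≤ d ^ m * imul b := fun m b => by
    induction m with
    | zero => simp
    | succ m ih =>
      calc imul (2 ^ (m + 1) * b) = imul (2 * (2 ^ m * b)) := by rw [pow_succ']; ring_nf
        _ ≤ d * (d ^ m * imul b) := (hd _).trans (Nat.mul_le_mul_left _ ih)
        _ = d ^ (m + 1) * imul b := by ring
  exact ⟨d ^ c, fun b => (hi.mono (Nat.mul_le_mul_right _ Nat.lt_two_pow_self.le)).trans (h c b)⟩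

/-- For fixed `a` the base is polynomial in `n` and has O(log n) bits. There are `n + N` growth
factors of O(k + log n) bits each, because `D ≤ n + 1`. -/
theorem bits_le {n N E k a D : ℕ} (hn : 1 ≤ n) (hN : N ≤ a * n) (hE : E ≤ N * (k + 1) ^ 2)
    (hk : k + 1 ≤ n) (hD : D ≤ n + 1) :
    Nat.size (baseOf n E N) + (n + N) * (3 * (k + 1) + 1 + Nat.size D) ≤
      (10 * a + 20) * (n * k + n * Nat.size n) := by
  set z := Nat.size n with hz
  have hz1 : 1 ≤ z := Nat.size_pos.2 hn
  have hnz : n < 2 ^ z := Nat.lt_size_self n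
  have hsD : Nat.size D ≤ z + 1 := Nat.size_le.2 (by rw [pow_succ]; omega)
  have h1 : n + E + N + 3 < 2 ^ (2 * a + 4 + 3 * z) := by
    have j1 : E ≤ a * n ^ 3 := by
      calc E ≤ a * n * n ^ 2 := hE.trans (Nat.mul_le_mul hN (Nat.pow_le_pow_left hk 2))
        _ = a * n ^ 3 := by ring
    have j2 : n ≤ n ^ 3 := Nat.le_self_pow (by norm_num) n
    have j3 : a * n ≤ a * n ^ 3 := Nat.mul_le_mul_left _ j2
    calc n + E + N + 3 ≤ (2 * a + 4) * n ^ 3 := by nlinarith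
      _ < 2 ^ (2 * a + 4) * (2 ^ z) ^ 3 :=
        Nat.mul_lt_mul'' Nat.lt_two_pow_self (Nat.pow_lt_pow_left hnz (by norm_num))
      _ = 2 ^ (2 * a + 4 + 3 * z) := by rw [← pow_mul, ← pow_add]; ring_nf
  have h2 : Nat.size (baseOf n E N) ≤ 4 * a + 8 + 6 * z := by
    rw [Nat.size_le, baseOf]
    calc _ < 2 ^ (2 * a + 4 + 3 * z) * 2 ^ (2 * a + 4 + 3 * z) := Nat.mul_lt_mul'' h1 h1
      _ = _ := by rw [← pow_add]; ring_nf
  have h3 : z ≤ n * z := Nat.le_mul_of_pos_left _ hn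
  have h4 : (n + N) * (3 * (k + 1) + 1 + Nat.size D) ≤ (a + 1) * (6 * (n * k + n * z)) := by
    calc (n + N) * (3 * (k + 1) + 1 + Nat.size D) ≤ ((a + 1) * n) * (3 * k + 6 * z) :=
          Nat.mul_le_mul (by linarith) (by omega)
      _ ≤ (a + 1) * (6 * (n * k + n * z)) := by
          rw [mul_assoc]; exact Nat.mul_le_mul_left _ (by nlinarith)
  have h5 : 4 * a + 8 + 6 * z ≤ (4 * a + 14) * (n * k + n * z) := by
    calc 4 * a + 8 + 6 * z ≤ (4 * a + 14) * z := by nlinarith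
      _ ≤ _ := Nat.mul_le_mul_left _ (by omega)
  nlinarith

/-- Every instruction is charged as a multiplication of numbers of the maximal length `β`. By the
doubling property, the constant factor between `β` and `n * k + n * Nat.size n` changes the price by
a constant factor only. -/
theorem computable_count {γ : Set ℕ} (h0 : 0 ∉ γ) (hγ : PolyTimeDecidable γ) (pack : Bool) {e : ℕ}
    (he : e ≤ 1) {out : ∀ n : ℕ, SimpleGraph (Fin n) → List ℕ}
    (hout : ∀ n G i, ∀ hi : i < (out n G).length, i < e * n + 1 ∧ (out n G)[i] =
      PowerSeries.coeff i (weightSum γ G pack (PowerSeries.X ^ e : PowerSeries ℕ) univ)) :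
    ComputableOnTreeDecompositions out
      (fun imul n k => n ^ (2 * e + 1) * (k + 1) ^ 2 * 2 ^ k * imul (n * k + n * Nat.size n)) := by
  obtain ⟨q, hq⟩ := decideProg_spec hγ
  set d := degree pack false e with hd
  refine ⟨algorithm pack false e q, 16, fun imul hi a => ?_⟩
  obtain ⟨C, hC⟩ := hq imul hi
  obtain ⟨C', hC'⟩ := hi.mul_le (d * (10 * a + 20))
  set A := 10 + 24 * (40410 + 540 * a) + 63379200 * (4 * a + 2) with hA
  -- `A` comes from `time_le`, the 4 from `D ^ 2 ≤ 4 * n ^ (2 * e)`, `1 + C'` from the price per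
  -- instruction, and `2 * C` from the simulations, as `2 ^ K` is twice `2 ^ k`.
  refine ⟨(1 + C') * (A * 4) + 2 * C, fun n N G T inp hn hN hT => ?_⟩
  obtain ⟨hE, hb, hL⟩ := isInput_bounds hT rfl
  set E := inp.getD 1 0 with hE'
  set K := T.width + 1 with hK
  set D := e * n + 1 with hD
  set Y := n * T.width + n * Nat.size n with hY
  have hKn : K ≤ n := by
    rw [hK, ← T.sup_card_bag ⟨0, hn⟩]
    exact Finset.sup_le fun x _ => (card_le_univ _).trans (by simp)
  have hDn : D ≤ n + 1 := by
    have : e * n ≤ 1 * n := Nat.mul_le_mul_right _ he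
    omega
  set β := d * (Nat.size (baseOf n E N) + (n + N) * (3 * K + 1 + Nat.size D)) with hβ
  have hβY : imul β ≤ C' * imul Y := by
    refine (hi.mono ?_).trans (hC' Y)
    rw [mul_assoc]
    exact Nat.mul_le_mul_left _ (bits_le hn hN hE hKn hDn)
  have hY1 : 1 ≤ imul Y := by
    refine le_trans ?_ (hi.le_self Y)
    have : 0 < n * Nat.size n := Nat.mul_pos hn (Nat.size_pos.2 hn)
    omega
  have hc : UnitCost (16 * (T.width + Nat.size inp.length)) imul (1 + imul β) β :=
    hi.unitCost fun b hb _ => hb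
  obtain ⟨m1, m2, m3⟩ := numberBound_spec (K := K) (D := D) (lim := n + N) (one_le_baseOf n E N) (by omega)
    (by omega)
  obtain ⟨s, ⟨t, ht, hs⟩, hres⟩ := algorithm_spec (D := D) (lim := n + N) (e := e) (pack := pack)
    (clamp := false) hc h0 hC hn hT hE'.symm hK hD.symm he (by omega) m1 m2 m3 (by simp)
    (numberBound_pow_lt (one_le_degree _ _ _))
  refine ⟨t, s, hs, ht.trans ?_, fun i hi' => ?_⟩
  · set Z := n ^ (2 * e + 1) * (T.width + 1) ^ 2 * 2 ^ T.width with hZ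
    have hD2 : D ^ 2 ≤ 4 * n ^ (2 * e) := by
      have h : D ≤ 2 * n ^ e := by
        interval_cases e
        · simp [hD]
        · simp only [hD, pow_one]; omega
      calc D ^ 2 ≤ (2 * n ^ e) ^ 2 := Nat.pow_le_pow_left h 2
        _ = 4 * n ^ (2 * e) := by rw [mul_pow, ← pow_mul, mul_comm e]; ring
    have h1 : A * (n * ((T.width + 1) ^ 2 * 2 ^ T.width) * D ^ 2) ≤ A * 4 * Z := by
      calc _ ≤ A * (n * ((T.width + 1) ^ 2 * 2 ^ T.width) * (4 * n ^ (2 * e))) := by gcongr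
        _ = A * 4 * Z := by rw [hZ, pow_succ]; ring
    have h2 : 1 + imul β ≤ (1 + C') * imul Y := by linarith
    have h3 : 2 ^ K ≤ 2 * (Z * imul Y) := by
      calc 2 ^ K = 2 * (1 * 2 ^ T.width * 1) := by rw [hK, pow_succ]; ring
        _ ≤ 2 * (Z * imul Y) := Nat.mul_le_mul_left _ (Nat.mul_le_mul
          (Nat.mul_le_mul_right _ (Nat.mul_pos (by positivity) (by positivity))) hY1)
    calc _ ≤ ((1 + C') * imul Y) * (A * 4 * Z) + C * (2 * (Z * imul Y)) :=
          Nat.add_le_add (Nat.mul_le_mul h2 ((time_le hn hN hE hK (by omega)).trans h1))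
            (Nat.mul_le_mul_left _ h3)
      _ = ((1 + C') * (A * 4) + 2 * C) * (Z * imul Y) := by ring
  · obtain ⟨h1, h2⟩ := hout n G i hi'
    rw [h2]
    exact (hres i h1).1

/-! ### Triangles -/

/-- With truncated subtraction, `(j - 3) + (3 - j)` is the distance of `j` from 3, and subtracting
it from 1 gives the answer. All eight instructions handle numbers of at most `j + 3` bits, hence the
time bound. -/
theorem polyTimeDecidable_three : PolyTimeDecidable {3} := by
  refine ⟨.seq (.load 1 0) <| .seq (.const 2 3) <| .seq (.sub 3 1 2) <| .seq (.sub 4 2 1) <|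
    .seq (.add 3 3 4) <| .seq (.const 4 1) <| .seq (.sub 4 4 3) (.store 0 4),
    8 * (Polynomial.X + 3) ^ 2, fun j => ?_⟩
  have hc : UnitCost 0 (fun b => b ^ 2) ((j + 3) ^ 2) (j + 3) :=
    ⟨fun b hb => by rw [linCost]; split_ifs <;> nlinarith,
      fun b hb => by rw [mulCost]; split_ifs <;> nlinarith⟩
  have hj : j + 3 < 2 ^ (j + 3) := Nat.lt_two_pow_self
  set s0 := initState [j]
  have l1 := hc.load s0 1 0 (by simp [s0, initState]) (by simp [s0, initState]; omega)
  set s1 := s0.setReg 1 (s0.mem (s0.reg 0)) with h1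
  have l2 := hc.const s1 2 3 (by omega)
  set s2 := s1.setReg 2 3 with h2
  have l3 := hc.sub s2 3 1 2 (by simp [h2, h1, s0, State.setReg_reg, initState]; omega)
    (by simp [h2, State.setReg_reg]; omega)
  set s3 := s2.setReg 3 (s2.reg 1 - s2.reg 2) with h3
  have l4 := hc.sub s3 4 2 1 (by simp [h3, h2, State.setReg_reg]; omega)
    (by simp [h3, h2, h1, s0, State.setReg_reg, initState]; omega)
  set s4 := s3.setReg 4 (s3.reg 2 - s3.reg 1) with h4
  have r3 : s4.reg 3 = j - 3 := by simp [h4, h3, h2, h1, s0, State.setReg_reg, initState]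
  have r4 : s4.reg 4 = 3 - j := by simp [h4, h3, h2, h1, s0, State.setReg_reg, initState]
  have l5 := hc.add s4 3 3 4 (by omega) (by omega)
  rw [r3, r4] at l5
  set s5 := s4.setReg 3 (j - 3 + (3 - j)) with h5
  have l6 := hc.const s5 4 1 (by omega)
  set s6 := s5.setReg 4 1 with h6
  have r63 : s6.reg 3 = j - 3 + (3 - j) := by simp [h6, h5, State.setReg_reg]
  have r64 : s6.reg 4 = 1 := by simp [h6, State.setReg_reg]
  have l7 := hc.sub s6 4 4 3 (by omega) (by omega)
  rw [r63, r64] at l7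
  set s7 := s6.setReg 4 (1 - (j - 3 + (3 - j))) with h7
  have r70 : s7.reg 0 = 0 := by simp [h7, h6, h5, h4, h3, h2, h1, s0, State.setReg_reg, initState]
  have r74 : s7.reg 4 = 1 - (j - 3 + (3 - j)) := by simp [h7, State.setReg_reg]
  have l8 := hc.store s7 0 4 (by omega) (by omega)
  rw [r70, r74] at l8
  obtain ⟨t, ht, hs⟩ := l1.seq <| l2.seq <| l3.seq <| l4.seq <| l5.seq <| l6.seq <| l7.seq l8
  refine ⟨t, _, hs, ht.trans ?_, fun i hi => ?_⟩
  · simp; linarith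
  · obtain rfl : i = 0 := by simpa using hi
    simp only [State.setMem_mem, if_true, answer, Set.mem_singleton_iff, List.getElem_cons_zero]
    split_ifs <;> omega

end RAM

theorem mainTheorem5 :
    (∀ γ : Set ℕ, 0 ∉ γ → RAM.PolyTimeDecidable γ →
      -- numbers of packings and of partitionings using `κ` cliques, for all `κ ≤ n`
      ComputableOnTreeDecompositions
        (fun n G => (List.range (n + 1)).map fun κ =>
          {𝒞 : Finset (Finset (Fin n)) | IsCliquePacking γ G 𝒞 ∧ 𝒞.card = κ}.ncard)
        (fun imul n k => n ^ 3 * (k + 1) ^ 2 * 2 ^ k * imul (n * k + n * Nat.size n)) ∧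
      ComputableOnTreeDecompositions
        (fun n G => (List.range (n + 1)).map fun κ =>
          {𝒞 : Finset (Finset (Fin n)) | IsCliquePartitioning γ G 𝒞 ∧ 𝒞.card = κ}.ncard)
        (fun imul n k => n ^ 3 * (k + 1) ^ 2 * 2 ^ k * imul (n * k + n * Nat.size n)) ∧
      -- existence of a partitioning
      ComputableOnTreeDecompositions
        (fun n G => [RAM.answer (∃ 𝒞 : Finset (Finset (Fin n)), IsCliquePartitioning γ G 𝒞)])
        (fun _ n k => n * (k + 1) ^ 2 * 2 ^ k) ∧
      -- total numbers of packings and of partitionings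
      ComputableOnTreeDecompositions
        (fun n G => [{𝒞 : Finset (Finset (Fin n)) | IsCliquePacking γ G 𝒞}.ncard])
        (fun imul n k => n * (k + 1) ^ 2 * 2 ^ k * imul (n * k + n * Nat.size n)) ∧
      ComputableOnTreeDecompositions
        (fun n G => [{𝒞 : Finset (Finset (Fin n)) | IsCliquePartitioning γ G 𝒞}.ncard])
        (fun imul n k => n * (k + 1) ^ 2 * 2 ^ k * imul (n * k + n * Nat.size n))) ∧
    -- Partition Into Triangles
    ComputableOnTreeDecompositions
      (fun n G => [RAM.answer (∃ 𝒞 : Finset (Finset (Fin n)), IsCliquePartitioning {3} G 𝒞)])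
      (fun _ n k => n * (k + 1) ^ 2 * 2 ^ k) := by
  refine ⟨fun γ h0 hγ => ⟨?_, ?_, RAM.computable_decision h0 hγ, ?_, ?_⟩,
    RAM.computable_decision (by simp) RAM.polyTimeDecidable_three⟩
  -- The proof `le_rfl` of `e ≤ 1` sets `e = 1`: the coefficient of `X ^ κ` then counts the
  -- collections of `κ` cliques, and `n ^ (2 * e + 1)` becomes `n ^ 3`.
  · refine RAM.computable_count h0 hγ true le_rfl fun n G i hi => ?_
    rw [RAM.coeff_weightSum RAM.packing_iff]
    simpa using hi
  · refine RAM.computable_count h0 hγ false le_rfl fun n G i hi => ?_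
    rw [RAM.coeff_weightSum RAM.partitioning_iff]
    simpa using hi
  -- For `e = 0` every collection has weight 1, and the single coefficient kept is the total number.
  · have h := RAM.computable_count (e := 0) h0 hγ true (Nat.zero_le 1)
      (out := fun n G => [{𝒞 : Finset (Finset (Fin n)) | IsCliquePacking γ G 𝒞}.ncard]) fun n G i hi => by
        obtain rfl : i = 0 := by simpa using hi
        rw [RAM.coeff_weightSum RAM.packing_iff]
        simp
    simpa using h
  · have h := RAM.computable_count (e := 0) h0 hγ false (Nat.zero_le 1)
      (out := fun n G => [{𝒞 : Finset (Finset (Fin n)) | IsCliquePartitioning γ G 𝒞}.ncard]) fun n G i hi => by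
        obtain rfl : i = 0 := by simpa using hi
        rw [RAM.coeff_weightSum RAM.partitioning_iff]
        simp
    simpa using h
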